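/- Let $n\ge 0$ and let $\mathcal{A}=\mathbb{Z}[X]/(X^2)$, with trace $\mathrm{tr}(1)=0$, $\mathrm{tr}(X)=1$ and comultiplication $\Delta(1)=1\otimes X+X\otimes 1$, $\Delta(X)=X\otimes X$. Let $\mathcal{F}$ be the two-dimensional topological quantum field theory defined by this Frobenius algebra; it assigns $\mathcal{A}^{\otimes k}$ to a union of $k$ circles. Let $B$ be the set of crossingless matchings of the points $1,\dots,2n$. For $a,b\in B$ let $W(b)a$ be the closed 1-manifold obtained by gluing $a$ and the reflection $W(b)$ of $b$. Let $$H^n=\bigoplus_{a,b\in B}\mathcal{F}(W(b)a)$$ be the ring whose multiplication $\mathcal{F}(W(c)b)\otimes\mathcal{F}(W(b)a)\to\mathcal{F}(W(c)a)$ is induced by the cobordism that contracts $b$ with $W(b)$ (products of non-matching summands are zero). For $1\le i\le 2n-1$ let $U_i$ be the flat diagram with $2n$ top and $2n$ bottom endpoints in which the $i$-th and $(i+1)$-st top endpoints are joined by an arc, so are the $i$-th and $(i+1)$-st bottom endpoints, and all other points lie on vertical segments. Let $\mathcal{F}(U_i)=\bigoplus_{a,b\in B}\mathcal{F}(W(b)U_ia)$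 be its $H^n$-bimodule and $\alpha:\mathcal{F}(U_i)\to H^n$ the bimodule homomorphism induced by the saddle cobordism from $U_i$ to the diagram of $2n$ vertical segments. Let $\mathcal{K}$ be the category of bounded complexes of left $H^n$-modules up to chain homotopy, and $\mathcal{R}_i:\mathcal{K}\to\mathcal{K}$ the functor of tensoring over $H^n$ with the complex of bimodules $$0\to\mathcal{F}(U_i)\xrightarrow{\ \alpha\ }H^n\to 0,$$ with $H^n$ in degree $0$. Let $Z(\mathcal{K})$ be the ring of natural transformations of the identity functor of $\mathcal{K}$ which commute with the shift $[1]$, and let $f:Z(H^n)\to Z(\mathcal{K})$ be the ring homomorphism that sends $z$ to multiplication by $z$ in each degree. For $1\le i\le 2n$ let $X_i=\sum_{a\in B}{}_a(X_i)_a\in Z(H^n)$, where ${}_a(X_i)_a\in\mathcal{F}(W(a)a)\cong\mathcal{A}^{\otimes n}$ is $(-1)^i$ times the element $X$ in the tensor factor of the circle through the $i$-th point. A weak action of a group $G$ on $\mathcal{K}$ consists of additive functors $F_g:\mathcal{K}\to\mathcal{K}$, $g\in G$, each commuting with $[1]$ up to isomorphism, such that $F_1\cong\mathrm{Id}$ and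 $F_gF_h\cong F_{gh}$ for all $g,h$ (no compatibility between these isomorphisms is required). Each $F_g$ is then an equivalence, and it induces the ring automorphism $\zeta\mapsto\zeta'$ of $Z(\mathcal{K})$ which is determined by $\zeta'_{F_g(M)}=F_g(\zeta_M)$ for all $M$; this defines an action of $G$ on $Z(\mathcal{K})$. Then the following hold. 1. There is a weak action of the braid group on $2n$ strands on $\mathcal{K}$ in which the standard generator $\sigma_i$ acts by a functor isomorphic to $\mathcal{R}_i$, for every $i$. (In other words, the functors $\mathcal{R}_i$ are invertible and satisfy the braid relations.) 2. The homomorphism $f$ is injective, and the elements $X_1,\dots,X_{2n}$ generate the ring $Z(H^n)$. 3. There is an action $\rho$ of the symmetric group $S_{2n}$ on $Z(H^n)$ by ring automorphisms with $\rho(w)X_i=X_{w(i)}$ for all $w\in S_{2n}$ and all $i$, such that for every weak action as in 1, every element $g$ of the braid group and every $z\in Z(H^n)$ $$g\cdot f(z)=f(\rho(\pi(g))\,z),$$ where $\pi$ is the homomorphism from the braid group to $S_{2n}$ with $\pi(\sigma_i)=(i\ \,i{+}1)$. Thus the braid group action on $Z(\mathcal{K})$ restricts to an action on the subring $f(Z(H^n))\cong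 Z(H^n)$, which factors through $S_{2n}$ and permutes the generators $X_i$. -/

import Mathlib

namespace Arc

/-- Two points lie on the same component of the closed 1-manifold obtained by gluing the two
matchings `σ` and `τ` of the point set `P` along their endpoints. -/
def SameCircle {P : Type} (σ τ : P → P) : P → P → Prop :=
  Relation.EqvGen fun p q => q = σ p ∨ q = τ p

/-- The ideal of relations `x_p ^ 2 = 0`, and `x_p = x_q` for `p`, `q` joined by an arc. -/
noncomputable def circleIdeal {P : Type} (σ τ : P → P) : Ideal (MvPolynomial P ℤ) :=
  Ideal.span {f | ∃ p, f = MvPolynomial.X p ^ 2 ∨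
    f = MvPolynomial.X p - MvPolynomial.X (σ p) ∨ f = MvPolynomial.X p - MvPolynomial.X (τ p)}

/-- The two copies of `τ` inside `W(σ)τ ⊔ W(τ)ρ`, after the arcs with endpoints in `S` have been
contracted with their mirror images, i.e. replaced by vertical segments. -/
noncomputable def stage {P : Type} (τ : P → P) (S : Set P) : P ⊕ P → P ⊕ P :=
  open scoped Classical in
  Sum.elim (fun p => if p ∈ S then Sum.inr p else Sum.inl (τ p))
    (fun p => if p ∈ S then Sum.inl p else Sum.inr (τ p))

/-- Contract the arcs of `τ` with endpoints in the list, one saddle at a time, those with endpoints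
in `S` being contracted already. A saddle which merges two circles is the
multiplication of `𝒜`, which identifies two variables; a saddle which splits a circle is the
comultiplication of `𝒜`, that is the multiplication by `x_p + x_q`, where `p` and `q` are the
endpoints of the contracted arc, which lie on the two circles after the saddle.
This is the product of the factors of all the splittings. -/
noncomputable def contractFactor {P : Type} (σ τ ρ : P → P) : List P → Set P → MvPolynomial P ℤ
  | [], _ => 1
  | p :: l, S =>
    open scoped Classical in
    if p ∈ S then contractFactor σ τ ρ l S else
      (if SameCircle (Sum.map σ ρ) (stage τ S) (Sum.inl p) (Sum.inr p) then
        MvPolynomial.X p + MvPolynomial.X (τ p) else 1) *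
      contractFactor σ τ ρ l (S ∪ {p, τ p})

/-- The effect on generators of the contraction cobordism from `W(σ)τ ⊔ W(τ)ρ` to `W(σ)ρ`. -/
noncomputable def eps {P : Type} [Fintype P] (σ τ ρ : P → P) : MvPolynomial P ℤ :=
  contractFactor σ τ ρ Finset.univ.toList ∅

section Eval

variable {P : Type}

/-- Value at the point with coordinates `± h` in `ℤ[h]`. -/
noncomputable def ev (s : P → Bool) : MvPolynomial P ℤ →+* Polynomial ℤ :=
  (MvPolynomial.aeval fun p => if s p then Polynomial.X else -Polynomial.X).toRingHom

theorem ev_X (s : P → Bool) (p : P) :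
    ev s (MvPolynomial.X p) = if s p then Polynomial.X else -Polynomial.X := by
  simp [ev]

theorem ev_rename {P' : Type} (f : P' → P) (s : P → Bool) (g : MvPolynomial P' ℤ) :
    ev s (MvPolynomial.rename f g) = ev (s ∘ f) g := by
  simp only [ev, AlgHom.toRingHom_eq_coe, RingHom.coe_coe, MvPolynomial.aeval_rename]
  rfl

theorem sameCircle_const {σ τ : P → P} {A : Type} {s : P → A} (h1 : ∀ p, s (σ p) = s p)
    (h2 : ∀ p, s (τ p) = s p) {p q : P} (h : SameCircle σ τ p q) : s p = s q := by
  induction h with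
  | rel x y h => rcases h with rfl | rfl <;> simp [h1, h2]
  | refl => rfl
  | symm _ _ _ h => exact h.symm
  | trans _ _ _ _ _ h h' => exact h.trans h'

theorem X_sub_X_mem {σ τ : P → P} {p q : P} (h : SameCircle σ τ p q) :
    (MvPolynomial.X p - MvPolynomial.X q : MvPolynomial P ℤ) ∈ circleIdeal σ τ := by
  induction h with
  | rel x y h =>
    refine Ideal.subset_span ⟨x, ?_⟩
    rcases h with rfl | rfl <;> simp
  | refl => simp
  | symm _ _ _ h => simpa using neg_mem h
  | trans _ _ _ _ _ h h' => simpa using add_mem h h'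

/-- A polynomial which vanishes at all points with coordinates `± h` that are constant along the
circles lies in the ideal of relations. -/
theorem mem_circleIdeal [Finite P] {σ τ : P → P} {f : MvPolynomial P ℤ}
    (hf : ∀ s : P → Bool, (∀ p, s (σ p) = s p) → (∀ p, s (τ p) = s p) → ev s f = 0) :
    f ∈ circleIdeal σ τ := by
  classical
  let r : Setoid P := ⟨SameCircle σ τ, Relation.EqvGen.is_equivalence _⟩
  let rep : P → P := fun p => (Quotient.mk r p).out
  have hrep : ∀ p, SameCircle σ τ p (rep p) := fun p =>
    r.symm (Quotient.mk_out (s := r) p)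
  have hrep' : ∀ p q, SameCircle σ τ p q → rep p = rep q := fun p q h => by
    have : Quotient.mk r p = Quotient.mk r q := Quotient.sound h
    simp only [rep, this]
  have h1 : f - MvPolynomial.rename rep f ∈ circleIdeal σ τ := by
    rw [← Ideal.Quotient.eq]
    have : (Ideal.Quotient.mkₐ ℤ (circleIdeal σ τ)) =
        (Ideal.Quotient.mkₐ ℤ (circleIdeal σ τ)).comp (MvPolynomial.rename rep) := by
      ext p
      simp only [AlgHom.comp_apply, MvPolynomial.rename_X, Ideal.Quotient.mkₐ_eq_mk]
      exact Ideal.Quotient.eq.2 (X_sub_X_mem (hrep p))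
    exact DFunLike.congr_fun this f
  have h2 : MvPolynomial.rename rep f ∈ circleIdeal σ τ := by
    set g := MvPolynomial.rename rep f with hg
    have hev : ∀ s : P → Bool, ev s g = 0 := by
      intro s
      rw [hg, ev_rename]
      apply hf
      · intro p
        exact congrArg s (hrep' _ _ (Relation.EqvGen.symm _ _ (.rel _ _ (Or.inl rfl))))
      · intro p
        exact congrArg s (hrep' _ _ (Relation.EqvGen.symm _ _ (.rel _ _ (Or.inr rfl))))
    let G : MvPolynomial P (Polynomial ℤ) := MvPolynomial.map Polynomial.C g
    have hX : (Polynomial.X : Polynomial ℤ) ≠ -Polynomial.X := by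
      intro h
      have := congrArg (Polynomial.coeff · 1) h
      simp at this
    obtain ⟨k, -, hk⟩ := MvPolynomial.combinatorial_nullstellensatz_exists_linearCombination
      (fun _ : P => ({Polynomial.X, -Polynomial.X} : Finset (Polynomial ℤ)))
      (fun _ => ⟨Polynomial.X, by simp⟩) G (by
        intro x hx
        have hx' : x = fun p => if decide (x p = Polynomial.X) then Polynomial.X
            else -Polynomial.X := by
          funext p
          have := hx p
          simp only [Finset.mem_insert, Finset.mem_singleton] at this
          rcases this with h | h
          · simp [h]
          · rw [h]; simp [hX.symm]
        have := hev (fun p => decide (x p = Polynomial.X))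
        rw [← this]
        simp only [ev, AlgHom.toRingHom_eq_coe, RingHom.coe_coe]
        rw [← hx', MvPolynomial.eval_map, MvPolynomial.aeval_def]
        rfl)
    have h0 : g = MvPolynomial.map (Polynomial.evalRingHom 0) G := by
      simp only [G, MvPolynomial.map_map]
      have : (Polynomial.evalRingHom (0 : ℤ)).comp Polynomial.C = RingHom.id ℤ := by
        ext; simp
      rw [this, MvPolynomial.map_id]
    rw [h0, hk, Finsupp.linearCombination_apply, Finsupp.sum, map_sum]
    refine Ideal.sum_mem _ fun p _ => ?_
    rw [smul_eq_mul, map_mul]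
    refine Ideal.mul_mem_left _ _ ?_
    rw [Finset.prod_pair hX]
    refine Ideal.subset_span ⟨p, Or.inl ?_⟩
    simp [sq]
  simpa using add_mem h1 h2

end Eval

section Count

/-- Every arc of the matching `σ` joins two points of different colours. -/
structure IsMatching {P : Type} (col : P → Bool) (σ : P → P) : Prop where
  invol : ∀ p, σ (σ p) = p
  col_flip : ∀ p, col (σ p) = !col p

theorem IsMatching.ne {P : Type} {col : P → Bool} {σ : P → P} (h : IsMatching col σ) (p : P) :
    σ p ≠ p := by
  intro e
  have := h.col_flip p
  rw [e] at this
  simp at this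

/-- The components of the 1-manifold, as a quotient of the set of points. -/
def circ {P : Type} (σ τ : P → P) : Setoid P :=
  ⟨SameCircle σ τ, Relation.EqvGen.is_equivalence _⟩

/-- The number of circles which meet the set `S`. -/
noncomputable def numCirc {P : Type} (σ τ : P → P) (S : Set P) : ℕ :=
  ((fun p => Quotient.mk (circ σ τ) p) '' S).ncard

theorem ncard_join {Q : Type} [Finite Q] (r r' : Setoid Q) (hle : ∀ x y, r x y → r' x y) (a b : Q)
    (hab : r' a b) (hr' : ∀ x y, r' x y → r x y ∨ (r x a ∧ r b y) ∨ (r x b ∧ r a y))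
    (hn : ¬ r a b) (S : Set Q) (hS : ∀ x y, r x y → (x ∈ S ↔ y ∈ S)) (hab' : a ∈ S ↔ b ∈ S) :
    (a ∈ S → ((fun p => Quotient.mk r p) '' S).ncard =
      ((fun p => Quotient.mk r' p) '' S).ncard + 1) ∧
    (a ∉ S → ((fun p => Quotient.mk r p) '' S).ncard =
      ((fun p => Quotient.mk r' p) '' S).ncard) := by
  let g : Quotient r → Quotient r' := Quotient.map' id hle
  have hg : ∀ x, g (Quotient.mk r x) = Quotient.mk r' x := fun x => rfl
  set D := ((fun p => Quotient.mk r p) '' S) \ {Quotient.mk r b} with hD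
  have h1 : (fun p => Quotient.mk r' p) '' S = g '' D := by
    apply Set.Subset.antisymm
    · rintro _ ⟨z, hz, rfl⟩
      by_cases hzb : r z b
      · have hb : b ∈ S := (hS _ _ hzb).1 hz
        refine ⟨Quotient.mk r a, ⟨⟨a, hab'.2 hb, rfl⟩, fun h => hn (Quotient.exact h)⟩, ?_⟩
        rw [hg]
        exact Quotient.sound (r'.trans hab (r'.symm (hle _ _ hzb)))
      · exact ⟨Quotient.mk r z, ⟨⟨z, hz, rfl⟩, fun h => hzb (Quotient.exact h)⟩, rfl⟩
    · rintro _ ⟨_, ⟨⟨z, hz, rfl⟩, -⟩, rfl⟩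
      exact ⟨z, hz, rfl⟩
  have h2 : Set.InjOn g D := by
    rintro _ ⟨⟨x, hx, rfl⟩, hxb⟩ _ ⟨⟨y, hy, rfl⟩, hyb⟩ h
    have hxb' : ¬ r x b := fun h => hxb (Quotient.sound h)
    have hyb' : ¬ r y b := fun h => hyb (Quotient.sound h)
    rcases hr' x y (Quotient.exact h) with h | ⟨-, h⟩ | ⟨h, -⟩
    · exact Quotient.sound h
    · exact absurd (r.symm h) hyb'
    · exact absurd h hxb'
  rw [h1, Set.InjOn.ncard_image h2, hD]
  constructor
  · intro ha
    exact (Set.ncard_sdiff_singleton_add_one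
      (s := (fun p => Quotient.mk r p) '' S) ⟨b, hab'.1 ha, rfl⟩).symm
  · intro ha
    rw [Set.sdiff_singleton_eq_self]
    rintro ⟨z, hz, h⟩
    exact ha (hab'.2 ((hS _ _ (Quotient.exact h)).1 hz))

theorem sameCycle_xor {Q : Type} [Finite Q] (B : Q → Prop) (f g : Equiv.Perm Q)
    (hB : ∀ u, B u → B (f u)) (a b : Q) (ha : B a) (hab : a ≠ b)
    (hgb : g b = f a) (hg : ∀ u, B u → u ≠ a → u ≠ b → g u = f u) :
    f.SameCycle a b ↔ ¬ g.SameCycle a b := by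
  classical
  have hBn : ∀ n : ℕ, B ((f ^ n) a) := by
    intro n
    induction n with
    | zero => exact ha
    | succ n ih => rw [pow_succ', Equiv.Perm.mul_apply]; exact hB _ ih
  constructor
  · intro h h'
    obtain ⟨k0, hk0⟩ := h.exists_nat_pow_eq
    have hex : ∃ k : ℕ, (f ^ k) a = b := ⟨k0, hk0⟩
    let k := Nat.find hex
    have hk : (f ^ k) a = b := Nat.find_spec hex
    have hmin : ∀ j < k, (f ^ j) a ≠ b := fun j hj => Nat.find_min hex hj
    have hk1 : 1 ≤ k := by
      rcases Nat.eq_zero_or_pos k with h0 | h0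
      · rw [h0] at hk; exact absurd hk hab
      · exact h0
    have haT : ∀ j, 1 ≤ j → j ≤ k → (f ^ j) a ≠ a := by
      intro j h1 h2 h3
      apply hmin (k - j) (by omega)
      have : (f ^ (k - j)) ((f ^ j) a) = b := by
        rw [← Equiv.Perm.mul_apply, ← pow_add, Nat.sub_add_cancel h2, hk]
      rwa [h3] at this
    have hT : ∀ n : ℕ, ∃ j, 1 ≤ j ∧ j ≤ k ∧ (g ^ n) b = (f ^ j) a := by
      intro n
      induction n with
      | zero => exact ⟨k, hk1, le_rfl, by simp [hk]⟩
      | succ n ih =>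
        obtain ⟨j, h1, h2, h3⟩ := ih
        rw [pow_succ', Equiv.Perm.mul_apply, h3]
        rcases Nat.lt_or_ge j k with h4 | h4
        · refine ⟨j + 1, by omega, by omega, ?_⟩
          rw [hg _ (hBn j) (haT j h1 h2) (hmin j h4), pow_succ', Equiv.Perm.mul_apply]
        · have : j = k := le_antisymm h2 h4
          rw [this, hk, hgb]
          exact ⟨1, le_rfl, hk1, by simp⟩
    obtain ⟨n, hn⟩ := h'.symm.exists_nat_pow_eq
    obtain ⟨j, h1, h2, h3⟩ := hT n
    exact haT j h1 h2 (by rw [← h3, hn])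
  · intro h
    by_contra hf
    apply h
    have hne : ∀ j : ℕ, (f ^ j) a ≠ b := fun j hj => hf ⟨j, by simpa using hj⟩
    have hex : ∃ k : ℕ, 1 ≤ k ∧ (f ^ k) a = a :=
      ⟨orderOf f, orderOf_pos f, by rw [pow_orderOf_eq_one]; rfl⟩
    let k := Nat.find hex
    have hk : 1 ≤ k ∧ (f ^ k) a = a := Nat.find_spec hex
    have hmin : ∀ j, 1 ≤ j → j < k → (f ^ j) a ≠ a :=
      fun j h1 hj h2 => Nat.find_min hex hj ⟨h1, h2⟩
    have : ∀ j, 1 ≤ j → j ≤ k → (g ^ j) b = (f ^ j) a := by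
      intro j h1
      induction j, h1 using Nat.le_induction with
      | base => intro _; simp [hgb]
      | succ j h1 ih =>
        intro h2
        rw [pow_succ', Equiv.Perm.mul_apply, ih (by omega),
          hg _ (hBn j) (hmin j h1 (by omega)) (hne j), pow_succ', Equiv.Perm.mul_apply]
    exact Equiv.Perm.SameCycle.symm ⟨k, by simpa [hk.2] using this k hk.1 le_rfl⟩

/-- The permutation which follows an arc of `t` and then an arc of `σ`. -/
def stepPerm {Q : Type} {col : Q → Bool} {σ t : Q → Q} (hσ : IsMatching col σ)
    (ht : IsMatching col t) : Equiv.Perm Q :=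
  (Function.Involutive.toPerm t ht.invol).trans (Function.Involutive.toPerm σ hσ.invol)

theorem stepPerm_apply {Q : Type} {col : Q → Bool} {σ t : Q → Q} (hσ : IsMatching col σ)
    (ht : IsMatching col t) (u : Q) : stepPerm hσ ht u = σ (t u) := rfl

theorem stepPerm_inv_apply {Q : Type} {col : Q → Bool} {σ t : Q → Q} (hσ : IsMatching col σ)
    (ht : IsMatching col t) (u : Q) : (stepPerm hσ ht)⁻¹ u = t (σ u) := rfl

theorem sameCircle_iff {Q : Type} {col : Q → Bool} {σ t : Q → Q} (hσ : IsMatching col σ)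
    (ht : IsMatching col t) (u v : Q) (huv : col u ≠ col v) :
    SameCircle σ t u v ↔ (stepPerm hσ ht).SameCycle u (t v) := by
  set π := stepPerm hσ ht with hπ
  have mem_iff : ∀ {S : Set Q}, (∀ v ∈ S, σ v ∈ S) → (∀ v ∈ S, t v ∈ S) →
      ∀ {x y}, SameCircle σ t x y → (x ∈ S ↔ y ∈ S) := by
    intro S h1 h2 x y h
    induction h with
    | rel x y h =>
      rcases h with rfl | rfl
      · exact ⟨h1 x, fun h => by simpa [hσ.invol] using h1 _ h⟩
      · exact ⟨h2 x, fun h => by simpa [ht.invol] using h2 _ h⟩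
    | refl => rfl
    | symm _ _ _ h => exact h.symm
    | trans _ _ _ _ _ h h' => exact h.trans h'
  constructor
  · intro h
    let S : Set Q := {w | (col u = col w ∧ π.SameCycle u w) ∨ (col u ≠ col w ∧ π.SameCycle u (t w))}
    have hu : u ∈ S := Or.inl ⟨rfl, Equiv.Perm.SameCycle.refl _ _⟩
    have hS1 : ∀ w ∈ S, σ w ∈ S := by
      rintro w (⟨h1, h2⟩ | ⟨h1, h2⟩)
      · refine Or.inr ⟨by rw [hσ.col_flip, h1]; cases col w <;> simp, ?_⟩
        rw [← stepPerm_inv_apply hσ ht, ← hπ]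
        exact Equiv.Perm.sameCycle_apply_right.1 (by simpa using h2)
      · refine Or.inl ⟨by rw [hσ.col_flip]; revert h1; cases col u <;> cases col w <;> simp, ?_⟩
        have : σ w = π (t w) := by rw [hπ, stepPerm_apply, ht.invol]
        rw [this]
        exact Equiv.Perm.sameCycle_apply_right.2 h2
    have hS2 : ∀ w ∈ S, t w ∈ S := by
      rintro w (⟨h1, h2⟩ | ⟨h1, h2⟩)
      · refine Or.inr ⟨by rw [ht.col_flip, h1]; cases col w <;> simp, ?_⟩
        rwa [ht.invol]
      · refine Or.inl ⟨by rw [ht.col_flip]; revert h1; cases col u <;> cases col w <;> simp, h2⟩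
    rcases (mem_iff hS1 hS2 h).1 hu with h | h
    · exact absurd h.1 huv
    · exact h.2
  · rintro ⟨i, hi⟩
    have hstep : ∀ w, SameCircle σ t w (π w) := fun w =>
      .trans _ _ _ (.rel _ _ (Or.inr rfl)) (.rel _ _ (Or.inl rfl))
    have : ∀ (i : ℤ) w, SameCircle σ t w ((π ^ i) w) := by
      intro i
      induction i with
      | zero => intro w; exact .refl _
      | succ i ih =>
        intro w
        rw [zpow_add_one, Equiv.Perm.mul_apply]
        exact .trans _ _ _ (hstep w) (ih _)
      | pred i ih =>
        intro w
        rw [zpow_sub_one, Equiv.Perm.mul_apply]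
        refine .trans _ _ _ (.symm _ _ ?_) (ih _)
        have := hstep (π⁻¹ w)
        rwa [show π (π⁻¹ w) = w by simp] at this
    refine .trans _ _ _ (hi ▸ this i u) (.symm _ _ (.rel _ _ (Or.inr rfl)))

/-- `t'` is obtained from `t` by a saddle along the arcs at `x` and `y`. -/
structure IsSaddle {Q : Type} (t t' : Q → Q) (x y : Q) : Prop where
  hx : t' x = y
  hy : t' y = x
  htx : t' (t x) = t y
  hty : t' (t y) = t x
  other : ∀ u, u ≠ x → u ≠ y → u ≠ t x → u ≠ t y → t' u = t u

theorem IsSaddle.symm {Q : Type} {t t' : Q → Q} (ht : ∀ q, t (t q) = q) {x y : Q}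
    (h : IsSaddle t t' x y) : IsSaddle t' t x (t x) where
  hx := rfl
  hy := ht x
  htx := by rw [h.hx, h.htx]
  hty := by rw [h.htx, ht, h.hx]
  other u h1 h2 h3 h4 := by
    rw [h.hx] at h3
    rw [h.htx] at h4
    exact (h.other u h1 h3 h2 h4).symm

theorem saddle_join {Q : Type} {σ t t' : Q → Q} {x y : Q} (h : IsSaddle t t' x y) (u v : Q)
    (huv : Relation.EqvGen (fun p q => q = σ p ∨ q = t p ∨ q = t' p) u v) :
    circ σ t u v ∨ (circ σ t u x ∧ circ σ t y v) ∨ (circ σ t u y ∧ circ σ t x v) := by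
  have hσ : ∀ p, circ σ t p (σ p) := fun p => .rel _ _ (Or.inl rfl)
  have ht : ∀ p, circ σ t p (t p) := fun p => .rel _ _ (Or.inr rfl)
  have rfl' : ∀ p, circ σ t p p := (circ σ t).refl
  have symm' : ∀ {p q}, circ σ t p q → circ σ t q p := (circ σ t).symm
  have trans' : ∀ {p q w}, circ σ t p q → circ σ t q w → circ σ t p w := (circ σ t).trans
  induction huv with
  | rel a b hab =>
    rcases hab with rfl | rfl | rfl
    · exact Or.inl (hσ a)
    · exact Or.inl (ht a)
    · by_cases h1 : a = x
      · subst h1; rw [h.hx]; exact Or.inr (Or.inl ⟨rfl' _, rfl' _⟩)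
      by_cases h2 : a = y
      · subst h2; rw [h.hy]; exact Or.inr (Or.inr ⟨rfl' _, rfl' _⟩)
      by_cases h3 : a = t x
      · subst h3; rw [h.htx]; exact Or.inr (Or.inl ⟨symm' (ht x), ht y⟩)
      by_cases h4 : a = t y
      · subst h4; rw [h.hty]; exact Or.inr (Or.inr ⟨symm' (ht y), ht x⟩)
      rw [h.other a h1 h2 h3 h4]
      exact Or.inl (ht a)
  | refl a => exact Or.inl (rfl' a)
  | symm a b _ ih =>
    rcases ih with h | ⟨h, h'⟩ | ⟨h, h'⟩
    · exact Or.inl (symm' h)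
    · exact Or.inr (Or.inr ⟨symm' h', symm' h⟩)
    · exact Or.inr (Or.inl ⟨symm' h', symm' h⟩)
  | trans a b c _ _ ih ih' =>
    rcases ih with h | ⟨h, h'⟩ | ⟨h, h'⟩ <;> rcases ih' with k | ⟨k, k'⟩ | ⟨k, k'⟩
    · exact Or.inl (trans' h k)
    · exact Or.inr (Or.inl ⟨trans' h k, k'⟩)
    · exact Or.inr (Or.inr ⟨trans' h k, k'⟩)
    · exact Or.inr (Or.inl ⟨h, trans' h' k⟩)
    · exact Or.inr (Or.inl ⟨h, k'⟩)
    · exact Or.inl (trans' h k')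
    · exact Or.inr (Or.inr ⟨h, trans' h' k⟩)
    · exact Or.inl (trans' h k')
    · exact Or.inr (Or.inr ⟨h, k'⟩)

theorem saddle_xor {Q : Type} [Finite Q] {col : Q → Bool} {σ t t' : Q → Q} {x y : Q}
    (hσ : IsMatching col σ) (ht : IsMatching col t) (ht' : IsMatching col t')
    (h : IsSaddle t t' x y) (hxy : col x ≠ col y) (hne : t x ≠ y) :
    SameCircle σ t x y ↔ ¬ SameCircle σ t' x (t x) := by
  rw [sameCircle_iff hσ ht _ _ hxy,
    sameCircle_iff hσ ht' x (t x) (by rw [ht.col_flip]; cases col x <;> simp), h.htx]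
  refine sameCycle_xor (fun u => col u = col x) _ _ ?_ x (t y) rfl ?_ ?_ ?_
  · intro u hu
    rw [stepPerm_apply, hσ.col_flip, ht.col_flip, hu]; simp
  · intro e
    apply hne
    rw [e, ht.invol]
  · rw [stepPerm_apply, stepPerm_apply, h.hty]
  · intro u hu h1 h2
    rw [stepPerm_apply, stepPerm_apply, h.other u h1 ?_ ?_ h2]
    · rintro rfl; exact hxy hu.symm
    · rintro rfl
      rw [ht.col_flip] at hu
      revert hu; cases col x <;> simp

/-- A saddle changes the number of circles by one. -/
theorem saddle_numCirc {Q : Type} [Finite Q] {col : Q → Bool} {σ t t' : Q → Q} {x y : Q}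
    (hσ : IsMatching col σ) (ht : IsMatching col t) (ht' : IsMatching col t')
    (h : IsSaddle t t' x y) (hxy : col x ≠ col y) (hne : t x ≠ y) (s : Q → Bool)
    (h1 : ∀ q, s (σ q) = s q) (h2 : ∀ q, s (t q) = s q) (h3 : ∀ q, s (t' q) = s q) (v : Bool) :
    (SameCircle σ t x y → numCirc σ t' {q | s q = v} =
      numCirc σ t {q | s q = v} + if s x = v then 1 else 0) ∧
    (¬ SameCircle σ t x y → numCirc σ t {q | s q = v} =
      numCirc σ t' {q | s q = v} + if s x = v then 1 else 0) := by
  let r' : Setoid Q := ⟨Relation.EqvGen (fun p q => q = σ p ∨ q = t p ∨ q = t' p),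
    Relation.EqvGen.is_equivalence _⟩
  have hle : ∀ u w, circ σ t u w → r' u w := fun u w huw =>
    Relation.EqvGen.mono (fun a b (hab : _ ∨ _) => by tauto) _ _ huw
  have hle' : ∀ u w, circ σ t' u w → r' u w := fun u w huw =>
    Relation.EqvGen.mono (fun a b (hab : _ ∨ _) => by tauto) _ _ huw
  have hJ := fun u w (huw : r' u w) => saddle_join h u w huw
  have hJ' := fun u w (huw : r' u w) => saddle_join (h.symm ht.invol) u w
    (Relation.EqvGen.mono (fun a b (hab : _ ∨ _) => by tauto) _ _ huw)
  have hxy' : r' x y := .rel _ _ (Or.inr (Or.inr h.hx.symm))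
  have hxt' : r' x (t x) := .rel _ _ (Or.inr (Or.inl rfl))
  have hS : ∀ u w, circ σ t u w → (u ∈ {q | s q = v} ↔ w ∈ {q | s q = v}) := fun u w huw => by
    simp only [Set.mem_ofPred_eq]; rw [sameCircle_const h1 h2 huw]
  have hS' : ∀ u w, circ σ t' u w → (u ∈ {q | s q = v} ↔ w ∈ {q | s q = v}) := fun u w huw => by
    simp only [Set.mem_ofPred_eq]; rw [sameCircle_const h1 h3 huw]
  have hsxy : s x = s y := by rw [← h.hx, h3]
  have key := saddle_xor hσ ht ht' h hxy hne
  have hr'eq : ∀ (r : Setoid Q) (a b : Q), r a b → (∀ u w, r u w → r' u w) →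
    (∀ u w, r' u w → r u w ∨ (r u a ∧ r b w) ∨ (r u b ∧ r a w)) → r = r' := by
    intro r a b hab hl hj
    ext u w
    refine ⟨hl u w, fun huw => ?_⟩
    rcases hj u w huw with h | ⟨h, h'⟩ | ⟨h, h'⟩
    · exact h
    · exact r.trans h (r.trans hab h')
    · exact r.trans h (r.trans (r.symm hab) h')
  have fin : ∀ (r : Setoid Q) (r'' : Setoid Q), r'' = r' → r' = r' →
      (s x = v → ((fun p => Quotient.mk r p) '' {q | s q = v}).ncard =
        ((fun p => Quotient.mk r' p) '' {q | s q = v}).ncard + 1) ∧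
      (¬ s x = v → ((fun p => Quotient.mk r p) '' {q | s q = v}).ncard =
        ((fun p => Quotient.mk r' p) '' {q | s q = v}).ncard) →
      ((fun p => Quotient.mk r p) '' {q | s q = v}).ncard =
        ((fun p => Quotient.mk r'' p) '' {q | s q = v}).ncard + if s x = v then 1 else 0 := by
    intro r r'' e _ hh
    subst e
    split_ifs with hv
    · exact hh.1 hv
    · simpa using hh.2 hv
  constructor
  · intro hc
    have hn : ¬ circ σ t' x (t x) := key.1 hc
    exact fin _ _ (hr'eq (circ σ t) x y hc hle hJ) rfl
      (ncard_join (circ σ t') r' hle' x (t x) hxt' hJ' hn _ hS' (by simp [h2]))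
  · intro hc
    have hn : circ σ t' x (t x) := by
      by_contra hh
      exact hc (key.2 hh)
    exact fin _ _ (hr'eq (circ σ t') x (t x) hn hle' hJ') rfl
      (ncard_join (circ σ t) r' hle x y hxy' hJ hc _ hS (by simp [hsxy]))

end Count

section EvalEps

variable {P : Type}

theorem numCirc_comm (σ τ : P → P) (S : Set P) : numCirc σ τ S = numCirc τ σ S := by
  have : circ σ τ = circ τ σ := by
    ext x y
    exact ⟨fun h => Relation.EqvGen.mono (fun a b (hab : _ ∨ _) => hab.symm) _ _ h,
      fun h => Relation.EqvGen.mono (fun a b (hab : _ ∨ _) => hab.symm) _ _ h⟩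
  unfold numCirc
  rw [this]

theorem ncard_image_circ {Q : Type} (f : P → Q) (r : Setoid P) (r' : Setoid Q)
    (h : ∀ x y, r' (f x) (f y) ↔ r x y) (A : Set P) :
    ((fun p => Quotient.mk r' p) '' (f '' A)).ncard = ((fun p => Quotient.mk r p) '' A).ncard := by
  let g : Quotient r → Quotient r' := Quotient.map' f fun x y hxy => (h x y).2 hxy
  have hg : Function.Injective g := by
    intro x y
    induction x using Quotient.inductionOn
    induction y using Quotient.inductionOn
    intro e
    exact Quotient.sound ((h _ _).1 (Quotient.exact e))
  rw [← Set.ncard_image_of_injective _ hg, Set.image_image, Set.image_image]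
  rfl

section Sum

variable {P₁ P₂ : Type} (σ τ : P₁ → P₁) (σ' τ' : P₂ → P₂)

theorem sameCircle_sum (u v : P₁ ⊕ P₂) (h : SameCircle (Sum.map σ σ') (Sum.map τ τ') u v) :
    Sum.LiftRel (SameCircle σ τ) (SameCircle σ' τ') u v := by
  induction h with
  | rel x y h =>
    rcases x with x | x <;> rcases h with rfl | rfl
    · exact .inl (.rel _ _ (Or.inl rfl))
    · exact .inl (.rel _ _ (Or.inr rfl))
    · exact .inr (.rel _ _ (Or.inl rfl))
    · exact .inr (.rel _ _ (Or.inr rfl))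
  | refl x => rcases x with x | x
              · exact .inl (.refl _)
              · exact .inr (.refl _)
  | symm x y _ ih =>
    cases ih with
    | inl h => exact .inl (.symm _ _ h)
    | inr h => exact .inr (.symm _ _ h)
  | trans x y z _ _ ih ih' =>
    cases ih with
    | inl h => cases ih' with
      | inl h' => exact .inl (.trans _ _ _ h h')
    | inr h => cases ih' with
      | inr h' => exact .inr (.trans _ _ _ h h')

theorem sameCircle_map {Q : Type} {f : P → Q} {σ τ : P → P} {σ' τ' : Q → Q}
    (h1 : ∀ p, SameCircle σ' τ' (f p) (f (σ p))) (h2 : ∀ p, SameCircle σ' τ' (f p) (f (τ p)))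
    {x y : P} (h : SameCircle σ τ x y) : SameCircle σ' τ' (f x) (f y) := by
  induction h with
  | rel x y h => rcases h with rfl | rfl <;> simp [h1, h2]
  | refl => exact .refl _
  | symm _ _ _ h => exact .symm _ _ h
  | trans _ _ _ _ _ h h' => exact .trans _ _ _ h h'

theorem numCirc_sum [Finite P₁] [Finite P₂] (s : P₁ ⊕ P₂ → Bool) (v : Bool) :
    numCirc (Sum.map σ σ') (Sum.map τ τ') {q | s q = v} =
      numCirc σ τ {p | s (Sum.inl p) = v} + numCirc σ' τ' {p | s (Sum.inr p) = v} := by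
  have e : {q | s q = v} = Sum.inl '' {p | s (Sum.inl p) = v} ∪
      Sum.inr '' {p | s (Sum.inr p) = v} := by
    ext q
    rcases q with q | q <;> simp
  unfold numCirc
  rw [e, Set.image_union, Set.ncard_union_eq]
  · congr 1
    · refine ncard_image_circ Sum.inl _ _ (fun x y => ⟨fun h => ?_, fun h => ?_⟩) _
      · cases sameCircle_sum σ τ σ' τ' _ _ h with
        | inl h => exact h
      · exact sameCircle_map (f := Sum.inl) (fun p => .rel _ _ (Or.inl rfl))
          (fun p => .rel _ _ (Or.inr rfl)) h
    · refine ncard_image_circ Sum.inr _ _ (fun x y => ⟨fun h => ?_, fun h => ?_⟩) _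
      · cases sameCircle_sum σ τ σ' τ' _ _ h with
        | inr h => exact h
      · exact sameCircle_map (f := Sum.inr) (fun p => .rel _ _ (Or.inl rfl))
          (fun p => .rel _ _ (Or.inr rfl)) h
  · rw [Set.disjoint_left]
    rintro _ ⟨_, ⟨p, _, rfl⟩, rfl⟩ ⟨_, ⟨q, _, rfl⟩, h⟩
    cases sameCircle_sum σ τ σ' τ' _ _ (Quotient.exact h)

end Sum

theorem stage_empty (τ : P → P) : stage τ ∅ = Sum.map τ τ := by
  funext x
  rcases x with x | x <;> simp [stage]

theorem stage_univ (τ : P → P) : stage τ Set.univ = Sum.swap := by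
  funext x
  rcases x with x | x <;> simp [stage]

theorem numCirc_stage_univ [Finite P] (σ τ ρ : P → P) (s : P → Bool) (v : Bool) :
    numCirc (Sum.map σ ρ) (stage τ Set.univ) {q | Sum.elim s s q = v} =
      numCirc σ ρ {p | s p = v} := by
  rw [stage_univ]
  have hv : ∀ x : P, SameCircle (Sum.map σ ρ) Sum.swap (Sum.inl x) (Sum.inr x) := fun x =>
    .rel _ _ (Or.inr rfl)
  have key : ∀ x y : P, SameCircle (Sum.map σ ρ) Sum.swap (Sum.inl x) (Sum.inl y) ↔
      SameCircle σ ρ x y := by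
    intro x y
    constructor
    · intro h
      refine sameCircle_map (f := Sum.elim id id) ?_ ?_ h
      · rintro (p | p)
        · exact .rel _ _ (Or.inl rfl)
        · exact .rel _ _ (Or.inr rfl)
      · rintro (p | p) <;> exact .refl _
    · intro h
      refine sameCircle_map (f := Sum.inl) ?_ ?_ h
      · intro p
        exact .rel _ _ (Or.inl rfl)
      · intro p
        exact .trans _ _ _ (hv p) (.trans _ _ _ (.rel _ _ (Or.inl rfl)) (.symm _ _ (hv _)))
  unfold numCirc
  rw [← ncard_image_circ Sum.inl (circ σ ρ) (circ (Sum.map σ ρ) Sum.swap) key]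
  congr 1
  ext c
  constructor
  · rintro ⟨q | q, hq, rfl⟩
    · exact ⟨_, ⟨q, hq, rfl⟩, rfl⟩
    · exact ⟨_, ⟨q, hq, rfl⟩, Quotient.sound (hv q)⟩
  · rintro ⟨_, ⟨q, hq, rfl⟩, rfl⟩
    exact ⟨Sum.inl q, hq, rfl⟩

/-- The colouring of the two copies of the points: vertical segments join different colours. -/
def dcol (col : P → Bool) : P ⊕ P → Bool := Sum.elim col fun p => !col p

theorem IsMatching.dmap {col : P → Bool} {σ ρ : P → P} (hσ : IsMatching col σ)
    (hρ : IsMatching col ρ) : IsMatching (dcol col) (Sum.map σ ρ) where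
  invol := by rintro (p | p) <;> simp [hσ.invol, hρ.invol]
  col_flip := by rintro (p | p) <;> simp [dcol, hσ.col_flip, hρ.col_flip]

theorem isMatching_stage {col : P → Bool} {τ : P → P} (hτ : IsMatching col τ) (S : Set P)
    (hS : ∀ p, p ∈ S ↔ τ p ∈ S) : IsMatching (dcol col) (stage τ S) where
  invol := by
    rintro (p | p) <;> by_cases hp : p ∈ S <;> have hp' := hp <;> rw [hS] at hp' <;>
      simp [stage, hp, hp', hτ.invol]
  col_flip := by
    rintro (p | p) <;> by_cases hp : p ∈ S <;> simp [stage, hp, dcol, hτ.col_flip]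

theorem isSaddle_stage (τ : P → P) (S : Set P) (p : P) (hp : p ∉ S) :
    IsSaddle (stage τ S) (stage τ (S ∪ {p, τ p})) (Sum.inl p) (Sum.inr p) where
  hx := by simp [stage]
  hy := by simp [stage]
  htx := by simp [stage, hp]
  hty := by simp [stage, hp]
  other := by
    rintro (u | u) h1 h2 h3 h4
    · have hup : u ≠ p := fun e => h1 (by rw [e])
      have huq : u ≠ τ p := fun e => h3 (by simp [stage, hp, e])
      by_cases hu : u ∈ S <;> simp [stage, hu, hup, huq]
    · have hup : u ≠ p := fun e => h2 (by rw [e])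
      have huq : u ≠ τ p := fun e => h4 (by simp [stage, hp, e])
      by_cases hu : u ∈ S <;> simp [stage, hu, hup, huq]

/-- The value `± 2 h` of the handle element. -/
noncomputable def hval (v : Bool) : Polynomial ℤ := if v then 2 * Polynomial.X else -2 * Polynomial.X

theorem closed_step {col : P → Bool} {τ : P → P} (hτ : IsMatching col τ) {S : Set P}
    (hS : ∀ p, p ∈ S ↔ τ p ∈ S) (p : P) : ∀ q, q ∈ S ∪ {p, τ p} ↔ τ q ∈ S ∪ {p, τ p} := by
  intro q
  have h1 : τ q = p ↔ q = τ p := by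
    constructor <;> rintro rfl <;> simp [hτ.invol]
  have h2 : τ q = τ p ↔ q = p := (Function.Involutive.injective hτ.invol).eq_iff
  simp only [Set.mem_union, Set.mem_insert_iff, Set.mem_singleton_iff, ← hS, h1, h2]
  tauto

theorem stage_const {τ : P → P} {S : Set P} {s : P → Bool} (h : ∀ p, p ∉ S → s (τ p) = s p) :
    ∀ q, Sum.elim s s (stage τ S q) = Sum.elim s s q := by
  rintro (q | q) <;> by_cases hq : q ∈ S <;> simp [stage, hq, h]

theorem const_of_ev_contractFactor_ne_zero [Finite P] {col : P → Bool} {σ τ ρ : P → P}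
    (hσ : IsMatching col σ) (hτ : IsMatching col τ) (hρ : IsMatching col ρ) (s : P → Bool)
    (h1 : ∀ p, s (σ p) = s p) (h2 : ∀ p, s (ρ p) = s p) (l : List P) :
    ∀ S : Set P, (∀ p, p ∈ S ↔ τ p ∈ S) → (∀ p, p ∈ S ∨ p ∈ l) →
      ev s (contractFactor σ τ ρ l S) ≠ 0 → ∀ p, p ∉ S → s (τ p) = s p := by
  induction l with
  | nil => intro S _ hl _ p hp; exact absurd (by simpa using hl p) hp
  | cons p l ih =>
    intro S hS hl hne
    rw [contractFactor] at hne
    split_ifs at hne with hp hc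
    · exact ih S hS (fun q => by
        rcases hl q with h | h
        · exact Or.inl h
        · rcases List.mem_cons.1 h with rfl | h
          · exact Or.inl hp
          · exact Or.inr h) hne
    all_goals
      rw [map_mul] at hne
      have hrest := ih (S ∪ {p, τ p}) (closed_step hτ hS p) (fun q => by
        rcases hl q with h | h
        · exact Or.inl (Or.inl h)
        · rcases List.mem_cons.1 h with rfl | h
          · exact Or.inl (Or.inr (Or.inl rfl))
          · exact Or.inr h) (right_ne_zero_of_mul hne)
      have hpp : s (τ p) = s p := by
        first
        | (have h0 := left_ne_zero_of_mul hne
           rw [map_add, ev_X, ev_X] at h0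
           revert h0
           cases s p <;> cases s (τ p) <;> simp)
        | (have hx := saddle_xor (hσ.dmap hρ) (isMatching_stage hτ S hS)
             (isMatching_stage hτ _ (closed_step hτ hS p)) (isSaddle_stage τ S p hp)
             (by simp [dcol]) (by simp [stage, hp])
           have hx' : SameCircle (Sum.map σ ρ) (stage τ (S ∪ {p, τ p})) (Sum.inl p)
               (stage τ S (Sum.inl p)) := by
             by_contra hh
             exact hc (hx.2 hh)
           have := sameCircle_const (s := Sum.elim s s) (by rintro (q | q) <;> simp [h1, h2])
             (stage_const hrest) hx'
           simpa [stage, hp] using this.symm)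
      intro q hq
      by_cases hq1 : q = p
      · rw [hq1, hpp]
      by_cases hq2 : q = τ p
      · rw [hq2, hτ.invol, hpp]
      exact hrest q (by simp [hq, hq1, hq2])

theorem ev_contractFactor [Finite P] {col : P → Bool} {σ τ ρ : P → P}
    (hσ : IsMatching col σ) (hτ : IsMatching col τ) (hρ : IsMatching col ρ) (s : P → Bool)
    (h1 : ∀ p, s (σ p) = s p) (h2 : ∀ p, s (ρ p) = s p) (h3 : ∀ p, s (τ p) = s p) (l : List P) :
    ∀ S : Set P, (∀ p, p ∈ S ↔ τ p ∈ S) → (∀ p, p ∈ S ∨ p ∈ l) →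
      ∃ e : Bool → ℕ, ev s (contractFactor σ τ ρ l S) = ∏ v, hval v ^ e v ∧
        ∀ v, 4 * e v + 2 * numCirc (Sum.map σ ρ) (stage τ S) {q | Sum.elim s s q = v} =
          2 * numCirc σ ρ {p | s p = v} + {p | p ∉ S ∧ s p = v}.ncard := by
  induction l with
  | nil =>
    intro S _ hl
    have hS : S = Set.univ := Set.eq_univ_of_forall fun p => by simpa using hl p
    subst hS
    refine ⟨0, by simp [contractFactor], fun v => ?_⟩
    rw [numCirc_stage_univ]
    simp
  | cons p l ih =>
    intro S hS hl
    rw [contractFactor]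
    by_cases hp : p ∈ S
    · rw [if_pos hp]
      exact ih S hS (fun q => by
        rcases hl q with h | h
        · exact Or.inl h
        · rcases List.mem_cons.1 h with rfl | h
          · exact Or.inl hp
          · exact Or.inr h)
    rw [if_neg hp, map_mul]
    obtain ⟨e, he, hev⟩ := ih (S ∪ {p, τ p}) (closed_step hτ hS p) (fun q => by
        rcases hl q with h | h
        · exact Or.inl (Or.inl h)
        · rcases List.mem_cons.1 h with rfl | h
          · exact Or.inl (Or.inr (Or.inl rfl))
          · exact Or.inr h)
    have hcount : ∀ v, {q | q ∉ S ∧ s q = v}.ncard =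
        {q | q ∉ S ∪ {p, τ p} ∧ s q = v}.ncard + if s p = v then 2 else 0 := by
      intro v
      split_ifs with hv
      · have : {q | q ∉ S ∧ s q = v} = {q | q ∉ S ∪ {p, τ p} ∧ s q = v} ∪ {p, τ p} := by
          ext q
          have hpS : τ p ∉ S := fun h => hp ((hS p).2 h)
          by_cases hq1 : q = p
          · subst hq1; simp [hp, hv]
          by_cases hq2 : q = τ p
          · subst hq2; simp [hpS, hv, h3]
          simp [hq1, hq2]
        rw [this, Set.ncard_union_eq, Set.ncard_pair (hτ.ne p).symm]
        rw [Set.disjoint_left]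
        rintro q ⟨hq, -⟩ hq'
        exact hq (Or.inr hq')
      · have : {q | q ∉ S ∧ s q = v} = {q | q ∉ S ∪ {p, τ p} ∧ s q = v} := by
          ext q
          by_cases hq1 : q = p
          · subst hq1; simp [hv]
          by_cases hq2 : q = τ p
          · subst hq2; simp [hv, h3]
          simp [hq1, hq2]
        rw [this, add_zero]
    have hsad := fun v => saddle_numCirc (hσ.dmap hρ) (isMatching_stage hτ S hS)
      (isMatching_stage hτ _ (closed_step hτ hS p)) (isSaddle_stage τ S p hp)
      (by simp [dcol]) (by simp [stage, hp]) (Sum.elim s s)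
      (by rintro (q | q) <;> simp [h1, h2]) (stage_const fun q _ => h3 q)
      (stage_const fun q _ => h3 q) v
    by_cases hc : SameCircle (Sum.map σ ρ) (stage τ S) (Sum.inl p) (Sum.inr p)
    · refine ⟨fun v => e v + if s p = v then 1 else 0, ?_, fun v => ?_⟩
      · rw [if_pos hc, he, map_add, ev_X, ev_X, h3]
        cases s p <;> simp [hval, pow_succ] <;> ring
      · have := (hsad v).1 hc
        have := hev v
        have := hcount v
        simp only [Sum.elim_inl] at *
        by_cases hv : s p = v <;> simp only [hv, if_true, if_false] at * <;> omega
    · refine ⟨e, ?_, fun v => ?_⟩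
      · rw [if_neg hc, he, map_one, one_mul]
      · have := (hsad v).2 hc
        have := hev v
        have := hcount v
        simp only [Sum.elim_inl] at *
        by_cases hv : s p = v <;> simp only [hv, if_true, if_false] at * <;> omega

/-- The value of `eps` at a point which is not constant along the arcs of `τ`. -/
theorem ev_eps_eq_zero [Fintype P] {col : P → Bool} {σ τ ρ : P → P}
    (hσ : IsMatching col σ) (hτ : IsMatching col τ) (hρ : IsMatching col ρ) (s : P → Bool)
    (h1 : ∀ p, s (σ p) = s p) (h2 : ∀ p, s (ρ p) = s p) (h3 : ¬ ∀ p, s (τ p) = s p) :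
    ev s (eps σ τ ρ) = 0 := by
  by_contra hne
  exact h3 fun p => const_of_ev_contractFactor_ne_zero hσ hτ hρ s h1 h2 _ ∅ (by simp) (by simp)
    hne p (by simp)

/-- The value of `eps` at a point which is constant along all arcs. -/
theorem ev_eps [Fintype P] {col : P → Bool} {σ τ ρ : P → P}
    (hσ : IsMatching col σ) (hτ : IsMatching col τ) (hρ : IsMatching col ρ) (s : P → Bool)
    (h1 : ∀ p, s (σ p) = s p) (h2 : ∀ p, s (ρ p) = s p) (h3 : ∀ p, s (τ p) = s p) :
    ∃ e : Bool → ℕ, ev s (eps σ τ ρ) = ∏ v, hval v ^ e v ∧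
      ∀ v, 4 * e v + 2 * numCirc σ τ {p | s p = v} + 2 * numCirc τ ρ {p | s p = v} =
        2 * numCirc σ ρ {p | s p = v} + {p | s p = v}.ncard := by
  obtain ⟨e, he, hv⟩ := ev_contractFactor hσ hτ hρ s h1 h2 h3 Finset.univ.toList ∅ (by simp)
    (by simp)
  refine ⟨e, he, fun v => ?_⟩
  have := hv v
  rw [stage_empty, numCirc_sum] at this
  simp only [Sum.elim_inl, Sum.elim_inr, Set.mem_empty_iff_false, not_false_eq_true,
    true_and] at this
  rw [numCirc_comm τ ρ]
  omega

end EvalEps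

section Category

/-- Matchings of `P` whose arcs join points of different colours; gluing two of them gives a
closed 1-manifold, oriented compatibly with the colours. -/
structure ColMatching {P : Type} (col : P → Bool) where
  pair : P → P
  isMatching : IsMatching col pair

instance {P : Type} (col : P → Bool) : CoeFun (ColMatching col) fun _ => P → P :=
  ⟨ColMatching.pair⟩

variable {P : Type} {col : P → Bool}

/-- The group `ℱ(W(σ)τ) = 𝒜 ^ {⊗ circles}`, where `𝒜 = ℤ[X] / (X ^ 2)`: the element `x_p`
is `X` in the factor of the circle through `p`. -/
abbrev Space (σ τ : P → P) : Type := MvPolynomial P ℤ ⧸ circleIdeal σ τ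

/-- The class of a polynomial. -/
noncomputable abbrev cls (σ τ : P → P) (f : MvPolynomial P ℤ) : Space σ τ := Ideal.Quotient.mk _ f

theorem cls_eq [Finite P] {σ τ : P → P} {f g : MvPolynomial P ℤ}
    (h : ∀ s : P → Bool, (∀ p, s (σ p) = s p) → (∀ p, s (τ p) = s p) → ev s f = ev s g) :
    cls σ τ f = cls σ τ g :=
  Ideal.Quotient.eq.2 (mem_circleIdeal fun s h1 h2 => by rw [map_sub, h s h1 h2, sub_self])

theorem circleIdeal_le {σ τ : P → P} {I : Ideal (MvPolynomial P ℤ)}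
    (h0 : ∀ p, MvPolynomial.X p ^ 2 ∈ I)
    (h1 : ∀ p, (MvPolynomial.X p - MvPolynomial.X (σ p) : MvPolynomial P ℤ) ∈ I)
    (h2 : ∀ p, (MvPolynomial.X p - MvPolynomial.X (τ p) : MvPolynomial P ℤ) ∈ I) :
    circleIdeal σ τ ≤ I := by
  refine Ideal.span_le.2 ?_
  rintro _ ⟨p, rfl | rfl | rfl⟩
  · exact h0 p
  · exact h1 p
  · exact h2 p

theorem X_sq_mem (σ τ : P → P) (p : P) :
    (MvPolynomial.X p ^ 2 : MvPolynomial P ℤ) ∈ circleIdeal σ τ :=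
  Ideal.subset_span ⟨p, Or.inl rfl⟩

variable [Fintype P]

theorem mul_eps_mem (σ τ ρ : ColMatching col) :
    (∀ f ∈ circleIdeal σ τ, f * eps σ τ ρ ∈ circleIdeal σ ρ) ∧
    (∀ f ∈ circleIdeal τ ρ, f * eps σ τ ρ ∈ circleIdeal σ ρ) := by
  have hσ : ∀ p, (MvPolynomial.X p - MvPolynomial.X (σ p) : MvPolynomial P ℤ) ∈
      circleIdeal σ ρ := fun p => X_sub_X_mem (.rel _ _ (Or.inl rfl))
  have hρ : ∀ p, (MvPolynomial.X p - MvPolynomial.X (ρ p) : MvPolynomial P ℤ) ∈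
      circleIdeal σ ρ := fun p => X_sub_X_mem (.rel _ _ (Or.inr rfl))
  have hτ : ∀ p, (MvPolynomial.X p - MvPolynomial.X (τ p)) * eps σ τ ρ ∈ circleIdeal σ ρ := by
    intro p
    refine mem_circleIdeal fun s h1 h2 => ?_
    rw [map_mul]
    by_cases h3 : ∀ p, s (τ p) = s p
    · rw [map_sub, ev_X, ev_X, h3, sub_self, zero_mul]
    · rw [ev_eps_eq_zero σ.isMatching τ.isMatching ρ.isMatching s h1 h2 h3, mul_zero]
  let I : Ideal (MvPolynomial P ℤ) :=
    Submodule.comap (LinearMap.mulRight (MvPolynomial P ℤ) (eps σ τ ρ)) (circleIdeal σ ρ)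
  have hI : ∀ f, f ∈ I ↔ f * eps σ τ ρ ∈ circleIdeal σ ρ := fun f => Iff.rfl
  clear_value I
  have hsq : ∀ p, MvPolynomial.X p ^ 2 ∈ I := fun p =>
    (hI _).2 (Ideal.mul_mem_right _ _ (X_sq_mem σ ρ p))
  constructor
  · intro f hf
    exact (hI f).1 (circleIdeal_le hsq (fun p => (hI _).2 (Ideal.mul_mem_right _ _ (hσ p)))
      (fun p => (hI _).2 (hτ p)) hf)
  · intro f hf
    exact (hI f).1 (circleIdeal_le hsq (fun p => (hI _).2 (hτ p))
      (fun p => (hI _).2 (Ideal.mul_mem_right _ _ (hρ p))) hf)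

/-- The map `ℱ(W(σ)τ) ⊗ ℱ(W(τ)ρ) → ℱ(W(σ)ρ)` induced by the contraction cobordism. -/
noncomputable def contract (σ τ ρ : ColMatching col) :
    Space σ τ →ₗ[MvPolynomial P ℤ] Space τ ρ →ₗ[MvPolynomial P ℤ] Space σ ρ :=
  Submodule.liftQ (circleIdeal σ τ)
    (LinearMap.toSpanSingleton _ _ (Submodule.liftQ (circleIdeal τ ρ)
      (LinearMap.toSpanSingleton _ _ (cls σ ρ (eps σ τ ρ))) (by
        intro f hf
        rw [LinearMap.mem_ker, LinearMap.toSpanSingleton_apply]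
        exact Ideal.Quotient.eq_zero_iff_mem.2 ((mul_eps_mem σ τ ρ).2 f hf)))) (by
    intro f hf
    rw [LinearMap.mem_ker, LinearMap.toSpanSingleton_apply]
    refine Submodule.linearMap_qext _ (LinearMap.ext_ring ?_)
    have : f • (1 : MvPolynomial P ℤ) • (cls σ ρ (eps σ τ ρ)) = 0 := by
      rw [one_smul]
      exact Ideal.Quotient.eq_zero_iff_mem.2 ((mul_eps_mem σ τ ρ).1 f hf)
    exact this)

theorem contract_cls (σ τ ρ : ColMatching col) (f g : MvPolynomial P ℤ) :
    contract σ τ ρ (cls σ τ f) (cls τ ρ g) = cls σ ρ (f * g * eps σ τ ρ) := by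
  change f • g • cls σ ρ (eps σ τ ρ) = _
  rw [smul_smul]
  rfl

theorem two_mul_numCirc_self (σ : ColMatching col) (s : P → Bool) (h : ∀ p, s (σ p) = s p)
    (v : Bool) : 2 * numCirc σ σ {p | s p = v} = {p | s p = v}.ncard := by
  have key : ∀ x y, SameCircle σ σ x y → y = x ∨ y = σ x := by
    intro x y hxy
    induction hxy with
    | rel a b h => rcases h with rfl | rfl <;> simp
    | refl => simp
    | symm a b _ ih => rcases ih with rfl | rfl <;> simp [σ.isMatching.invol]
    | trans a b c _ _ ih ih' =>
      rcases ih with rfl | rfl <;> rcases ih' with rfl | rfl <;> simp [σ.isMatching.invol]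
  set B : Set P := {p | s p = v ∧ col p = true} with hB
  have h1 : (fun p => Quotient.mk (circ σ σ) p) '' {p | s p = v} =
      (fun p => Quotient.mk (circ σ σ) p) '' B := by
    apply Set.Subset.antisymm
    · rintro _ ⟨p, hp, rfl⟩
      by_cases hc : col p = true
      · exact ⟨p, ⟨hp, hc⟩, rfl⟩
      · refine ⟨σ p, ⟨(h p).trans hp, ?_⟩, Quotient.sound (.symm _ _ (.rel _ _ (Or.inl rfl)))⟩
        rw [σ.isMatching.col_flip]; simpa using hc
    · exact Set.image_mono fun p hp => hp.1
  have h2 : Set.InjOn (fun p => Quotient.mk (circ σ σ) p) B := by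
    rintro x ⟨-, hx⟩ y ⟨-, hy⟩ hxy
    rcases key x y (Quotient.exact hxy) with e | e
    · exact e.symm
    · rw [e, σ.isMatching.col_flip, hx] at hy
      simp at hy
  have h3 : {p | s p = v} = B ∪ σ '' B := by
    ext p
    constructor
    · intro hp
      by_cases hc : col p = true
      · exact Or.inl ⟨hp, hc⟩
      · refine Or.inr ⟨σ p, ⟨(h p).trans hp, ?_⟩, σ.isMatching.invol p⟩
        rw [σ.isMatching.col_flip]; simpa using hc
    · rintro (hp | ⟨q, hq, rfl⟩)
      · exact hp.1
      · exact (h q).trans hq.1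
  unfold numCirc
  rw [h1, Set.InjOn.ncard_image h2, h3, Set.ncard_union_eq,
    Set.ncard_image_of_injective _ (Function.Involutive.injective σ.isMatching.invol), two_mul]
  rw [Set.disjoint_left]
  rintro _ ⟨-, hx⟩ ⟨y, ⟨-, hy⟩, rfl⟩
  rw [σ.isMatching.col_flip, hy] at hx
  simp at hx

theorem contract_one_left (σ ρ : ColMatching col) (x : Space σ ρ) :
    contract σ σ ρ (cls σ σ 1) x = x := by
  obtain ⟨f, rfl⟩ := Ideal.Quotient.mk_surjective x
  rw [contract_cls]
  refine cls_eq fun s h1 h2 => ?_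
  obtain ⟨e, he, hv⟩ := ev_eps σ.isMatching σ.isMatching ρ.isMatching s h1 h2 h1
  have : e = 0 := by
    funext v
    have := hv v
    have := two_mul_numCirc_self σ s h1 v
    simp only [Pi.zero_apply]
    omega
  rw [map_mul, he, this]
  simp

theorem contract_one_right (σ ρ : ColMatching col) (x : Space σ ρ) :
    contract σ ρ ρ x (cls ρ ρ 1) = x := by
  obtain ⟨f, rfl⟩ := Ideal.Quotient.mk_surjective x
  rw [contract_cls]
  refine cls_eq fun s h1 h2 => ?_
  obtain ⟨e, he, hv⟩ := ev_eps σ.isMatching ρ.isMatching ρ.isMatching s h1 h2 h2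
  have : e = 0 := by
    funext v
    have := hv v
    have := two_mul_numCirc_self ρ s h2 v
    simp only [Pi.zero_apply]
    omega
  rw [map_mul, he, this]
  simp

theorem ev_assoc (σ τ ρ υ : ColMatching col) (s : P → Bool) (h1 : ∀ p, s (σ p) = s p)
    (h2 : ∀ p, s (υ p) = s p) :
    ev s (eps σ τ ρ * eps σ ρ υ) = ev s (eps τ ρ υ * eps σ τ υ) := by
  rw [map_mul, map_mul]
  by_cases h3 : ∀ p, s (τ p) = s p
  · by_cases h4 : ∀ p, s (ρ p) = s p
    · obtain ⟨e₁, he₁, hv₁⟩ := ev_eps σ.isMatching τ.isMatching ρ.isMatching s h1 h4 h3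
      obtain ⟨e₂, he₂, hv₂⟩ := ev_eps σ.isMatching ρ.isMatching υ.isMatching s h1 h2 h4
      obtain ⟨e₃, he₃, hv₃⟩ := ev_eps τ.isMatching ρ.isMatching υ.isMatching s h3 h2 h4
      obtain ⟨e₄, he₄, hv₄⟩ := ev_eps σ.isMatching τ.isMatching υ.isMatching s h1 h2 h3
      rw [he₁, he₂, he₃, he₄, ← Finset.prod_mul_distrib, ← Finset.prod_mul_distrib]
      refine Finset.prod_congr rfl fun v _ => ?_
      rw [← pow_add, ← pow_add]
      congr 1
      have := hv₁ v
      have := hv₂ v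
      have := hv₃ v
      have := hv₄ v
      omega
    · rw [ev_eps_eq_zero σ.isMatching ρ.isMatching υ.isMatching s h1 h2 h4,
        ev_eps_eq_zero τ.isMatching ρ.isMatching υ.isMatching s h3 h2 h4]
      simp
  · rw [ev_eps_eq_zero σ.isMatching τ.isMatching υ.isMatching s h1 h2 h3]
    by_cases h4 : ∀ p, s (ρ p) = s p
    · rw [ev_eps_eq_zero σ.isMatching τ.isMatching ρ.isMatching s h1 h4 h3]
      simp
    · rw [ev_eps_eq_zero σ.isMatching ρ.isMatching υ.isMatching s h1 h2 h4]
      simp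

theorem contract_assoc (σ τ ρ υ : ColMatching col) (x : Space σ τ) (y : Space τ ρ)
    (z : Space ρ υ) :
    contract σ ρ υ (contract σ τ ρ x y) z = contract σ τ υ x (contract τ ρ υ y z) := by
  obtain ⟨f, rfl⟩ := Ideal.Quotient.mk_surjective x
  obtain ⟨g, rfl⟩ := Ideal.Quotient.mk_surjective y
  obtain ⟨k, rfl⟩ := Ideal.Quotient.mk_surjective z
  rw [contract_cls, contract_cls, contract_cls, contract_cls]
  refine cls_eq fun s h1 h2 => ?_
  have := ev_assoc σ τ ρ υ s h1 h2
  simp only [map_mul] at this ⊢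
  linear_combination (ev s f * ev s g * ev s k) * this

end Category

section ClosedSum

variable {P : Type} {col : P → Bool}

/-- The disjoint union of a matching of the top points and a matching of the bottom points. -/
def ColMatching.sum (b a : ColMatching col) : ColMatching (dcol col) :=
  ⟨Sum.map b a, b.isMatching.dmap a.isMatching⟩

theorem sum_const_iff (b a : ColMatching col) (s : P ⊕ P → Bool) :
    (∀ q, s (b.sum a q) = s q) ↔
      (∀ p, s (Sum.inl (b p)) = s (Sum.inl p)) ∧ (∀ p, s (Sum.inr (a p)) = s (Sum.inr p)) := by
  simp [ColMatching.sum, Sum.forall]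

theorem ncard_sum [Finite P] (s : P ⊕ P → Bool) (v : Bool) : {q | s q = v}.ncard =
    {p | s (Sum.inl p) = v}.ncard + {p | s (Sum.inr p) = v}.ncard := by
  have e : {q | s q = v} = Sum.inl '' {p | s (Sum.inl p) = v} ∪
      Sum.inr '' {p | s (Sum.inr p) = v} := by
    ext q
    rcases q with q | q <;> simp
  rw [e, Set.ncard_union_eq, Set.ncard_image_of_injective _ Sum.inl_injective,
    Set.ncard_image_of_injective _ Sum.inr_injective]
  rw [Set.disjoint_left]
  rintro _ ⟨p, _, rfl⟩ ⟨q, _, h⟩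
  cases h

theorem numCirc_closed [Finite P] (b a b' a' : ColMatching col) (s : P ⊕ P → Bool) (v : Bool) :
    numCirc (b.sum a) (b'.sum a') {q | s q = v} =
      numCirc b b' {p | s (Sum.inl p) = v} + numCirc a a' {p | s (Sum.inr p) = v} :=
  numCirc_sum _ _ _ _ s v

/-- `x ↦ x ⊗ 1`, from `ℱ(W(c)b)` to `ℱ(W(c)b ⊔ W(a)a)`. -/
noncomputable def inL (c b a : ColMatching col) :
    Space c b →+* Space (c.sum a) (b.sum a) :=
  Ideal.quotientMap _ (MvPolynomial.rename Sum.inl).toRingHom (by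
    refine circleIdeal_le (fun p => ?_) (fun p => ?_) (fun p => ?_)
    · simpa using X_sq_mem (c.sum a) (b.sum a) (Sum.inl p)
    · simpa using X_sub_X_mem (σ := c.sum a) (τ := b.sum a) (p := Sum.inl p)
        (q := Sum.inl (c p)) (.rel _ _ (Or.inl rfl))
    · simpa using X_sub_X_mem (σ := c.sum a) (τ := b.sum a) (p := Sum.inl p)
        (q := Sum.inl (b p)) (.rel _ _ (Or.inr rfl)))

/-- `x ↦ 1 ⊗ x`, from `ℱ(W(c)a)` to `ℱ(W(b)b ⊔ W(c)a)`. -/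
noncomputable def inR (b c a : ColMatching col) :
    Space c a →+* Space (b.sum a) (b.sum c) :=
  Ideal.quotientMap _ (MvPolynomial.rename Sum.inr).toRingHom (by
    refine circleIdeal_le (fun p => ?_) (fun p => ?_) (fun p => ?_)
    · simpa using X_sq_mem (b.sum a) (b.sum c) (Sum.inr p)
    · simpa using X_sub_X_mem (σ := b.sum a) (τ := b.sum c) (p := Sum.inr p)
        (q := Sum.inr (c p)) (.rel _ _ (Or.inr rfl))
    · simpa using X_sub_X_mem (σ := b.sum a) (τ := b.sum c) (p := Sum.inr p)
        (q := Sum.inr (a p)) (.rel _ _ (Or.inl rfl)))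

theorem inL_cls (c b a : ColMatching col) (f : MvPolynomial P ℤ) :
    inL c b a (cls c b f) = cls (c.sum a) (b.sum a) (MvPolynomial.rename Sum.inl f) := rfl

theorem inR_cls (b c a : ColMatching col) (f : MvPolynomial P ℤ) :
    inR b c a (cls c a f) = cls (b.sum a) (b.sum c) (MvPolynomial.rename Sum.inr f) := rfl

variable [Fintype P]

theorem contract_inL (c b d a : ColMatching col) (x : Space c b) (y : Space b d) :
    contract (c.sum a) (b.sum a) (d.sum a) (inL c b a x) (inL b d a y) =
      inL c d a (contract c b d x y) := by
  obtain ⟨f, rfl⟩ := Ideal.Quotient.mk_surjective x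
  obtain ⟨g, rfl⟩ := Ideal.Quotient.mk_surjective y
  rw [inL_cls, inL_cls, contract_cls, contract_cls, inL_cls]
  refine cls_eq fun s h1 h2 => ?_
  simp only [map_mul, ev_rename]
  congr 1
  obtain ⟨h1, h1'⟩ := (sum_const_iff _ _ s).1 h1
  obtain ⟨h2, h2'⟩ := (sum_const_iff _ _ s).1 h2
  by_cases h3 : ∀ p, s (Sum.inl (b p)) = s (Sum.inl p)
  · obtain ⟨e, he, hv⟩ := ev_eps (c.sum a).isMatching (b.sum a).isMatching (d.sum a).isMatching s
      ((sum_const_iff _ _ s).2 ⟨h1, h1'⟩) ((sum_const_iff _ _ s).2 ⟨h2, h2'⟩)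
      ((sum_const_iff _ _ s).2 ⟨h3, h1'⟩)
    obtain ⟨e', he', hv'⟩ := ev_eps c.isMatching b.isMatching d.isMatching (s ∘ Sum.inl) h1 h2 h3
    rw [he, he']
    refine Finset.prod_congr rfl fun v _ => ?_
    congr 1
    have := hv v
    have := hv' v
    have := two_mul_numCirc_self a (s ∘ Sum.inr) h1' v
    simp only [numCirc_closed, ncard_sum, Function.comp_apply] at *
    omega
  · rw [ev_eps_eq_zero (c.sum a).isMatching (b.sum a).isMatching (d.sum a).isMatching s
      ((sum_const_iff _ _ s).2 ⟨h1, h1'⟩) ((sum_const_iff _ _ s).2 ⟨h2, h2'⟩)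
      (fun h => h3 ((sum_const_iff _ _ s).1 h).1),
      ev_eps_eq_zero c.isMatching b.isMatching d.isMatching (s ∘ Sum.inl) h1 h2 h3]

theorem contract_inR (b a a' a'' : ColMatching col) (x : Space a'' a') (y : Space a' a) :
    contract (b.sum a) (b.sum a') (b.sum a'') (inR b a' a y) (inR b a'' a' x) =
      inR b a'' a (contract a'' a' a x y) := by
  obtain ⟨f, rfl⟩ := Ideal.Quotient.mk_surjective x
  obtain ⟨g, rfl⟩ := Ideal.Quotient.mk_surjective y
  rw [inR_cls, inR_cls, contract_cls, contract_cls, inR_cls]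
  refine cls_eq fun s h1 h2 => ?_
  simp only [map_mul, ev_rename]
  rw [mul_comm (ev (s ∘ Sum.inr) g)]
  congr 1
  obtain ⟨h1, h1'⟩ := (sum_const_iff _ _ s).1 h1
  obtain ⟨h2, h2'⟩ := (sum_const_iff _ _ s).1 h2
  by_cases h3 : ∀ p, s (Sum.inr (a' p)) = s (Sum.inr p)
  · obtain ⟨e, he, hv⟩ := ev_eps (b.sum a).isMatching (b.sum a').isMatching
      (b.sum a'').isMatching s
      ((sum_const_iff _ _ s).2 ⟨h1, h1'⟩) ((sum_const_iff _ _ s).2 ⟨h2, h2'⟩)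
      ((sum_const_iff _ _ s).2 ⟨h1, h3⟩)
    obtain ⟨e', he', hv'⟩ := ev_eps a''.isMatching a'.isMatching a.isMatching
      (s ∘ Sum.inr) h2' h1' h3
    rw [he, he']
    refine Finset.prod_congr rfl fun v _ => ?_
    congr 1
    have := hv v
    have := hv' v
    have := two_mul_numCirc_self b (s ∘ Sum.inl) h1 v
    simp only [numCirc_closed, ncard_sum, Function.comp_apply, numCirc_comm a' a'',
      numCirc_comm a a''] at *
    rw [numCirc_comm a' a] at *
    omega
  · rw [ev_eps_eq_zero (b.sum a).isMatching (b.sum a').isMatching (b.sum a'').isMatching s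
      ((sum_const_iff _ _ s).2 ⟨h1, h1'⟩) ((sum_const_iff _ _ s).2 ⟨h2, h2'⟩)
      (fun h => h3 ((sum_const_iff _ _ s).1 h).2),
      ev_eps_eq_zero a''.isMatching a'.isMatching a.isMatching (s ∘ Sum.inr) h2' h1' h3]

theorem contract_inL_inR (c b a a' : ColMatching col) (x : Space c b) (y : Space a a') :
    contract (c.sum a') (b.sum a') (b.sum a) (inL c b a' x) (inR b a a' y) =
      contract (c.sum a') (c.sum a) (b.sum a) (inR c a a' y) (inL c b a x) := by
  obtain ⟨f, rfl⟩ := Ideal.Quotient.mk_surjective x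
  obtain ⟨g, rfl⟩ := Ideal.Quotient.mk_surjective y
  rw [inL_cls, inL_cls, inR_cls, inR_cls, contract_cls, contract_cls]
  refine cls_eq fun s h1 h2 => ?_
  obtain ⟨h1, h1'⟩ := (sum_const_iff _ _ s).1 h1
  obtain ⟨h2, h2'⟩ := (sum_const_iff _ _ s).1 h2
  obtain ⟨e, he, hv⟩ := ev_eps (c.sum a').isMatching (b.sum a').isMatching (b.sum a).isMatching s
    ((sum_const_iff _ _ s).2 ⟨h1, h1'⟩) ((sum_const_iff _ _ s).2 ⟨h2, h2'⟩)
    ((sum_const_iff _ _ s).2 ⟨h2, h1'⟩)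
  obtain ⟨e', he', hv'⟩ := ev_eps (c.sum a').isMatching (c.sum a).isMatching (b.sum a).isMatching
    s ((sum_const_iff _ _ s).2 ⟨h1, h1'⟩) ((sum_const_iff _ _ s).2 ⟨h2, h2'⟩)
    ((sum_const_iff _ _ s).2 ⟨h1, h2'⟩)
  have hee : e = e' := by
    funext v
    have := hv v
    have := hv' v
    have := two_mul_numCirc_self b (s ∘ Sum.inl) h2 v
    have := two_mul_numCirc_self c (s ∘ Sum.inl) h1 v
    have := two_mul_numCirc_self a (s ∘ Sum.inr) h2' v
    have := two_mul_numCirc_self a' (s ∘ Sum.inr) h1' v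
    simp only [numCirc_closed, ncard_sum, Function.comp_apply] at *
    omega
  simp only [map_mul, he, he', hee]
  ring

end ClosedSum

section ArcRing

/-- Crossingless matchings of the points `1, …, 2n` (numbered here from `0` to `2n - 1`). -/
structure Crossingless (n : ℕ) where
  pair : Fin (2 * n) → Fin (2 * n)
  invol : ∀ i, pair (pair i) = i
  pair_ne : ∀ i, pair i ≠ i
  noncrossing : ∀ i j k l, i < j → j < k → k < l → ¬ (pair i = k ∧ pair j = l)

theorem Crossingless.pair_injective (n : ℕ) :
    Function.Injective (Crossingless.pair : Crossingless n → _) := by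
  rintro ⟨p, _, _, _⟩ ⟨q, _, _, _⟩ rfl
  rfl

noncomputable instance (n : ℕ) : Fintype (Crossingless n) :=
  haveI := Finite.of_injective _ (Crossingless.pair_injective n)
  Fintype.ofFinite _

/-- The parity of a point. -/
def par (n : ℕ) (i : Fin (2 * n)) : Bool := i.1.bodd

theorem Crossingless.par_pair_of_lt {n : ℕ} (a : Crossingless n) (i : Fin (2 * n))
    (h : i < a.pair i) : par n (a.pair i) = !par n i := by
  have hmem : ∀ j ∈ Finset.Ioo i (a.pair i), a.pair j ∈ Finset.Ioo i (a.pair i) := by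
    intro j hj
    rw [Finset.mem_Ioo] at hj ⊢
    obtain ⟨h1, h2⟩ := hj
    refine ⟨?_, ?_⟩
    · by_contra hlt
      rcases lt_or_eq_of_le (not_lt.1 hlt) with h3 | h3
      · exact a.noncrossing _ _ _ _ h3 h1 h2 ⟨a.invol j, rfl⟩
      · rw [← h3, a.invol] at h2
        exact lt_irrefl _ h2
    · by_contra hlt
      rcases lt_or_eq_of_le (not_lt.1 hlt) with h3 | h3
      · exact a.noncrossing _ _ _ _ h1 h2 h3 ⟨rfl, rfl⟩
      · have := congrArg a.pair h3
        rw [a.invol, a.invol] at this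
        exact absurd this h1.ne
  have hcard : ((Finset.Ioo i (a.pair i)).card : ZMod 2) = 0 := by
    rw [Finset.card_eq_sum_ones, Nat.cast_sum]
    refine Finset.sum_involution (fun j _ => a.pair j) (fun _ _ => by decide)
      (fun j _ _ => a.pair_ne j) hmem (fun j _ => a.invol j)
  rw [ZMod.natCast_eq_zero_iff, Fin.card_Ioo] at hcard
  obtain ⟨k, hk⟩ := hcard
  have h' : i.1 < (a.pair i).1 := h
  have : (a.pair i).1 = i.1 + 1 + 2 * k := by omega
  simp only [par, this, Nat.bodd_add, Nat.bodd_mul]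
  simp

theorem Crossingless.par_pair {n : ℕ} (a : Crossingless n) (i : Fin (2 * n)) :
    par n (a.pair i) = !par n i := by
  rcases lt_trichotomy i (a.pair i) with h | h | h
  · exact a.par_pair_of_lt i h
  · exact absurd h.symm (a.pair_ne i)
  · have := a.par_pair_of_lt (a.pair i) (by rwa [a.invol])
    rw [a.invol] at this
    rw [this, Bool.not_not]

/-- A crossingless matching as a matching of points of opposite parity. -/
def Crossingless.toCol {n : ℕ} (a : Crossingless n) : ColMatching (par n) :=
  ⟨a.pair, a.invol, a.par_pair⟩

/-- The ring `H^n`, the direct sum of the groups `ℱ(W(b)a)`; the component of `x` in the summand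
`1_b H^n 1_a = ℱ(W(b)a)` is `x b a`. -/
def ArcRing (n : ℕ) : Type := ∀ b a : Crossingless n, Space b.toCol a.toCol

namespace ArcRing

variable {n : ℕ}

noncomputable instance : AddCommGroup (ArcRing n) :=
  inferInstanceAs (AddCommGroup (∀ b a : Crossingless n, Space b.toCol a.toCol))

noncomputable instance : Mul (ArcRing n) :=
  ⟨fun x y c a => ∑ b : Crossingless n, contract c.toCol b.toCol a.toCol (x c b) (y b a)⟩

/-- The diagonal element with components represented by the polynomial `f`. -/
noncomputable def diag (f : MvPolynomial (Fin (2 * n)) ℤ) : ArcRing n :=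
  open scoped Classical in
  fun b a => if b = a then cls b.toCol a.toCol f else 0

noncomputable instance : One (ArcRing n) := ⟨diag 1⟩

theorem mul_apply (x y : ArcRing n) (c a : Crossingless n) :
    (x * y) c a = ∑ b : Crossingless n, contract c.toCol b.toCol a.toCol (x c b) (y b a) := rfl

theorem add_apply (x y : ArcRing n) (c a : Crossingless n) : (x + y) c a = x c a + y c a := rfl

theorem zero_apply (c a : Crossingless n) : (0 : ArcRing n) c a = 0 := rfl

@[ext]
theorem ext {x y : ArcRing n} (h : ∀ c a, x c a = y c a) : x = y :=
  funext fun c => funext fun a => h c a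

theorem diag_self (f : MvPolynomial (Fin (2 * n)) ℤ) (a : Crossingless n) :
    (diag f : ArcRing n) a a = cls a.toCol a.toCol f := by simp [diag]

theorem diag_ne (f : MvPolynomial (Fin (2 * n)) ℤ) {b a : Crossingless n} (h : b ≠ a) :
    (diag f : ArcRing n) b a = 0 := by simp [diag, h]

theorem diag_mul_apply (f : MvPolynomial (Fin (2 * n)) ℤ) (x : ArcRing n) (b a : Crossingless n) :
    (diag f * x) b a = f • x b a := by
  rw [mul_apply, Finset.sum_eq_single b]
  · have : cls b.toCol b.toCol f = f • cls b.toCol b.toCol 1 :=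
      (congrArg (cls b.toCol b.toCol) (mul_one f)).symm
    rw [diag_self, this, map_smul, LinearMap.smul_apply, contract_one_left]
  · intro c _ hc
    rw [diag_ne f hc.symm, map_zero, LinearMap.zero_apply]
  · simp

theorem mul_diag_apply (f : MvPolynomial (Fin (2 * n)) ℤ) (x : ArcRing n) (b a : Crossingless n) :
    (x * diag f) b a = f • x b a := by
  rw [mul_apply, Finset.sum_eq_single a]
  · have : cls a.toCol a.toCol f = f • cls a.toCol a.toCol 1 :=
      (congrArg (cls a.toCol a.toCol) (mul_one f)).symm
    rw [diag_self, this, map_smul, contract_one_right]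
  · intro c _ hc
    rw [diag_ne f hc, map_zero]
  · simp

noncomputable instance : Ring (ArcRing n) where
  __ := (inferInstance : AddCommGroup (ArcRing n))
  __ := (inferInstance : Mul (ArcRing n))
  __ := (inferInstance : One (ArcRing n))
  left_distrib x y z := by
    ext c a
    simp only [mul_apply, add_apply, map_add, Finset.sum_add_distrib]
  right_distrib x y z := by
    ext c a
    simp only [mul_apply, add_apply, map_add, LinearMap.add_apply, Finset.sum_add_distrib]
  zero_mul x := by
    ext c a
    simp only [mul_apply, zero_apply, map_zero, LinearMap.zero_apply, Finset.sum_const_zero]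
  mul_zero x := by
    ext c a
    simp only [mul_apply, zero_apply, map_zero, Finset.sum_const_zero]
  mul_assoc x y z := by
    ext d a
    simp only [mul_apply, map_sum, LinearMap.sum_apply]
    rw [Finset.sum_comm]
    simp only [contract_assoc]
  one_mul x := by
    ext c a
    change (diag 1 * x : ArcRing n) c a = _
    rw [diag_mul_apply, one_smul]
  mul_one x := by
    ext c a
    change (x * diag 1 : ArcRing n) c a = _
    rw [mul_diag_apply, one_smul]

/-- The element `X_i = ∑ₐ ₐ(X_i)ₐ`, where `ₐ(X_i)ₐ` is `(-1)^i` times `X` in the factor of the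
circle of `W(a)a` through the `i`-th point. As points are numbered from `0`, the sign is
`(-1)^(i+1)`. -/
noncomputable def gen (i : Fin (2 * n)) : ArcRing n := diag ((-1) ^ (i.1 + 1) * MvPolynomial.X i)

theorem gen_mem_center (i : Fin (2 * n)) : gen i ∈ Subring.center (ArcRing n) := by
  rw [Subring.mem_center_iff]
  intro x
  ext c a
  rw [gen, mul_diag_apply, diag_mul_apply]

end ArcRing

end ArcRing

section Bimodule

variable {n : ℕ}

/-- The bimodule `ℱ(T) = ⨁ ℱ(W(b)Ta)` of a flat tangle `T` with `2n` top and `2n` bottom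
endpoints (`Sum.inl`, respectively `Sum.inr`) and without closed components. -/
def TangleBimod (T : ColMatching (dcol (par n))) : Type :=
  ∀ b a : Crossingless n, Space (b.toCol.sum a.toCol) T

namespace TangleBimod

variable {T : ColMatching (dcol (par n))}

noncomputable instance : AddCommGroup (TangleBimod T) :=
  inferInstanceAs (AddCommGroup (∀ b a : Crossingless n, Space (b.toCol.sum a.toCol) T))

/-- The left action contracts `b` with `W(b)` in `W(c)b ⊔ W(b)Ta`. -/
noncomputable instance : SMul (ArcRing n) (TangleBimod T) :=
  ⟨fun x m c a => ∑ b : Crossingless n, contract (c.toCol.sum a.toCol) (b.toCol.sum a.toCol) T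
    (inL c.toCol b.toCol a.toCol (x c b)) (m b a)⟩

open MulOpposite in
/-- The right action contracts `a'` with `W(a')` in `W(b)Ta' ⊔ W(a')a`. -/
noncomputable instance : SMul (ArcRing n)ᵐᵒᵖ (TangleBimod T) :=
  ⟨fun x m b a => ∑ a' : Crossingless n, contract (b.toCol.sum a.toCol) (b.toCol.sum a'.toCol) T
    (inR b.toCol a'.toCol a.toCol (unop x a' a)) (m b a')⟩

theorem smul_apply (x : ArcRing n) (m : TangleBimod T) (c a : Crossingless n) :
    (x • m) c a = ∑ b : Crossingless n, contract (c.toCol.sum a.toCol) (b.toCol.sum a.toCol) T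
      (inL c.toCol b.toCol a.toCol (x c b)) (m b a) := rfl

theorem op_smul_apply (x : (ArcRing n)ᵐᵒᵖ) (m : TangleBimod T) (b a : Crossingless n) :
    (x • m) b a = ∑ a' : Crossingless n,
      contract (b.toCol.sum a.toCol) (b.toCol.sum a'.toCol) T
        (inR b.toCol a'.toCol a.toCol (x.unop a' a)) (m b a') := rfl

theorem add_apply (x y : TangleBimod T) (c a : Crossingless n) : (x + y) c a = x c a + y c a := rfl

theorem zero_apply (c a : Crossingless n) : (0 : TangleBimod T) c a = 0 := rfl

@[ext]
theorem ext {x y : TangleBimod T} (h : ∀ c a, x c a = y c a) : x = y :=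
  funext fun c => funext fun a => h c a

noncomputable instance : Module (ArcRing n) (TangleBimod T) where
  smul_add x m m' := by
    ext c a
    simp only [smul_apply, add_apply, map_add, Finset.sum_add_distrib]
  add_smul x y m := by
    ext c a
    simp only [smul_apply, add_apply, ArcRing.add_apply, map_add, LinearMap.add_apply,
      Finset.sum_add_distrib]
  smul_zero x := by
    ext c a
    simp only [smul_apply, zero_apply, map_zero, Finset.sum_const_zero]
  zero_smul m := by
    ext c a
    simp only [smul_apply, zero_apply, ArcRing.zero_apply, map_zero, LinearMap.zero_apply,
      Finset.sum_const_zero]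
  mul_smul x y m := by
    ext d a
    simp only [smul_apply, ArcRing.mul_apply, map_sum, LinearMap.sum_apply, ← contract_inL]
    rw [Finset.sum_comm]
    simp only [contract_assoc]
  one_smul m := by
    ext c a
    rw [smul_apply, Finset.sum_eq_single c]
    · change contract _ _ _ (inL _ _ _ ((ArcRing.diag 1 : ArcRing n) c c)) _ = _
      rw [ArcRing.diag_self, inL_cls, map_one, contract_one_left]
    · intro b _ hb
      change contract _ _ _ (inL _ _ _ ((ArcRing.diag 1 : ArcRing n) c b)) _ = _
      rw [ArcRing.diag_ne 1 hb.symm, map_zero, map_zero, LinearMap.zero_apply]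
    · simp

noncomputable instance : Module (ArcRing n)ᵐᵒᵖ (TangleBimod T) where
  smul_add x m m' := by
    ext c a
    simp only [op_smul_apply, add_apply, map_add, Finset.sum_add_distrib]
  add_smul x y m := by
    ext c a
    simp only [op_smul_apply, add_apply, MulOpposite.unop_add, ArcRing.add_apply, map_add,
      LinearMap.add_apply, Finset.sum_add_distrib]
  smul_zero x := by
    ext c a
    simp only [op_smul_apply, zero_apply, map_zero, Finset.sum_const_zero]
  zero_smul m := by
    ext c a
    simp only [op_smul_apply, zero_apply, MulOpposite.unop_zero, ArcRing.zero_apply, map_zero,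
      LinearMap.zero_apply, Finset.sum_const_zero]
  mul_smul x y m := by
    ext b a
    simp only [op_smul_apply, MulOpposite.unop_mul, ArcRing.mul_apply, map_sum,
      LinearMap.sum_apply, ← contract_inR]
    rw [Finset.sum_comm]
    simp only [contract_assoc]
  one_smul m := by
    ext b a
    rw [op_smul_apply, Finset.sum_eq_single a]
    · change contract _ _ _ (inR _ _ _ ((ArcRing.diag 1 : ArcRing n) a a)) _ = _
      rw [ArcRing.diag_self, inR_cls, map_one, contract_one_left]
    · intro c _ hc
      change contract _ _ _ (inR _ _ _ ((ArcRing.diag 1 : ArcRing n) c a)) _ = _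
      rw [ArcRing.diag_ne 1 hc, map_zero, map_zero, LinearMap.zero_apply]
    · simp

instance : SMulCommClass (ArcRing n) (ArcRing n)ᵐᵒᵖ (TangleBimod T) where
  smul_comm x y m := by
    ext c a
    simp only [smul_apply, op_smul_apply, map_sum, ← contract_assoc, contract_inL_inR]
    rw [Finset.sum_comm]

end TangleBimod

end Bimodule

section Saddle

variable {n : ℕ}

/-- The `i`-th point. -/
def lo (i : Fin (2 * n - 1)) : Fin (2 * n) := ⟨i.1, by omega⟩

/-- The `(i+1)`-st point. -/
def hi (i : Fin (2 * n - 1)) : Fin (2 * n) := ⟨i.1 + 1, by omega⟩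

theorem lo_ne_hi (i : Fin (2 * n - 1)) : lo i ≠ hi i := by
  simp [lo, hi, Fin.ext_iff]

/-- The matching of the endpoints in the diagram `U_i`: the `i`-th and `(i+1)`-st top points are
joined, and so are the `i`-th and `(i+1)`-st bottom points; all other points lie on vertical
segments. -/
def cupCap (i : Fin (2 * n - 1)) : Fin (2 * n) ⊕ Fin (2 * n) → Fin (2 * n) ⊕ Fin (2 * n) :=
  Sum.elim (fun p => if p = lo i then Sum.inl (hi i) else if p = hi i then Sum.inl (lo i)
      else Sum.inr p)
    (fun p => if p = lo i then Sum.inr (hi i) else if p = hi i then Sum.inr (lo i)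
      else Sum.inl p)

theorem par_hi (i : Fin (2 * n - 1)) : par n (hi i) = !par n (lo i) := by
  simp [par, hi, lo]

theorem isMatching_cupCap (i : Fin (2 * n - 1)) : IsMatching (dcol (par n)) (cupCap i) where
  invol := by
    have h := (lo_ne_hi i).symm
    rintro (p | p) <;> by_cases h1 : p = lo i <;> by_cases h2 : p = hi i <;>
      simp [cupCap, h1, h2, h]
  col_flip := by
    have h := par_hi i
    have h' := lo_ne_hi i
    rintro (p | p) <;> by_cases h1 : p = lo i <;> by_cases h2 : p = hi i <;>
      simp_all [cupCap, dcol]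

/-- The diagram `U_i`. -/
def diagU (i : Fin (2 * n - 1)) : ColMatching (dcol (par n)) := ⟨cupCap i, isMatching_cupCap i⟩

/-- The factor of the saddle cobordism from `W(b) U_i a` to `W(b) a`, in the notation of
`contractFactor`. -/
noncomputable def saddleFactor (i : Fin (2 * n - 1)) (b a : ColMatching (par n)) :
    MvPolynomial (Fin (2 * n)) ℤ :=
  open scoped Classical in
  if SameCircle (b.sum a) (diagU i) (Sum.inl (lo i)) (Sum.inr (lo i)) then
    MvPolynomial.X (lo i) + MvPolynomial.X (hi i) else 1

/-- Identify the `p`-th top point and the `p`-th bottom point. -/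
noncomputable def fold (n : ℕ) :
    MvPolynomial (Fin (2 * n) ⊕ Fin (2 * n)) ℤ →+* MvPolynomial (Fin (2 * n)) ℤ :=
  (MvPolynomial.rename (Sum.elim id id)).toRingHom

theorem ev_fold (s : Fin (2 * n) → Bool) (f : MvPolynomial (Fin (2 * n) ⊕ Fin (2 * n)) ℤ) :
    ev s (fold n f) = ev (Sum.elim s s) f := by
  change ev s (MvPolynomial.rename _ f) = _
  rw [ev_rename]
  congr 2
  funext q
  rcases q with q | q <;> rfl

theorem isMatching_swap : IsMatching (dcol (par n)) Sum.swap where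
  invol := by simp
  col_flip := by rintro (p | p) <;> simp [dcol]

theorem isSaddle_diagU (i : Fin (2 * n - 1)) :
    IsSaddle (diagU i) Sum.swap (Sum.inl (lo i)) (Sum.inr (lo i)) where
  hx := rfl
  hy := rfl
  htx := by simp [diagU, cupCap]
  hty := by simp [diagU, cupCap]
  other := by
    rintro (u | u) h1 h2 h3 h4
    · have hup : u ≠ lo i := fun e => h1 (by rw [e])
      have huq : u ≠ hi i := fun e => h3 (by simp [diagU, cupCap, e])
      simp [diagU, cupCap, hup, huq]
    · have hup : u ≠ lo i := fun e => h2 (by rw [e])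
      have huq : u ≠ hi i := fun e => h4 (by simp [diagU, cupCap, e])
      simp [diagU, cupCap, hup, huq]

theorem diagU_inl_lo (i : Fin (2 * n - 1)) : diagU i (Sum.inl (lo i)) = Sum.inl (hi i) := by
  simp [diagU, cupCap]

theorem sameCircle_lo_hi (i : Fin (2 * n - 1)) (b a : ColMatching (par n))
    (h : ¬ SameCircle (b.sum a) (diagU i) (Sum.inl (lo i)) (Sum.inr (lo i))) :
    SameCircle b a (lo i) (hi i) := by
  have hx := saddle_xor (b.sum a).isMatching (diagU i).isMatching isMatching_swap
    (isSaddle_diagU i) (by simp [dcol]) (by simp [diagU, cupCap])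
  have h' : SameCircle (b.sum a) Sum.swap (Sum.inl (lo i)) (Sum.inl (hi i)) := by
    by_contra hh
    exact h (hx.2 (by rwa [diagU_inl_lo]))
  refine sameCircle_map (f := Sum.elim id id) ?_ ?_ h'
  · rintro (p | p)
    · exact .rel _ _ (Or.inl rfl)
    · exact .rel _ _ (Or.inr rfl)
  · rintro (p | p) <;> exact .refl _

theorem ev_saddleFactor_eq_zero (i : Fin (2 * n - 1)) (b a : ColMatching (par n))
    (s : Fin (2 * n) → Bool) (h1 : ∀ p, s (b p) = s p) (h2 : ∀ p, s (a p) = s p)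
    (h : s (hi i) ≠ s (lo i)) : ev s (saddleFactor i b a) = 0 := by
  rw [saddleFactor]
  split_ifs with hc
  · rw [map_add, ev_X, ev_X]
    revert h
    cases s (hi i) <;> cases s (lo i) <;> simp
  · exact absurd (sameCircle_const h1 h2 (sameCircle_lo_hi i b a hc)).symm h

theorem const_diagU (i : Fin (2 * n - 1)) (s : Fin (2 * n) → Bool)
    (h : s (hi i) = s (lo i)) : ∀ q, Sum.elim s s (diagU i q) = Sum.elim s s q := by
  rintro (p | p) <;> by_cases h1 : p = lo i <;> by_cases h2 : p = hi i <;>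
    simp [diagU, cupCap, h1, h2, h, (lo_ne_hi i).symm]

theorem ev_saddleFactor (i : Fin (2 * n - 1)) (b a : ColMatching (par n))
    (s : Fin (2 * n) → Bool) (h1 : ∀ p, s (b p) = s p) (h2 : ∀ p, s (a p) = s p)
    (h : s (hi i) = s (lo i)) : ∃ e : Bool → ℕ, ev s (saddleFactor i b a) = ∏ v, hval v ^ e v ∧
      ∀ v, 2 * e v + numCirc (b.sum a) (diagU i) {q | Sum.elim s s q = v} =
        numCirc b a {p | s p = v} + if s (lo i) = v then 1 else 0 := by
  have hsad := fun v => saddle_numCirc (b.sum a).isMatching (diagU i).isMatching isMatching_swap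
    (isSaddle_diagU i) (by simp [dcol]) (by simp [diagU, cupCap]) (Sum.elim s s)
    ((sum_const_iff b a _).2 ⟨h1, h2⟩) (const_diagU i s h) (by rintro (p | p) <;> rfl) v
  have hun := fun v => numCirc_stage_univ b b a s v
  rw [stage_univ] at hun
  change ∀ v, numCirc (b.sum a) Sum.swap _ = _ at hun
  rw [saddleFactor]
  split_ifs with hc
  · refine ⟨fun v => if s (lo i) = v then 1 else 0, ?_, fun v => ?_⟩
    · rw [map_add, ev_X, ev_X, h]
      cases s (lo i) <;> simp [hval] <;> ring
    · have := (hsad v).1 hc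
      have := hun v
      simp only [Sum.elim_inl] at *
      by_cases hv : s (lo i) = v <;> simp only [hv, if_true, if_false] at * <;> omega
  · refine ⟨0, by simp, fun v => ?_⟩
    have := (hsad v).2 hc
    have := hun v
    simp only [Sum.elim_inl, Pi.zero_apply] at *
    by_cases hv : s (lo i) = v <;> simp only [hv, if_true, if_false] at * <;> omega

/-- The map `ℱ(W(b) U_i a) → ℱ(W(b) a)` induced by the saddle cobordism. -/
noncomputable def saddleMap (i : Fin (2 * n - 1)) (b a : ColMatching (par n)) :
    Space (b.sum a) (diagU i) →ₛₗ[fold n] Space b a :=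
  Submodule.liftQ (circleIdeal (b.sum a) (diagU i))
    { toFun := fun f => cls b a (fold n f * saddleFactor i b a)
      map_add' := fun f g => by
        rw [map_add, add_mul]
        exact (Ideal.Quotient.mk _).map_add _ _
      map_smul' := fun f g => by
        rw [smul_eq_mul, map_mul, mul_assoc]
        rfl } (by
    let I : Ideal (MvPolynomial (Fin (2 * n)) ℤ) :=
      Submodule.comap (LinearMap.mulRight _ (saddleFactor i b a)) (circleIdeal b a)
    have hI : ∀ f, f ∈ I ↔ f * saddleFactor i b a ∈ circleIdeal b a := fun f => Iff.rfl
    clear_value I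
    have hle : circleIdeal (b.sum a) (diagU i) ≤ I.comap (fold n) := by
      have hX : ∀ q : Fin (2 * n) ⊕ Fin (2 * n),
          fold n (MvPolynomial.X q) = MvPolynomial.X (Sum.elim id id q) := fun q => by
        change MvPolynomial.rename _ _ = _
        rw [MvPolynomial.rename_X]
      have hxy : (MvPolynomial.X (lo i) - MvPolynomial.X (hi i)) * saddleFactor i b a ∈
          circleIdeal b a := by
        refine mem_circleIdeal fun s h1 h2 => ?_
        rw [map_mul]
        by_cases h : s (hi i) = s (lo i)
        · rw [map_sub, ev_X, ev_X, h, sub_self, zero_mul]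
        · rw [ev_saddleFactor_eq_zero i b a s h1 h2 h, mul_zero]
      refine circleIdeal_le (fun q => ?_) (fun q => ?_) (fun q => ?_)
      · rw [Ideal.mem_comap, map_pow, hX, hI]
        exact Ideal.mul_mem_right _ _ (X_sq_mem _ _ _)
      · rw [Ideal.mem_comap, map_sub, hX, hX, hI]
        refine Ideal.mul_mem_right _ _ (X_sub_X_mem ?_)
        rcases q with q | q
        · exact .rel _ _ (Or.inl rfl)
        · exact .rel _ _ (Or.inr rfl)
      · rw [Ideal.mem_comap, map_sub, hX, hX, hI]
        have hyx : (MvPolynomial.X (hi i) - MvPolynomial.X (lo i)) * saddleFactor i b a ∈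
            circleIdeal b a := by
          have := neg_mem hxy
          rwa [← neg_mul, neg_sub] at this
        rcases q with q | q <;> by_cases h1 : q = lo i <;> by_cases h2 : q = hi i
        all_goals first
          | exact absurd (h1.symm.trans h2) (lo_ne_hi i)
          | (rw [h1]
             simpa [diagU, cupCap] using hxy)
          | (rw [h2]
             simpa [diagU, cupCap, (lo_ne_hi i).symm] using hyx)
          | simp [diagU, cupCap, h1, h2]
    intro f hf
    exact Ideal.Quotient.eq_zero_iff_mem.2 ((hI _).1 (hle hf)))

theorem saddleMap_cls (i : Fin (2 * n - 1)) (b a : ColMatching (par n))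
    (f : MvPolynomial (Fin (2 * n) ⊕ Fin (2 * n)) ℤ) :
    saddleMap i b a (cls (b.sum a) (diagU i) f) = cls b a (fold n f * saddleFactor i b a) := rfl

theorem saddleMap_inL (i : Fin (2 * n - 1)) (c b a : ColMatching (par n))
    (x : Space c b) (m : Space (b.sum a) (diagU i)) :
    saddleMap i c a (contract (c.sum a) (b.sum a) (diagU i) (inL c b a x) m) =
      contract c b a x (saddleMap i b a m) := by
  obtain ⟨f, rfl⟩ := Ideal.Quotient.mk_surjective x
  obtain ⟨g, rfl⟩ := Ideal.Quotient.mk_surjective m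
  rw [inL_cls, contract_cls, saddleMap_cls, saddleMap_cls, contract_cls]
  refine cls_eq fun s h1 h2 => ?_
  simp only [map_mul, ev_fold, ev_rename]
  suffices h : ev (Sum.elim s s) (eps (c.sum a) (b.sum a) (diagU i)) * ev s (saddleFactor i c a) =
      ev s (saddleFactor i b a) * ev s (eps c b a) by
    have hs : (Sum.elim s s) ∘ Sum.inl = s := rfl
    rw [hs]
    linear_combination (ev s f * ev (Sum.elim s s) g) * h
  by_cases h : s (hi i) = s (lo i)
  · have hU := const_diagU i s h
    have hca := (sum_const_iff c a (Sum.elim s s)).2 ⟨h1, h2⟩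
    by_cases h3 : ∀ p, s (b p) = s p
    · have hba := (sum_const_iff b a (Sum.elim s s)).2 ⟨h3, h2⟩
      obtain ⟨e₁, he₁, hv₁⟩ := ev_eps (c.sum a).isMatching (b.sum a).isMatching
        (diagU i).isMatching _ hca hU hba
      obtain ⟨e₂, he₂, hv₂⟩ := ev_saddleFactor i c a s h1 h2 h
      obtain ⟨e₃, he₃, hv₃⟩ := ev_saddleFactor i b a s h3 h2 h
      obtain ⟨e₄, he₄, hv₄⟩ := ev_eps c.isMatching b.isMatching a.isMatching s h1 h2 h3
      rw [he₁, he₂, he₃, he₄, ← Finset.prod_mul_distrib, ← Finset.prod_mul_distrib]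
      refine Finset.prod_congr rfl fun v _ => ?_
      rw [← pow_add, ← pow_add]
      congr 1
      have := hv₁ v
      have := hv₂ v
      have := hv₃ v
      have := hv₄ v
      have := two_mul_numCirc_self a s h2 v
      simp only [numCirc_closed, ncard_sum, Sum.elim_inl, Sum.elim_inr] at *
      omega
    · rw [ev_eps_eq_zero c.isMatching b.isMatching a.isMatching s h1 h2 h3,
        ev_eps_eq_zero (c.sum a).isMatching (b.sum a).isMatching (diagU i).isMatching _ hca hU
          (fun hh => h3 ((sum_const_iff b a _).1 hh).1)]
      simp
  · rw [ev_saddleFactor_eq_zero i c a s h1 h2 h, mul_zero]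
    by_cases h3 : ∀ p, s (b p) = s p
    · rw [ev_saddleFactor_eq_zero i b a s h3 h2 h, zero_mul]
    · rw [ev_eps_eq_zero c.isMatching b.isMatching a.isMatching s h1 h2 h3, mul_zero]

theorem saddleMap_inR (i : Fin (2 * n - 1)) (b c a : ColMatching (par n))
    (x : Space c a) (m : Space (b.sum c) (diagU i)) :
    saddleMap i b a (contract (b.sum a) (b.sum c) (diagU i) (inR b c a x) m) =
      contract b c a (saddleMap i b c m) x := by
  obtain ⟨f, rfl⟩ := Ideal.Quotient.mk_surjective x
  obtain ⟨g, rfl⟩ := Ideal.Quotient.mk_surjective m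
  rw [inR_cls, contract_cls, saddleMap_cls, saddleMap_cls, contract_cls]
  refine cls_eq fun s h1 h2 => ?_
  simp only [map_mul, ev_fold, ev_rename]
  suffices h : ev (Sum.elim s s) (eps (b.sum a) (b.sum c) (diagU i)) * ev s (saddleFactor i b a) =
      ev s (saddleFactor i b c) * ev s (eps b c a) by
    have hs : (Sum.elim s s) ∘ Sum.inr = s := rfl
    rw [hs]
    linear_combination (ev s f * ev (Sum.elim s s) g) * h
  by_cases h : s (hi i) = s (lo i)
  · have hU := const_diagU i s h
    have hba := (sum_const_iff b a (Sum.elim s s)).2 ⟨h1, h2⟩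
    by_cases h3 : ∀ p, s (c p) = s p
    · have hbc := (sum_const_iff b c (Sum.elim s s)).2 ⟨h1, h3⟩
      obtain ⟨e₁, he₁, hv₁⟩ := ev_eps (b.sum a).isMatching (b.sum c).isMatching
        (diagU i).isMatching _ hba hU hbc
      obtain ⟨e₂, he₂, hv₂⟩ := ev_saddleFactor i b a s h1 h2 h
      obtain ⟨e₃, he₃, hv₃⟩ := ev_saddleFactor i b c s h1 h3 h
      obtain ⟨e₄, he₄, hv₄⟩ := ev_eps b.isMatching c.isMatching a.isMatching s h1 h2 h3
      rw [he₁, he₂, he₃, he₄, ← Finset.prod_mul_distrib, ← Finset.prod_mul_distrib]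
      refine Finset.prod_congr rfl fun v _ => ?_
      rw [← pow_add, ← pow_add]
      congr 1
      have := hv₁ v
      have := hv₂ v
      have := hv₃ v
      have := hv₄ v
      have := two_mul_numCirc_self b s h1 v
      simp only [numCirc_closed, ncard_sum, Sum.elim_inl, Sum.elim_inr] at *
      rw [numCirc_comm a c] at *
      omega
    · rw [ev_eps_eq_zero b.isMatching c.isMatching a.isMatching s h1 h2 h3,
        ev_eps_eq_zero (b.sum a).isMatching (b.sum c).isMatching (diagU i).isMatching _ hba hU
          (fun hh => h3 ((sum_const_iff b c _).1 hh).2)]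
      simp
  · rw [ev_saddleFactor_eq_zero i b a s h1 h2 h, mul_zero]
    by_cases h3 : ∀ p, s (c p) = s p
    · rw [ev_saddleFactor_eq_zero i b c s h1 h3 h, zero_mul]
    · rw [ev_eps_eq_zero b.isMatching c.isMatching a.isMatching s h1 h2 h3, mul_zero]

/-- The map underlying `α : ℱ(U_i) → H^n`. -/
noncomputable def alphaFun (i : Fin (2 * n - 1)) (m : TangleBimod (diagU i)) : ArcRing n :=
  fun b a => saddleMap i b.toCol a.toCol (m b a)

theorem alphaFun_apply (i : Fin (2 * n - 1)) (m : TangleBimod (diagU i)) (b a : Crossingless n) :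
    alphaFun i m b a = saddleMap i b.toCol a.toCol (m b a) := rfl

/-- The bimodule homomorphism `α : ℱ(U_i) → H^n` induced by the saddle cobordisms, as a
homomorphism of left modules. -/
noncomputable def alpha (i : Fin (2 * n - 1)) :
    TangleBimod (diagU i) →ₗ[ArcRing n] ArcRing n where
  toFun := alphaFun i
  map_add' m m' := by
    ext b a
    simp only [alphaFun_apply, TangleBimod.add_apply, map_add, ArcRing.add_apply]
  map_smul' x m := by
    ext c a
    simp only [alphaFun_apply, TangleBimod.smul_apply, map_sum, saddleMap_inL, RingHom.id_apply,
      smul_eq_mul, ArcRing.mul_apply]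

theorem alpha_apply (i : Fin (2 * n - 1)) (m : TangleBimod (diagU i)) (b a : Crossingless n) :
    alpha i m b a = saddleMap i b.toCol a.toCol (m b a) := rfl

/-- `α` is a homomorphism of right modules. -/
theorem alpha_op_smul (i : Fin (2 * n - 1)) (x : ArcRing n) (m : TangleBimod (diagU i)) :
    alpha i (MulOpposite.op x • m) = alpha i m * x := by
  ext b a
  simp only [alpha_apply, TangleBimod.op_smul_apply, map_sum, MulOpposite.unop_op, saddleMap_inR,
    ArcRing.mul_apply]

end Saddle

section TensorFunctor

open CategoryTheory MulOpposite TensorProduct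

universe u

variable (A : Type u) [Ring A] (V : Type u) [AddCommGroup V] [Module A V]

/-- The map `V ⊗_ℤ M → V ⊗_ℤ N` induced by `M → N`. -/
noncomputable def preTensorMap {M N : Type u} [AddCommGroup M] [Module A M] [AddCommGroup N]
    [Module A N] (f : M →ₗ[A] N) : V ⊗[ℤ] M →ₗ[A] V ⊗[ℤ] N :=
  TensorProduct.AlgebraTensorModule.lTensor A V (f.restrictScalars ℤ)

theorem preTensorMap_tmul {M N : Type u} [AddCommGroup M] [Module A M] [AddCommGroup N]
    [Module A N] (f : M →ₗ[A] N) (v : V) (m : M) :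
    preTensorMap A V f (v ⊗ₜ m) = v ⊗ₜ f m := rfl

variable {A V} in
/-- The map `V ⊗_ℤ M → M`, `v ⊗ m ↦ φ(v) m`, where `φ : V → A`. -/
noncomputable def preCounit (φ : V →ₗ[A] A) (M : Type u) [AddCommGroup M] [Module A M] :
    V ⊗[ℤ] M →ₗ[A] M :=
  TensorProduct.AlgebraTensorModule.lift
    { toFun := fun v =>
        { toFun := fun m => φ v • m
          map_add' := fun m m' => smul_add _ _ _
          map_smul' := fun k m => smul_comm _ _ _ }
      map_add' := fun v w => by
        ext m
        exact (congrArg (· • m) (map_add φ v w)).trans (add_smul _ _ _)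
      map_smul' := fun x v => by
        ext m
        exact (congrArg (· • m) (map_smul φ x v)).trans (mul_smul _ _ _) }

variable {A V} in
theorem preCounit_tmul (φ : V →ₗ[A] A) {M : Type u} [AddCommGroup M] [Module A M] (v : V)
    (m : M) : preCounit φ M (v ⊗ₜ m) = φ v • m := rfl

variable [Module Aᵐᵒᵖ V]

/-- The relations `v x ⊗ m = v ⊗ x m` which define the quotient `V ⊗_A M` of `V ⊗_ℤ M`. -/
def balance (M : Type u) [AddCommGroup M] [Module A M] : Submodule A (V ⊗[ℤ] M) :=
  Submodule.span A {t | ∃ (v : V) (x : A) (m : M), t = (op x • v) ⊗ₜ[ℤ] m - v ⊗ₜ[ℤ] (x • m)}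

theorem balance_le {M N : Type u} [AddCommGroup M] [Module A M] [AddCommGroup N]
    [Module A N] (f : M →ₗ[A] N) :
    balance A V M ≤ (balance A V N).comap (preTensorMap A V f) := by
  refine Submodule.span_le.2 ?_
  rintro _ ⟨v, x, m, rfl⟩
  refine Submodule.subset_span ⟨v, x, f m, ?_⟩
  rw [map_sub, preTensorMap_tmul, preTensorMap_tmul, map_smul]

/-- The left module `V ⊗_A M`. -/
abbrev BalTensor (M : Type u) [AddCommGroup M] [Module A M] : Type u :=
  (V ⊗[ℤ] M) ⧸ balance A V M

variable {A} in
/-- The element `v ⊗ m` of `V ⊗_A M`. -/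
def tmk {M : Type u} [AddCommGroup M] [Module A M] (v : V) (m : M) : BalTensor A V M :=
  Submodule.Quotient.mk (v ⊗ₜ m)

/-- The map `V ⊗_A M → V ⊗_A N` induced by `M → N`. -/
noncomputable def tensorMap {M N : Type u} [AddCommGroup M] [Module A M] [AddCommGroup N]
    [Module A N] (f : M →ₗ[A] N) : BalTensor A V M →ₗ[A] BalTensor A V N :=
  Submodule.mapQ _ _ (preTensorMap A V f) (balance_le A V f)

theorem tensorMap_tmk {M N : Type u} [AddCommGroup M] [Module A M] [AddCommGroup N]
    [Module A N] (f : M →ₗ[A] N) (v : V) (m : M) :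
    tensorMap A V f (tmk V v m) = tmk V v (f m) := rfl

variable {A V} in
theorem balTensor_hom_ext {M N : Type u} [AddCommGroup M] [Module A M] [AddCommGroup N]
    [Module A N] {f g : BalTensor A V M →ₗ[A] N}
    (h : ∀ v m, f (tmk V v m) = g (tmk V v m)) : f = g := by
  refine Submodule.linearMap_qext _ (TensorProduct.AlgebraTensorModule.ext fun v m => h v m)

/-- The functor `V ⊗_A -` of tensoring with the bimodule `V`. -/
noncomputable def tensorFunctor : ModuleCat.{u} A ⥤ ModuleCat.{u} A where
  obj M := ModuleCat.of A (BalTensor A V M)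
  map f := ModuleCat.ofHom (tensorMap A V f.hom)
  map_id M := by
    ext1
    exact balTensor_hom_ext fun v m => rfl
  map_comp f g := by
    ext1
    exact balTensor_hom_ext fun v m => rfl

instance : (tensorFunctor A V).Additive where
  map_add {M N f g} := by
    ext1
    refine balTensor_hom_ext (N := BalTensor A V N) fun v m => ?_
    exact congrArg (Submodule.Quotient.mk (p := balance A V N)) (TensorProduct.tmul_add _ _ _)

variable {A V}

/-- The map `V ⊗_A M → M`, `v ⊗ m ↦ φ(v) m`, where `φ : V → A` is a bimodule homomorphism. -/
noncomputable def counitMap (φ : V →ₗ[A] A) (hφ : ∀ (x : A) (v : V), φ (op x • v) = φ v * x)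
    (M : Type u) [AddCommGroup M] [Module A M] : BalTensor A V M →ₗ[A] M :=
  Submodule.liftQ _ (preCounit φ M) (by
    refine Submodule.span_le.2 ?_
    rintro _ ⟨v, x, m, rfl⟩
    change preCounit φ M _ = 0
    rw [map_sub, preCounit_tmul, preCounit_tmul, hφ, mul_smul, sub_self])

/-- The natural transformation from `V ⊗_A -` to the identity functor, which is induced by a
bimodule homomorphism `V → A`. -/
noncomputable def tensorCounit (φ : V →ₗ[A] A)
    (hφ : ∀ (x : A) (v : V), φ (op x • v) = φ v * x) : tensorFunctor A V ⟶ 𝟭 _ where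
  app M := ModuleCat.ofHom (counitMap φ hφ M)
  naturality {M N} f := by
    ext1
    refine balTensor_hom_ext (N := N) fun v m => ?_
    exact (map_smul f.hom (φ v) m).symm

end TensorFunctor

section ConeFunctor

open CategoryTheory CochainComplex CochainComplex.HomComplex

universe v u

variable {C : Type u} [Category.{v} C] [Preadditive C]

/-- Compatible homotopies induce a homotopy between maps of mapping cones. -/
noncomputable def coneMapHomotopy [Limits.HasBinaryBiproducts C]
    {K₁ L₁ K₂ L₂ : CochainComplex C ℤ} (φ₁ : K₁ ⟶ L₁) (φ₂ : K₂ ⟶ L₂) {a a' : K₁ ⟶ K₂}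
    {b b' : L₁ ⟶ L₂} (comm : φ₁ ≫ b = a ≫ φ₂) (comm' : φ₁ ≫ b' = a' ≫ φ₂)
    (s : Homotopy a a') (t : Homotopy b b')
    (h : ∀ p q, s.hom p q ≫ φ₂.f q = φ₁.f p ≫ t.hom p q) :
    Homotopy (mappingCone.map φ₁ φ₂ a b comm) (mappingCone.map φ₁ φ₂ a' b' comm') :=
  mappingCone.descHomotopy _ _ _
    (-(Cochain.ofHomotopy s).comp (mappingCone.inl φ₂) (by decide))
    ((Cochain.ofHomotopy t).comp (Cochain.ofHom (mappingCone.inr φ₂)) (add_zero _))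
    (by
      have hn : (Cochain.ofHomotopy s).comp (Cochain.ofHom φ₂) (add_zero (-1)) =
          (Cochain.ofHom φ₁).comp (Cochain.ofHomotopy t) (zero_add (-1)) := by
        ext p q hpq
        simp only [Cochain.comp_zero_cochain_v, Cochain.zero_cochain_comp_v, Cochain.ofHom_v]
        exact h p q
      have hn' : (Cochain.ofHomotopy s).comp
          (Cochain.ofHom (φ₂ ≫ mappingCone.inr φ₂)) (add_zero (-1)) =
          (Cochain.ofHom φ₁).comp ((Cochain.ofHomotopy t).comp
            (Cochain.ofHom (mappingCone.inr φ₂)) (add_zero (-1))) (zero_add (-1)) := by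
        rw [Cochain.ofHom_comp, ← Cochain.comp_assoc_of_second_is_zero_cochain, hn,
          Cochain.comp_assoc_of_first_is_zero_cochain]
      rw [δ_neg, δ_comp _ _ _ 0 (-1 + 1) (-1) (by decide) (by decide) (by decide)]
      rw [mappingCone.map, mappingCone.map, mappingCone.inl_desc, mappingCone.inl_desc]
      change _ = -(_ + _ • (δ (-1) 0 _).comp _ _) + _ + _
      rw [δ_ofHomotopy]
      erw [mappingCone.δ_inl]
      rw [hn']
      simp [Cochain.sub_comp])
    (by
      rw [mappingCone.map, mappingCone.map, mappingCone.inr_desc, mappingCone.inr_desc,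
        δ_comp_ofHom, δ_ofHomotopy, Cochain.sub_comp, ← Cochain.ofHom_comp,
        ← Cochain.ofHom_comp, sub_add_cancel])

variable (G : C ⥤ C) [G.Additive] (η : G ⟶ 𝟭 C)

/-- The chain map `G(M) → M` given by `η` in each degree. -/
def coneMap (M : CochainComplex C ℤ) : (G.mapHomologicalComplex (.up ℤ)).obj M ⟶ M where
  f p := η.app (M.X p)
  comm' p q _ := (η.naturality (M.d p q)).symm

theorem coneMap_naturality {M N : CochainComplex C ℤ} (f : M ⟶ N) :
    coneMap G η M ≫ f = (G.mapHomologicalComplex (.up ℤ)).map f ≫ coneMap G η N := by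
  ext p
  exact (η.naturality (f.f p)).symm

variable [Limits.HasBinaryBiproducts C]

/-- The map of mapping cones induced by a chain map. -/
noncomputable def coneHom {M N : CochainComplex C ℤ} (f : M ⟶ N) :
    mappingCone (coneMap G η M) ⟶ mappingCone (coneMap G η N) :=
  mappingCone.map _ _ ((G.mapHomologicalComplex (.up ℤ)).map f) f (coneMap_naturality G η f)

/-- The functor which sends a complex `M` to the mapping cone of `G(M) → M`, that is, to the total
complex of `0 → G(M) → M → 0` with `M` placed in degree `0`. -/
noncomputable def coneFunctor : CochainComplex C ℤ ⥤ CochainComplex C ℤ where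
  obj M := mappingCone (coneMap G η M)
  map f := coneHom G η f
  map_id M := by
    rw [← mappingCone.map_id, coneHom]
    congr 1
    exact CategoryTheory.Functor.map_id _ _
  map_comp f g := by
    rw [coneHom, coneHom, coneHom, ← mappingCone.map_comp]
    congr 1
    exact CategoryTheory.Functor.map_comp _ _ _

/-- The functor `coneFunctor` respects homotopies. -/
noncomputable def coneHomotopy {M N : CochainComplex C ℤ} {f g : M ⟶ N} (h : Homotopy f g) :
    Homotopy (coneHom G η f) (coneHom G η g) :=
  coneMapHomotopy _ _ _ _ (G.mapHomotopy h) h fun p q => η.naturality (h.hom p q)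

/-- The functor induced by `coneFunctor` on the homotopy category of complexes. -/
noncomputable def coneFunctorH :
    HomotopyCategory C (.up ℤ) ⥤ HomotopyCategory C (.up ℤ) :=
  CategoryTheory.Quotient.lift _ (coneFunctor G η ⋙ HomotopyCategory.quotient C (.up ℤ))
    (fun _ _ _ _ ⟨h⟩ => HomotopyCategory.eq_of_homotopy _ _ (coneHomotopy G η h))

end ConeFunctor

section BoundedComplexes

open CategoryTheory CochainComplex

universe v u

variable (C : Type u) [Category.{v} C] [Preadditive C]

/-- The homotopy category objects which are bounded complexes. -/
def bddProp : ObjectProperty (HomotopyCategory C (.up ℤ)) :=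
  fun K => ∃ a b : ℤ, CochainComplex.IsStrictlyGE K.as a ∧ CochainComplex.IsStrictlyLE K.as b

instance : (bddProp C).IsStableUnderShift ℤ where
  isStableUnderShiftBy m :=
    { le_shift := by
        intro K hK
        obtain ⟨K : CochainComplex C ℤ, rfl⟩ := K.quotient_obj_surjective
        obtain ⟨a, b, ha, hb⟩ := hK
        change CochainComplex.IsStrictlyGE K a at ha
        change CochainComplex.IsStrictlyLE K b at hb
        rw [ObjectProperty.prop_shift_iff, HomotopyCategory.shift_quotient_obj]
        exact ⟨a - m, b - m, CochainComplex.isStrictlyGE_shift K a m (a - m) (by lia),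
          CochainComplex.isStrictlyLE_shift K b m (b - m) (by lia)⟩ }

/-- The category of bounded complexes in `C` up to chain homotopy. -/
abbrev KBdd : Type _ := (bddProp C).FullSubcategory

variable {C}

theorem bddProp_cone [Limits.HasBinaryBiproducts C] (G : C ⥤ C) [G.Additive] (η : G ⟶ 𝟭 C)
    (K : HomotopyCategory C (.up ℤ)) (hK : bddProp C K) :
    bddProp C ((coneFunctorH G η).obj K) := by
  obtain ⟨a, b, ha, hb⟩ := hK
  refine ⟨a - 1, b, ?_, ?_⟩
  · change CochainComplex.IsStrictlyGE (mappingCone (coneMap G η K.as)) _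
    rw [CochainComplex.isStrictlyGE_iff]
    intro i hi
    rw [mappingCone.isZero_X_iff]
    exact ⟨G.map_isZero (CochainComplex.isZero_of_isStrictlyGE K.as a _ (by lia)),
      CochainComplex.isZero_of_isStrictlyGE K.as a _ (by lia)⟩
  · change CochainComplex.IsStrictlyLE (mappingCone (coneMap G η K.as)) _
    rw [CochainComplex.isStrictlyLE_iff]
    intro i hi
    rw [mappingCone.isZero_X_iff]
    exact ⟨G.map_isZero (CochainComplex.isZero_of_isStrictlyLE K.as b _ (by lia)),
      CochainComplex.isZero_of_isStrictlyLE K.as b _ (by lia)⟩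

/-- The functor induced by `coneFunctor` on bounded complexes up to homotopy. -/
noncomputable def coneFunctorK [Limits.HasBinaryBiproducts C] (G : C ⥤ C) [G.Additive]
    (η : G ⟶ 𝟭 C) : KBdd C ⥤ KBdd C :=
  (bddProp C).lift ((bddProp C).ι ⋙ coneFunctorH G η)
    fun K => bddProp_cone G η K.obj K.property

end BoundedComplexes

section TriangulatedCenter

open CategoryTheory

universe v u

/-- The centre of a triangulated category: the ring of natural transformations of the identity
functor which commute with the shift `[1]`. -/
def TriCenter (D : Type u) [Category.{v} D] [Preadditive D] [HasShift D ℤ]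
    [(shiftFunctor D (1 : ℤ)).Additive] : Subring (CatCenter D) where
  carrier := {z | ∀ X : D, z.app (X⟦(1 : ℤ)⟧) = (z.app X)⟦(1 : ℤ)⟧'}
  mul_mem' {x y} hx hy X := by
    rw [CatCenter.mul_app, CatCenter.mul_app, hx, hy, Functor.map_comp]
  one_mem' X := ((shiftFunctor D (1 : ℤ)).map_id X).symm
  add_mem' {x y} hx hy X := by
    refine Eq.trans ?_ (Functor.map_add _).symm
    exact congrArg₂ (· + ·) (hx X) (hy X)
  zero_mem' X := (Functor.map_zero (shiftFunctor D (1 : ℤ)) X X).symm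
  neg_mem' {x} hx X := by
    refine Eq.trans ?_ (Functor.map_neg _).symm
    exact congrArg Neg.neg (hx X)

section

variable {D E : Type*} [Category* D] [Category* E] [HasShift D ℤ] [HasShift E ℤ]
  (F : D ⥤ E) [F.CommShift ℤ] (z : CatCenter D) (w : CatCenter E)

theorem map_center_shift (h : ∀ X, w.app (F.obj X) = F.map (z.app X)) (X : D) :
    F.map (z.app (X⟦(1 : ℤ)⟧)) ≫ (F.commShiftIso (1 : ℤ)).hom.app X =
      (F.commShiftIso (1 : ℤ)).hom.app X ≫ w.app ((F.obj X)⟦(1 : ℤ)⟧) := by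
  rw [← h]
  exact (w.naturality ((F.commShiftIso (1 : ℤ)).hom.app X)).symm

theorem map_center_shift' (h : ∀ X, w.app (F.obj X) = F.map (z.app X)) (X : D) :
    F.map ((z.app X)⟦(1 : ℤ)⟧') ≫ (F.commShiftIso (1 : ℤ)).hom.app X =
      (F.commShiftIso (1 : ℤ)).hom.app X ≫ (w.app (F.obj X))⟦(1 : ℤ)⟧' := by
  rw [h]
  exact (F.commShiftIso (1 : ℤ)).hom.naturality (z.app X)

theorem center_shift_of_map (h : ∀ X, w.app (F.obj X) = F.map (z.app X)) (X : D)
    (hX : z.app (X⟦(1 : ℤ)⟧) = (z.app X)⟦(1 : ℤ)⟧') :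
    w.app ((F.obj X)⟦(1 : ℤ)⟧) = (w.app (F.obj X))⟦(1 : ℤ)⟧' := by
  rw [← cancel_epi ((F.commShiftIso (1 : ℤ)).hom.app X), ← map_center_shift F z w h,
    ← map_center_shift' F z w h, hX]

theorem center_shift_of_faithful [F.Faithful]
    (h : ∀ X, w.app (F.obj X) = F.map (z.app X)) (X : D)
    (hX : w.app ((F.obj X)⟦(1 : ℤ)⟧) = (w.app (F.obj X))⟦(1 : ℤ)⟧') :
    z.app (X⟦(1 : ℤ)⟧) = (z.app X)⟦(1 : ℤ)⟧' := by
  refine F.map_injective ?_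
  rw [← cancel_mono ((F.commShiftIso (1 : ℤ)).hom.app X), map_center_shift F z w h,
    map_center_shift' F z w h, hX]

end

variable {C : Type u} [Category.{v} C] [Preadditive C]

/-- The endomorphism of a complex which is `z` in each degree. -/
def termwise (z : CatCenter C) : CatCenter (CochainComplex C ℤ) where
  app M :=
    { f := fun p => z.app (M.X p)
      comm' := fun p q _ => (z.naturality (M.d p q)).symm }
  naturality M N f := by
    ext p
    exact z.naturality (f.f p)

/-- The endomorphism of a complex up to homotopy which is `z` in each degree. -/
def termwiseH (z : CatCenter C) : CatCenter (HomotopyCategory C (.up ℤ)) where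
  app M := (HomotopyCategory.quotient C (.up ℤ)).map ((termwise z).app M.as)
  naturality M N f := by
    obtain ⟨f, rfl⟩ := (HomotopyCategory.quotient C (.up ℤ)).map_surjective f
    exact ((HomotopyCategory.quotient C (.up ℤ)).map_comp _ _).symm.trans
      ((congrArg _ ((termwise z).naturality f)).trans
        ((HomotopyCategory.quotient C (.up ℤ)).map_comp _ _))

/-- The endomorphism of a bounded complex, up to homotopy, which is `z` in each degree. -/
def termwiseK (z : CatCenter C) : CatCenter (KBdd C) where
  app M := ObjectProperty.homMk ((termwiseH z).app M.obj)
  naturality M N f := by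
    ext
    exact (termwiseH z).naturality f.hom

theorem termwiseK_shift (z : CatCenter C) : termwiseK z ∈ TriCenter (KBdd C) := by
  intro M
  refine center_shift_of_faithful (bddProp C).ι _ (termwiseH z) (fun _ => rfl) M ?_
  refine center_shift_of_map (HomotopyCategory.quotient C (.up ℤ)) (termwise z) (termwiseH z)
    (fun _ => rfl) M.obj.as ?_
  ext p
  rfl

variable (C) in
/-- The ring homomorphism from the centre of `C` to the centre of the category of bounded
complexes in `C` up to homotopy which extends natural transformations termwise. -/
def centerToK : CatCenter C →+* TriCenter (KBdd C) where
  toFun z := ⟨termwiseK z, termwiseK_shift z⟩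
  map_one' := by
    ext M
    rfl
  map_mul' x y := by
    ext M
    rfl
  map_zero' := by
    ext M
    rfl
  map_add' x y := by
    ext M
    rfl

end TriangulatedCenter

section RingCenter

open CategoryTheory

universe u

variable (A : Type u) [Ring A]

/-- Multiplication by a central element, as a natural transformation of the identity functor of
the category of left modules. -/
def centerModule : Subring.center A →+* CatCenter (ModuleCat.{u} A) where
  toFun z :=
    { app := fun M => ModuleCat.ofHom
        { toFun := fun m => z.1 • m
          map_add' := fun m m' => smul_add _ _ _
          map_smul' := fun x m => by
            rw [RingHom.id_apply, smul_smul, smul_smul, Subring.mem_center_iff.1 z.2 x] }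
      naturality := fun M N f => by
        ext m
        exact (map_smul f.hom z.1 m).symm }
  map_one' := by
    ext M m
    exact one_smul A m
  map_mul' x y := by
    ext M m
    exact mul_smul x.1 y.1 m
  map_zero' := by
    ext M m
    exact zero_smul A m
  map_add' x y := by
    ext M m
    exact add_smul x.1 y.1 m

end RingCenter

section WeakActions

open CategoryTheory

universe v u

variable {D : Type u} [Category.{v} D]

/-- The element `α'` of the centre with `α'` at `E(X)` equal to `E(α_X)`, where `E` is an
equivalence. It is determined by this property, see `conj_unique`. -/
noncomputable def conj (E : D ⥤ D) [E.IsEquivalence] (α : CatCenter D) : CatCenter D where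
  app Y := (E.objObjPreimageIso Y).inv ≫ E.map (α.app (E.objPreimage Y)) ≫
    (E.objObjPreimageIso Y).hom
  naturality Y Z f := by
    obtain ⟨p, hp⟩ := E.map_surjective
      ((E.objObjPreimageIso Y).hom ≫ f ≫ (E.objObjPreimageIso Z).inv)
    have h := congrArg E.map (α.naturality p)
    rw [E.map_comp, E.map_comp, hp, Category.assoc, Category.assoc] at h
    change f ≫ (E.objObjPreimageIso Z).inv ≫ E.map (α.app (E.objPreimage Z)) ≫
      (E.objObjPreimageIso Z).hom = ((E.objObjPreimageIso Y).inv ≫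
        E.map (α.app (E.objPreimage Y)) ≫ (E.objObjPreimageIso Y).hom) ≫ f
    rw [← cancel_epi (E.objObjPreimageIso Y).hom, ← cancel_mono (E.objObjPreimageIso Z).inv]
    simpa only [Category.assoc, Iso.hom_inv_id_assoc, Iso.hom_inv_id, Category.comp_id] using h

theorem conj_app (E : D ⥤ D) [E.IsEquivalence] (α : CatCenter D) (X : D) :
    (conj E α).app (E.obj X) = E.map (α.app X) := by
  obtain ⟨p, hp⟩ := E.map_surjective (E.objObjPreimageIso (E.obj X)).hom
  have h := congrArg E.map (α.naturality p)
  rw [E.map_comp, E.map_comp, hp] at h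
  change (E.objObjPreimageIso (E.obj X)).inv ≫ E.map (α.app (E.objPreimage (E.obj X))) ≫
    (E.objObjPreimageIso (E.obj X)).hom = _
  rw [← cancel_epi (E.objObjPreimageIso (E.obj X)).hom, Iso.hom_inv_id_assoc]
  exact h.symm

theorem conj_unique (E : D ⥤ D) [E.IsEquivalence] (α β : CatCenter D)
    (h : ∀ X, β.app (E.obj X) = E.map (α.app X)) : β = conj E α := by
  ext Y
  have h1 := β.naturality (E.objObjPreimageIso Y).hom
  have h2 := (conj E α).naturality (E.objObjPreimageIso Y).hom
  rw [h] at h1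
  rw [conj_app] at h2
  rw [← cancel_epi (E.objObjPreimageIso Y).hom]
  exact h1.trans h2.symm

variable [Preadditive D] [HasShift D ℤ]

variable (D) in
/-- A weak action of a group on a triangulated category: additive functors `F_g` which commute with
the shift, such that `F_1 ≅ Id` and `F_g F_h ≅ F_{gh}`, without compatibility conditions on these
isomorphisms. -/
structure WeakAction (G : Type*) [Group G] where
  obj : G → D ⥤ D
  additive : ∀ g, (obj g).Additive
  shift : ∀ g, Nonempty (shiftFunctor D (1 : ℤ) ⋙ obj g ≅ obj g ⋙ shiftFunctor D (1 : ℤ))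
  one : Nonempty (obj 1 ≅ 𝟭 D)
  mul : ∀ g h, Nonempty (obj h ⋙ obj g ≅ obj (g * h))

namespace WeakAction

variable {G : Type*} [Group G] (F : WeakAction D G)

instance (g : G) : (F.obj g).Additive := F.additive g

instance (g : G) : (F.obj g).IsEquivalence := by
  obtain ⟨e⟩ := F.mul g⁻¹ g
  obtain ⟨e'⟩ := F.mul g g⁻¹
  obtain ⟨o⟩ := F.one
  exact (CategoryTheory.Equivalence.mk (F.obj g) (F.obj g⁻¹)
    (o.symm ≪≫ eqToIso (by rw [inv_mul_cancel]) ≪≫ e.symm)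
    (e' ≪≫ eqToIso (by rw [mul_inv_cancel]) ≪≫ o)).isEquivalence_functor

theorem conj_obj_mul (g h : G) (α : CatCenter D) :
    conj (F.obj (g * h)) α = conj (F.obj g) (conj (F.obj h) α) := by
  symm
  refine conj_unique _ _ _ fun X => ?_
  obtain ⟨e⟩ := F.mul g h
  have h1 := (conj (F.obj g) (conj (F.obj h) α)).naturality (e.hom.app X)
  have h2 := e.hom.naturality (α.app X)
  change e.hom.app X ≫ (conj (F.obj g) (conj (F.obj h) α)).app ((F.obj (g * h)).obj X) =
    (conj (F.obj g) (conj (F.obj h) α)).app ((F.obj g).obj ((F.obj h).obj X)) ≫ e.hom.app X at h1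
  change (F.obj g).map ((F.obj h).map (α.app X)) ≫ e.hom.app X = e.hom.app X ≫
    (F.obj (g * h)).map (α.app X) at h2
  rw [conj_app, conj_app] at h1
  rw [← cancel_epi (e.hom.app X), h1, h2]

theorem conj_obj_one (α : CatCenter D) : conj (F.obj 1) α = α := by
  symm
  refine conj_unique _ _ _ fun X => ?_
  obtain ⟨o⟩ := F.one
  have h1 := α.naturality (o.hom.app X)
  have h2 := o.hom.naturality (α.app X)
  change o.hom.app X ≫ α.app X = α.app ((F.obj 1).obj X) ≫ o.hom.app X at h1
  change (F.obj 1).map (α.app X) ≫ o.hom.app X = o.hom.app X ≫ α.app X at h2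
  rw [← cancel_mono (o.hom.app X), ← h1, h2]

variable [(shiftFunctor D (1 : ℤ)).Additive]

theorem conj_mem (E : D ⥤ D) [E.IsEquivalence]
    (s : shiftFunctor D (1 : ℤ) ⋙ E ≅ E ⋙ shiftFunctor D (1 : ℤ)) (α : CatCenter D)
    (hα : α ∈ TriCenter D) : conj E α ∈ TriCenter D := by
  intro Y
  have key : ∀ X, (conj E α).app ((E.obj X)⟦(1 : ℤ)⟧) =
      ((conj E α).app (E.obj X))⟦(1 : ℤ)⟧' := by
    intro X
    have h1 := (conj E α).naturality (s.hom.app X)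
    have h2 := s.hom.naturality (α.app X)
    change s.hom.app X ≫ (conj E α).app ((E.obj X)⟦(1 : ℤ)⟧) =
      (conj E α).app (E.obj (X⟦(1 : ℤ)⟧)) ≫ s.hom.app X at h1
    change E.map ((α.app X)⟦(1 : ℤ)⟧') ≫ s.hom.app X = s.hom.app X ≫
      (E.map (α.app X))⟦(1 : ℤ)⟧' at h2
    rw [conj_app, hα] at h1
    rw [conj_app, ← cancel_epi (s.hom.app X), h1, h2]
  let e := E.objObjPreimageIso Y
  have h1 := (conj E α).naturality (e.hom⟦(1 : ℤ)⟧')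
  have h2 := congrArg (shiftFunctor D (1 : ℤ)).map ((conj E α).naturality e.hom)
  rw [Functor.map_comp, Functor.map_comp] at h2
  rw [← cancel_epi (e.hom⟦(1 : ℤ)⟧')]
  refine h1.trans (Eq.trans ?_ h2.symm)
  exact congrArg (· ≫ _) (key _)

/-- The automorphism `α ↦ α'` of the centre which is defined by `F_g`. -/
noncomputable def conjEquiv (g : G) : RingAut (TriCenter D) where
  toFun α := ⟨conj (F.obj g) α.1, conj_mem _ (F.shift g).some α.1 α.2⟩
  invFun α := ⟨conj (F.obj g⁻¹) α.1, conj_mem _ (F.shift g⁻¹).some α.1 α.2⟩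
  left_inv α := Subtype.ext (by
    change conj (F.obj g⁻¹) (conj (F.obj g) α.1) = α.1
    rw [← conj_obj_mul, inv_mul_cancel, conj_obj_one])
  right_inv α := Subtype.ext (by
    change conj (F.obj g) (conj (F.obj g⁻¹) α.1) = α.1
    rw [← conj_obj_mul, mul_inv_cancel, conj_obj_one])
  map_mul' α β := Subtype.ext (by
    refine (conj_unique _ _ _ fun X => ?_).symm
    change (conj (F.obj g) α.1 * conj (F.obj g) β.1).app _ = (F.obj g).map ((α.1 * β.1).app X)
    rw [CatCenter.mul_app, CatCenter.mul_app, conj_app, conj_app, Functor.map_comp])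
  map_add' α β := Subtype.ext (by
    refine (conj_unique _ _ _ fun X => ?_).symm
    refine Eq.trans ?_ (Functor.map_add _).symm
    exact congrArg₂ (· + ·) (conj_app _ _ _) (conj_app _ _ _))

theorem conjEquiv_app (g : G) (α : TriCenter D) (X : D) :
    (F.conjEquiv g α).1.app ((F.obj g).obj X) = (F.obj g).map (α.1.app X) :=
  conj_app _ _ _

/-- The action of `G` on the centre, induced by a weak action of `G`. -/
noncomputable def centerAction : G →* RingAut (TriCenter D) where
  toFun := F.conjEquiv
  map_one' := by
    ext1 α
    exact Subtype.ext (F.conj_obj_one α.1)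
  map_mul' g h := by
    ext1 α
    exact Subtype.ext (F.conj_obj_mul g h α.1)

end WeakAction

end WeakActions

section Braids

/-- The relations of the braid group on the strands `1, …, m`. -/
inductive BraidRel (m : ℕ) : FreeGroup (Fin (m - 1)) → Prop
  | far (i j : Fin (m - 1)) : i.1 + 2 ≤ j.1 →
      BraidRel m (FreeGroup.of i * FreeGroup.of j * (FreeGroup.of j * FreeGroup.of i)⁻¹)
  | near (i j : Fin (m - 1)) : i.1 + 1 = j.1 →
      BraidRel m (FreeGroup.of i * FreeGroup.of j * FreeGroup.of i *
        (FreeGroup.of j * FreeGroup.of i * FreeGroup.of j)⁻¹)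

/-- The braid group on `m` strands. -/
abbrev BraidGroup (m : ℕ) : Type := PresentedGroup ({r | BraidRel m r})

/-- The generator of the braid group which exchanges the `i`-th and the `(i+1)`-st strand. -/
def BraidGroup.σ {m : ℕ} (i : Fin (m - 1)) : BraidGroup m := PresentedGroup.of i

/-- The homomorphism from the braid group to the symmetric group. -/
def BraidGroup.perm (n : ℕ) : BraidGroup (2 * n) →* Equiv.Perm (Fin (2 * n)) :=
  PresentedGroup.toGroup (f := fun i : Fin (2 * n - 1) => Equiv.swap (lo i) (hi i)) (by
    rintro _ (⟨i, j, h⟩ | ⟨i, j, h⟩)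
    · simp only [map_mul, map_inv, FreeGroup.lift_apply_of, mul_inv_eq_one]
      refine Equiv.Perm.Disjoint.commute ?_
      refine Equiv.Perm.disjoint_iff_disjoint_support.2 ?_
      rw [Equiv.Perm.support_swap (lo_ne_hi i), Equiv.Perm.support_swap (lo_ne_hi j)]
      simp [lo, hi, Fin.ext_iff]
      omega
    · simp only [map_mul, map_inv, FreeGroup.lift_apply_of, mul_inv_eq_one]
      have e : lo j = hi i := by simp [lo, hi, h]
      have h1 : lo i ≠ hi j := by
        simp [lo, hi, Fin.ext_iff]
        omega
      have h2 := Equiv.swap_mul_swap_mul_swap (lo_ne_hi i) h1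
      have h3 := Equiv.swap_mul_swap_mul_swap (lo_ne_hi j).symm h1.symm
      rw [e, Equiv.swap_comm (hi i) (lo i), Equiv.swap_comm (hi j) (hi i)] at h3
      rw [e, h2, h3, Equiv.swap_comm])

end Braids

section Main

open CategoryTheory

variable {n : ℕ}

/-- The category of bounded complexes of left `H^n`-modules up to chain homotopy. -/
abbrev KArc (n : ℕ) : Type 1 := KBdd (ModuleCat.{0} (ArcRing n))

/-- The functor of tensoring over `H^n` with the complex of bimodules `0 → ℱ(U_i) → H^n → 0`, with
differential `α` and with `H^n` in degree `0`. -/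
noncomputable def tensorU (i : Fin (2 * n - 1)) : KArc n ⥤ KArc n :=
  coneFunctorK (tensorFunctor (ArcRing n) (TangleBimod (diagU i)))
    (tensorCounit (alpha i) (alpha_op_smul i))

/-- A weak action of the braid group on `2n` strands such that the generator which exchanges the
`i`-th and the `(i+1)`-st strand acts by tensoring with `0 → ℱ(U_i) → H^n → 0`. -/
def IsBraidAction (F : WeakAction (KArc n) (BraidGroup (2 * n))) : Prop :=
  ∀ i : Fin (2 * n - 1), Nonempty (F.obj (BraidGroup.σ i) ≅ tensorU i)

/-- The element `X_i` of the centre of `H^n`. -/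
noncomputable def genZ (i : Fin (2 * n)) : Subring.center (ArcRing n) :=
  ⟨ArcRing.gen i, ArcRing.gen_mem_center i⟩

/-- The ring homomorphism which sends `z` in the centre of `H^n` to the natural transformation that
multiplies by `z` in each degree. -/
noncomputable def toCenterK (n : ℕ) : Subring.center (ArcRing n) →+* TriCenter (KArc n) :=
  (centerToK (ModuleCat.{0} (ArcRing n))).comp (centerModule (ArcRing n))

end Main

end Arc

/-! Write `G` and `G'` for the functors of tensoring with the bimodules of two diagrams `U_i` and
`U_j`, `α` and `α'` for their saddles to the identity, and `R`, `R'` for the cones of `α`, `α'`.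

The topological input consists of three facts. The diagram `U_i U_i` is `U_i` with an extra circle,
so `GG` is `G ⊕ G`; for neighbouring `i`, `j` the diagram `U_i U_j U_i` is `U_i`; distant diagrams
commute. These facts are not derived from a general formula for the bimodule of a composite tangle.
Instead, each bimodule is generated by a single element `g`, the sum of the units over the matchings
that join `i` with `i + 1`. The structure `Bubble` lists the relations of `g` that are needed,
`bubbleU` verifies them, and `Bubble.IsAdjacent` and `Bubble.IsDistant` relate two diagrams.
Identities in the groups of circles are checked with `cls_eq`, at points with coordinates `±h` that
are constant on circles. There the cobordism factors become powers of `±2h`, and the exponents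
follow from a count of circles (`ev_eps`, `numCirc_diagU`).

Invertibility: the opposite saddle gives `β` from the identity to `G`. Both `G(β)` and `β` at `G(M)`
are complements in `GG(M)` of a map `ι` that splits `α`. Therefore the cone of `β`, composed with
`R` in either order, is the shift (`nonempty_iso_shift`).

Braid relation: let `S` be the total complex of `G(M) ⊕ G'(M) ⟶ M`, and let `Q` be the cone of `G(M)
⟶ GR'(M)`, which is equivalent to `GG'(M)⟦1⟧`. Then `RR'(M)` is the cone of `Q ⟶ S`. With `Q'` the
analogue of `Q` for the exchanged roles, the relation `U_j U_i U_j = U_j` makes `Q' ⟶ G'(S) ⟶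
G'RR'(M)` an equivalence (`isIso_quadLift`). So `R'RR'(M)` is the cone of `Q' ⟶ S ⟶ cone (Q ⟶ S)`.
By the octahedral axiom this does not change when `Q` and `Q'` are exchanged (`nonempty_iso_cones`,
`nonempty_iso_braid`).

Isomorphisms of cones are not natural in `M`. For this reason the objectwise statements are applied
to the tautological complex in the category of functors on complexes, and then evaluated (`univ`,
`nonempty_evc_iso`). A weak action is a homomorphism to the invertible isomorphism classes of
functors, so nothing further is required (`exists_weakAction_braidGroup`).

Centre: a central element is diagonal, and its entries at `a` and `b` agree in the group of `W(b)a`.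
Such a family comes from one polynomial by an interpolation along the lexicographic order of bracket
words (`exists_cls_eq`). Hence the `X_i` generate.

Action: up to sign, the composite of the two opposite saddles is the difference of the signed
elements `X_i` and `X_{i+1}`. A multiple of `β` is therefore a homotopy between multiplication by
one of them on `R(M)` and `R` of multiplication by the other (`toCenterK_tensorU`). Since `f` is
injective and a braid action exists, all relations between the `X_i` are stable under permutations
(`genHom_rename_eq`), and this defines `ρ`. -/

namespace Arc

set_option linter.unusedSectionVars false

/-! ### Direct sum decompositions in preadditive categories. -/

section Splittings

open CategoryTheory Limits

universe v u v' u'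

variable {C : Type u} [Category.{v} C] [Preadditive C]

/-- The maps `f` and `g` are the inclusions of a direct sum decomposition of `Z`, with projections
`r` and `s`. -/
structure IsSplitting {X Y Z : C} (f : X ⟶ Z) (g : Y ⟶ Z) (r : Z ⟶ X) (s : Z ⟶ Y) : Prop where
  fr : f ≫ r = 𝟙 X
  fs : f ≫ s = 0
  gr : g ≫ r = 0
  gs : g ≫ s = 𝟙 Y
  tot : r ≫ f + s ≫ g = 𝟙 Z

namespace IsSplitting

variable {X Y Z : C} {f : X ⟶ Z} {g : Y ⟶ Z} {r : Z ⟶ X} {s : Z ⟶ Y}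

theorem symm (h : IsSplitting f g r s) : IsSplitting g f s r :=
  ⟨h.gs, h.gr, h.fs, h.fr, by rw [add_comm]; exact h.tot⟩

theorem map (h : IsSplitting f g r s) {D : Type u'} [Category.{v'} D] [Preadditive D]
    (F : C ⥤ D) [F.Additive] : IsSplitting (F.map f) (F.map g) (F.map r) (F.map s) where
  fr := by rw [← F.map_comp, h.fr, F.map_id]
  fs := by rw [← F.map_comp, h.fs, F.map_zero]
  gr := by rw [← F.map_comp, h.gr, F.map_zero]
  gs := by rw [← F.map_comp, h.gs, F.map_id]
  tot := by rw [← F.map_comp, ← F.map_comp, ← F.map_add, h.tot, F.map_id]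

end IsSplitting

end Splittings

/-! ### Consequences of the octahedral axiom. -/

section Triangles

open CategoryTheory Limits Pretriangulated Triangulated

universe v u

variable {T : Type u} [Category.{v} T] [Preadditive T] [HasZeroObject T] [HasShift T ℤ]
  [∀ n : ℤ, Functor.Additive (shiftFunctor T n)] [Pretriangulated T]

theorem distinguished_of_isos {X Y Z X' Y' Z' : T} {f : X ⟶ Y} {g : Y ⟶ Z} {k : Z ⟶ X⟦(1 : ℤ)⟧}
    {f' : X' ⟶ Y'} {g' : Y' ⟶ Z'} {k' : Z' ⟶ X'⟦(1 : ℤ)⟧}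
    (h : Triangle.mk f' g' k' ∈ distTriang T) (a : X ≅ X') (b : Y ≅ Y') (c : Z ≅ Z')
    (hf : f ≫ b.hom = a.hom ≫ f') (hg : g ≫ c.hom = b.hom ≫ g')
    (hk : k ≫ a.hom⟦(1 : ℤ)⟧' = c.hom ≫ k') : Triangle.mk f g k ∈ distTriang T :=
  isomorphic_distinguished _ h _ (Triangle.isoMk _ _ a b c hf hg hk)

theorem exists_iso₃ {X Y Z X' Y' Z' : T} {f : X ⟶ Y} {g : Y ⟶ Z} {k : Z ⟶ X⟦(1 : ℤ)⟧}
    {f' : X' ⟶ Y'} {g' : Y' ⟶ Z'} {k' : Z' ⟶ X'⟦(1 : ℤ)⟧}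
    (h : Triangle.mk f g k ∈ distTriang T) (h' : Triangle.mk f' g' k' ∈ distTriang T)
    (a : X ≅ X') (b : Y ≅ Y') (comm : f ≫ b.hom = a.hom ≫ f') :
    ∃ c : Z ≅ Z', g ≫ c.hom = b.hom ≫ g' ∧ k ≫ a.hom⟦(1 : ℤ)⟧' = c.hom ≫ k' := by
  let e := isoTriangleOfIso₁₂ _ _ h h' a b comm
  refine ⟨Triangle.π₃.mapIso e, ?_, ?_⟩
  · exact e.hom.comm₂
  · exact e.hom.comm₃

/-- The splitting identifies `Z` with `Y ⊞ X`, and the triangle with that of the biproduct. -/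
theorem IsSplitting.distinguished {X Y Z : T} {f : X ⟶ Z} {g : Y ⟶ Z} {r : Z ⟶ X} {s : Z ⟶ Y}
    (h : IsSplitting f g r s) : Triangle.mk g r (0 : X ⟶ Y⟦(1 : ℤ)⟧) ∈ distTriang T := by
  refine distinguished_of_isos (binaryBiproductTriangle_distinguished Y X) (Iso.refl Y)
    ⟨biprod.lift s r, biprod.desc g f, ?_, ?_⟩ (Iso.refl X) ?_ ?_ ?_
  · rw [biprod.lift_desc, add_comm]; exact h.tot
  · apply biprod.hom_ext' <;> apply biprod.hom_ext <;> simp [h.fr, h.fs, h.gr, h.gs]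
  · apply biprod.hom_ext <;> simp [h.gs, h.gr]
  · simp
  · simp

/-- Isomorphic maps have isomorphic cones. -/
theorem nonempty_iso_cone {X Y Z X' Y' Z' : T} {f : X ⟶ Y} {g : Y ⟶ Z} {k : Z ⟶ X⟦(1 : ℤ)⟧}
    (h : Triangle.mk f g k ∈ distTriang T) {f' : X' ⟶ Y'} {g' : Y' ⟶ Z'} {k' : Z' ⟶ X'⟦(1 : ℤ)⟧}
    (h' : Triangle.mk f' g' k' ∈ distTriang T) (a : X ≅ X') (b : Y ≅ Y')
    (comm : f ≫ b.hom = a.hom ≫ f') : Nonempty (Z ≅ Z') :=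
  (exists_iso₃ h h' a b comm).elim fun c _ => ⟨c⟩

theorem distinguished_of_iso₂ {X Y Y' Z : T} {f : X ⟶ Y} {g : Y ⟶ Z} {k : Z ⟶ X⟦(1 : ℤ)⟧}
    (h : Triangle.mk f g k ∈ distTriang T) (u : Y ≅ Y') :
    Triangle.mk (f ≫ u.hom) (u.inv ≫ g) k ∈ distTriang T :=
  distinguished_of_isos h (Iso.refl X) u.symm (Iso.refl Z) (by simp) (by simp) (by simp)

variable [IsTriangulated T]

/-- Two distinguished triangles through the same object `B`. -/
theorem isIso_comp_of_isIso_comp {A B C Z N : T} {a : A ⟶ B} {p : B ⟶ C} {c : C ⟶ A⟦(1 : ℤ)⟧}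
    (h₁ : Triangle.mk a p c ∈ distTriang T) {s : Z ⟶ B} {q : B ⟶ N} {d : N ⟶ Z⟦(1 : ℤ)⟧}
    (h₂ : Triangle.mk s q d ∈ distTriang T) (h : IsIso (s ≫ p)) : IsIso (a ≫ q) := by
  obtain ⟨W, v, w, h₃⟩ := distinguished_cocone_triangle (s ≫ p)
  -- The octahedron of `s ≫ p` is a triangle `N ⟶ W ⟶ A⟦1⟧ ⟶ N⟦1⟧` with last map `-(a ≫ q)⟦1⟧`. This
  -- map is invertible because the cone `W` of the isomorphism `s ≫ p` vanishes.
  obtain ⟨o⟩ := IsTriangulated.octahedron_axiom (rfl : s ≫ p = s ≫ p) h₂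
    (rot_of_distTriang _ h₁) h₃
  have hW : IsZero W := Triangle.isZero₃_of_isIso₁ _ h₃ h
  have h4 := (Triangle.isZero₂_iff_isIso₃ _ o.mem).1 hW
  change IsIso ((-a⟦(1 : ℤ)⟧') ≫ q⟦(1 : ℤ)⟧') at h4
  have h5 : IsIso ((shiftFunctor T (1 : ℤ)).map (-(a ≫ q))) := by
    rw [Functor.map_neg, Functor.map_comp, ← Preadditive.neg_comp]; exact h4
  have h6 : IsIso (-(a ≫ q)) := isIso_of_reflects_iso _ (shiftFunctor T (1 : ℤ))
  obtain ⟨j, h1, h2⟩ := h6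
  exact ⟨-j, by rw [Preadditive.comp_neg, ← Preadditive.neg_comp, h1],
    by rw [Preadditive.neg_comp, ← Preadditive.comp_neg, h2]⟩

/-- The cone of a split inclusion is its complement: the triangle of the splitting and `hT` pass
through the same object `Z`, and `f ≫ r` is the identity. -/
theorem isIso_of_splitting {X Y Z N : T} {f : X ⟶ Z} {g : Y ⟶ Z} {r : Z ⟶ X} {s : Z ⟶ Y}
    (h : IsSplitting f g r s) {q : Z ⟶ N} {d : N ⟶ X⟦(1 : ℤ)⟧}
    (hT : Triangle.mk f q d ∈ distTriang T) : IsIso (g ≫ q) :=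
  isIso_comp_of_isIso_comp h.distinguished hT (by rw [h.fr]; infer_instance)

/-- The cones of `Y → P → cone f` and of `X → P → cone g` are isomorphic. -/
theorem nonempty_iso_cones {X Y P N N' W W' : T} {f : X ⟶ P} {g : Y ⟶ P}
    {k : P ⟶ N} {w : N ⟶ X⟦(1 : ℤ)⟧} (hf : Triangle.mk f k w ∈ distTriang T)
    {k' : P ⟶ N'} {w' : N' ⟶ Y⟦(1 : ℤ)⟧} (hg : Triangle.mk g k' w' ∈ distTriang T)
    {c : N ⟶ W} {d : W ⟶ Y⟦(1 : ℤ)⟧} (h : Triangle.mk (g ≫ k) c d ∈ distTriang T)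
    {c' : N' ⟶ W'} {d' : W' ⟶ X⟦(1 : ℤ)⟧} (h' : Triangle.mk (f ≫ k') c' d' ∈ distTriang T) :
    Nonempty (W ≅ W') := by
  -- The octahedron of `g ≫ k` shows that `W` completes the map `-(f ≫ k')⟦1⟧` from `X⟦1⟧` to
  -- `N'⟦1⟧`. The rotated triangle `h'` shows the same for `W'`.
  obtain ⟨o⟩ := IsTriangulated.octahedron_axiom (rfl : g ≫ k = g ≫ k) hg
    (rot_of_distTriang _ hf) h
  let e := isoTriangleOfIso₁₃ _ _ o.mem (rot_of_distTriang _ h') (Iso.refl N') (Iso.refl _)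
    (by
      change ((-(f⟦(1 : ℤ)⟧')) ≫ k'⟦(1 : ℤ)⟧') ≫ (𝟙 N')⟦(1 : ℤ)⟧' =
        𝟙 (X⟦(1 : ℤ)⟧) ≫ (-((f ≫ k')⟦(1 : ℤ)⟧'))
      rw [Category.id_comp, CategoryTheory.Functor.map_id, Category.comp_id, Functor.map_comp,
        Preadditive.neg_comp])
  exact ⟨Triangle.π₂.mapIso e⟩

end Triangles

/-! ### Mapping cones and additive functors. -/

section Cones

open CategoryTheory Limits CochainComplex CochainComplex.HomComplex

universe v u v' u'

variable {C : Type u} [Category.{v} C] [Preadditive C] [HasBinaryBiproducts C]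
  {D : Type u'} [Category.{v'} D] [Preadditive D] [HasBinaryBiproducts D]

theorem inl_map {K L K' L' : CochainComplex C ℤ} {f : K ⟶ L} {g : K' ⟶ L'} {a : K ⟶ K'}
    {b : L ⟶ L'} (w : f ≫ b = a ≫ g) (p q : ℤ) (h : p + (-1) = q) :
    (mappingCone.inl f).v p q h ≫ (mappingCone.map f g a b w).f q =
      a.f p ≫ (mappingCone.inl g).v p q h := by
  rw [mappingCone.map, mappingCone.inl_v_desc_f, Cochain.zero_cochain_comp_v, Cochain.ofHom_v]

theorem inr_map {K L K' L' : CochainComplex C ℤ} {f : K ⟶ L} {g : K' ⟶ L'} {a : K ⟶ K'}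
    {b : L ⟶ L'} (w : f ≫ b = a ≫ g) (p : ℤ) :
    (mappingCone.inr f).f p ≫ (mappingCone.map f g a b w).f p =
      b.f p ≫ (mappingCone.inr g).f p := by
  rw [mappingCone.map, mappingCone.inr_f_desc_f, HomologicalComplex.comp_f]

theorem inr_comp_map {K L K' L' : CochainComplex C ℤ} {f : K ⟶ L} {g : K' ⟶ L'} {a : K ⟶ K'}
    {b : L ⟶ L'} (w : f ≫ b = a ≫ g) :
    mappingCone.inr f ≫ mappingCone.map f g a b w = b ≫ mappingCone.inr g := by
  rw [mappingCone.map, mappingCone.inr_desc]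

theorem inl_comp_map {K L K' L' : CochainComplex C ℤ} {f : K ⟶ L} {g : K' ⟶ L'} {a : K ⟶ K'}
    {b : L ⟶ L'} (w : f ≫ b = a ≫ g) :
    (mappingCone.inl f).comp (Cochain.ofHom (mappingCone.map f g a b w)) (add_zero _) =
      (Cochain.ofHom a).comp (mappingCone.inl g) (zero_add _) := by
  rw [mappingCone.map, mappingCone.inl_desc]

theorem cone_hom_ext {K L M : CochainComplex C ℤ} {f : K ⟶ L} {a b : mappingCone f ⟶ M}
    (h1 : ∀ p q (h : p + (-1) = q), (mappingCone.inl f).v p q h ≫ a.f q =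
      (mappingCone.inl f).v p q h ≫ b.f q)
    (h2 : ∀ p, (mappingCone.inr f).f p ≫ a.f p = (mappingCone.inr f).f p ≫ b.f p) : a = b := by
  ext p
  exact mappingCone.ext_from f (p + 1) p rfl (h1 _ _ _) (h2 _)

section MapCone

variable (F : C ⥤ D) [F.Additive] {K L : CochainComplex C ℤ} (f : K ⟶ L)

theorem map_comp_add_eq_left {X Y Z : C} {T : D} {i : X ⟶ Y} {p : Y ⟶ X} {q : Y ⟶ Z}
    (h₁ : i ≫ p = 𝟙 X) (h₂ : i ≫ q = 0) (a : F.obj X ⟶ T) (b : F.obj Z ⟶ T) :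
    F.map i ≫ (F.map p ≫ a + F.map q ≫ b) = a := by
  rw [Preadditive.comp_add, ← F.map_comp_assoc, ← F.map_comp_assoc, h₁, h₂,
    CategoryTheory.Functor.map_id, F.map_zero, zero_comp, add_zero, Category.id_comp]

theorem map_inl_coneIso (p q : ℤ) (h : p + (-1) = q) :
    ((mappingCone.inl f).map F).v p q h ≫ (mappingCone.mapHomologicalComplexIso f F).hom.f q =
      (mappingCone.inl ((F.mapHomologicalComplex (.up ℤ)).map f)).v p q h := by
  obtain rfl : p = q + 1 := by lia
  exact map_comp_add_eq_left F (mappingCone.inl_v_fst_v f (q + 1) q rfl)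
    (mappingCone.inl_v_snd_v f (q + 1) q h) _ _

theorem map_inr_coneIso (p : ℤ) :
    ((F.mapHomologicalComplex (.up ℤ)).map (mappingCone.inr f)).f p ≫
        (mappingCone.mapHomologicalComplexIso f F).hom.f p =
      (mappingCone.inr ((F.mapHomologicalComplex (.up ℤ)).map f)).f p := by
  rw [← HomologicalComplex.comp_f, mappingCone.map_inr]

theorem map_cone_hom_ext {M : CochainComplex D ℤ}
    {a b : (F.mapHomologicalComplex (.up ℤ)).obj (mappingCone f) ⟶ M}
    (h1 : ∀ p q (h : p + (-1) = q), ((mappingCone.inl f).map F).v p q h ≫ a.f q =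
      ((mappingCone.inl f).map F).v p q h ≫ b.f q)
    (h2 : ∀ p, ((F.mapHomologicalComplex (.up ℤ)).map (mappingCone.inr f)).f p ≫ a.f p =
      ((F.mapHomologicalComplex (.up ℤ)).map (mappingCone.inr f)).f p ≫ b.f p) : a = b := by
  rw [← cancel_epi (mappingCone.mapHomologicalComplexIso f F).inv]
  have e : ∀ q, (mappingCone.mapHomologicalComplexIso f F).hom.f q ≫
      (mappingCone.mapHomologicalComplexIso f F).inv.f q = 𝟙 _ := fun q => by
    rw [← HomologicalComplex.comp_f, Iso.hom_inv_id, HomologicalComplex.id_f]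
  apply cone_hom_ext
  · intro p q h
    rw [← map_inl_coneIso, HomologicalComplex.comp_f, HomologicalComplex.comp_f, Category.assoc,
      Category.assoc, ← Category.assoc (_ : _ ⟶ _) _ (a.f q), ← Category.assoc (_ : _ ⟶ _) _ (b.f q),
      e, Category.id_comp, Category.id_comp, h1]
  · intro p
    rw [← map_inr_coneIso, HomologicalComplex.comp_f, HomologicalComplex.comp_f, Category.assoc,
      Category.assoc, ← Category.assoc (_ : _ ⟶ _) _ (a.f p), ← Category.assoc (_ : _ ⟶ _) _ (b.f p),
      e, Category.id_comp, Category.id_comp, h2]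

end MapCone

section Naturality

variable {K L : CochainComplex C ℤ} (f : K ⟶ L)

theorem map_inl_app {F F' : C ⥤ D} [F.Additive] [F'.Additive] (ω : F ⟶ F') (p q : ℤ)
    (h : p + (-1) = q) : ((mappingCone.inl f).map F).v p q h ≫
      ((NatTrans.mapHomologicalComplex ω (.up ℤ)).app (mappingCone f)).f q =
    ((NatTrans.mapHomologicalComplex ω (.up ℤ)).app K).f p ≫
      ((mappingCone.inl f).map F').v p q h :=
  ω.naturality _

/-- Checked on the two summands of the cone. It makes evaluation of complexes of functors compatible
with cones, naturally in the argument. -/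
theorem mapCone_naturality {F F' : C ⥤ D} [F.Additive] [F'.Additive] (ω : F ⟶ F')
    (w : (F.mapHomologicalComplex (.up ℤ)).map f ≫
        (NatTrans.mapHomologicalComplex ω (.up ℤ)).app L =
      (NatTrans.mapHomologicalComplex ω (.up ℤ)).app K ≫
        (F'.mapHomologicalComplex (.up ℤ)).map f) :
    (NatTrans.mapHomologicalComplex ω (.up ℤ)).app (mappingCone f) ≫
        (mappingCone.mapHomologicalComplexIso f F').hom =
      (mappingCone.mapHomologicalComplexIso f F).hom ≫ mappingCone.map _ _ _ _ w := by
  apply map_cone_hom_ext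
  · intro p q h
    rw [HomologicalComplex.comp_f, HomologicalComplex.comp_f, ← Category.assoc, ← Category.assoc,
      map_inl_coneIso, inl_map, map_inl_app, Category.assoc, map_inl_coneIso]
  · intro p
    rw [HomologicalComplex.comp_f, HomologicalComplex.comp_f, ← Category.assoc, ← Category.assoc,
      map_inr_coneIso, inr_map, ← HomologicalComplex.comp_f, NatTrans.naturality,
      HomologicalComplex.comp_f, Category.assoc, map_inr_coneIso]

theorem map_inl_coneMap {G : C ⥤ C} [G.Additive] (η : G ⟶ 𝟭 C) (p q : ℤ)
    (h : p + (-1) = q) : ((mappingCone.inl f).map G).v p q h ≫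
      (coneMap G η (mappingCone f)).f q =
    (coneMap G η K).f p ≫ (mappingCone.inl f).v p q h :=
  η.naturality _

/-- A natural transformation acts on the two summands of a cone separately. This turns the cone
construction, applied to a cone, into a double cone of a commutative square. -/
theorem coneMap_mappingCone {G : C ⥤ C} [G.Additive] (η : G ⟶ 𝟭 C)
    (w : (G.mapHomologicalComplex (.up ℤ)).map f ≫ coneMap G η L = coneMap G η K ≫ f) :
    coneMap G η (mappingCone f) =
      (mappingCone.mapHomologicalComplexIso f G).hom ≫ mappingCone.map _ _ _ _ w := by
  apply map_cone_hom_ext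
  · intro p q h
    rw [HomologicalComplex.comp_f, ← Category.assoc, map_inl_coneIso, inl_map, map_inl_coneMap]
  · intro p
    rw [HomologicalComplex.comp_f, ← Category.assoc, map_inr_coneIso, inr_map,
      ← HomologicalComplex.comp_f, ← coneMap_naturality, HomologicalComplex.comp_f]

end Naturality

end Cones

/-! ### Two ways to form the total complex of a span or of a square. -/

section DoubleCones

open CategoryTheory Limits CochainComplex CochainComplex.HomComplex

universe v u

variable {C : Type u} [Category.{v} C] [Preadditive C] [HasBinaryBiproducts C]

section Swap

variable {X Y Z : CochainComplex C ℤ} (f : X ⟶ Z) (g : Y ⟶ Z)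

/-- The two ways to form the total complex of `X ⟶ Z ⟵ Y` as an iterated cone. -/
noncomputable def swapHom :
    mappingCone (f ≫ mappingCone.inr g) ⟶ mappingCone (g ≫ mappingCone.inr f) :=
  mappingCone.desc _ ((mappingCone.inl f).comp
      (Cochain.ofHom (mappingCone.inr (g ≫ mappingCone.inr f))) (add_zero _))
    (mappingCone.desc _ (mappingCone.inl (g ≫ mappingCone.inr f))
      (mappingCone.inr f ≫ mappingCone.inr (g ≫ mappingCone.inr f))
      (by rw [mappingCone.δ_inl, Category.assoc]))
    (by rw [δ_comp_ofHom, mappingCone.δ_inl, ← Cochain.ofHom_comp, Category.assoc, Category.assoc,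
      mappingCone.inr_desc])

theorem inl_swapHom (p q : ℤ) (h : p + (-1) = q) :
    (mappingCone.inl (f ≫ mappingCone.inr g)).v p q h ≫ (swapHom f g).f q =
      (mappingCone.inl f).v p q h ≫ (mappingCone.inr (g ≫ mappingCone.inr f)).f q := by
  rw [swapHom, mappingCone.inl_v_desc_f, Cochain.comp_zero_cochain_v, Cochain.ofHom_v]

theorem inr_swapHom : mappingCone.inr (f ≫ mappingCone.inr g) ≫ swapHom f g =
    mappingCone.desc _ (mappingCone.inl (g ≫ mappingCone.inr f))
      (mappingCone.inr f ≫ mappingCone.inr (g ≫ mappingCone.inr f))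
      (by rw [mappingCone.δ_inl, Category.assoc]) := by
  rw [swapHom, mappingCone.inr_desc]

theorem inr_f_swapHom (p : ℤ) :
    (mappingCone.inr (f ≫ mappingCone.inr g)).f p ≫ (swapHom f g).f p =
    (mappingCone.desc g (mappingCone.inl (g ≫ mappingCone.inr f))
      (mappingCone.inr f ≫ mappingCone.inr (g ≫ mappingCone.inr f))
      (by rw [mappingCone.δ_inl, Category.assoc])).f p := by
  rw [← HomologicalComplex.comp_f, inr_swapHom]

theorem swapHom_swapHom : swapHom f g ≫ swapHom g f = 𝟙 _ := by
  apply cone_hom_ext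
  · intro p q h
    rw [HomologicalComplex.comp_f, ← Category.assoc, inl_swapHom, Category.assoc, inr_f_swapHom,
      mappingCone.inl_v_desc_f, HomologicalComplex.id_f, Category.comp_id]
  · intro p
    rw [HomologicalComplex.comp_f, ← Category.assoc, inr_f_swapHom, HomologicalComplex.id_f,
      Category.comp_id]
    apply mappingCone.ext_from g (p + 1) p rfl
    · rw [← Category.assoc, mappingCone.inl_v_desc_f, inl_swapHom]
    · rw [← Category.assoc, mappingCone.inr_f_desc_f, HomologicalComplex.comp_f, Category.assoc,
        inr_f_swapHom, mappingCone.inr_f_desc_f, HomologicalComplex.comp_f]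

/-- The isomorphism `swapHom`. -/
noncomputable def swapIso :
    mappingCone (f ≫ mappingCone.inr g) ≅ mappingCone (g ≫ mappingCone.inr f) :=
  ⟨swapHom f g, swapHom g f, swapHom_swapHom f g, swapHom_swapHom g f⟩

end Swap

section Flip

variable {K L K' L' : CochainComplex C ℤ} {f : K ⟶ L} {g : K' ⟶ L'} {a : K ⟶ K'}
    {b : L ⟶ L'} (w : f ≫ b = a ≫ g)

theorem flip_aux_inr : δ (-1) 0 ((Cochain.ofHom (mappingCone.inr a)).comp
      (mappingCone.inl (mappingCone.map a b f g w.symm)) (zero_add _)) =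
    Cochain.ofHom (g ≫ mappingCone.inr b ≫ mappingCone.inr (mappingCone.map a b f g w.symm)) := by
  rw [δ_ofHom_comp, mappingCone.δ_inl, ← Cochain.ofHom_comp, ← Category.assoc,
    mappingCone.map, mappingCone.inr_desc, Category.assoc]

/-- The minus sign on the summand `K` is the Koszul sign for exchanging the two shifts of a double
cone. With it the differentials of all four components match. -/
theorem flip_aux : δ (-1) 0 (mappingCone.descCochain f (m := -2) (n := -1)
      (-(mappingCone.inl a).comp (mappingCone.inl (mappingCone.map a b f g w.symm)) (by decide))
      ((mappingCone.inl b).comp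
        (Cochain.ofHom (mappingCone.inr (mappingCone.map a b f g w.symm))) (add_zero _))
      (by decide)) =
    Cochain.ofHom (mappingCone.map f g a b w ≫ mappingCone.desc _
      ((Cochain.ofHom (mappingCone.inr a)).comp
        (mappingCone.inl (mappingCone.map a b f g w.symm)) (zero_add _))
      (mappingCone.inr b ≫ mappingCone.inr (mappingCone.map a b f g w.symm)) (flip_aux_inr w)) := by
  have h1 : δ (-2) (-1) (-(mappingCone.inl a).comp
      (mappingCone.inl (mappingCone.map a b f g w.symm)) (by decide : -1 + -1 = (-2 : ℤ))) =
      -((Cochain.ofHom f).comp ((mappingCone.inl b).comp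
        (Cochain.ofHom (mappingCone.inr (mappingCone.map a b f g w.symm))) (add_zero _))
          (zero_add _)) + (Cochain.ofHom a).comp ((Cochain.ofHom (mappingCone.inr a)).comp
        (mappingCone.inl (mappingCone.map a b f g w.symm)) (zero_add _)) (zero_add _) := by
    rw [δ_neg, δ_comp _ _ _ 0 0 (-1) (by decide) (by decide) (by decide), mappingCone.δ_inl,
      mappingCone.δ_inl]
    ext p q h
    simp only [Cochain.neg_v, Cochain.add_v, Int.negOnePow_neg,
      Int.negOnePow_one, Units.neg_smul, one_smul, Cochain.comp_zero_cochain_v,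
      Cochain.zero_cochain_comp_v, Cochain.ofHom_v, HomologicalComplex.comp_f, neg_add_rev,
      neg_neg, Category.assoc]
    rw [← Category.assoc ((mappingCone.inl a).v p q h), inl_map, Category.assoc, add_comm]
  rw [mappingCone.δ_descCochain _ _ _ _ 0 (by decide), h1, Int.negOnePow_zero, one_smul,
    δ_comp_ofHom, mappingCone.δ_inl, mappingCone.ext_cochain_from_iff _ (-1) 0 (by decide)]
  constructor
  · rw [neg_add_cancel_comm, Cochain.comp_add, mappingCone.inl_fst_assoc,
      mappingCone.inl_snd_assoc, add_zero, Cochain.ofHom_comp,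
      ← Cochain.comp_assoc_of_second_is_zero_cochain (mappingCone.inl f), inl_comp_map,
      Cochain.comp_assoc_of_first_is_zero_cochain, mappingCone.inl_desc]
  · rw [Cochain.comp_add, mappingCone.inr_fst_assoc, mappingCone.inr_snd_assoc, zero_add,
      ← Cochain.ofHom_comp, ← Cochain.ofHom_comp, ← Category.assoc (mappingCone.inr f),
      inr_comp_map, Category.assoc, Category.assoc, mappingCone.inr_desc]

/-- The two ways to form the total complex of a commutative square as an iterated cone. -/
noncomputable def flipHom :
    mappingCone (mappingCone.map f g a b w) ⟶ mappingCone (mappingCone.map a b f g w.symm) :=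
  mappingCone.desc _
    (mappingCone.descCochain f (m := -2) (n := -1)
      (-(mappingCone.inl a).comp (mappingCone.inl (mappingCone.map a b f g w.symm)) (by decide))
      ((mappingCone.inl b).comp
        (Cochain.ofHom (mappingCone.inr (mappingCone.map a b f g w.symm))) (add_zero _))
      (by decide))
    (mappingCone.desc _
      ((Cochain.ofHom (mappingCone.inr a)).comp
        (mappingCone.inl (mappingCone.map a b f g w.symm)) (zero_add _))
      (mappingCone.inr b ≫ mappingCone.inr (mappingCone.map a b f g w.symm))
      (flip_aux_inr w))
    (flip_aux w)

theorem inl_flipHom (p q : ℤ) (h : p + (-1) = q) :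
    (mappingCone.inl (mappingCone.map f g a b w)).v p q h ≫ (flipHom w).f q =
    (mappingCone.descCochain f (m := -2) (n := -1)
      (-(mappingCone.inl a).comp (mappingCone.inl (mappingCone.map a b f g w.symm)) (by decide))
      ((mappingCone.inl b).comp
        (Cochain.ofHom (mappingCone.inr (mappingCone.map a b f g w.symm))) (add_zero _))
      (by decide)).v p q h := by
  rw [flipHom, mappingCone.inl_v_desc_f]

theorem inl_inl_flipHom (p q r : ℤ) (h : p + (-1) = q) (h' : q + (-1) = r) :
    (mappingCone.inl f).v p q h ≫
      (mappingCone.inl (mappingCone.map f g a b w)).v q r h' ≫ (flipHom w).f r =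
    -((mappingCone.inl a).v p q h ≫
      (mappingCone.inl (mappingCone.map a b f g w.symm)).v q r h') := by
  rw [inl_flipHom, mappingCone.inl_v_descCochain_v, Cochain.neg_v,
    Cochain.comp_v _ _ (by decide : -1 + -1 = -2) p q r h h']

theorem inr_inl_flipHom (p q : ℤ) (h : p + (-1) = q) :
    (mappingCone.inr f).f p ≫
      (mappingCone.inl (mappingCone.map f g a b w)).v p q h ≫ (flipHom w).f q =
    (mappingCone.inl b).v p q h ≫ (mappingCone.inr (mappingCone.map a b f g w.symm)).f q := by
  rw [inl_flipHom, mappingCone.inr_f_descCochain_v, Cochain.comp_zero_cochain_v, Cochain.ofHom_v]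

theorem inl_inr_flipHom (p q : ℤ) (h : p + (-1) = q) :
    (mappingCone.inl g).v p q h ≫
      (mappingCone.inr (mappingCone.map f g a b w)).f q ≫ (flipHom w).f q =
    (mappingCone.inr a).f p ≫ (mappingCone.inl (mappingCone.map a b f g w.symm)).v p q h := by
  rw [flipHom, mappingCone.inr_f_desc_f, mappingCone.inl_v_desc_f, Cochain.zero_cochain_comp_v,
    Cochain.ofHom_v]

theorem inr_inr_flipHom (p : ℤ) :
    (mappingCone.inr g).f p ≫
      (mappingCone.inr (mappingCone.map f g a b w)).f p ≫ (flipHom w).f p =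
    (mappingCone.inr b).f p ≫ (mappingCone.inr (mappingCone.map a b f g w.symm)).f p := by
  rw [flipHom, mappingCone.inr_f_desc_f, mappingCone.inr_f_desc_f, HomologicalComplex.comp_f]

theorem flipHom_flipHom : flipHom w ≫ flipHom w.symm = 𝟙 _ := by
  apply cone_hom_ext
  · intro q r h
    rw [HomologicalComplex.comp_f, HomologicalComplex.id_f, Category.comp_id]
    apply mappingCone.ext_from f (q + 1) q rfl
    · rw [← Category.assoc (_ : _ ⟶ _) ((flipHom w).f r), ← Category.assoc, inl_inl_flipHom,
        Preadditive.neg_comp, Category.assoc, inl_inl_flipHom, neg_neg]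
    · rw [← Category.assoc (_ : _ ⟶ _) ((flipHom w).f r), ← Category.assoc, inr_inl_flipHom,
        Category.assoc, inl_inr_flipHom]
  · intro p
    rw [HomologicalComplex.comp_f, HomologicalComplex.id_f, Category.comp_id]
    apply mappingCone.ext_from g (p + 1) p rfl
    · rw [← Category.assoc (_ : _ ⟶ _) ((flipHom w).f p), ← Category.assoc, inl_inr_flipHom,
        Category.assoc, inr_inl_flipHom]
    · rw [← Category.assoc (_ : _ ⟶ _) ((flipHom w).f p), ← Category.assoc, inr_inr_flipHom,
        Category.assoc, inr_inr_flipHom]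

/-- The isomorphism `flipHom`. -/
noncomputable def flipIso :
    mappingCone (mappingCone.map f g a b w) ≅ mappingCone (mappingCone.map a b f g w.symm) :=
  ⟨flipHom w, flipHom w.symm, flipHom_flipHom w, flipHom_flipHom w.symm⟩

end Flip

end DoubleCones

/-! ### Mapping cones in the homotopy category. -/

section HomotopyCones

open CategoryTheory Limits CochainComplex CochainComplex.HomComplex Pretriangulated

universe v u

variable {C : Type u} [Category.{v} C] [Preadditive C] [HasBinaryBiproducts C]

/-- The connecting map of a mapping cone. -/
noncomputable def coneδ {K L : CochainComplex C ℤ} (f : K ⟶ L) :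
    mappingCone f ⟶ K⟦(1 : ℤ)⟧ := (mappingCone.triangle f).mor₃

theorem inr_coneδ {K L : CochainComplex C ℤ} (f : K ⟶ L) :
    mappingCone.inr f ≫ coneδ f = 0 := mappingCone.inr_triangleδ f

theorem inl_coneδ {K L : CochainComplex C ℤ} (f : K ⟶ L) (p q : ℤ) (h : p + (-1) = q) :
    (mappingCone.inl f).v p q h ≫ (coneδ f).f q =
      -(K.shiftFunctorObjXIso 1 q p (by rw [← h, neg_add_cancel_right])).inv :=
  mappingCone.inl_v_triangle_mor₃_f f p q h

/-- With `inl_swapHom_coneδ` this computes the projection of the double cone to `Y⟦1⟧` in the other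
order of forming it: the connecting map on the cone of `g`, and zero on the summand of `X`. -/
theorem inr_swapHom_coneδ {X Y Z : CochainComplex C ℤ} (f : X ⟶ Z) (g : Y ⟶ Z) :
    mappingCone.inr (f ≫ mappingCone.inr g) ≫ swapHom f g ≫ coneδ (g ≫ mappingCone.inr f) =
      coneδ g := by
  rw [← Category.assoc, inr_swapHom]
  apply cone_hom_ext
  · intro p q h
    rw [HomologicalComplex.comp_f, ← Category.assoc, mappingCone.inl_v_desc_f, inl_coneδ,
      inl_coneδ]
  · intro p
    rw [← HomologicalComplex.comp_f, ← HomologicalComplex.comp_f, ← Category.assoc,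
      mappingCone.inr_desc, inr_coneδ, Category.assoc, inr_coneδ, comp_zero]

theorem inl_swapHom_coneδ {X Y Z : CochainComplex C ℤ} (f : X ⟶ Z) (g : Y ⟶ Z) (p q : ℤ)
    (h : p + (-1) = q) : (mappingCone.inl (f ≫ mappingCone.inr g)).v p q h ≫
      (swapHom f g ≫ coneδ (g ≫ mappingCone.inr f)).f q = 0 := by
  rw [HomologicalComplex.comp_f, ← Category.assoc, inl_swapHom, Category.assoc,
    ← HomologicalComplex.comp_f, inr_coneδ, HomologicalComplex.zero_f, comp_zero]

/-- The homotopy equivalence from the cone of `L ⟶ cone f` to `K⟦1⟧`. -/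
noncomputable def coneInr {K L : CochainComplex C ℤ} (f : K ⟶ L) :
    mappingCone (mappingCone.inr f) ⟶ K⟦(1 : ℤ)⟧ :=
  mappingCone.desc _ 0 (coneδ f) (by rw [inr_coneδ, δ_zero, Cochain.ofHom_zero])

theorem inl_coneInr {K L : CochainComplex C ℤ} (f : K ⟶ L) (p q : ℤ) (h : p + (-1) = q) :
    (mappingCone.inl (mappingCone.inr f)).v p q h ≫ (coneInr f).f q = 0 := by
  rw [coneInr, mappingCone.inl_v_desc_f, Cochain.zero_v]

theorem inr_coneInr {K L : CochainComplex C ℤ} (f : K ⟶ L) :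
    mappingCone.inr (mappingCone.inr f) ≫ coneInr f = coneδ f :=
  mappingCone.inr_desc _ _ _ _

variable (C) in
/-- The projection to the homotopy category. -/
abbrev hq : CochainComplex C ℤ ⥤ HomotopyCategory C (.up ℤ) :=
  HomotopyCategory.quotient C (.up ℤ)

instance isIso_coneInr {K L : CochainComplex C ℤ} (f : K ⟶ L) : IsIso ((hq C).map (coneInr f)) :=
  (HomotopyCategory.isoOfHomotopyEquiv (mappingCone.rotateHomotopyEquiv f)).isIso_inv

instance isIso_hq_map {D : Type*} [Category* D] [Preadditive D] (F : C ⥤ D) [F.Additive]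
    {K L : CochainComplex C ℤ} (f : K ⟶ L)
    [IsIso ((hq C).map f)] : IsIso ((hq D).map ((F.mapHomologicalComplex (.up ℤ)).map f)) := by
  have : IsIso ((hq C).map f) := inferInstance
  exact (F.mapHomotopyCategory (.up ℤ)).map_isIso ((hq C).map f)

variable [HasZeroObject C]

theorem hq_cone_distinguished {K L : CochainComplex C ℤ} (f : K ⟶ L) :
    Triangle.mk ((hq C).map f) ((hq C).map (mappingCone.inr f))
      ((hq C).map (coneδ f) ≫ ((hq C).commShiftIso (1 : ℤ)).hom.app K) ∈
        distTriang (HomotopyCategory C (.up ℤ)) :=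
  HomotopyCategory.mappingCone_triangleh_distinguished f

/-- The octahedral triangle of a composite, realised by explicit maps of mapping cones. Later steps
compute with these maps on the level of chains. -/
theorem hq_comp_distinguished {K L M : CochainComplex C ℤ} (f : K ⟶ L) (g : L ⟶ M)
    {k : K ⟶ M} (e : f ≫ g = k) (w : f ≫ g = 𝟙 K ≫ k) (w' : k ≫ 𝟙 M = f ≫ g) :
    Triangle.mk ((hq C).map (mappingCone.map f k (𝟙 K) g w))
      ((hq C).map (mappingCone.map k g f (𝟙 M) w'))
      ((hq C).map (coneδ g ≫ (mappingCone.inr f)⟦(1 : ℤ)⟧') ≫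
        ((hq C).commShiftIso (1 : ℤ)).hom.app _) ∈
        distTriang (HomotopyCategory C (.up ℤ)) := by
  subst e
  exact HomotopyCategory.mappingConeCompTriangleh_distinguished f g

theorem nonempty_iso_cone_hq {K L K' L' : CochainComplex C ℤ} {f : K ⟶ L} {g : K' ⟶ L'}
    (a : (hq C).obj K ≅ (hq C).obj K') (b : (hq C).obj L ≅ (hq C).obj L')
    (w : (hq C).map f ≫ b.hom = a.hom ≫ (hq C).map g) :
    Nonempty ((hq C).obj (mappingCone f) ≅ (hq C).obj (mappingCone g)) :=
  nonempty_iso_cone (hq_cone_distinguished f) (hq_cone_distinguished g) a b w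

theorem isIso_hq_of_splitting {X Y Z : CochainComplex C ℤ} {f : X ⟶ Z} {g : Y ⟶ Z} {r : Z ⟶ X}
    {s : Z ⟶ Y} (h : IsSplitting f g r s) : IsIso ((hq C).map (g ≫ mappingCone.inr f)) := by
  rw [(hq C).map_comp]
  exact isIso_of_splitting (h.map (hq C)) (hq_cone_distinguished f)

/-- If the second summand of the target of `b'` maps identically to that of `b`, then the
cone of `cone b' ⟶ cone b` is the cone of the inclusion into `cone b`. -/
theorem nonempty_iso_shift {M N M' N' : CochainComplex C ℤ} {b : M ⟶ N} {b' : M' ⟶ N'}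
    {c : mappingCone b' ⟶ mappingCone b} {ι : N ⟶ N'} {r : N' ⟶ M'} {s : N' ⟶ N}
    (h : IsSplitting b' ι r s) (hc : ι ≫ mappingCone.inr b' ≫ c = mappingCone.inr b) :
    Nonempty ((hq C).obj (mappingCone c) ≅ (hq C).obj (M⟦(1 : ℤ)⟧)) := by
  have := isIso_hq_of_splitting h
  -- By the splitting, `ι ≫ inr b'` is invertible up to homotopy. It allows `c` to be replaced by
  -- `inr b`, whose cone is the shift of `M`.
  obtain ⟨e⟩ := nonempty_iso_cone_hq (f := mappingCone.inr b) (g := c)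
    (asIso ((hq C).map (ι ≫ mappingCone.inr b'))) (Iso.refl _) (by
      rw [Iso.refl_hom, Category.comp_id, asIso_hom, ← (hq C).map_comp, Category.assoc, hc])
  exact ⟨e.symm ≪≫ asIso ((hq C).map (coneInr b))⟩

end HomotopyCones

/-! ### Invertibility and far commutativity for cones of natural transformations. -/

section Braiding

open CategoryTheory Limits CochainComplex CochainComplex.HomComplex Pretriangulated

universe v u

variable {C : Type u} [Category.{v} C] [Preadditive C]

/-- The functor induced on complexes. -/
abbrev cx (G : C ⥤ C) [G.Additive] : CochainComplex C ℤ ⥤ CochainComplex C ℤ :=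
  G.mapHomologicalComplex (.up ℤ)

/-- The chain map `M → G(M)` given by `β` in each degree. -/
def unitMap (G : C ⥤ C) [G.Additive] (β : 𝟭 C ⟶ G) (M : CochainComplex C ℤ) :
    M ⟶ (cx G).obj M where
  f p := β.app (M.X p)
  comm' p q _ := (β.naturality (M.d p q)).symm

theorem unitMap_naturality (G : C ⥤ C) [G.Additive] (β : 𝟭 C ⟶ G) {M N : CochainComplex C ℤ}
    (f : M ⟶ N) : f ≫ unitMap G β N = unitMap G β M ≫ (cx G).map f := by
  ext p
  exact β.naturality (f.f p)

theorem coneMap_shift (G : C ⥤ C) [G.Additive] (α : G ⟶ 𝟭 C) (M : CochainComplex C ℤ) :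
    coneMap G α (M⟦(1 : ℤ)⟧) =
      ((cx G).commShiftIso (1 : ℤ)).hom.app M ≫ (coneMap G α M)⟦(1 : ℤ)⟧' := by
  ext p
  exact (Category.id_comp (α.app (M.X (p + 1)))).symm

variable [HasBinaryBiproducts C]

/-- The counterpart of `coneMap_mappingCone` for a transformation from the identity. -/
theorem unitMap_mappingCone {K L : CochainComplex C ℤ} (f : K ⟶ L) {G : C ⥤ C} [G.Additive]
    (β : 𝟭 C ⟶ G)
    (w : f ≫ unitMap G β L = unitMap G β K ≫ (G.mapHomologicalComplex (.up ℤ)).map f) :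
    unitMap G β (mappingCone f) ≫ (mappingCone.mapHomologicalComplexIso f G).hom =
      mappingCone.map _ _ _ _ w := by
  apply cone_hom_ext
  · intro p q h
    have : (mappingCone.inl f).v p q h ≫ (unitMap G β (mappingCone f)).f q =
      (unitMap G β K).f p ≫ ((mappingCone.inl f).map G).v p q h := β.naturality _
    rw [HomologicalComplex.comp_f, ← Category.assoc, this, Category.assoc, map_inl_coneIso, inl_map]
  · intro p
    rw [HomologicalComplex.comp_f, ← Category.assoc, ← HomologicalComplex.comp_f,
      unitMap_naturality, HomologicalComplex.comp_f, Category.assoc, map_inr_coneIso, inr_map]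

theorem map_coneδ {K L : CochainComplex C ℤ} (f : K ⟶ L) (G : C ⥤ C) [G.Additive] :
    (cx G).map (coneδ f) ≫ ((cx G).commShiftIso (1 : ℤ)).hom.app K =
      (mappingCone.mapHomologicalComplexIso f G).hom ≫ coneδ ((cx G).map f) :=
  mappingCone.map_δ f G

instance isIso_hq_shift {K L : CochainComplex C ℤ} (f : K ⟶ L) [IsIso ((hq C).map f)] :
    IsIso ((hq C).map (f⟦(1 : ℤ)⟧')) := by
  have h : IsIso (((hq C).map f)⟦(1 : ℤ)⟧') := inferInstance
  have e := NatIso.naturality_2 ((hq C).commShiftIso (1 : ℤ)) f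
  change _ = (hq C).map (f⟦(1 : ℤ)⟧') at e
  rw [← e]
  exact IsIso.comp_isIso' inferInstance (IsIso.comp_isIso' h inferInstance)

variable [HasZeroObject C]

section Inverse

variable {G : C ⥤ C} [G.Additive] {α : G ⟶ 𝟭 C} {β : 𝟭 C ⟶ G} {M : CochainComplex C ℤ}
  {ι : (cx G).obj M ⟶ (cx G).obj ((cx G).obj M)}

/-- The complex is the cone of `cone G(β) ⟶ cone β`. As `ι` is both a complement of `G(β)` and a
section of `α` at `G(M)`, everything cancels except the source of `β`. -/
theorem nonempty_iso_cone_unit {r : (cx G).obj ((cx G).obj M) ⟶ (cx G).obj M}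
    {s : (cx G).obj ((cx G).obj M) ⟶ (cx G).obj M}
    (h : IsSplitting ((cx G).map (unitMap G β M)) ι r s)
    (hι : ι ≫ coneMap G α ((cx G).obj M) = 𝟙 _) :
    Nonempty ((hq C).obj (mappingCone (coneMap G α (mappingCone (unitMap G β M)))) ≅
      (hq C).obj (M⟦(1 : ℤ)⟧)) := by
  have w := (coneMap_naturality G α (unitMap G β M)).symm
  obtain ⟨e⟩ := nonempty_iso_shift (c := mappingCone.map _ _ _ _ w) h (by
    rw [inr_comp_map, ← Category.assoc, hι, Category.id_comp])
  obtain ⟨e'⟩ := nonempty_iso_cone_hq (f := coneMap G α (mappingCone (unitMap G β M)))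
    (g := mappingCone.map _ _ _ _ w)
    ((hq C).mapIso (mappingCone.mapHomologicalComplexIso _ G)) (Iso.refl _) (by
      rw [Iso.refl_hom, Category.comp_id, Functor.mapIso_hom, ← (hq C).map_comp,
        ← coneMap_mappingCone])
  exact ⟨e' ≪≫ e⟩

/-- The same cancellation in the other order. The double cone is flipped first, so that the cones of
`β` become the inner ones. -/
theorem nonempty_iso_unit_cone {r : (cx G).obj ((cx G).obj M) ⟶ (cx G).obj M}
    {s : (cx G).obj ((cx G).obj M) ⟶ (cx G).obj M}
    (h : IsSplitting (unitMap G β ((cx G).obj M)) ι r s)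
    (hι : ι ≫ (cx G).map (coneMap G α M) = 𝟙 _) :
    Nonempty ((hq C).obj (mappingCone (unitMap G β (mappingCone (coneMap G α M)))) ≅
      (hq C).obj (M⟦(1 : ℤ)⟧)) := by
  have w := unitMap_naturality G β (coneMap G α M)
  obtain ⟨e⟩ := nonempty_iso_shift (c := mappingCone.map _ _ _ _ w.symm) h (by
    rw [inr_comp_map, ← Category.assoc, hι, Category.id_comp])
  obtain ⟨e'⟩ := nonempty_iso_cone_hq (f := unitMap G β (mappingCone (coneMap G α M)))
    (g := mappingCone.map _ _ _ _ w) (Iso.refl _)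
    ((hq C).mapIso (mappingCone.mapHomologicalComplexIso _ G)) (by
      rw [Iso.refl_hom, Category.id_comp, Functor.mapIso_hom, ← (hq C).map_comp,
        unitMap_mappingCone])
  exact ⟨e' ≪≫ (hq C).mapIso (flipIso w) ≪≫ e⟩

end Inverse

section Far

variable {G G' : C ⥤ C} [G.Additive] [G'.Additive] {α : G ⟶ 𝟭 C} {α' : G' ⟶ 𝟭 C}
  {M : CochainComplex C ℤ}

/-- Both sides are total complexes of one square with corners `GG'(M)`, `G(M)`, `G'(M)` and `M`;
flipping the square and applying `τ` at its corner identifies them. -/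
theorem nonempty_iso_cone_cone
    (τ : (cx G).obj ((cx G').obj M) ≅ (cx G').obj ((cx G).obj M))
    (hτ : τ.hom ≫ (cx G').map (coneMap G α M) = coneMap G α ((cx G').obj M))
    (hτ' : τ.hom ≫ coneMap G' α' ((cx G).obj M) = (cx G).map (coneMap G' α' M)) :
    Nonempty ((hq C).obj (mappingCone (coneMap G α (mappingCone (coneMap G' α' M)))) ≅
      (hq C).obj (mappingCone (coneMap G' α' (mappingCone (coneMap G α M))))) := by
  have w := (coneMap_naturality G α (coneMap G' α' M)).symm
  have w' := (coneMap_naturality G' α' (coneMap G α M)).symm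
  obtain ⟨e⟩ := nonempty_iso_cone_hq (f := coneMap G α (mappingCone (coneMap G' α' M)))
    (g := mappingCone.map _ _ _ _ w)
    ((hq C).mapIso (mappingCone.mapHomologicalComplexIso _ G)) (Iso.refl _) (by
      rw [Iso.refl_hom, Category.comp_id, Functor.mapIso_hom, ← (hq C).map_comp,
        ← coneMap_mappingCone])
  obtain ⟨e'⟩ := nonempty_iso_cone_hq (f := coneMap G' α' (mappingCone (coneMap G α M)))
    (g := mappingCone.map _ _ _ _ w')
    ((hq C).mapIso (mappingCone.mapHomologicalComplexIso _ G')) (Iso.refl _) (by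
      rw [Iso.refl_hom, Category.comp_id, Functor.mapIso_hom, ← (hq C).map_comp,
        ← coneMap_mappingCone])
  have z : coneMap G α ((cx G').obj M) ≫ 𝟙 _ = τ.hom ≫ (cx G').map (coneMap G α M) := by
    rw [hτ, Category.comp_id]
  have z' : (cx G').map (coneMap G α M) ≫ 𝟙 _ = τ.inv ≫ coneMap G α ((cx G').obj M) := by
    rw [← hτ, Iso.inv_hom_id_assoc, Category.comp_id]
  let k : mappingCone (coneMap G α ((cx G').obj M)) ≅ mappingCone ((cx G').map (coneMap G α M)) :=
    ⟨mappingCone.map _ _ _ _ z, mappingCone.map _ _ _ _ z', by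
      rw [← mappingCone.map_comp, ← mappingCone.map_id]
      congr 1
      · exact τ.hom_inv_id
      · exact Category.comp_id _, by
      rw [← mappingCone.map_comp, ← mappingCone.map_id]
      congr 1
      · exact τ.inv_hom_id
      · exact Category.comp_id _⟩
  obtain ⟨e''⟩ := nonempty_iso_cone_hq (f := mappingCone.map _ _ _ _ w.symm)
    (g := mappingCone.map _ _ _ _ w') ((hq C).mapIso k) (Iso.refl _) (by
      rw [Iso.refl_hom, Category.comp_id, Functor.mapIso_hom, ← (hq C).map_comp]
      congr 1
      change _ = mappingCone.map _ _ _ _ z ≫ _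
      rw [← mappingCone.map_comp]
      congr 1
      · exact hτ'.symm
      · exact (Category.id_comp _).symm)
  exact ⟨e ≪≫ (hq C).mapIso (flipIso w) ≪≫ e'' ≪≫ e'.symm⟩

end Far

end Braiding

/-! ### The braid relation for iterated cones. -/

section Near

open CategoryTheory Limits CochainComplex CochainComplex.HomComplex Pretriangulated

universe v u

variable {C : Type u} [Category.{v} C] [Preadditive C] [HasBinaryBiproducts C]
  {G G' : C ⥤ C} [G.Additive] [G'.Additive] (α : G ⟶ 𝟭 C) (α' : G' ⟶ 𝟭 C)
  (M : CochainComplex C ℤ)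

/-- The cone of `G(M) ⟶ G(R'(M))`, where `R'` is the cone of `α'`. -/
noncomputable abbrev quadCone : CochainComplex C ℤ :=
  mappingCone ((cx G).map (mappingCone.inr (coneMap G' α' M)))

/-- The total complex of `G(M) ⟶ M ⟵ G'(M)`. -/
noncomputable abbrev spanCone : CochainComplex C ℤ :=
  mappingCone (coneMap G α M ≫ mappingCone.inr (coneMap G' α' M))

theorem spanCone_comm : (cx G).map (mappingCone.inr (coneMap G' α' M)) ≫
    coneMap G α (mappingCone (coneMap G' α' M)) =
      coneMap G α M ≫ mappingCone.inr (coneMap G' α' M) :=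
  (coneMap_naturality G α _).symm

theorem quadToSpan_comm : (cx G).map (mappingCone.inr (coneMap G' α' M)) ≫
    coneMap G α (mappingCone (coneMap G' α' M)) =
      𝟙 _ ≫ coneMap G α M ≫ mappingCone.inr (coneMap G' α' M) := by
  rw [spanCone_comm, Category.id_comp]

/-- The map induced by `α`. -/
noncomputable def quadToSpan : quadCone (G := G) α' M ⟶ spanCone α α' M :=
  mappingCone.map _ _ (𝟙 _) (coneMap G α (mappingCone (coneMap G' α' M))) (quadToSpan_comm α α' M)

theorem spanToCone_comm : (coneMap G α M ≫ mappingCone.inr (coneMap G' α' M)) ≫ 𝟙 _ =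
    (cx G).map (mappingCone.inr (coneMap G' α' M)) ≫
      coneMap G α (mappingCone (coneMap G' α' M)) := by
  rw [spanCone_comm, Category.comp_id]

/-- The map to the iterated cone. -/
noncomputable def spanToCone :
    spanCone α α' M ⟶ mappingCone (coneMap G α (mappingCone (coneMap G' α' M))) :=
  mappingCone.map _ _ ((cx G).map (mappingCone.inr (coneMap G' α' M))) (𝟙 _)
    (spanToCone_comm α α' M)

/-- The homotopy equivalence of `quadCone` and `G(G'(M)⟦1⟧)`. -/
noncomputable def quadProj : quadCone (G := G) α' M ⟶ (cx G).obj (((cx G').obj M)⟦(1 : ℤ)⟧) :=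
  (mappingCone.mapHomologicalComplexIso _ G).inv ≫ (cx G).map (coneInr (coneMap G' α' M))

/-- Only the part `G(G'(M)⟦1⟧)` of the source survives up to homotopy. On it, the component of
`quadToSpan` towards `G'(M)⟦1⟧` is the transformation `α`. -/
theorem quadToSpan_swap_coneδ : quadToSpan α α' M ≫ swapHom _ _ ≫ coneδ _ =
    quadProj α' M ≫ coneMap G α (((cx G').obj M)⟦(1 : ℤ)⟧) := by
  rw [← cancel_epi (mappingCone.mapHomologicalComplexIso _ G).hom, quadProj, Category.assoc,
    Iso.hom_inv_id_assoc]
  apply map_cone_hom_ext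
  · intro p q h
    have h0 : ((mappingCone.inl (mappingCone.inr (coneMap G' α' M))).map G).v p q h ≫
        ((cx G).map (coneInr (coneMap G' α' M))).f q = 0 := by
      have := congrArg G.map (inl_coneInr (coneMap G' α' M) p q h)
      rw [G.map_comp, G.map_zero] at this
      exact this
    rw [HomologicalComplex.comp_f, HomologicalComplex.comp_f, HomologicalComplex.comp_f,
      ← Category.assoc, ← Category.assoc, map_inl_coneIso, ← Category.assoc, quadToSpan, inl_map,
      HomologicalComplex.id_f, Category.id_comp, Category.assoc, ← HomologicalComplex.comp_f,
      inl_swapHom_coneδ, HomologicalComplex.comp_f, ← Category.assoc, h0, zero_comp]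
  · intro p
    rw [← HomologicalComplex.comp_f, ← HomologicalComplex.comp_f, ← Category.assoc,
      mappingCone.map_inr, ← Category.assoc, quadToSpan, inr_comp_map, Category.assoc,
      inr_swapHom_coneδ, ← Category.assoc, ← (cx G).map_comp, inr_coneInr, coneMap_naturality]

instance isIso_quadProj : IsIso ((hq C).map (quadProj (G := G) α' M)) := by
  rw [quadProj, (hq C).map_comp]
  have h1 : IsIso ((hq C).map (coneInr (coneMap G' α' M))) := inferInstance
  have h2 : IsIso ((hq C).map ((cx G).map (coneInr (coneMap G' α' M)))) := isIso_hq_map G _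
  have h3 : IsIso ((hq C).map (mappingCone.mapHomologicalComplexIso
    (mappingCone.inr (coneMap G' α' M)) G).inv) := inferInstance
  exact IsIso.comp_isIso

variable [HasZeroObject C]

/-- `spanCone` is the cone of the composite `G(M) ⟶ GR'(M) ⟶ R'(M)`, so this is the octahedral
triangle of that composite. -/
theorem quad_span_cone_distinguished :
    ∃ d, Triangle.mk ((hq C).map (quadToSpan α α' M)) ((hq C).map (spanToCone α α' M)) d ∈
      distTriang (HomotopyCategory C (.up ℤ)) :=
  ⟨_, hq_comp_distinguished _ _ (spanCone_comm α α' M) _ _⟩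

variable {α α' M}

theorem map_ι_comm {ι' : (cx G').obj M ⟶ (cx G').obj ((cx G').obj M)}
    (hι' : ι' ≫ (cx G').map (coneMap G' α' M) = 𝟙 _) :
    (cx G').map (mappingCone.inr (coneMap G α M)) ≫ 𝟙 _ =
      ι' ≫ (cx G').map (coneMap G' α' M ≫ mappingCone.inr (coneMap G α M)) := by
  rw [Functor.map_comp, ← Category.assoc, hι', Category.id_comp, Category.comp_id]

/-- The map `quadCone ⟶ G'(spanCone)` induced by `ι'`. -/
noncomputable def quadLift (ι' : (cx G').obj M ⟶ (cx G').obj ((cx G').obj M))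
    (hι' : ι' ≫ (cx G').map (coneMap G' α' M) = 𝟙 _) :
    quadCone (G := G') α M ⟶ mappingCone ((cx G').map
      (coneMap G' α' M ≫ mappingCone.inr (coneMap G α M))) :=
  mappingCone.map _ _ ι' (𝟙 _) (map_ι_comm hι')

/-- Hence `quadToSpan` factors through the counit `G'(S) ⟶ S`. The section property of `ι'` with
respect to `α'` at `G'(M)` is what makes the components agree. -/
theorem quadLift_coneMap (ι' : (cx G').obj M ⟶ (cx G').obj ((cx G').obj M))
    (hι' : ι' ≫ (cx G').map (coneMap G' α' M) = 𝟙 _)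
    (hι : ι' ≫ coneMap G' α' ((cx G').obj M) = 𝟙 _) :
    quadLift (α := α) ι' hι' ≫ (mappingCone.mapHomologicalComplexIso _ G').inv ≫
      coneMap G' α' (spanCone α' α M) = quadToSpan α' α M := by
  rw [coneMap_mappingCone _ _ (coneMap_naturality G' α' _).symm, Iso.inv_hom_id_assoc, quadLift,
    ← mappingCone.map_comp, quadToSpan]
  congr 1
  exact Category.id_comp _

theorem coneMap_shift_comm (X : CochainComplex C ℤ) :
    (cx G').map (coneMap G α (X⟦(1 : ℤ)⟧)) ≫ ((cx G').commShiftIso (1 : ℤ)).hom.app X =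
      (cx G').map (((cx G).commShiftIso (1 : ℤ)).hom.app X) ≫
        ((cx G').commShiftIso (1 : ℤ)).hom.app ((cx G).obj X) ≫
          ((cx G').map (coneMap G α X))⟦(1 : ℤ)⟧' := by
  rw [coneMap_shift, (cx G').map_comp, Category.assoc]
  congr 1
  exact ((cx G').commShiftIso (1 : ℤ)).hom.naturality (coneMap G α X)

theorem map_quadToSpan_coneδ : (cx G').map (quadToSpan α α' M ≫ swapHom _ _) ≫
      (mappingCone.mapHomologicalComplexIso _ G').hom ≫ coneδ ((cx G').map
        (coneMap G' α' M ≫ mappingCone.inr (coneMap G α M))) =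
      (cx G').map (quadProj (G := G) α' M) ≫
        ((cx G').mapIso (((cx G).commShiftIso (1 : ℤ)).app ((cx G').obj M)) ≪≫
        ((cx G').commShiftIso (1 : ℤ)).app _).hom ≫
          ((cx G').map (coneMap G α ((cx G').obj M)))⟦(1 : ℤ)⟧' := by
  rw [← map_coneδ, ← Category.assoc, ← (cx G').map_comp, Category.assoc, quadToSpan_swap_coneδ,
    (cx G').map_comp, Category.assoc, coneMap_shift_comm, Iso.trans_hom, Functor.mapIso_hom,
    Category.assoc]
  rfl

/-- Up to equivalences and a shift, the map is `G'GG'(M) ⟶ G'G'(M) ⟶ cone ι'`. It is invertible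
because its first map is a complement of `ι'`. -/
theorem isIso_quad_comp {ι' : (cx G').obj M ⟶ (cx G').obj ((cx G').obj M)}
    {r : (cx G').obj ((cx G').obj M) ⟶ (cx G').obj ((cx G).obj ((cx G').obj M))}
    {s : (cx G').obj ((cx G').obj M) ⟶ (cx G').obj M}
    (h : IsSplitting ((cx G').map (coneMap G α ((cx G').obj M))) ι' r s) :
    IsIso ((hq C).map (((cx G').map (quadToSpan α α' M ≫ swapHom _ _) ≫
      (mappingCone.mapHomologicalComplexIso _ G').hom) ≫ coneδ ((cx G').map
        (coneMap G' α' M ≫ mappingCone.inr (coneMap G α M))) ≫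
          (mappingCone.inr ι')⟦(1 : ℤ)⟧')) := by
  have h3 : IsIso ((hq C).map ((cx G').map (coneMap G α ((cx G').obj M)) ≫ mappingCone.inr ι')) :=
    isIso_hq_of_splitting h.symm
  have h4 := isIso_hq_shift ((cx G').map (coneMap G α ((cx G').obj M)) ≫ mappingCone.inr ι')
  have h5 : IsIso ((hq C).map ((cx G').map (quadProj (G := G) α' M))) := isIso_hq_map G' _
  rw [Category.assoc, ← Category.assoc (mappingCone.mapHomologicalComplexIso _ G').hom,
    ← Category.assoc, map_quadToSpan_coneδ, Category.assoc, Category.assoc, ← Functor.map_comp,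
    (hq C).map_comp, (hq C).map_comp]
  exact IsIso.comp_isIso' h5 (IsIso.comp_isIso' inferInstance h4)

/-- Two triangles pass through `G'(S)`: one starts with `quadLift` and continues to the shifted cone
of `ι'`, the other is `G'` of the triangle of `Q`, `S` and `RR'(M)`. By `isIso_comp_of_isIso_comp`
the claim reduces to `isIso_quad_comp`. -/
theorem isIso_quadLift {ι' : (cx G').obj M ⟶ (cx G').obj ((cx G').obj M)}
    (hι' : ι' ≫ (cx G').map (coneMap G' α' M) = 𝟙 _)
    {r : (cx G').obj ((cx G').obj M) ⟶ (cx G').obj ((cx G).obj ((cx G').obj M))}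
    {s : (cx G').obj ((cx G').obj M) ⟶ (cx G').obj M}
    (h : IsSplitting ((cx G').map (coneMap G α ((cx G').obj M))) ι' r s) :
    IsIso ((hq C).map (quadLift (α := α) ι' hι' ≫ (mappingCone.mapHomologicalComplexIso _ G').inv ≫
        (cx G').map (swapHom _ _ ≫ spanToCone α α' M))) := by
  -- The rotated octahedral triangle of `ι'` followed by `G'(G'(M) ⟶ M ⟶ R(M))`. By the section
  -- property the composite is `G'(M ⟶ R(M))`.
  have hT : Triangle.mk ((hq C).map (quadLift (α := α) ι' hι')) _ _ ∈ distTriang _ :=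
    rot_of_distTriang _ (hq_comp_distinguished ι'
    ((cx G').map (coneMap G' α' M ≫ mappingCone.inr (coneMap G α M)))
    ((map_ι_comm hι').symm.trans (Category.comp_id _))
    (((map_ι_comm hι').symm.trans (Category.comp_id _)).trans (Category.id_comp _).symm)
    (map_ι_comm hι'))
  obtain ⟨d, hd⟩ := quad_span_cone_distinguished α α' M
  have hd' : Triangle.mk ((hq C).map ((cx G').map (quadToSpan α α' M)))
      ((hq C).map ((cx G').map (spanToCone α α' M))) _ ∈ distTriang _ :=
    (G'.mapHomotopyCategory (.up ℤ)).map_distinguished _ hd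
  let e : (hq C).obj ((cx G').obj (spanCone α α' M)) ≅ (hq C).obj (mappingCone ((cx G').map
      (coneMap G' α' M ≫ mappingCone.inr (coneMap G α M)))) :=
    (hq C).mapIso ((cx G').mapIso (swapIso _ _) ≪≫ mappingCone.mapHomologicalComplexIso _ G')
  have hd'' := distinguished_of_iso₂ hd' e
  have h1 := isIso_comp_of_isIso_comp hT hd'' ?_
  · have e1 : e.inv = (hq C).map ((mappingCone.mapHomologicalComplexIso _ G').inv ≫
        (cx G').map (swapHom _ _)) := rfl
    rw [e1, ← (hq C).map_comp, ← (hq C).map_comp, Category.assoc, ← (cx G').map_comp] at h1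
    exact h1
  · have e2 : e.hom = (hq C).map ((cx G').map (swapHom _ _) ≫
        (mappingCone.mapHomologicalComplexIso _ G').hom) := rfl
    rw [e2, ← (hq C).map_comp, ← Category.assoc, ← (cx G').map_comp]
    have h6 := IsIso.comp_isIso' (isIso_quad_comp (α' := α') h) (inferInstance :
      IsIso (((hq C).commShiftIso (1 : ℤ)).hom.app (mappingCone ι')))
    rw [(hq C).map_comp ((cx G').map (quadToSpan α α' M ≫ swapHom _ _) ≫ _)] at h6
    exact (congrArg (fun f => IsIso f) (Category.assoc _ _ _)).mp h6

/-- The braid relation for the iterated cones. -/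
theorem nonempty_iso_braid {ι : (cx G).obj M ⟶ (cx G).obj ((cx G).obj M)}
    {ι' : (cx G').obj M ⟶ (cx G').obj ((cx G').obj M)}
    (hι : ι ≫ (cx G).map (coneMap G α M) = 𝟙 _)
    (hι₁ : ι ≫ coneMap G α ((cx G).obj M) = 𝟙 _)
    (hι' : ι' ≫ (cx G').map (coneMap G' α' M) = 𝟙 _)
    (hι'₁ : ι' ≫ coneMap G' α' ((cx G').obj M) = 𝟙 _)
    {r : (cx G).obj ((cx G).obj M) ⟶ (cx G).obj ((cx G').obj ((cx G).obj M))}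
    {s : (cx G).obj ((cx G).obj M) ⟶ (cx G).obj M}
    (h : IsSplitting ((cx G).map (coneMap G' α' ((cx G).obj M))) ι r s)
    {r' : (cx G').obj ((cx G').obj M) ⟶ (cx G').obj ((cx G).obj ((cx G').obj M))}
    {s' : (cx G').obj ((cx G').obj M) ⟶ (cx G').obj M}
    (h' : IsSplitting ((cx G').map (coneMap G α ((cx G').obj M))) ι' r' s') :
    Nonempty ((hq C).obj (mappingCone (coneMap G' α' (mappingCone (coneMap G α
        (mappingCone (coneMap G' α' M)))))) ≅
      (hq C).obj (mappingCone (coneMap G α (mappingCone (coneMap G' α'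
        (mappingCone (coneMap G α M))))))) := by
  -- Replacing `G'RR'(M)` by the equivalent source of `quadLift` turns the counit at `RR'(M)` into
  -- the composite `Q' ⟶ S ⟶ RR'(M)`, by naturality of the counit.
  have key : ∀ {G G' : C ⥤ C} [G.Additive] [G'.Additive] {α : G ⟶ 𝟭 C} {α' : G' ⟶ 𝟭 C}
    {ι' : (cx G').obj M ⟶ (cx G').obj ((cx G').obj M)}
    (hι' : ι' ≫ (cx G').map (coneMap G' α' M) = 𝟙 _)
    (hι'₁ : ι' ≫ coneMap G' α' ((cx G').obj M) = 𝟙 _)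
    {r' : (cx G').obj ((cx G').obj M) ⟶ (cx G').obj ((cx G).obj ((cx G').obj M))}
    {s' : (cx G').obj ((cx G').obj M) ⟶ (cx G').obj M}
    (h' : IsSplitting ((cx G').map (coneMap G α ((cx G').obj M))) ι' r' s'),
    Nonempty ((hq C).obj (mappingCone (quadToSpan α' α M ≫ swapHom _ _ ≫ spanToCone α α' M)) ≅
      (hq C).obj (mappingCone (coneMap G' α' (mappingCone (coneMap G α
        (mappingCone (coneMap G' α' M))))))) := by
    intro G G' _ _ α α' ι' hι' hι'₁ r' s' h'
    have := isIso_quadLift hι' h'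
    refine nonempty_iso_cone_hq (asIso ((hq C).map (quadLift (α := α) ι' hι' ≫
      (mappingCone.mapHomologicalComplexIso _ G').inv ≫
        (cx G').map (swapHom _ _ ≫ spanToCone α α' M)))) (Iso.refl _) ?_
    rw [Iso.refl_hom, Category.comp_id, asIso_hom, ← (hq C).map_comp]
    congr 1
    rw [Category.assoc, Category.assoc, ← coneMap_naturality, ← quadLift_coneMap ι' hι' hι'₁,
      Category.assoc, Category.assoc]
  obtain ⟨e⟩ := key (α := α) hι' hι'₁ h'
  obtain ⟨e'⟩ := key (α := α') hι hι₁ h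
  obtain ⟨d, hd⟩ := quad_span_cone_distinguished α α' M
  obtain ⟨d', hd'⟩ := quad_span_cone_distinguished α' α M
  let sw : (hq C).obj (spanCone α' α M) ≅ (hq C).obj (spanCone α α' M) :=
    (hq C).mapIso (swapIso _ _)
  have hd₂ := distinguished_of_iso₂ hd' sw
  have t1 := hq_cone_distinguished (quadToSpan α' α M ≫ swapHom _ _ ≫ spanToCone α α' M)
  have t2 := hq_cone_distinguished (quadToSpan α α' M ≫ swapHom _ _ ≫ spanToCone α' α M)
  have e1 : (hq C).map (quadToSpan α' α M ≫ swapHom _ _ ≫ spanToCone α α' M) =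
      ((hq C).map (quadToSpan α' α M) ≫ sw.hom) ≫ (hq C).map (spanToCone α α' M) := by
    rw [(hq C).map_comp, (hq C).map_comp, Category.assoc]
    rfl
  have e2 : (hq C).map (quadToSpan α α' M ≫ swapHom _ _ ≫ spanToCone α' α M) =
      (hq C).map (quadToSpan α α' M) ≫ (sw.inv ≫ (hq C).map (spanToCone α' α M)) := by
    rw [(hq C).map_comp, (hq C).map_comp]
    rfl
  rw [e1] at t1
  rw [e2] at t2
  -- Both sides are now obtained from the same two maps to `S`, attached in opposite orders.
  obtain ⟨k⟩ := nonempty_iso_cones hd hd₂ t1 t2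
  exact ⟨e.symm ≪≫ k ≪≫ e'⟩

end Near

/-! ### Complexes of functors: from objectwise to natural isomorphisms. -/

section Universal

open CategoryTheory Limits CochainComplex CochainComplex.HomComplex

universe v u v' u'

variable {C : Type u} [Category.{v} C] [Preadditive C] {J : Type u'} [Category.{v'} J]

/-- Postcomposition with an endofunctor. -/
abbrev post (J : Type u') [Category.{v'} J] (G : C ⥤ C) : (J ⥤ C) ⥤ (J ⥤ C) :=
  (Functor.whiskeringRight J C C).obj G

instance post_additive (G : C ⥤ C) [G.Additive] : (post J G).Additive where
  map_add {F F' f g} := by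
    ext X
    exact G.map_add

/-- A natural transformation to the identity acts on functor categories. -/
@[simps] def postCounit (J : Type u') [Category.{v'} J] {G : C ⥤ C} (α : G ⟶ 𝟭 C) :
    post J G ⟶ 𝟭 (J ⥤ C) where
  app F :=
    { app := fun X => α.app (F.obj X)
      naturality := fun X Y f => α.naturality (F.map f) }
  naturality F F' f := by
    ext X
    exact α.naturality (f.app X)

/-- A natural transformation from the identity acts on functor categories. -/
@[simps] def postUnit (J : Type u') [Category.{v'} J] {G : C ⥤ C} (β : 𝟭 C ⟶ G) :
    𝟭 (J ⥤ C) ⟶ post J G where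
  app F :=
    { app := fun X => β.app (F.obj X)
      naturality := fun X Y f => β.naturality (F.map f) }
  naturality F F' f := by
    ext X
    exact β.naturality (f.app X)

variable (C J) in
/-- Evaluation of complexes of functors. -/
def evc : CochainComplex (J ⥤ C) ℤ ⥤ J ⥤ CochainComplex C ℤ where
  obj K :=
    { obj := fun M => (((evaluation J C).obj M).mapHomologicalComplex (.up ℤ)).obj K
      map := fun f => (NatTrans.mapHomologicalComplex ((evaluation J C).map f) (.up ℤ)).app K
      map_id := fun M => by ext p; exact (K.X p).map_id M
      map_comp := fun f g => by ext p; exact (K.X p).map_comp f g }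
  map φ :=
    { app := fun M => (((evaluation J C).obj M).mapHomologicalComplex (.up ℤ)).map φ
      naturality := fun M N f => by ext p; exact (φ.f p).naturality f }
  map_id K := by ext M p; rfl
  map_comp φ ψ := by ext M p; rfl

/-- Isomorphic objects of the homotopy category of complexes of functors give isomorphic functors
to the homotopy category. -/
theorem nonempty_evc_iso {A B : CochainComplex (J ⥤ C) ℤ}
    (e : (hq (J ⥤ C)).obj A ≅ (hq (J ⥤ C)).obj B) :
    Nonempty ((evc C J).obj A ⋙ hq C ≅ (evc C J).obj B ⋙ hq C) := by
  -- A chain map `f` of complexes of functors is strictly natural after evaluation, and each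
  -- evaluation, being additive, keeps it invertible up to homotopy.
  obtain ⟨f, hf⟩ := (hq (J ⥤ C)).map_surjective e.hom
  have hi : IsIso ((hq (J ⥤ C)).map f) := by rw [hf]; infer_instance
  have : ∀ M, IsIso ((Functor.whiskerRight ((evc C J).map f) (hq C)).app M) := fun M =>
    isIso_hq_map ((evaluation J C).obj M) f
  have := NatIso.isIso_of_isIso_app (Functor.whiskerRight ((evc C J).map f) (hq C))
  exact ⟨asIso (Functor.whiskerRight ((evc C J).map f) (hq C))⟩

/-- Evaluation commutes with the shift. -/
noncomputable def evcShift (K : CochainComplex (J ⥤ C) ℤ) :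
    (evc C J).obj (K⟦(1 : ℤ)⟧) ≅ (evc C J).obj K ⋙ CategoryTheory.shiftFunctor (CochainComplex C ℤ) (1 : ℤ) :=
  NatIso.ofComponents (fun M =>
    ((((evaluation J C).obj M).mapHomologicalComplex (.up ℤ)).commShiftIso (1 : ℤ)).app K)
    (fun f => by
      ext p
      exact (Category.comp_id _).trans (Category.id_comp _).symm)

variable (C) in
/-- The tautological complex of functors on complexes, followed by a functor. -/
def univ (F : C ⥤ C) [F.Additive] : CochainComplex (CochainComplex C ℤ ⥤ C) ℤ where
  X p := HomologicalComplex.eval C (.up ℤ) p ⋙ F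
  d p q :=
    { app := fun M => F.map (M.d p q)
      naturality := fun M N f => by
        have := congrArg F.map (f.comm p q)
        rw [F.map_comp, F.map_comp] at this
        exact this }
  shape p q h := by
    ext M
    change F.map (M.d p q) = 0
    rw [M.shape p q h, F.map_zero]
  d_comp_d' p q r _ _ := by
    ext M
    change F.map (M.d p q) ≫ F.map (M.d q r) = 0
    rw [← F.map_comp, M.d_comp_d, F.map_zero]

/-- Evaluation of the tautological complex. -/
def evcUniv : (evc C (CochainComplex C ℤ)).obj (univ C (𝟭 C)) ≅ 𝟭 (CochainComplex C ℤ) :=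
  NatIso.ofComponents (fun M => HomologicalComplex.Hom.isoOfComponents (fun p => Iso.refl _)
    (fun p q _ => (Category.id_comp _).trans (Category.comp_id _).symm))
    (fun f => by
      ext p
      exact (Category.comp_id _).trans (Category.id_comp _).symm)

/-- The map of tautological complexes induced by a natural transformation. -/
def univMap {F F' : C ⥤ C} [F.Additive] [F'.Additive] (τ : F ⟶ F') : univ C F ⟶ univ C F' where
  f p :=
    { app := fun M => τ.app (M.X p)
      naturality := fun M N f => τ.naturality (f.f p) }
  comm' p q _ := by
    ext M
    exact (τ.naturality (M.d p q)).symm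

theorem isSplitting_univMap {F₁ F₂ F₃ : C ⥤ C} [F₁.Additive] [F₂.Additive] [F₃.Additive]
    {f : F₁ ⟶ F₃} {g : F₂ ⟶ F₃} {r : F₃ ⟶ F₁} {s : F₃ ⟶ F₂}
    (h : ∀ X, IsSplitting (f.app X) (g.app X) (r.app X) (s.app X)) :
    IsSplitting (univMap f) (univMap g) (univMap r) (univMap s) where
  fr := by ext p M; exact (h (M.X p)).fr
  fs := by ext p M; exact (h (M.X p)).fs
  gr := by ext p M; exact (h (M.X p)).gr
  gs := by ext p M; exact (h (M.X p)).gs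
  tot := by ext p M; exact (h (M.X p)).tot

variable [HasBinaryBiproducts C]

instance functor_hasBinaryBiproducts : HasBinaryBiproducts (J ⥤ C) :=
  HasBinaryBiproducts.of_hasBinaryProducts

/-- Evaluation of the cone of the counit. -/
noncomputable def evcCone (G : C ⥤ C) [G.Additive] (α : G ⟶ 𝟭 C)
    (K : CochainComplex (J ⥤ C) ℤ) :
    (evc C J).obj (mappingCone (coneMap (post J G) (postCounit J α) K)) ≅
      (evc C J).obj K ⋙ coneFunctor G α :=
  NatIso.ofComponents (fun M => mappingCone.mapHomologicalComplexIso
      (coneMap (post J G) (postCounit J α) K) ((evaluation J C).obj M))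
    (fun f => mapCone_naturality (coneMap (post J G) (postCounit J α) K)
      ((evaluation J C).map f)
      (NatTrans.naturality (NatTrans.mapHomologicalComplex ((evaluation J C).map f) (.up ℤ)) _))

end Universal

/-! ### The cone of the unit, and functors on bounded complexes. -/

section UnitCone

open CategoryTheory Limits CochainComplex CochainComplex.HomComplex

universe v u v' u'

variable {C : Type u} [Category.{v} C] [Preadditive C] [HasBinaryBiproducts C]

/-- The functor which sends `M` to the cone of `M ⟶ G(M)`. -/
noncomputable def unitCone (G : C ⥤ C) [G.Additive] (β : 𝟭 C ⟶ G) :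
    CochainComplex C ℤ ⥤ CochainComplex C ℤ where
  obj M := mappingCone (unitMap G β M)
  map {M N} f := mappingCone.map _ _ f ((cx G).map f) (unitMap_naturality G β f).symm
  map_id M := by
    rw [← mappingCone.map_id]
    congr 1
    exact (cx G).map_id M
  map_comp f g := by
    rw [← mappingCone.map_comp]
    congr 1
    exact (cx G).map_comp f g

/-- Homotopic maps have homotopic images. -/
noncomputable def unitConeHomotopy (G : C ⥤ C) [G.Additive] (β : 𝟭 C ⟶ G)
    {M N : CochainComplex C ℤ} {f g : M ⟶ N} (h : Homotopy f g) :
    Homotopy ((unitCone G β).map f) ((unitCone G β).map g) :=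
  coneMapHomotopy _ _ (unitMap_naturality G β f).symm (unitMap_naturality G β g).symm h
    (G.mapHomotopy h) fun p q => β.naturality (h.hom p q)

/-- The functor induced by `unitCone` on the homotopy category. -/
noncomputable def unitConeH (G : C ⥤ C) [G.Additive] (β : 𝟭 C ⟶ G) :
    HomotopyCategory C (.up ℤ) ⥤ HomotopyCategory C (.up ℤ) :=
  CategoryTheory.Quotient.lift _ (unitCone G β ⋙ hq C)
    (fun _ _ _ _ ⟨h⟩ => HomotopyCategory.eq_of_homotopy _ _ (unitConeHomotopy G β h))

theorem bddProp_unitCone (G : C ⥤ C) [G.Additive] (β : 𝟭 C ⟶ G)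
    (K : HomotopyCategory C (.up ℤ)) (hK : bddProp C K) :
    bddProp C ((unitConeH G β).obj K) := by
  obtain ⟨a, b, ha, hb⟩ := hK
  refine ⟨a - 1, b, ?_, ?_⟩
  · change CochainComplex.IsStrictlyGE (mappingCone (unitMap G β K.as)) _
    rw [CochainComplex.isStrictlyGE_iff]
    intro i hi
    rw [mappingCone.isZero_X_iff]
    exact ⟨CochainComplex.isZero_of_isStrictlyGE K.as a _ (by lia),
      G.map_isZero (CochainComplex.isZero_of_isStrictlyGE K.as a _ (by lia))⟩
  · change CochainComplex.IsStrictlyLE (mappingCone (unitMap G β K.as)) _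
    rw [CochainComplex.isStrictlyLE_iff]
    intro i hi
    rw [mappingCone.isZero_X_iff]
    exact ⟨CochainComplex.isZero_of_isStrictlyLE K.as b _ (by lia),
      G.map_isZero (CochainComplex.isZero_of_isStrictlyLE K.as b _ (by lia))⟩

/-- The functor induced by `unitCone` on bounded complexes up to homotopy. -/
noncomputable def unitConeK (G : C ⥤ C) [G.Additive] (β : 𝟭 C ⟶ G) : KBdd C ⥤ KBdd C :=
  (bddProp C).lift ((bddProp C).ι ⋙ unitConeH G β)
    fun K => bddProp_unitCone G β K.obj K.property

/-- Evaluation of the cone of the unit. -/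
noncomputable def evcUnitCone {J : Type u'} [Category.{v'} J] (G : C ⥤ C) [G.Additive]
    (β : 𝟭 C ⟶ G) (K : CochainComplex (J ⥤ C) ℤ) :
    (evc C J).obj (mappingCone (unitMap (post J G) (postUnit J β) K)) ≅
      (evc C J).obj K ⋙ unitCone G β :=
  NatIso.ofComponents (fun M => mappingCone.mapHomologicalComplexIso
      (unitMap (post J G) (postUnit J β) K) ((evaluation J C).obj M))
    (fun f => mapCone_naturality (unitMap (post J G) (postUnit J β) K)
      ((evaluation J C).map f)
      (NatTrans.naturality (NatTrans.mapHomologicalComplex ((evaluation J C).map f) (.up ℤ)) _))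

/-- A functor on bounded complexes up to homotopy which is induced by a functor on complexes. -/
def IsInducedBy (A : KBdd C ⥤ KBdd C) (P : CochainComplex C ℤ ⥤ CochainComplex C ℤ) : Prop :=
  ∃ B : HomotopyCategory C (.up ℤ) ⥤ HomotopyCategory C (.up ℤ),
    Nonempty (hq C ⋙ B ≅ P ⋙ hq C) ∧ Nonempty (A ⋙ (bddProp C).ι ≅ (bddProp C).ι ⋙ B)

namespace IsInducedBy

variable {A A' : KBdd C ⥤ KBdd C} {P P' : CochainComplex C ℤ ⥤ CochainComplex C ℤ}

/-- The homotopy category is a quotient by a congruence, so isomorphisms descend to the lifted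
functors; the bounded complexes form a full subcategory, so they also restrict. -/
theorem nonempty_iso (h : IsInducedBy A P) (h' : IsInducedBy A' P')
    (e : Nonempty (P ⋙ hq C ≅ P' ⋙ hq C)) : Nonempty (A ≅ A') := by
  obtain ⟨B, ⟨a⟩, ⟨b⟩⟩ := h
  obtain ⟨B', ⟨a'⟩, ⟨b'⟩⟩ := h'
  obtain ⟨e⟩ := e
  have c : B ≅ B' := Quotient.natIsoLift _ (a ≪≫ e ≪≫ a'.symm)
  exact ⟨Functor.fullyFaithfulCancelRight (bddProp C).ι
    (b ≪≫ Functor.isoWhiskerLeft _ c ≪≫ b'.symm)⟩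

theorem comp (h : IsInducedBy A P) (h' : IsInducedBy A' P') :
    IsInducedBy (A ⋙ A') (P ⋙ P') := by
  obtain ⟨B, ⟨a⟩, ⟨b⟩⟩ := h
  obtain ⟨B', ⟨a'⟩, ⟨b'⟩⟩ := h'
  exact ⟨B ⋙ B', ⟨Functor.isoWhiskerRight a B' ≪≫ Functor.isoWhiskerLeft P a'⟩,
    ⟨Functor.isoWhiskerLeft A b' ≪≫ Functor.isoWhiskerRight b B'⟩⟩

variable (C) in
theorem shift : IsInducedBy (CategoryTheory.shiftFunctor (KBdd C) (1 : ℤ))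
    (CategoryTheory.shiftFunctor (CochainComplex C ℤ) (1 : ℤ)) :=
  ⟨CategoryTheory.shiftFunctor _ (1 : ℤ), ⟨((hq C).commShiftIso (1 : ℤ)).symm⟩,
    ⟨(bddProp C).ι.commShiftIso (1 : ℤ)⟩⟩

theorem coneFunctorK (G : C ⥤ C) [G.Additive] (α : G ⟶ 𝟭 C) :
    IsInducedBy (coneFunctorK G α) (coneFunctor G α) :=
  ⟨coneFunctorH G α, ⟨Iso.refl _⟩, ⟨Iso.refl _⟩⟩

theorem unitConeK (G : C ⥤ C) [G.Additive] (β : 𝟭 C ⟶ G) :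
    IsInducedBy (unitConeK G β) (unitCone G β) :=
  ⟨unitConeH G β, ⟨Iso.refl _⟩, ⟨Iso.refl _⟩⟩

end IsInducedBy

/-- A complex of functors whose evaluation is a given functor. -/
def IsEval (K : CochainComplex (CochainComplex C ℤ ⥤ C) ℤ)
    (P : CochainComplex C ℤ ⥤ CochainComplex C ℤ) : Prop :=
  Nonempty ((evc C (CochainComplex C ℤ)).obj K ≅ P)

namespace IsEval

variable {K K' : CochainComplex (CochainComplex C ℤ ⥤ C) ℤ}
  {P P' : CochainComplex C ℤ ⥤ CochainComplex C ℤ}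

variable (C) in
theorem univ : IsEval (univ C (𝟭 C)) (𝟭 _) := ⟨evcUniv⟩

theorem shift (h : IsEval K P) : IsEval (K⟦(1 : ℤ)⟧) (P ⋙ CategoryTheory.shiftFunctor _ (1 : ℤ)) :=
  h.map fun e => evcShift K ≪≫ Functor.isoWhiskerRight e _

theorem cone (h : IsEval K P) (G : C ⥤ C) [G.Additive] (α : G ⟶ 𝟭 C) :
    IsEval (mappingCone (coneMap (post _ G) (postCounit _ α) K)) (P ⋙ coneFunctor G α) :=
  h.map fun e => evcCone G α K ≪≫ Functor.isoWhiskerRight e _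

theorem unitCone (h : IsEval K P) (G : C ⥤ C) [G.Additive] (β : 𝟭 C ⟶ G) :
    IsEval (mappingCone (unitMap (post _ G) (postUnit _ β) K)) (P ⋙ unitCone G β) :=
  h.map fun e => evcUnitCone G β K ≪≫ Functor.isoWhiskerRight e _

theorem nonempty_iso (h : IsEval K P) (h' : IsEval K' P')
    (e : Nonempty ((hq _).obj K ≅ (hq _).obj K')) : Nonempty (P ⋙ hq C ≅ P' ⋙ hq C) := by
  obtain ⟨a⟩ := h
  obtain ⟨a'⟩ := h'
  obtain ⟨e⟩ := e
  obtain ⟨e⟩ := nonempty_evc_iso e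
  exact ⟨Functor.isoWhiskerRight a.symm _ ≪≫ e ≪≫ Functor.isoWhiskerRight a' _⟩

end IsEval

variable [HasZeroObject C]

section Functors

variable {G G' : C ⥤ C} [G.Additive] [G'.Additive] {α : G ⟶ 𝟭 C} {α' : G' ⟶ 𝟭 C}

/-- `nonempty_iso_braid` is applied in the category of functors to the tautological complex.
Evaluating the resulting isomorphism gives one which is natural in the complex. -/
theorem nonempty_coneFunctorK_braid {ι : G ⟶ G ⋙ G} {ι' : G' ⟶ G' ⋙ G'}
    (hι : ∀ X, ι.app X ≫ G.map (α.app X) = 𝟙 _)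
    (hι₁ : ∀ X, ι.app X ≫ α.app (G.obj X) = 𝟙 _)
    (hι' : ∀ X, ι'.app X ≫ G'.map (α'.app X) = 𝟙 _)
    (hι'₁ : ∀ X, ι'.app X ≫ α'.app (G'.obj X) = 𝟙 _)
    {r : G ⋙ G ⟶ G ⋙ G' ⋙ G} {s : G ⋙ G ⟶ G}
    (h : ∀ X, IsSplitting (G.map (α'.app (G.obj X))) (ι.app X) (r.app X) (s.app X))
    {r' : G' ⋙ G' ⟶ G' ⋙ G ⋙ G'} {s' : G' ⋙ G' ⟶ G'}
    (h' : ∀ X, IsSplitting (G'.map (α.app (G'.obj X))) (ι'.app X) (r'.app X) (s'.app X)) :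
    Nonempty (coneFunctorK G' α' ⋙ coneFunctorK G α ⋙ coneFunctorK G' α' ≅
      coneFunctorK G α ⋙ coneFunctorK G' α' ⋙ coneFunctorK G α) := by
  have R := IsInducedBy.coneFunctorK G α
  have R' := IsInducedBy.coneFunctorK G' α'
  have hz : HasZeroObject (CochainComplex C ℤ ⥤ C) := inferInstance
  refine (R'.comp (R.comp R')).nonempty_iso (R.comp (R'.comp R)) ?_
  refine IsEval.nonempty_iso ((((IsEval.univ C).cone G' α').cone G α).cone G' α')
    ((((IsEval.univ C).cone G α).cone G' α').cone G α) ?_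
  exact nonempty_iso_braid (C := CochainComplex C ℤ ⥤ C)
    (ι := univMap ι) (ι' := univMap ι')
    (by ext p M; exact hι (M.X p)) (by ext p M; exact hι₁ (M.X p))
    (by ext p M; exact hι' (M.X p)) (by ext p M; exact hι'₁ (M.X p))
    (r := univMap r) (s := univMap s)
    (isSplitting_univMap (f := Functor.whiskerRight (Functor.whiskerLeft G α') G) h)
    (r' := univMap r') (s' := univMap s')
    (isSplitting_univMap (f := Functor.whiskerRight (Functor.whiskerLeft G' α) G') h')

theorem nonempty_coneFunctorK_comm (τ : G' ⋙ G ≅ G ⋙ G')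
    (hτ : ∀ X, τ.hom.app X ≫ G'.map (α.app X) = α.app (G'.obj X))
    (hτ' : ∀ X, τ.hom.app X ≫ α'.app (G.obj X) = G.map (α'.app X)) :
    Nonempty (coneFunctorK G' α' ⋙ coneFunctorK G α ≅
      coneFunctorK G α ⋙ coneFunctorK G' α') := by
  have R := IsInducedBy.coneFunctorK G α
  have R' := IsInducedBy.coneFunctorK G' α'
  have hz : HasZeroObject (CochainComplex C ℤ ⥤ C) := inferInstance
  refine (R'.comp R).nonempty_iso (R.comp R') ?_
  refine IsEval.nonempty_iso (((IsEval.univ C).cone G' α').cone G α)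
    (((IsEval.univ C).cone G α).cone G' α') ?_
  let t : (cx (post (CochainComplex C ℤ) G)).obj ((cx (post _ G')).obj (univ C (𝟭 C))) ≅
      (cx (post _ G')).obj ((cx (post _ G)).obj (univ C (𝟭 C))) :=
    { hom := univMap τ.hom
      inv := univMap τ.inv
      hom_inv_id := by ext p M; exact τ.hom_inv_id_app (M.X p)
      inv_hom_id := by ext p M; exact τ.inv_hom_id_app (M.X p) }
  exact nonempty_iso_cone_cone (C := CochainComplex C ℤ ⥤ C) t
    (by ext p M; exact hτ (M.X p)) (by ext p M; exact hτ' (M.X p))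

/-- The counit at `M⟦1⟧` is the shifted counit up to the comparison of `G` with the shift, and cones
commute with shifts. -/
theorem nonempty_coneFunctorK_shift (G : C ⥤ C) [G.Additive] (α : G ⟶ 𝟭 C) :
    Nonempty (CategoryTheory.shiftFunctor (KBdd C) (1 : ℤ) ⋙ coneFunctorK G α ≅
      coneFunctorK G α ⋙ CategoryTheory.shiftFunctor (KBdd C) (1 : ℤ)) := by
  have R := IsInducedBy.coneFunctorK G α
  have S := IsInducedBy.shift C
  have hz : HasZeroObject (CochainComplex C ℤ ⥤ C) := inferInstance
  refine (S.comp R).nonempty_iso (R.comp S) ?_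
  refine IsEval.nonempty_iso ((IsEval.univ C).shift.cone G α) ((IsEval.univ C).cone G α).shift ?_
  let φ := coneMap (post (CochainComplex C ℤ) G) (postCounit _ α) (univ C (𝟭 C))
  obtain ⟨e⟩ := nonempty_iso_cone_hq
    (f := coneMap (post (CochainComplex C ℤ) G) (postCounit _ α) ((univ C (𝟭 C))⟦(1 : ℤ)⟧))
    (g := φ⟦(1 : ℤ)⟧')
    ((hq _).mapIso (((cx (post _ G)).commShiftIso (1 : ℤ)).app (univ C (𝟭 C)))) (Iso.refl _) (by
      rw [coneMap_shift, (hq _).map_comp, Iso.refl_hom, Category.comp_id]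
      rfl)
  exact ⟨e ≪≫ (hq _).mapIso (mappingCone.shiftIso φ (1 : ℤ)).symm⟩

variable {β : 𝟭 C ⟶ G}

theorem nonempty_unitConeK_coneFunctorK {ι : G ⟶ G ⋙ G} {r s : G ⋙ G ⟶ G}
    (h : ∀ X, IsSplitting (G.map (β.app X)) (ι.app X) (r.app X) (s.app X))
    (hι : ∀ X, ι.app X ≫ α.app (G.obj X) = 𝟙 _) :
    Nonempty (unitConeK G β ⋙ coneFunctorK G α ≅
      CategoryTheory.shiftFunctor (KBdd C) (1 : ℤ)) := by
  have hz : HasZeroObject (CochainComplex C ℤ ⥤ C) := inferInstance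
  refine ((IsInducedBy.unitConeK G β).comp (IsInducedBy.coneFunctorK G α)).nonempty_iso
    (IsInducedBy.shift C) ?_
  refine IsEval.nonempty_iso (((IsEval.univ C).unitCone G β).cone G α) (IsEval.univ C).shift ?_
  exact nonempty_iso_cone_unit (C := CochainComplex C ℤ ⥤ C) (ι := univMap ι)
    (r := univMap r) (s := univMap s)
    (isSplitting_univMap (f := Functor.whiskerRight β G) h)
    (by ext p M; exact hι (M.X p))

theorem nonempty_coneFunctorK_unitConeK {ι : G ⟶ G ⋙ G} {r s : G ⋙ G ⟶ G}
    (h : ∀ X, IsSplitting (β.app (G.obj X)) (ι.app X) (r.app X) (s.app X))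
    (hι : ∀ X, ι.app X ≫ G.map (α.app X) = 𝟙 _) :
    Nonempty (coneFunctorK G α ⋙ unitConeK G β ≅
      CategoryTheory.shiftFunctor (KBdd C) (1 : ℤ)) := by
  have hz : HasZeroObject (CochainComplex C ℤ ⥤ C) := inferInstance
  refine ((IsInducedBy.coneFunctorK G α).comp (IsInducedBy.unitConeK G β)).nonempty_iso
    (IsInducedBy.shift C) ?_
  refine IsEval.nonempty_iso (((IsEval.univ C).cone G α).unitCone G β) (IsEval.univ C).shift ?_
  exact nonempty_iso_unit_cone (C := CochainComplex C ℤ ⥤ C) (ι := univMap ι)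
    (r := univMap r) (s := univMap s)
    (isSplitting_univMap (f := Functor.whiskerLeft G β) h)
    (by ext p M; exact hι (M.X p))

end Functors

end UnitCone

/-! ### Weak actions as homomorphisms to isomorphism classes of functors. -/

section IsoClasses

open CategoryTheory

universe v u

variable (D : Type u) [Category.{v} D]

/-- The monoid of isomorphism classes of endofunctors. -/
def EndClass : Type _ := Quotient (isIsomorphicSetoid (D ⥤ D))

variable {D}

/-- The isomorphism class of an endofunctor. -/
def endClass (F : D ⥤ D) : EndClass D := Quotient.mk _ F

theorem endClass_eq_iff {F F' : D ⥤ D} : endClass F = endClass F' ↔ Nonempty (F ≅ F') :=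
  Quotient.eq (r := isIsomorphicSetoid (D ⥤ D))

theorem endClass_surjective (a : EndClass D) : ∃ F, endClass F = a :=
  Quotient.exists_rep a

/-- The right factor of a product is applied first, in accordance with `F_g F_h ≅ F_{gh}`. -/
instance : Monoid (EndClass D) where
  mul := Quotient.map₂ (fun F F' => F' ⋙ F) (by
    rintro F G ⟨e⟩ F' G' ⟨e'⟩
    exact ⟨Functor.isoWhiskerRight e' F ≪≫ Functor.isoWhiskerLeft G' e⟩)
  one := endClass (𝟭 D)
  mul_assoc a b c := by
    obtain ⟨F, rfl⟩ := endClass_surjective a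
    obtain ⟨F', rfl⟩ := endClass_surjective b
    obtain ⟨F'', rfl⟩ := endClass_surjective c
    rfl
  one_mul a := by
    obtain ⟨F, rfl⟩ := endClass_surjective a
    rfl
  mul_one a := by
    obtain ⟨F, rfl⟩ := endClass_surjective a
    rfl

theorem endClass_comp (F F' : D ⥤ D) : endClass (F' ⋙ F) = endClass F * endClass F' := rfl

variable [Preadditive D] [HasShift D ℤ]

variable (D) in
/-- The unit given by the shift functor. -/
noncomputable def shiftClass : (EndClass D)ˣ where
  val := endClass (shiftFunctor D (1 : ℤ))
  inv := endClass (shiftFunctor D (-1 : ℤ))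
  val_inv := endClass_eq_iff.2 ⟨shiftFunctorCompIsoId D (-1 : ℤ) 1 (by decide)⟩
  inv_val := endClass_eq_iff.2 ⟨shiftFunctorCompIsoId D (1 : ℤ) (-1) (by decide)⟩

/-- The units which are classes of additive functors that commute with the shift. -/
def additiveUnits : Subgroup (EndClass D)ˣ where
  carrier := {u | Commute u (shiftClass D) ∧ ∃ F : D ⥤ D, F.Additive ∧ endClass F = u.1}
  one_mem' := ⟨Commute.one_left _, 𝟭 D, inferInstance, rfl⟩
  mul_mem' {u v} := by
    rintro ⟨hu, F, hF, eF⟩ ⟨hv, G, hG, eG⟩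
    exact ⟨hu.mul_left hv, G ⋙ F, inferInstance, by rw [endClass_comp, eF, eG]; rfl⟩
  inv_mem' {u} := by
    rintro ⟨hu, F, hF, eF⟩
    obtain ⟨F', eF'⟩ := endClass_surjective (u⁻¹).1
    refine ⟨hu.inv_left, F', ?_, eF'⟩
    -- A quasi-inverse of an additive equivalence is additive, so additivity need not be imposed on
    -- the inverse class.
    obtain ⟨a⟩ := endClass_eq_iff.1 ((endClass_comp F' F).trans (by
      rw [eF, eF', ← Units.val_mul, inv_mul_cancel]; rfl : _ = endClass (𝟭 D)))
    obtain ⟨b⟩ := endClass_eq_iff.1 ((endClass_comp F F').trans (by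
      rw [eF, eF', ← Units.val_mul, mul_inv_cancel]; rfl : _ = endClass (𝟭 D)))
    have : (CategoryTheory.Equivalence.mk F F' a.symm b).functor.Additive := hF
    exact (CategoryTheory.Equivalence.mk F F' a.symm b).inverse_additive

/-- A homomorphism to the group of classes of invertible functors gives a weak action. -/
theorem exists_weakAction_of_hom {Γ : Type*} [Group Γ] (φ : Γ →* (EndClass D)ˣ)
    (hφ : ∀ g, φ g ∈ additiveUnits) :
    ∃ F : WeakAction D Γ, ∀ g, endClass (F.obj g) = (φ g).1 := by
  choose h F hF e using hφ
  refine ⟨{ obj := F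
            additive := hF
            shift := fun g => endClass_eq_iff.1 ?_
            one := endClass_eq_iff.1 ?_
            mul := fun a b => endClass_eq_iff.1 ?_ }, e⟩
  · have := congrArg Units.val (h g).eq
    rw [Units.val_mul, Units.val_mul, ← e] at this
    exact this
  · rw [e, map_one]
    rfl
  · rw [endClass_comp, e, e, e, map_mul]
    rfl

/-- Functors which satisfy the braid relations define a weak action of the braid group. -/
theorem exists_weakAction_braidGroup {m : ℕ} (R U : Fin (m - 1) → D ⥤ D)
    (hR : ∀ i, (R i).Additive)
    (hs : ∀ i, Nonempty (shiftFunctor D (1 : ℤ) ⋙ R i ≅ R i ⋙ shiftFunctor D (1 : ℤ)))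
    (hU : ∀ i, Nonempty (U i ⋙ R i ≅ shiftFunctor D (1 : ℤ)))
    (hU' : ∀ i, Nonempty (R i ⋙ U i ≅ shiftFunctor D (1 : ℤ)))
    (far : ∀ i j : Fin (m - 1), i.1 + 2 ≤ j.1 → Nonempty (R j ⋙ R i ≅ R i ⋙ R j))
    (near : ∀ i j : Fin (m - 1), i.1 + 1 = j.1 →
      Nonempty (R i ⋙ R j ⋙ R i ≅ R j ⋙ R i ⋙ R j)) :
    ∃ F : WeakAction D (BraidGroup m), ∀ i, Nonempty (F.obj (BraidGroup.σ i) ≅ R i) := by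
  have hunit : ∀ i, IsUnit (endClass (R i)) := by
    intro i
    rw [isUnit_iff_exists_and_exists]
    have h := (endClass_comp _ _).symm.trans (endClass_eq_iff.2 (hU i))
    have h' := (endClass_comp _ _).symm.trans (endClass_eq_iff.2 (hU' i))
    -- Both composites with `U i` are the shift. Cancelling the shift on the appropriate side gives
    -- a right inverse and a left inverse.
    refine ⟨⟨endClass (U i) * (shiftClass D)⁻¹.1, ?_⟩, ⟨(shiftClass D)⁻¹.1 * endClass (U i), ?_⟩⟩
    · rw [← mul_assoc, h]
      exact (shiftClass D).mul_inv
    · rw [mul_assoc, h']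
      exact (shiftClass D).inv_mul
  choose r hr using hunit
  have hrel : ∀ w ∈ {w | BraidRel m w}, FreeGroup.lift r w = 1 := by
    rintro _ (⟨i, j, h⟩ | ⟨i, j, h⟩)
    · simp only [map_mul, map_inv, FreeGroup.lift_apply_of, mul_inv_eq_one]
      ext
      rw [Units.val_mul, Units.val_mul, hr, hr]
      exact endClass_eq_iff.2 (far i j h)
    · simp only [map_mul, map_inv, FreeGroup.lift_apply_of, mul_inv_eq_one]
      ext
      rw [Units.val_mul, Units.val_mul, Units.val_mul, Units.val_mul, hr, hr]
      exact endClass_eq_iff.2 (near i j h)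
  have hσ : ∀ i, PresentedGroup.toGroup hrel (BraidGroup.σ i) = r i := fun i =>
    PresentedGroup.toGroup.of hrel
  -- The admissible classes form a subgroup, so it suffices that they contain the images of the
  -- generators.
  obtain ⟨F, hF⟩ := exists_weakAction_of_hom (PresentedGroup.toGroup hrel) (fun g => by
    have hg : g ∈ Subgroup.closure (Set.range (PresentedGroup.of (rels := {w | BraidRel m w}))) := by
      rw [PresentedGroup.closure_range_of]
      trivial
    have : Subgroup.closure (Set.range (PresentedGroup.of (rels := {w | BraidRel m w}))) ≤
        additiveUnits.comap (PresentedGroup.toGroup hrel) := by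
      rw [Subgroup.closure_le]
      rintro _ ⟨i, rfl⟩
      change PresentedGroup.toGroup hrel (BraidGroup.σ i) ∈ additiveUnits
      rw [hσ]
      refine ⟨?_, R i, hR i, (hr i).symm⟩
      ext
      rw [Units.val_mul, Units.val_mul, hr]
      exact endClass_eq_iff.2 (hs i)
    exact this hg)
  refine ⟨F, fun i => endClass_eq_iff.1 ?_⟩
  rw [hF, hσ, hr]

end IsoClasses

/-! ### Additivity of the cone functor. -/

section Additive

open CategoryTheory CochainComplex

universe v u

variable {C : Type u} [Category.{v} C] [Preadditive C] [Limits.HasBinaryBiproducts C]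

instance coneFunctor_additive (G : C ⥤ C) [G.Additive] (α : G ⟶ 𝟭 C) :
    (coneFunctor G α).Additive where
  map_add {M N f g} := by
    apply cone_hom_ext
    · intro p q h
      change (mappingCone.inl _).v p q h ≫ (coneHom G α (f + g)).f q =
        (mappingCone.inl _).v p q h ≫ ((coneHom G α f).f q + (coneHom G α g).f q)
      rw [Preadditive.comp_add, coneHom, coneHom, coneHom, inl_map, inl_map, inl_map]
      change G.map (f.f p + g.f p) ≫ _ = _
      exact (congrArg (· ≫ (mappingCone.inl (coneMap G α N)).v p q h) G.map_add).trans
        (Preadditive.add_comp _ _ _ _ _ _)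
    · intro p
      change (mappingCone.inr _).f p ≫ (coneHom G α (f + g)).f p =
        (mappingCone.inr _).f p ≫ ((coneHom G α f).f p + (coneHom G α g).f p)
      rw [Preadditive.comp_add, coneHom, coneHom, coneHom, inr_map, inr_map, inr_map,
        ← Preadditive.add_comp]
      rfl

instance coneFunctorK_additive (G : C ⥤ C) [G.Additive] (α : G ⟶ 𝟭 C) :
    (coneFunctorK G α).Additive where
  map_add {M N f g} := by
    obtain ⟨f', hf⟩ := (hq C).map_surjective f.hom
    obtain ⟨g', hg⟩ := (hq C).map_surjective g.hom
    ext
    change (coneFunctorH G α).map (f.hom + g.hom) =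
      (coneFunctorH G α).map f.hom + (coneFunctorH G α).map g.hom
    rw [← hf, ← hg]
    refine (congrArg (coneFunctorH G α).map (hq C).map_add.symm).trans ?_
    change (hq C).map ((coneFunctor G α).map (f' + g')) =
      (hq C).map ((coneFunctor G α).map f') + (hq C).map ((coneFunctor G α).map g')
    rw [(coneFunctor G α).map_add, (hq C).map_add]

end Additive

/-! ### Elements of the balanced tensor product. -/

section BalancedTensor

open MulOpposite TensorProduct

universe u

variable {A V : Type u} [Ring A] [AddCommGroup V] [Module A V] [Module Aᵐᵒᵖ V]
  {M N : Type u} [AddCommGroup M] [Module A M] [AddCommGroup N] [Module A N]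

local notation "tm" => tmk (A := A) V

theorem tmk_add_left (v w : V) (m : M) : tm (v + w) m = tm v m + tm w m :=
  congrArg (Submodule.Quotient.mk (p := balance A V M)) (TensorProduct.add_tmul v w m)

theorem tmk_add_right (v : V) (m m' : M) : tm v (m + m') = tm v m + tm v m' :=
  congrArg (Submodule.Quotient.mk (p := balance A V M)) (TensorProduct.tmul_add v m m')

theorem tmk_zero_right (v : V) : tm v (0 : M) = 0 :=
  congrArg (Submodule.Quotient.mk (p := balance A V M)) (TensorProduct.tmul_zero M v)

theorem smul_tmk (a : A) (v : V) (m : M) : a • tm v m = tm (a • v) m := rfl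

theorem tmk_op_smul (a : A) (v : V) (m : M) : tm (op a • v) m = tm v (a • m) :=
  (Submodule.Quotient.eq (balance A V M)).2 (Submodule.subset_span ⟨v, a, m, rfl⟩)

/-- `v ⊗ m` as an additive map in `m`. -/
def tmkRight (v : V) : M →+ BalTensor A V M where
  toFun m := tm v m
  map_zero' := tmk_zero_right v
  map_add' m m' := tmk_add_right v m m'

theorem tmkRight_apply (v : V) (m : M) : tmkRight (A := A) v m = tm v m := rfl

theorem tmk_sum_left {K : Type*} (s : Finset K) (v : K → V) (m : M) :
    tm (∑ k ∈ s, v k) m = ∑ k ∈ s, tm (v k) m := by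
  classical
  induction s using Finset.induction_on with
  | empty =>
    rw [Finset.sum_empty, Finset.sum_empty]
    exact congrArg (Submodule.Quotient.mk (p := balance A V M)) (TensorProduct.zero_tmul V m)
  | insert k s hk ih => rw [Finset.sum_insert hk, Finset.sum_insert hk, tmk_add_left, ih]

theorem balTensor_induction {P : BalTensor A V M → Prop} (h0 : P 0)
    (h : ∀ v m, P (tm v m)) (hadd : ∀ y z, P y → P z → P (y + z)) (y : BalTensor A V M) :
    P y := by
  obtain ⟨y, rfl⟩ := Submodule.Quotient.mk_surjective _ y
  induction y using TensorProduct.induction_on with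
  | zero => exact h0
  | tmul v m => exact h v m
  | add y z hy hz => exact hadd _ _ hy hz

/-- The additive map which is induced by a balanced biadditive map. -/
noncomputable def balLift {N : Type*} [AddCommGroup N] (f : V →+ M →+ N)
    (hf : ∀ (a : A) v m, f (op a • v) m = f v (a • m)) [SMulCommClass A Aᵐᵒᵖ V] :
    BalTensor A V M →+ N :=
  QuotientAddGroup.lift (balance A V M).toAddSubgroup
    (TensorProduct.liftAddHom f fun k v m => by
      rw [map_zsmul f, map_zsmul (f v), AddMonoidHom.smul_apply]) (by
    intro y hy
    -- The relations span an `A`-submodule. As an additive group it is generated by `A`-multiples of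
    -- relations, which `f` kills because the two actions on `V` commute.
    refine Submodule.closure_induction (p := fun y _ => TensorProduct.liftAddHom f _ y = 0)
      (map_zero _) (fun y z _ _ hy hz => by rw [map_add, hy, hz, add_zero]) ?_ hy
    rintro b _ ⟨v, a, m, rfl⟩
    rw [smul_sub, TensorProduct.smul_tmul', TensorProduct.smul_tmul', map_sub,
      TensorProduct.liftAddHom_tmul, TensorProduct.liftAddHom_tmul, smul_comm, hf, sub_self])

end BalancedTensor

/-! ### Algebra of a bimodule with one generator. -/

section Bubbles

open MulOpposite TensorProduct

universe u

/-- The structure of the bimodule of a diagram `U` with a cap and a cup, and with its saddle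
`α`. -/
structure Bubble {A V : Type u} [Ring A] [AddCommGroup V] [Module A V] [Module Aᵐᵒᵖ V]
    (α : V →ₗ[A] A) where
  g : V
  x : A
  t : V
  ψ : V →+ A
  K : Type
  [fintype : Fintype K]
  p : K → A
  q : K → A
  alpha_op : ∀ (a : A) v, α (op a • v) = α v * a
  x_comm : ∀ a, x * a = a * x
  x_mul_x : x * x = 0
  left_unit : α g • g = g
  right_unit : op (α g) • g = g
  ψ_op : ∀ (a : A) v, ψ (op a • v) = ψ v * a
  ψ_g : ψ g = 0
  ψ_xg : ψ (x • g) = α g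
  decomp : ∀ v, α g • v = op (ψ (x • v)) • g + x • op (ψ v) • g
  ψ_comm : ∀ a : A, op (ψ (a • g)) • g = ψ (a • g) • g
  span : ∀ v, v = ∑ k, p k • op (ψ (q k • v)) • g
  t_comm : ∀ a : A, a • t = op a • t
  t_eq : α g • t = x • g + op x • g

namespace Bubble

variable {A V : Type u} [Ring A] [AddCommGroup V] [Module A V] [Module Aᵐᵒᵖ V]
  [SMulCommClass A Aᵐᵒᵖ V] {α : V →ₗ[A] A} (B : Bubble α)
  {M N : Type u} [AddCommGroup M] [Module A M] [AddCommGroup N] [Module A N]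

local notation "tm" => tmk (A := A) V

instance : Fintype B.K := B.fintype

theorem op_smul_smul (a b : A) (v : V) : op a • b • v = b • op a • v := (smul_comm b (op a) v).symm

theorem alpha_mul_alpha : α B.g * α B.g = α B.g := by
  rw [← smul_eq_mul, ← map_smul, B.left_unit]

/-- Apply `ψ` to `decomp`: the first term dies because `ψ` kills `g`, and the second gives `α B.g`
because `ψ` sends `x • g` to it. -/
theorem ψ_alpha_smul (v : V) : B.ψ (α B.g • v) = α B.g * B.ψ v := by
  rw [B.decomp, map_add, B.ψ_op, ← op_smul_smul, B.ψ_op, B.ψ_g, B.ψ_xg, zero_mul, zero_add]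

theorem alpha_mul_of_comm {a : A} (h : a • B.g = op a • B.g) : a * α B.g = α B.g * a := by
  have := congrArg α h
  rwa [map_smul, B.alpha_op] at this

theorem x_smul (v : V) (a : A) : B.x • a • v = a • B.x • v := by
  rw [smul_smul, smul_smul, B.x_comm]

/-- Each summand in `span` has its right factor next to the tensor sign, so it can be moved to `m`.
Thus the elements `g ⊗ m` generate the module. -/
theorem tmk_eq (v : V) (m : M) :
    tm v m = ∑ k, B.p k • tm B.g (B.ψ (B.q k • v) • m) := by
  conv_lhs => rw [B.span v]
  rw [tmk_sum_left]
  refine Finset.sum_congr rfl fun k _ => ?_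
  rw [← tmk_op_smul]
  rfl

theorem hom_ext {f f' : BalTensor A V M →ₗ[A] N}
    (h : ∀ m, f (tm B.g m) = f' (tm B.g m)) : f = f' :=
  balTensor_hom_ext fun v m => by
    rw [B.tmk_eq, map_sum, map_sum]
    exact Finset.sum_congr rfl fun k _ => by rw [map_smul f, map_smul f', h]

/-- The element `g` behaves like a generator with the single relation of being fixed by the
idempotent `α B.g`, apart from the elements `ψ (a • g)`, which pass through `g` from one side to the
other. The two hypotheses express exactly this compatibility. -/
theorem exists_lift (n : M →+ N)
    (hn : ∀ (a : A) m, n (B.ψ (a • B.g) • m) = B.ψ (a • B.g) • n m) (he : ∀ m, α B.g • n m = n m) :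
    ∃ f : BalTensor A V M →ₗ[A] N, ∀ m, f (tm B.g m) = n m := by
  -- The formula is forced by `tmk_eq`.
  let L : V → M → N := fun v m => ∑ k, B.p k • n (B.ψ (B.q k • v) • m)
  have hL : ∀ v m, L v m = ∑ k, B.p k • n (B.ψ (B.q k • v) • m) := fun _ _ => rfl
  have hadd : ∀ v w m, L (v + w) m = L v m + L w m := fun v w m => by
    simp only [hL, smul_add, map_add, add_smul, Finset.sum_add_distrib]
  have hadd' : ∀ v m m', L v (m + m') = L v m + L v m' := fun v m m' => by
    simp only [hL, smul_add, map_add, Finset.sum_add_distrib]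
  have hop : ∀ (a : A) v m, L (op a • v) m = L v (a • m) := fun a v m => by
    simp only [hL]
    refine Finset.sum_congr rfl fun k _ => ?_
    rw [smul_comm (B.q k) (op a) v, B.ψ_op, mul_smul]
  have hg : ∀ (a : A) m, L (a • B.g) m = a • n m := fun a m => by
    have h1 : L (a • B.g) m = (∑ k, B.p k * B.ψ (B.q k • a • B.g)) • n m := by
      rw [hL, Finset.sum_smul]
      refine Finset.sum_congr rfl fun k _ => ?_
      rw [smul_smul (B.q k), hn, smul_smul]
    -- This is `span` for `a • g`, with the right factors moved to the left by `ψ_comm`. Applying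
    -- `α` gives an identity in `A` after multiplication with `α B.g`, which suffices since `α B.g`
    -- fixes the values of `n`.
    have h2 : (∑ k, B.p k * B.ψ (B.q k • a • B.g)) • B.g = a • B.g := by
      conv_rhs => rw [B.span (a • B.g)]
      rw [Finset.sum_smul]
      refine Finset.sum_congr rfl fun k _ => ?_
      rw [smul_smul (B.q k), B.ψ_comm, smul_smul]
    have h3 := congrArg α h2
    rw [map_smul, map_smul, smul_eq_mul, smul_eq_mul] at h3
    rw [h1, ← he, smul_smul, h3, ← smul_smul, he]
  have hsum : ∀ {K : Type} (s : Finset K) (v : K → V) m,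
      L (∑ k ∈ s, v k) m = ∑ k ∈ s, L (v k) m := fun s v m =>
    map_sum (AddMonoidHom.mk' (fun v => L v m) fun v w => hadd v w m) v s
  have hsmul : ∀ (a : A) v m, L (a • v) m = a • L v m := fun a v m => by
    have h1 : ∀ b : A, L (b • v) m = ∑ k, (b * B.p k) • n (B.ψ (B.q k • v) • m) := fun b => by
      conv_lhs => rw [B.span v, Finset.smul_sum]
      rw [hsum]
      refine Finset.sum_congr rfl fun k _ => ?_
      rw [smul_smul, smul_comm (b * B.p k) (op (B.ψ (B.q k • v))) B.g, hop, hg]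
    rw [h1, hL, Finset.smul_sum]
    exact Finset.sum_congr rfl fun k _ => mul_smul _ _ _
  refine ⟨Submodule.liftQ _ (TensorProduct.AlgebraTensorModule.lift
    { toFun := fun v => (AddMonoidHom.mk' (L v) (hadd' v)).toIntLinearMap
      map_add' := fun v w => by ext m; exact hadd v w m
      map_smul' := fun a v => by ext m; exact hsmul a v m }) ?_, fun m => ?_⟩
  · refine Submodule.span_le.2 ?_
    rintro _ ⟨v, a, m, rfl⟩
    rw [SetLike.mem_coe, LinearMap.mem_ker, map_sub]
    exact sub_eq_zero.2 (hop a v m)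
  · change L B.g m = n m
    have := hg 1 m
    rwa [one_smul, one_smul] at this

/-- The homomorphism `V ⊗ M → N` with a given value on `g ⊗ m`. -/
noncomputable def lift (n : M →+ N)
    (hn : ∀ (a : A) m, n (B.ψ (a • B.g) • m) = B.ψ (a • B.g) • n m) (he : ∀ m, α B.g • n m = n m) :
    BalTensor A V M →ₗ[A] N :=
  (B.exists_lift n hn he).choose

theorem lift_tmk (n : M →+ N)
    (hn : ∀ (a : A) m, n (B.ψ (a • B.g) • m) = B.ψ (a • B.g) • n m) (he : ∀ m, α B.g • n m = n m)
    (m : M) : B.lift n hn he (tm B.g m) = n m :=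
  (B.exists_lift n hn he).choose_spec m

/-- Multiplication by `x`. -/
def xMap (M : Type u) [AddCommGroup M] [Module A M] : M →ₗ[A] M where
  toFun m := B.x • m
  map_add' := smul_add _
  map_smul' a m := by rw [smul_smul, B.x_comm, mul_smul]; rfl

theorem xMap_apply (m : M) : B.xMap M m = B.x • m := rfl

/-- `g ⊗ m ↦ g ⊗ g ⊗ m`. -/
noncomputable def iota (M : Type u) [AddCommGroup M] [Module A M] :
    BalTensor A V M →ₗ[A] BalTensor A V (BalTensor A V M) :=
  B.lift ((tmkRight B.g).comp (tmkRight B.g))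
    (fun a m => by
      simp only [AddMonoidHom.comp_apply, tmkRight_apply, smul_tmk]
      rw [← tmk_op_smul, B.ψ_comm, ← smul_tmk (B.ψ _), tmk_op_smul .. |>.symm, B.ψ_comm])
    (fun m => by
      simp only [AddMonoidHom.comp_apply, tmkRight_apply, smul_tmk]
      rw [B.left_unit])

theorem iota_tmk (m : M) : B.iota M (tm B.g m) = tm B.g (tm B.g m) :=
  B.lift_tmk _ _ _ m

/-- `w ⊗ m ↦ g ⊗ ψ(w) m`. -/
noncomputable def rhoAux (M : Type u) [AddCommGroup M] [Module A M] :
    BalTensor A V M →+ BalTensor A V M :=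
  balLift (AddMonoidHom.mk' (fun w => (tmkRight B.g).comp
      (DistribSMul.toAddMonoidHom M (B.ψ w))) fun w w' => by
        ext m
        simp only [AddMonoidHom.comp_apply, AddMonoidHom.add_apply, tmkRight_apply,
          DistribSMul.toAddMonoidHom_apply, map_add, add_smul])
    fun a v m => by
      change tm B.g (B.ψ (op a • v) • m) = tm B.g (B.ψ v • a • m)
      rw [B.ψ_op, mul_smul]

theorem rhoAux_tmk (w : V) (m : M) : B.rhoAux M (tm w m) = tm B.g (B.ψ w • m) := rfl

theorem tmk_alpha_smul (m : M) : tm B.g (α B.g • m) = tm B.g m := by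
  rw [← tmk_op_smul, B.right_unit]

/-- Elements which commute with `g` pass through `g` and through `ψ`. This is needed to define `rho`
on the outer factor by its values on `g ⊗ y`. -/
theorem rhoAux_comm {a : A} (ha : a • B.g = op a • B.g) (y : BalTensor A V M) :
    B.rhoAux M (a • y) = a • B.rhoAux M y := by
  refine balTensor_induction (P := fun y => B.rhoAux M (a • y) = a • B.rhoAux M y)
    (by rw [smul_zero, map_zero, smul_zero]) (fun w m => ?_)
    (fun y z hy hz => by rw [smul_add, map_add, map_add, hy, hz, smul_add]) y
  -- Apply `ψ` to `a` times `decomp`. The factor `α B.g` does no harm, since `g ⊗ α(g) m = g ⊗ m`.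
  have h : α B.g * B.ψ (a • w) = α B.g * (a * B.ψ w) := by
    rw [← B.ψ_alpha_smul, smul_smul, ← B.alpha_mul_of_comm ha, ← smul_smul, B.decomp, smul_add,
      map_add, ← op_smul_smul, ha, smul_smul, ← op_mul, B.ψ_op, B.ψ_g, zero_mul, zero_add,
      ← B.x_smul, ← op_smul_smul, ha, smul_smul, ← op_mul, ← op_smul_smul, B.ψ_op, B.ψ_xg]
  rw [smul_tmk, rhoAux_tmk, rhoAux_tmk, smul_tmk, ha, tmk_op_smul, ← B.tmk_alpha_smul,
    smul_smul, h, ← B.tmk_alpha_smul (a • _), smul_smul, smul_smul, mul_assoc]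

/-- `g ⊗ w ⊗ m ↦ g ⊗ ψ(w) m`. -/
noncomputable def rho (M : Type u) [AddCommGroup M] [Module A M] :
    BalTensor A V (BalTensor A V M) →ₗ[A] BalTensor A V M :=
  B.lift (B.rhoAux M) (fun a y => B.rhoAux_comm (B.ψ_comm a).symm y) (fun y => by
    rw [← B.rhoAux_comm (by rw [B.left_unit, B.right_unit])]
    refine balTensor_induction (P := fun y => B.rhoAux M (α B.g • y) = B.rhoAux M y)
      (by rw [smul_zero]) (fun w m => ?_)
      (fun y z hy hz => by rw [smul_add, map_add, map_add, hy, hz]) y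
    rw [smul_tmk, rhoAux_tmk, rhoAux_tmk, B.ψ_alpha_smul, mul_smul, tmk_alpha_smul])

theorem rho_tmk (w : V) (m : M) : B.rho M (tm B.g (tm w m)) = tm B.g (B.ψ w • m) :=
  B.lift_tmk _ _ _ _

theorem decomp_tmk (w : V) (m : M) :
    tm B.g (B.x • tm B.g (B.ψ w • m)) + tm B.g (tm B.g (B.ψ (B.x • w) • m)) =
      tm B.g (tm w m) := by
  conv_rhs => rw [← B.tmk_alpha_smul, smul_tmk, B.decomp, tmk_add_left, tmk_add_right]
  rw [tmk_op_smul, ← smul_tmk B.x, tmk_op_smul, add_comm]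

end Bubble

end Bubbles

/-! ### Shears of splittings. -/

section SplittingChange

open CategoryTheory

variable {C : Type*} [Category* C] [Preadditive C] {X Y Z : C} {f : X ⟶ Z} {g : Y ⟶ Z}
  {r : Z ⟶ X} {s : Z ⟶ Y}

/-- A shear: a complement of `Y` may be moved by any map to `Y`. -/
theorem IsSplitting.add (h : IsSplitting f g r s) (k : X ⟶ Y) :
    IsSplitting (f + k ≫ g) g r (s - r ≫ k) where
  fr := by rw [Preadditive.add_comp, Category.assoc, h.gr, h.fr, Limits.comp_zero, add_zero]
  fs := by
    rw [Preadditive.add_comp, Preadditive.comp_sub, Preadditive.comp_sub, Category.assoc, h.gs,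
      h.fs, ← Category.assoc, h.fr, Category.assoc, ← Category.assoc g, h.gr, Limits.zero_comp]
    simp
  gr := h.gr
  gs := by rw [Preadditive.comp_sub, h.gs, ← Category.assoc, h.gr, Limits.zero_comp, sub_zero]
  tot := by
    rw [Preadditive.comp_add, Preadditive.sub_comp, Category.assoc, ← h.tot]
    abel

/-- The splitting makes the epimorphism `θ` a split monomorphism as well, hence invertible, so it
can be removed. -/
theorem IsSplitting.of_epi {X' : C} {θ : X ⟶ X'} [Epi θ] {f : X' ⟶ Z}
    (h : IsSplitting (θ ≫ f) g r s) : IsSplitting f g (r ≫ θ) s where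
  fr := by
    have := congrArg (· ≫ θ) h.fr
    rw [← cancel_epi θ]
    simpa using this
  fs := by rw [← cancel_epi θ, ← Category.assoc, h.fs, Limits.comp_zero]
  gr := by rw [← Category.assoc, h.gr, Limits.zero_comp]
  gs := h.gs
  tot := by rw [Category.assoc, h.tot]

end SplittingChange

/-! ### The functor of a bubble, its unit, and invertibility. -/

namespace Bubble

open MulOpposite CategoryTheory

universe u

variable {A V : Type u} [Ring A] [AddCommGroup V] [Module A V] [Module Aᵐᵒᵖ V]
  [SMulCommClass A Aᵐᵒᵖ V] {α : V →ₗ[A] A} (B : Bubble α)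

local notation "tm" => tmk (A := A) V

local notation "𝐆" => tensorFunctor A V

theorem hom_ext' {M N : ModuleCat.{u} A} {f f' : (𝐆).obj M ⟶ N}
    (h : ∀ m : M, f.hom (tm B.g m) = f'.hom (tm B.g m)) : f = f' :=
  ModuleCat.hom_ext (B.hom_ext h)

/-- `g ⊗ m ↦ g ⊗ g ⊗ m`. -/
noncomputable def ι : 𝐆 ⟶ 𝐆 ⋙ 𝐆 where
  app M := ModuleCat.ofHom (B.iota M)
  naturality M N f := B.hom_ext' fun m => by
    change B.iota N (tm B.g (f.hom m)) = tensorMap A V (tensorMap A V f.hom) (B.iota M (tm B.g m))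
    rw [B.iota_tmk, B.iota_tmk]
    rfl

/-- `g ⊗ w ⊗ m ↦ g ⊗ ψ(w) m`. -/
noncomputable def ρ : 𝐆 ⋙ 𝐆 ⟶ 𝐆 where
  app M := ModuleCat.ofHom (B.rho M)
  naturality M N f := B.hom_ext' fun y => by
    refine balTensor_induction (P := fun y => B.rho N (tensorMap A V (tensorMap A V f.hom)
      (tm B.g y)) = tensorMap A V f.hom (B.rho M (tm B.g y))) ?_ (fun w m => ?_) ?_ y
    · rw [tmk_zero_right, map_zero, map_zero, map_zero, map_zero]
    · rw [tensorMap_tmk, tensorMap_tmk, B.rho_tmk, B.rho_tmk, tensorMap_tmk, map_smul]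
    · intro y z hy hz
      rw [tmk_add_right, map_add, map_add, map_add, map_add, hy, hz]

/-- `m ↦ t ⊗ m`. -/
noncomputable def β : 𝟭 (ModuleCat.{u} A) ⟶ 𝐆 where
  app M := ModuleCat.ofHom
    { toFun := fun m => tm B.t m
      map_add' := fun m m' => tmk_add_right _ _ _
      map_smul' := fun a m => by rw [RingHom.id_apply, smul_tmk, B.t_comm, tmk_op_smul] }
  naturality M N f := by
    ext m
    rfl

/-- `v ⊗ m ↦ v ⊗ x m`. -/
noncomputable def xIn : 𝐆 ⟶ 𝐆 where
  app M := ModuleCat.ofHom (tensorMap A V (B.xMap M))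
  naturality M N f := B.hom_ext' fun m => by
    change tm B.g (B.x • f.hom m) = tm B.g (f.hom (B.x • m))
    rw [map_smul]

/-- `v ⊗ m ↦ x v ⊗ m`. -/
noncomputable def xOut : 𝐆 ⟶ 𝐆 where
  app M := ModuleCat.ofHom (B.xMap (BalTensor A V M))
  naturality _ _ _ := B.hom_ext' fun _ => rfl

/-- `u ⊗ v ⊗ m ↦ u ⊗ x v ⊗ m`. -/
noncomputable def xMid : 𝐆 ⋙ 𝐆 ⟶ 𝐆 ⋙ 𝐆 := Functor.whiskerLeft (𝐆) B.xIn

/-- The middle circle of `U_i U_i` contributes a factor `𝒜` with basis `1`, `X`. Here `ι` inserts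
`1` and `ι ≫ xMid` inserts `X`; `ρ` reads the coefficient of `X`, and `xMid ≫ ρ` that of `1`. -/
theorem isSplitting (M : ModuleCat.{u} A) :
    IsSplitting (B.ι.app M ≫ B.xMid.app M) (B.ι.app M) (B.ρ.app M)
      (B.xMid.app M ≫ B.ρ.app M) where
  fr := B.hom_ext' fun m => by
    change B.rho M (tensorMap A V (B.xMap (BalTensor A V M)) (B.iota M (tm B.g m))) = tm B.g m
    rw [iota_tmk, tensorMap_tmk, xMap_apply, smul_tmk, rho_tmk, B.ψ_xg, tmk_alpha_smul]
  fs := B.hom_ext' fun m => by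
    change B.rho M (tensorMap A V (B.xMap (BalTensor A V M)) (tensorMap A V
      (B.xMap (BalTensor A V M)) (B.iota M (tm B.g m)))) = 0
    rw [iota_tmk, tensorMap_tmk, tensorMap_tmk, xMap_apply, xMap_apply, smul_smul, B.x_mul_x,
      zero_smul, tmk_zero_right, map_zero]
  gr := B.hom_ext' fun m => by
    change B.rho M (B.iota M (tm B.g m)) = 0
    rw [iota_tmk, rho_tmk, B.ψ_g, zero_smul, tmk_zero_right]
  gs := B.hom_ext' fun m => by
    change B.rho M (tensorMap A V (B.xMap (BalTensor A V M)) (B.iota M (tm B.g m))) = tm B.g m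
    rw [iota_tmk, tensorMap_tmk, xMap_apply, smul_tmk, rho_tmk, B.ψ_xg, tmk_alpha_smul]
  tot := B.hom_ext' fun y => by
    let F : BalTensor A V (BalTensor A V M) →ₗ[A] BalTensor A V (BalTensor A V M) :=
      tensorMap A V (B.xMap (BalTensor A V M)) ∘ₗ B.iota M ∘ₗ B.rho M +
        B.iota M ∘ₗ B.rho M ∘ₗ tensorMap A V (B.xMap (BalTensor A V M))
    change F (tm B.g y) = tm B.g y
    refine balTensor_induction (P := fun y => F (tm B.g y) = tm B.g y) ?_ (fun w m => ?_) ?_ y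
    · rw [tmk_zero_right, map_zero]
    · change tensorMap A V (B.xMap (BalTensor A V M)) (B.iota M (B.rho M _)) +
        B.iota M (B.rho M (tensorMap A V (B.xMap (BalTensor A V M)) _)) = _
      rw [rho_tmk, iota_tmk, tensorMap_tmk, tensorMap_tmk, xMap_apply, xMap_apply, smul_tmk B.x w,
        rho_tmk, iota_tmk]
      exact B.decomp_tmk w m
    · intro y z hy hz
      rw [tmk_add_right, map_add, hy, hz]

theorem ι_comp_map_counit (M : ModuleCat.{u} A) :
    B.ι.app M ≫ (𝐆).map ((tensorCounit α B.alpha_op).app M) = 𝟙 _ := B.hom_ext' fun m => by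
  change tensorMap A V (counitMap α B.alpha_op M) (B.iota M (tm B.g m)) = tm B.g m
  rw [iota_tmk, tensorMap_tmk]
  exact B.tmk_alpha_smul m

theorem ι_comp_counit (M : ModuleCat.{u} A) :
    B.ι.app M ≫ (tensorCounit α B.alpha_op).app ((𝐆).obj M) = 𝟙 _ := B.hom_ext' fun m => by
  change counitMap α B.alpha_op (BalTensor A V M) (B.iota M (tm B.g m)) = tm B.g m
  rw [iota_tmk]
  change tm (α B.g • B.g) m = _
  rw [B.left_unit]

/-- By `t_eq` the unit puts `x` on one of the two sides of a cut neck. So `G(β)` is a shear of the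
inclusion that inserts `x` in the middle, and it is still a complement of `ι`. -/
theorem map_β (M : ModuleCat.{u} A) : ((𝐆).map (B.β.app M) : (𝐆).obj M ⟶ (𝐆 ⋙ 𝐆).obj M) =
    B.ι.app M ≫ B.xMid.app M + B.xIn.app M ≫ B.ι.app M :=
  B.hom_ext' fun m => by
    change tm B.g (tm B.t m) = tensorMap A V (B.xMap (BalTensor A V M)) (B.iota M (tm B.g m)) +
      B.iota M (tensorMap A V (B.xMap M) (tm B.g m))
    rw [iota_tmk, tensorMap_tmk, tensorMap_tmk, iota_tmk, ← tmk_alpha_smul, smul_tmk, B.t_eq,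
      tmk_add_left, tmk_add_right, tmk_op_smul]
    rfl

/-- The mirror image of `map_β`. Moving `α B.g` across `t` by `t_comm` first makes `t_eq`
applicable. -/
theorem β_obj (M : ModuleCat.{u} A) : (B.β.app ((𝐆).obj M) : (𝐆).obj M ⟶ (𝐆 ⋙ 𝐆).obj M) =
    B.ι.app M ≫ B.xMid.app M + B.xOut.app M ≫ B.ι.app M :=
  B.hom_ext' fun m => by
    change tm B.t (tm B.g m) =
      tensorMap A V (B.xMap (BalTensor A V M)) (B.iota M (tm B.g m)) + B.iota M (B.x • tm B.g m)
    rw [map_smul, iota_tmk, tensorMap_tmk]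
    conv_lhs => rw [← B.left_unit, ← smul_tmk, ← tmk_op_smul, ← B.t_comm, B.t_eq, tmk_add_left,
      tmk_op_smul, add_comm]
    rfl

/-- Tensoring with the complex `0 → V → A → 0`. -/
noncomputable abbrev tensorCone : KBdd (ModuleCat.{u} A) ⥤ KBdd (ModuleCat.{u} A) :=
  coneFunctorK (𝐆) (tensorCounit α B.alpha_op)

theorem nonempty_unit_comp : Nonempty (unitConeK (𝐆) B.β ⋙ B.tensorCone ≅
    CategoryTheory.shiftFunctor (KBdd (ModuleCat.{u} A)) (1 : ℤ)) := by
  refine nonempty_unitConeK_coneFunctorK (ι := B.ι) (r := B.ρ)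
    (s := B.xMid ≫ B.ρ - B.ρ ≫ B.xIn) (fun M => ?_) B.ι_comp_counit
  have h := (B.isSplitting M).add (B.xIn.app M)
  rw [← map_β] at h
  exact h

theorem nonempty_comp_unit : Nonempty (B.tensorCone ⋙ unitConeK (𝐆) B.β ≅
    CategoryTheory.shiftFunctor (KBdd (ModuleCat.{u} A)) (1 : ℤ)) := by
  refine nonempty_coneFunctorK_unitConeK (ι := B.ι) (r := B.ρ)
    (s := B.xMid ≫ B.ρ - B.ρ ≫ B.xOut) (fun M => ?_) B.ι_comp_map_counit
  have h := (B.isSplitting M).add (B.xOut.app M)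
  rw [← β_obj] at h
  exact h

end Bubble

/-! ### Adjacent diagrams. -/

namespace Bubble

open MulOpposite CategoryTheory

universe u

variable {A V V' : Type u} [Ring A] [AddCommGroup V] [Module A V] [Module Aᵐᵒᵖ V]
  [SMulCommClass A Aᵐᵒᵖ V] {α : V →ₗ[A] A} (B : Bubble α)
  [AddCommGroup V'] [Module A V'] [Module Aᵐᵒᵖ V']
  [SMulCommClass A Aᵐᵒᵖ V'] {α' : V' →ₗ[A] A} (B' : Bubble α')

local notation "tm" => tmk (A := A) V

local notation "tm'" => tmk (A := A) V'

local notation "𝐆" => tensorFunctor A V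

local notation "𝐆'" => tensorFunctor A V'

section Adjacent

/-- `m ↦ t ⊗ m`. -/
def betaMap (M : Type u) [AddCommGroup M] [Module A M] : M →ₗ[A] BalTensor A V M where
  toFun m := tm B.t m
  map_add' _ _ := tmk_add_right _ _ _
  map_smul' a m := by rw [RingHom.id_apply, smul_tmk, B.t_comm, tmk_op_smul]

/-- `g ⊗ m ↦ g ⊗ t' ⊗ g ⊗ m`. -/
noncomputable def insertMap (M : Type u) [AddCommGroup M] [Module A M] :
    BalTensor A V M →ₗ[A] BalTensor A V (BalTensor A V' (BalTensor A V M)) :=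
  tensorMap A V (B'.betaMap (BalTensor A V M)) ∘ₗ B.iota M

theorem insertMap_tmk {M : Type u} [AddCommGroup M] [Module A M] (m : M) :
    B.insertMap B' M (tm B.g m) = tm B.g (tm' B'.t (tm B.g m)) :=
  congrArg (tensorMap A V (B'.betaMap (BalTensor A V M))) (B.iota_tmk m)

/-- `g ⊗ m ↦ g ⊗ t' ⊗ g ⊗ m`. -/
noncomputable def insert : 𝐆 ⟶ 𝐆 ⋙ 𝐆' ⋙ 𝐆 :=
  B.ι ≫ Functor.whiskerRight (Functor.whiskerLeft (𝐆) B'.β) (𝐆)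

/-- The diagrams of the two bubbles are adjacent. -/
structure IsAdjacent where
  x : A
  y : A
  y_comm : ∀ a, y * a = a * y
  alpha_t : α' B'.t = x + y
  x_smul : x • B.g = B.x • B.g
  y_smul : y • B.g = op y • B.g
  exists_smul_t : ∀ w : V', ∃ a : A, a • B.g = op a • B.g ∧
    α B.g • op (α B.g) • w = a • B'.t

variable {B B'}

/-- Every tensor reduces to elements `g ⊗ w ⊗ g ⊗ m`. Between two copies of `g`, the vector `w` is a
multiple of `t'` by an element that commutes with `g`, and this element can be pulled out on the
left. -/
theorem IsAdjacent.range_insertMap (h : B.IsAdjacent B') (M : Type u) [AddCommGroup M]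
    [Module A M] : LinearMap.range (B.insertMap B' M) = ⊤ := by
  rw [eq_top_iff]
  have h1 : ∀ (w : V') (m : M), tm B.g (tm' w (tm B.g m)) ∈
      LinearMap.range (B.insertMap B' M) := by
    intro w m
    obtain ⟨a, ha, hw⟩ := h.exists_smul_t w
    refine ⟨a • tm B.g m, ?_⟩
    rw [map_smul, insertMap_tmk, smul_tmk, ha, tmk_op_smul, smul_tmk, ← hw, ← smul_tmk,
      tmk_alpha_smul, tmk_op_smul, smul_tmk, B.left_unit]
  have h2 : ∀ (w : V') (u : BalTensor A V M), tm B.g (tm' w u) ∈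
      LinearMap.range (B.insertMap B' M) := by
    intro w u
    refine balTensor_induction (P := fun u => tm B.g (tm' w u) ∈
      LinearMap.range (B.insertMap B' M)) ?_ (fun v m => ?_) ?_ u
    · rw [tmk_zero_right, tmk_zero_right]
      exact zero_mem _
    · rw [B.tmk_eq v]
      have := map_sum ((tmkRight (A := A) (V := V) B.g).comp (tmkRight (A := A) (V := V')
        (M := BalTensor A V M) w)) (fun k => B.p k • tm B.g (B.ψ (B.q k • v) • m)) Finset.univ
      simp only [AddMonoidHom.comp_apply, tmkRight_apply] at this
      rw [this]
      refine Submodule.sum_mem _ fun k _ => ?_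
      rw [← tmk_op_smul]
      exact h1 _ _
    · intro y z hy hz
      rw [tmk_add_right, tmk_add_right]
      exact add_mem hy hz
  have h3 : ∀ z : BalTensor A V' (BalTensor A V M), tm B.g z ∈
      LinearMap.range (B.insertMap B' M) := by
    intro z
    refine balTensor_induction (P := fun z => tm B.g z ∈
      LinearMap.range (B.insertMap B' M)) ?_ (fun v m => h2 v m) ?_ z
    · rw [tmk_zero_right]
      exact zero_mem _
    · intro y z hy hz
      rw [tmk_add_right]
      exact add_mem hy hz
  rintro z -
  refine balTensor_induction (P := fun z => z ∈
      LinearMap.range (B.insertMap B' M)) (zero_mem _) (fun v m => ?_)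
      (fun y z hy hz => add_mem hy hz) z
  rw [B.tmk_eq]
  exact Submodule.sum_mem _ fun k _ => Submodule.smul_mem _ _ (h3 _)

theorem IsAdjacent.epi_insert (h : B.IsAdjacent B') (M : ModuleCat.{u} A) :
    Epi ((B.insert B').app M) := by
  exact (ModuleCat.epi_iff_surjective (ModuleCat.ofHom (B.insertMap B' M))).2
    (LinearMap.range_eq_top.1 (h.range_insertMap M))

/-- Multiplication by a central element. -/
def centMap {z : A} (hz : ∀ a, z * a = a * z) (M : Type u) [AddCommGroup M] [Module A M] :
    M →ₗ[A] M where
  toFun m := z • m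
  map_add' := smul_add _
  map_smul' a m := by rw [smul_smul, hz, mul_smul]; rfl

variable (B) in
/-- `v ⊗ m ↦ v ⊗ z m` for a central element `z`. -/
noncomputable def smulIn {z : A} (hz : ∀ a, z * a = a * z) : 𝐆 ⟶ 𝐆 where
  app M := ModuleCat.ofHom (tensorMap A V (centMap hz M))
  naturality M N f := B.hom_ext' fun m => by
    change tm B.g (z • f.hom m) = tm B.g (f.hom (z • m))
    rw [map_smul]

/-- The opposite saddles of the second diagram compose to `α' t' = x + y`. The summand `x` acts on
the middle circle and `y` passes through `g` to `m`, so the composite is a shear of `ι ≫ xMid`. -/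
theorem IsAdjacent.insert_comp (h : B.IsAdjacent B') (M : ModuleCat.{u} A) :
    (B.insert B').app M ≫ ((𝐆).map ((tensorCounit α' B'.alpha_op).app ((𝐆).obj M)) :
      (𝐆 ⋙ 𝐆' ⋙ 𝐆).obj M ⟶ (𝐆 ⋙ 𝐆).obj M) =
      B.ι.app M ≫ B.xMid.app M + (B.smulIn h.y_comm).app M ≫ B.ι.app M := B.hom_ext' fun m => by
  change tensorMap A V (counitMap α' B'.alpha_op (BalTensor A V M))
      (B.insertMap B' M (tm B.g m)) =
    tensorMap A V (B.xMap (BalTensor A V M)) (B.iota M (tm B.g m)) +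
      B.iota M (tensorMap A V (centMap h.y_comm M) (tm B.g m))
  rw [insertMap_tmk, iota_tmk, tensorMap_tmk, tensorMap_tmk, tensorMap_tmk, iota_tmk, xMap_apply,
    smul_tmk, ← h.x_smul]
  change tm B.g (tm (α' B'.t • B.g) m) = _ + tm B.g (tm B.g (h.y • m))
  rw [h.alpha_t, add_smul, tmk_add_left, tmk_add_right, ← tmk_op_smul h.y, ← h.y_smul]

/-- The shear in `insert_comp` is a complement of `ι`. Surjectivity of `insert` is enough to pass
from the composite to its second factor; injectivity then follows. -/
theorem IsAdjacent.isSplitting (h : B.IsAdjacent B') (M : ModuleCat.{u} A) :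
    IsSplitting ((𝐆).map ((tensorCounit α' B'.alpha_op).app ((𝐆).obj M))) (B.ι.app M)
      ((B.ρ ≫ B.insert B').app M) ((B.xMid ≫ B.ρ - B.ρ ≫ B.smulIn h.y_comm).app M) := by
  have h1 := (B.isSplitting M).add ((B.smulIn h.y_comm).app M)
  rw [← h.insert_comp] at h1
  have := h.epi_insert M
  exact h1.of_epi

theorem nonempty_braid (h : B.IsAdjacent B') (h' : B'.IsAdjacent B) :
    Nonempty (B.tensorCone ⋙ B'.tensorCone ⋙ B.tensorCone ≅
      B'.tensorCone ⋙ B.tensorCone ⋙ B'.tensorCone) :=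
  nonempty_coneFunctorK_braid B'.ι_comp_map_counit B'.ι_comp_counit B.ι_comp_map_counit
    B.ι_comp_counit h'.isSplitting h.isSplitting

end Adjacent

end Bubble

/-! ### Distant diagrams. -/

namespace Bubble

open MulOpposite CategoryTheory

universe u

variable {A V V' : Type u} [Ring A] [AddCommGroup V] [Module A V] [Module Aᵐᵒᵖ V]
  [SMulCommClass A Aᵐᵒᵖ V] {α : V →ₗ[A] A} {B : Bubble α}
  [AddCommGroup V'] [Module A V'] [Module Aᵐᵒᵖ V']
  [SMulCommClass A Aᵐᵒᵖ V'] {α' : V' →ₗ[A] A} {B' : Bubble α'}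

local notation "tm" => tmk (A := A) V

local notation "tm'" => tmk (A := A) V'

local notation "𝐆" => tensorFunctor A V

local notation "𝐆'" => tensorFunctor A V'

section Distant

variable (B B') in
/-- The diagrams of the two bubbles have disjoint supports. -/
structure IsDistant : Prop where
  alpha_smul : α B.g • B'.g = op (α B.g) • B'.g
  p_comm : ∀ l, (α B.g * B'.p l) • B.g = op (α B.g * B'.p l) • B.g
  q_comm : ∀ l, (B'.q l * α B.g) • B.g = op (B'.q l * α B.g) • B.g
  ψ_comm : ∀ a : A, a • B.g = op a • B.g → α B.g * a = a →
    B'.ψ (a • B'.g) • B.g = op (B'.ψ (a • B'.g)) • B.g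

variable {M N : Type u} [AddCommGroup M] [Module A M] [AddCommGroup N] [Module A N]

theorem ψ_smul_mul_alpha (a : A) : B.ψ (a • B.g) * α B.g = B.ψ (a • B.g) := by
  rw [← B.ψ_op, op_smul_smul, B.right_unit]

theorem alpha_mul_ψ_smul (a : A) : α B.g * B.ψ (a • B.g) = B.ψ (a • B.g) := by
  rw [← B.alpha_mul_of_comm (B.ψ_comm a).symm, ψ_smul_mul_alpha]

theorem smul_comm_mul {a b : A} (ha : a • B.g = op a • B.g) (hb : b • B.g = op b • B.g) :
    (a * b) • B.g = op (a * b) • B.g := by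
  rw [mul_smul, hb, ← op_smul_smul, ha, smul_smul, op_mul]

/-- Expanding only the corner part of `v` replaces the coefficients `p` by `α B.g * p`, and these
are the ones that commute with `g`. -/
theorem alpha_smul_eq (v : V') : α B.g • v =
    ∑ l, (α B.g * B'.p l) • op (B'.ψ (B'.q l • α B.g • v)) • B'.g := by
  have h : α B.g • v = α B.g • α B.g • v := by rw [smul_smul, B.alpha_mul_alpha]
  conv_lhs => rw [h, B'.span (α B.g • v), Finset.smul_sum]
  exact Finset.sum_congr rfl fun l _ => smul_smul _ _ _

namespace IsDistant

/-- The coefficients in `alpha_smul_eq` commute with `g`, so they leave the first tensor factor on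
the left. Hence the elements `g ⊗ g' ⊗ m` generate. -/
theorem tmk_tmk_eq (h : IsDistant B B') (v : V') (m : M) : tm B.g (tm' v m) =
    ∑ l, (α B.g * B'.p l) • tm B.g (tm' B'.g (B'.ψ (B'.q l • α B.g • v) • m)) := by
  conv_lhs => rw [← B.tmk_alpha_smul, smul_tmk, alpha_smul_eq (B' := B'), tmk_sum_left]
  have := map_sum (tmkRight (A := A) (V := V) (M := BalTensor A V' M) B.g)
    (fun l => tm' ((α B.g * B'.p l) • op (B'.ψ (B'.q l • α B.g • v)) • B'.g) m) Finset.univ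
  simp only [tmkRight_apply] at this
  rw [this]
  refine Finset.sum_congr rfl fun l _ => ?_
  rw [← smul_tmk, tmk_op_smul, ← tmk_op_smul, ← h.p_comm, smul_tmk]

theorem hom_ext (h : IsDistant B B') {f f' : BalTensor A V (BalTensor A V' M) →ₗ[A] N}
    (hf : ∀ m, f (tm B.g (tm' B'.g m)) = f' (tm B.g (tm' B'.g m))) : f = f' :=
  B.hom_ext fun y => by
    refine balTensor_induction (P := fun y => f (tm B.g y) = f' (tm B.g y)) ?_ (fun v m => ?_)
      (fun y z hy hz => ?_) y
    · rw [tmk_zero_right, map_zero, map_zero]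
    · rw [h.tmk_tmk_eq, map_sum, map_sum]
      refine Finset.sum_congr rfl fun l _ => ?_
      rw [map_smul f, map_smul f', hf]
    · rw [tmk_add_right, map_add, map_add, hy, hz]

variable (B B') in
/-- `v ⊗ m ↦ v ⊗ g ⊗ m` for `v` in `V'`. -/
noncomputable def swapAux (M : Type u) [AddCommGroup M] [Module A M] :
    BalTensor A V' M →+ BalTensor A V' (BalTensor A V M) :=
  balLift (AddMonoidHom.mk' (fun v => AddMonoidHom.mk' (fun m => ∑ l, (α B.g * B'.p l) •
      tm' B'.g (tm B.g (B'.ψ (B'.q l • α B.g • v) • m))) fun m m' => by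
        simp only [smul_add, tmk_add_right, Finset.sum_add_distrib]) fun v v' => by
    ext m
    simp only [AddMonoidHom.mk'_apply, AddMonoidHom.add_apply, smul_add, map_add, add_smul,
      tmk_add_right, Finset.sum_add_distrib])
    fun a v m => by
      simp only [AddMonoidHom.mk'_apply]
      refine Finset.sum_congr rfl fun l _ => ?_
      rw [← op_smul_smul, smul_comm (B'.q l) (op a), B'.ψ_op, mul_smul (B'.ψ _)]

theorem swapAux_tmk (v : V') (m : M) : swapAux B B' M (tm' v m) = ∑ l, (α B.g * B'.p l) •
      tm' B'.g (tm B.g (B'.ψ (B'.q l • α B.g • v) • m)) := rfl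

/-- The coordinates `ψ'` of multiples of `g'` pass through `g` by the distance condition and through
`g'` by `Bubble.ψ_comm`. They collect in front, where `span` sums them up to `a`. -/
theorem swapAux_smul_tmk (h : IsDistant B B') {a : A} (ha : a • B.g = op a • B.g)
    (ha' : α B.g * a = a) (m : M) :
    swapAux B B' M (tm' (a • B'.g) m) = a • tm' B'.g (tm B.g m) := by
  have hq : ∀ l, B'.q l * α B.g = α B.g * (B'.q l * α B.g) := fun l => by
    rw [← B.alpha_mul_of_comm (h.q_comm l), mul_assoc, B.alpha_mul_alpha]
  have h1 : ∀ l, tm' B'.g (tm B.g (B'.ψ (B'.q l • α B.g • a • B'.g) • m)) =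
      B'.ψ (B'.q l • a • B'.g) • tm' B'.g (tm B.g m) := fun l => by
    have h2 : B'.q l • α B.g • a • B'.g = (B'.q l * α B.g * a) • B'.g := by
      rw [smul_smul, smul_smul]
    have h3 : B'.q l • a • B'.g = (B'.q l * α B.g * a) • B'.g := by
      rw [smul_smul, mul_assoc, ha']
    rw [h2, h3, ← tmk_op_smul, ← h.ψ_comm _ (smul_comm_mul (h.q_comm l) ha) (by
      rw [← mul_assoc, ← hq]), ← smul_tmk, ← tmk_op_smul, B'.ψ_comm, ← smul_tmk]
  rw [swapAux_tmk]
  simp only [h1]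
  simp only [smul_smul _ _ (tm' B'.g (tm B.g m)), mul_assoc]
  rw [← Finset.sum_smul, ← Finset.mul_sum, mul_smul, smul_tmk]
  have h4 : (∑ l, B'.p l * B'.ψ (B'.q l • a • B'.g)) • B'.g = a • B'.g := by
    conv_rhs => rw [B'.span (a • B'.g)]
    rw [Finset.sum_smul]
    refine Finset.sum_congr rfl fun l _ => ?_
    rw [smul_smul (B'.q l), B'.ψ_comm, smul_smul]
  rw [h4, ← smul_tmk, smul_smul, ha']

theorem swapAux_smul (h : IsDistant B B') {a : A} (ha : a • B.g = op a • B.g)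
    (ha' : α B.g * a = a) (y : BalTensor A V' M) :
    swapAux B B' M (a • y) = a • swapAux B B' M y := by
  refine balTensor_induction (P := fun y => swapAux B B' M (a • y) = a • swapAux B B' M y)
    (by rw [smul_zero, map_zero, smul_zero]) (fun v m => ?_)
    (fun y z hy hz => by rw [smul_add, map_add, map_add, hy, hz, smul_add]) y
  have h1 : a • v = a • α B.g • v := by rw [smul_smul, B.alpha_mul_of_comm ha, ha']
  rw [swapAux_tmk, smul_tmk, h1]
  conv_lhs => rw [alpha_smul_eq (B' := B'), Finset.smul_sum, tmk_sum_left, map_sum]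
  rw [Finset.smul_sum]
  refine Finset.sum_congr rfl fun l _ => ?_
  rw [smul_smul, smul_comm _ (op _) B'.g, tmk_op_smul, swapAux_smul_tmk h
    (smul_comm_mul ha (h.p_comm l)) (by rw [← mul_assoc, ha']), mul_smul]

/-- `g ⊗ g' ⊗ m ↦ g' ⊗ g ⊗ m`. -/
noncomputable def swap (h : IsDistant B B') (M : Type u) [AddCommGroup M] [Module A M] :
    BalTensor A V (BalTensor A V' M) →ₗ[A] BalTensor A V' (BalTensor A V M) :=
  B.lift (swapAux B B' M)
    (fun a y => h.swapAux_smul (B.ψ_comm a).symm (alpha_mul_ψ_smul a) y)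
    (fun y => by
      rw [← h.swapAux_smul (by rw [B.left_unit, B.right_unit]) B.alpha_mul_alpha]
      refine balTensor_induction (P := fun y => swapAux B B' M (α B.g • y) = swapAux B B' M y)
        (by rw [smul_zero]) (fun v m => ?_)
        (fun y z hy hz => by rw [smul_add, map_add, map_add, hy, hz]) y
      rw [smul_tmk, swapAux_tmk, swapAux_tmk, smul_smul (α B.g) (α B.g), B.alpha_mul_alpha])

theorem swap_tmk (h : IsDistant B B') (m : M) :
    h.swap M (tm B.g (tm' B'.g m)) = tm' B'.g (tm B.g m) := by
  have h1 : tm B.g (tm' B'.g m) = tm B.g (tm' (α B.g • B'.g) m) := by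
    rw [← smul_tmk, B.tmk_alpha_smul]
  rw [h1, swap, lift_tmk, h.swapAux_smul_tmk (by rw [B.left_unit, B.right_unit])
    B.alpha_mul_alpha, smul_tmk, h.alpha_smul, tmk_op_smul, smul_tmk, B.left_unit]

/-- Both composites fix the generators `g ⊗ g' ⊗ m`. -/
theorem swap_swap (h : IsDistant B B') (h' : IsDistant B' B) :
    h'.swap M ∘ₗ h.swap M = LinearMap.id := h.hom_ext fun m => by
  rw [LinearMap.comp_apply, h.swap_tmk, h'.swap_tmk, LinearMap.id_apply]

/-- The functors of distant diagrams commute. -/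
noncomputable def swapIso (h : IsDistant B B') (h' : IsDistant B' B) : 𝐆' ⋙ 𝐆 ≅ 𝐆 ⋙ 𝐆' where
  hom :=
    { app := fun M => ModuleCat.ofHom (h.swap M)
      naturality := fun M N f => ModuleCat.hom_ext (h.hom_ext fun m => by
        change h.swap N (tm B.g (tm' B'.g (f.hom m))) =
          tensorMap A V' (tensorMap A V f.hom) (h.swap M (tm B.g (tm' B'.g m)))
        rw [h.swap_tmk, h.swap_tmk]
        rfl) }
  inv :=
    { app := fun M => ModuleCat.ofHom (h'.swap M)
      naturality := fun M N f => ModuleCat.hom_ext (h'.hom_ext fun m => by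
        change h'.swap N (tm' B'.g (tm B.g (f.hom m))) =
          tensorMap A V (tensorMap A V' f.hom) (h'.swap M (tm' B'.g (tm B.g m)))
        rw [h'.swap_tmk, h'.swap_tmk]
        rfl) }
  hom_inv_id := by
    ext M : 2
    exact ModuleCat.hom_ext (swap_swap h h')
  inv_hom_id := by
    ext M : 2
    exact ModuleCat.hom_ext (swap_swap h' h)

theorem nonempty_comm (h : IsDistant B B') (h' : IsDistant B' B) :
    Nonempty (B'.tensorCone ⋙ B.tensorCone ≅ B.tensorCone ⋙ B'.tensorCone) := by
  refine nonempty_coneFunctorK_comm (h.swapIso h') (fun M => ModuleCat.hom_ext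
    (h.hom_ext fun m => ?_)) (fun M => ModuleCat.hom_ext (h.hom_ext fun m => ?_))
  · change tensorMap A V' (counitMap α B.alpha_op M) (h.swap M (tm B.g (tm' B'.g m))) =
      tm' (α B.g • B'.g) m
    rw [h.swap_tmk, tensorMap_tmk, h.alpha_smul, tmk_op_smul]
    rfl
  · change counitMap α' B'.alpha_op (BalTensor A V M) (h.swap M (tm B.g (tm' B'.g m))) =
      tm B.g (α' B'.g • m)
    rw [h.swap_tmk, ← tmk_op_smul, ← h'.alpha_smul]
    rfl

end IsDistant

end Distant

end Bubble

/-! ### The saddle at `i`, `i + 1` on crossingless matchings. -/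

section Turn

variable {n : ℕ} (i : Fin (2 * n - 1))

theorem Crossingless.mem_Ioo_pair {n : ℕ} (b : Crossingless n) {x y : Fin (2 * n)}
    (h1 : x < y) (h2 : y < b.pair x) : x < b.pair y ∧ b.pair y < b.pair x := by
  refine ⟨?_, ?_⟩
  · by_contra h
    rcases lt_or_eq_of_le (not_lt.1 h) with h | h
    · exact b.noncrossing _ _ _ _ h h1 h2 ⟨b.invol y, rfl⟩
    · rw [← h, b.invol] at h2
      exact lt_irrefl _ h2
  · by_contra h
    rcases lt_or_eq_of_le (not_lt.1 h) with h | h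
    · exact b.noncrossing _ _ _ _ h1 h2 h ⟨rfl, rfl⟩
    · rw [(Function.Involutive.injective b.invol) h] at h1
      exact lt_irrefl _ h1

theorem Crossingless.mem_Ioo_pair_iff {n : ℕ} (b : Crossingless n) (x y : Fin (2 * n)) :
    (x < y ∧ y < b.pair x) ↔ (x < b.pair y ∧ b.pair y < b.pair x) := by
  refine ⟨fun h => b.mem_Ioo_pair h.1 h.2, fun h => ?_⟩
  have := b.mem_Ioo_pair h.1 h.2
  rwa [b.invol] at this

/-- The matching which is obtained from `b` by a saddle which joins `i` with `i + 1`. -/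
def turnFun (b : Fin (2 * n) → Fin (2 * n)) (p : Fin (2 * n)) : Fin (2 * n) :=
  if p = lo i then hi i else if p = hi i then lo i else if p = b (lo i) then b (hi i) else
    if p = b (hi i) then b (lo i) else b p

theorem turnFun_lo (b : Fin (2 * n) → Fin (2 * n)) : turnFun i b (lo i) = hi i := if_pos rfl

theorem turnFun_hi (b : Fin (2 * n) → Fin (2 * n)) : turnFun i b (hi i) = lo i := by
  simp [turnFun, (lo_ne_hi i).symm]

theorem lt_hi_iff {p : Fin (2 * n)} (h : p ≠ lo i) : p < hi i ↔ p < lo i := by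
  rw [ne_eq, Fin.ext_iff] at h
  simp only [Fin.lt_def, lo, hi] at *
  omega

theorem hi_lt_iff {p : Fin (2 * n)} (h : p ≠ hi i) : hi i < p ↔ lo i < p := by
  rw [ne_eq, Fin.ext_iff] at h
  simp only [Fin.lt_def, lo, hi] at *
  omega

variable (b : Crossingless n)

theorem turnFun_cases (p : Fin (2 * n)) :
    (p = lo i ∧ turnFun i b.pair p = hi i) ∨ (p = hi i ∧ turnFun i b.pair p = lo i) ∨
    (p = b.pair (lo i) ∧ p ≠ lo i ∧ p ≠ hi i ∧ turnFun i b.pair p = b.pair (hi i)) ∨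
    (p = b.pair (hi i) ∧ p ≠ lo i ∧ p ≠ hi i ∧ turnFun i b.pair p = b.pair (lo i)) ∨
    (p ≠ lo i ∧ p ≠ hi i ∧ p ≠ b.pair (lo i) ∧ p ≠ b.pair (hi i) ∧
      turnFun i b.pair p = b.pair p) := by
  unfold turnFun
  split_ifs with h1 h2 h3 h4 <;> simp_all

/-- The matching which is obtained from `b` by a saddle which joins `i` with `i + 1`. -/
def Crossingless.turn : Crossingless n where
  pair := turnFun i b.pair
  invol p := by
    have := lo_ne_hi i
    have h := b.invol
    have h' := b.pair_ne
    unfold turnFun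
    grind
  pair_ne p := by
    have := lo_ne_hi i
    have h := b.invol
    have h' := b.pair_ne
    unfold turnFun
    grind
  noncrossing p q r s hpq hqr hrs := by
    rintro ⟨h1, h2⟩
    -- As `lo i` and `hi i` are neighbours, any other arc encloses both or neither of them, and by
    -- noncrossing the same holds for their partners.
    have key : ∀ x, x ≠ lo i → x ≠ hi i → x ≠ b.pair (lo i) → x ≠ b.pair (hi i) →
        ((x < b.pair (lo i) ∧ b.pair (lo i) < b.pair x) ↔
          (x < b.pair (hi i) ∧ b.pair (hi i) < b.pair x)) := by
      intro x x1 x2 x3 x4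
      rw [← b.mem_Ioo_pair_iff, ← b.mem_Ioo_pair_iff, lt_hi_iff i x1, hi_lt_iff]
      intro h
      exact x4 (by rw [← h, b.invol])
    have hlh : (hi i).1 = (lo i).1 + 1 := rfl
    have cp := turnFun_cases i b p
    have cq := turnFun_cases i b q
    rw [h1] at cp
    rw [h2] at cq
    have kp := key p
    have kq := key q
    have nc := b.noncrossing p q r s hpq hqr hrs
    -- The arc of neighbours crosses nothing, and old arcs do not cross each other. Only a crossing
    -- of the new arc between the two partners with an old arc requires `key`.
    rcases cp with ⟨p1, p2⟩ | ⟨p1, p2⟩ | ⟨p1, -, -, p2⟩ | ⟨p1, -, -, p2⟩ | ⟨p1, p2, p3, p4, p5⟩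
    · simp only [Fin.lt_def, Fin.ext_iff] at *; omega
    · simp only [Fin.lt_def, Fin.ext_iff] at *; omega
    · rcases cq with ⟨q1, q2⟩ | ⟨q1, q2⟩ | ⟨q1, -, -, q2⟩ | ⟨q1, -, -, q2⟩ | ⟨q1, q2, q3, q4, q5⟩
      · simp only [Fin.lt_def, Fin.ext_iff] at *; omega
      · simp only [Fin.lt_def, Fin.ext_iff] at *; omega
      · exact absurd (p1.trans q1.symm) hpq.ne
      · exact absurd (q1.trans p2.symm) hqr.ne
      · have := (kq q1 q2 q3 q4).2
        rw [← p1, ← p2, ← q5] at this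
        exact absurd (this ⟨hqr, hrs⟩).1 hpq.not_gt
    · rcases cq with ⟨q1, q2⟩ | ⟨q1, q2⟩ | ⟨q1, -, -, q2⟩ | ⟨q1, -, -, q2⟩ | ⟨q1, q2, q3, q4, q5⟩
      · simp only [Fin.lt_def, Fin.ext_iff] at *; omega
      · simp only [Fin.lt_def, Fin.ext_iff] at *; omega
      · exact absurd (q1.trans p2.symm) hqr.ne
      · exact absurd (p1.trans q1.symm) hpq.ne
      · have := (kq q1 q2 q3 q4).1
        rw [← p1, ← p2, ← q5] at this
        exact absurd (this ⟨hqr, hrs⟩).1 hpq.not_gt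
    · rcases cq with ⟨q1, q2⟩ | ⟨q1, q2⟩ | ⟨q1, -, -, q2⟩ | ⟨q1, -, -, q2⟩ | ⟨q1, q2, q3, q4, q5⟩
      · simp only [Fin.lt_def, Fin.ext_iff] at *; omega
      · simp only [Fin.lt_def, Fin.ext_iff] at *; omega
      · have := (kp p1 p2 p3 p4).1
        rw [← q1, ← q2, ← p5] at this
        exact absurd (this ⟨hpq, hqr⟩).2 hrs.not_gt
      · have := (kp p1 p2 p3 p4).2
        rw [← q1, ← q2, ← p5] at this
        exact absurd (this ⟨hpq, hqr⟩).2 hrs.not_gt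
      · exact nc ⟨p5.symm, q5.symm⟩

theorem turn_pair (p : Fin (2 * n)) : (b.turn i).pair p = turnFun i b.pair p := rfl

theorem toCol_apply (p : Fin (2 * n)) : b.toCol p = b.pair p := rfl

/-- The points `i` and `i + 1` are joined. -/
def IsCap (c : Crossingless n) : Prop := c.pair (lo i) = hi i

theorem isCap_turn : IsCap i (b.turn i) := turnFun_lo i _

variable {i b}

theorem IsCap.pair_hi (h : IsCap i b) : b.pair (hi i) = lo i := by
  rw [← h, b.invol]

theorem IsCap.turn_eq (h : IsCap i b) : b.turn i = b := by
  refine Crossingless.pair_injective n (funext fun p => ?_)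
  rw [turn_pair]
  have h1 := h.pair_hi
  have h2 : b.pair (lo i) = hi i := h
  unfold turnFun
  split_ifs <;> simp_all

theorem IsCap.pair_ne (h : IsCap i b) {p : Fin (2 * n)} (h1 : p ≠ lo i) (h2 : p ≠ hi i) :
    b.pair p ≠ lo i ∧ b.pair p ≠ hi i := by
  refine ⟨fun e => h2 ?_, fun e => h1 ?_⟩
  · rw [← h, ← e, b.invol]
  · rw [← h.pair_hi, ← e, b.invol]

theorem pair_lo_ne (h : ¬ IsCap i b) : b.pair (lo i) ≠ hi i ∧ b.pair (hi i) ≠ lo i :=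
  ⟨h, fun e => h (by rw [IsCap, ← e, b.invol])⟩

theorem isSaddle_turn (h : ¬ IsCap i b) : IsSaddle b.toCol (b.turn i).toCol (lo i) (hi i) := by
  have h1 := pair_lo_ne h
  have h2 := b.pair_ne (lo i)
  have h3 := b.pair_ne (hi i)
  have h4 : b.pair (hi i) ≠ b.pair (lo i) := fun e =>
    lo_ne_hi i (Function.Involutive.injective b.invol e.symm)
  refine ⟨turnFun_lo i _, turnFun_hi i _, ?_, ?_, fun u u1 u2 u3 u4 => ?_⟩
  · change turnFun i b.pair (b.pair (lo i)) = b.pair (hi i)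
    simp [turnFun, h1, h2]
  · change turnFun i b.pair (b.pair (hi i)) = b.pair (lo i)
    simp [turnFun, h1, h3, h4]
  · change turnFun i b.pair u = b.pair u
    rw [toCol_apply] at u3 u4
    simp [turnFun, u1, u2, u3, u4]

theorem diagU_inl_hi : diagU i (Sum.inl (hi i)) = Sum.inl (lo i) := by
  simp [diagU, cupCap, (lo_ne_hi i).symm]

theorem diagU_inr_lo : diagU i (Sum.inr (lo i)) = Sum.inr (hi i) := by
  simp [diagU, cupCap]

theorem diagU_inr_hi : diagU i (Sum.inr (hi i)) = Sum.inr (lo i) := by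
  simp [diagU, cupCap, (lo_ne_hi i).symm]

theorem diagU_inl {p : Fin (2 * n)} (h1 : p ≠ lo i) (h2 : p ≠ hi i) :
    diagU i (Sum.inl p) = Sum.inr p := by
  simp [diagU, cupCap, h1, h2]

theorem diagU_inr {p : Fin (2 * n)} (h1 : p ≠ lo i) (h2 : p ≠ hi i) :
    diagU i (Sum.inr p) = Sum.inl p := by
  simp [diagU, cupCap, h1, h2]

end Turn

/-! ### Circles of closures of `U_i`. -/

section CountU

variable {n : ℕ} {i : Fin (2 * n - 1)}

theorem circ_left (b a : ColMatching (par n)) (T : ColMatching (dcol (par n))) (p : Fin (2 * n)) :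
    circ (b.sum a) T (Sum.inl p) (Sum.inl (b p)) := .rel _ _ (Or.inl rfl)

theorem circ_right (b a : ColMatching (par n)) (T : ColMatching (dcol (par n)))
    (p : Fin (2 * n)) : circ (b.sum a) T (Sum.inr p) (Sum.inr (a p)) := .rel _ _ (Or.inl rfl)

theorem circ_diag {σ : Fin (2 * n) ⊕ Fin (2 * n) → Fin (2 * n) ⊕ Fin (2 * n)}
    {T : ColMatching (dcol (par n))} {p q : Fin (2 * n) ⊕ Fin (2 * n)} (h : T p = q) :
    circ σ T p q := .rel _ _ (Or.inr h.symm)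

variable (i) in
/-- In `W(b) U_i a`, the bottom points lie on the same circle if they do so in `W(u_i b) a`. -/
theorem circ_inr_turn (b : Crossingless n) (a : ColMatching (par n)) (p : Fin (2 * n)) :
    circ (b.toCol.sum a) (diagU i) (Sum.inr p) (Sum.inr ((b.turn i).toCol p)) := by
  have trans' : ∀ {p q w}, circ (b.toCol.sum a) (diagU i) p q →
    circ (b.toCol.sum a) (diagU i) q w → circ (b.toCol.sum a) (diagU i) p w :=
    (circ (b.toCol.sum a) (diagU i)).trans
  have symm' : ∀ {p q}, circ (b.toCol.sum a) (diagU i) p q →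
    circ (b.toCol.sum a) (diagU i) q p := (circ (b.toCol.sum a) (diagU i)).symm
  have hl := circ_left b.toCol a (diagU i)
  have key : ∀ q, b.pair q ≠ lo i → b.pair q ≠ hi i →
      circ (b.toCol.sum a) (diagU i) (Sum.inr (b.pair q)) (Sum.inl q) := fun q h1 h2 =>
    trans' (circ_diag (diagU_inr h1 h2)) (symm' (hl q))
  have hc : circ (b.toCol.sum a) (diagU i) (Sum.inl (lo i)) (Sum.inl (hi i)) :=
    circ_diag (diagU_inl_lo i)
  change circ _ _ _ (Sum.inr (turnFun i b.pair p))
  rcases turnFun_cases i b p with ⟨h, e⟩ | ⟨h, e⟩ | ⟨h, h1, h2, e⟩ | ⟨h, h1, h2, e⟩ |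
    ⟨h1, h2, h3, h4, e⟩ <;> rw [e]
  · rw [h]; exact circ_diag diagU_inr_lo
  · rw [h]; exact circ_diag diagU_inr_hi
  · have hb : ¬ IsCap i b := fun hb => h2 (h.trans hb)
    rw [h] at h1 h2 ⊢
    exact trans' (key _ h1 h2) (trans' hc (symm' (key _ (pair_lo_ne hb).2 (b.pair_ne _))))
  · have hb : ¬ IsCap i b := fun hb => h1 (h.trans hb.pair_hi)
    rw [h] at h1 h2 ⊢
    exact trans' (key _ h1 h2) (trans' (symm' hc) (symm' (key _ (b.pair_ne _) (pair_lo_ne hb).1)))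
  · have h5 : b.pair p ≠ lo i := fun e => h3 (by rw [← e, b.invol])
    have h6 : b.pair p ≠ hi i := fun e => h4 (by rw [← e, b.invol])
    exact trans' (circ_diag (diagU_inr h1 h2)) (symm' (key _ h5 h6))

/-- The top matching, followed by `U_i`, is isotopic to its saddle at `i`, apart from a closed
circle when there is already an arc there. -/
theorem circ_inr_iff (b : Crossingless n) (a : ColMatching (par n)) (x y : Fin (2 * n)) :
    circ (b.toCol.sum a) (diagU i) (Sum.inr x) (Sum.inr y) ↔ circ (b.turn i).toCol a x y := by
  constructor
  · intro h
    have e1 : ∀ p, turnFun i b.pair p = (b.turn i).toCol p := fun _ => rfl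
    have ht : ∀ p q, turnFun i b.pair p = q → SameCircle (b.turn i).toCol a p q :=
      fun p q h => .rel _ _ (Or.inl h.symm)
    have ha : ∀ p, circ (b.turn i).toCol a p (a p) := fun p => .rel _ _ (Or.inr rfl)
    have hr : ∀ p, SameCircle (b.turn i).toCol a p p := fun p => .refl _
    -- A retraction onto the bottom points. The top points `lo i` and `hi i` have no vertical
    -- segment, so they are moved to their partners in `b`.
    have := sameCircle_map (f := Sum.elim (fun p => if p = lo i then b.pair (lo i) else
      if p = hi i then b.pair (hi i) else p) id) (σ := b.toCol.sum a) (τ := diagU i)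
      (σ' := (b.turn i).toCol) (τ' := a) ?_ ?_ h
    · exact this
    · rintro (p | p)
      · change SameCircle _ _
          (if p = lo i then b.pair (lo i) else if p = hi i then b.pair (hi i) else p)
          (if b.pair p = lo i then b.pair (lo i) else if b.pair p = hi i then b.pair (hi i)
            else b.pair p)
        by_cases hb : IsCap i b
        · have h0 := hb.pair_hi
          have h00 : b.pair (lo i) = hi i := hb
          have h01 := lo_ne_hi i
          by_cases h1 : p = lo i
          · simp only [h1, h00, if_true, h01.symm, if_false, h0]
            exact ht _ _ (turnFun_hi i _)
          by_cases h2 : p = hi i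
          · simp only [h2, h00, if_true, h01.symm, if_false, h0]
            exact ht _ _ (turnFun_lo i _)
          have h3 := hb.pair_ne h1 h2
          simp only [h1, h2, h3.1, h3.2, if_false]
          refine ht _ _ ?_
          change (b.turn i).pair p = _
          rw [hb.turn_eq]
        · have h0 := pair_lo_ne hb
          by_cases h1 : p = lo i
          · simp only [h1, h0.1, b.pair_ne, if_true, if_false]
            exact hr _
          by_cases h2 : p = hi i
          · simp only [h2, h0.2, b.pair_ne, if_true, if_false, (lo_ne_hi i).symm]
            exact hr _
          by_cases h3 : b.pair p = lo i
          · have : p = b.pair (lo i) := by rw [← h3, b.invol]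
            simp only [h1, h2, h3, if_true, if_false, ← this]
            exact hr _
          by_cases h4 : b.pair p = hi i
          · have : p = b.pair (hi i) := by rw [← h4, b.invol]
            simp only [h1, h2, h4, (lo_ne_hi i).symm, if_true, if_false, ← this]
            exact hr _
          simp only [h1, h2, h3, h4, if_false]
          refine ht _ _ ((isSaddle_turn hb).other p h1 h2 (fun e => h3 ?_) (fun e => h4 ?_))
          · rw [e, toCol_apply, b.invol]
          · rw [e, toCol_apply, b.invol]
      · exact ha p
    · have hlh : SameCircle (b.turn i).toCol a (b.pair (lo i)) (b.pair (hi i)) := by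
        by_cases hb : IsCap i b
        · have h00 : b.pair (lo i) = hi i := hb
          rw [h00, hb.pair_hi]
          exact ht _ _ (turnFun_hi i _)
        · exact ht _ _ (isSaddle_turn hb).htx
      rintro (p | p) <;> by_cases h1 : p = lo i
      · rw [h1, diagU_inl_lo]
        simpa [(lo_ne_hi i).symm] using hlh
      · by_cases h2 : p = hi i
        · rw [h2, diagU_inl_hi]
          have hhl : SameCircle (b.turn i).toCol a (b.pair (hi i)) (b.pair (lo i)) :=
            .symm _ _ hlh
          simpa [(lo_ne_hi i).symm] using hhl
        · rw [diagU_inl h1 h2]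
          simpa only [Sum.elim_inl, Sum.elim_inr, id, h1, h2, if_false] using hr p
      · rw [h1, diagU_inr_lo]
        exact ht _ _ (turnFun_lo i _)
      · by_cases h2 : p = hi i
        · rw [h2, diagU_inr_hi]
          exact ht _ _ (turnFun_hi i _)
        · rw [diagU_inr h1 h2]
          simpa only [Sum.elim_inl, Sum.elim_inr, id, h1, h2, if_false] using hr p
  · intro h
    exact sameCircle_map (f := Sum.inr) (circ_inr_turn i b a) (circ_right b.toCol a (diagU i)) h

/-- The arc of `c` at `i` closes up with the cap of `U_i` to a circle with no further points. -/
theorem circ_inl_cap {c : Crossingless n} (hc : IsCap i c) (a : ColMatching (par n))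
    {x y : Fin (2 * n) ⊕ Fin (2 * n)} (h : circ (c.toCol.sum a) (diagU i) x y) :
    (x = Sum.inl (lo i) ∨ x = Sum.inl (hi i)) ↔ (y = Sum.inl (lo i) ∨ y = Sum.inl (hi i)) := by
  have := sameCircle_const (A := Prop) (s := fun q => q = Sum.inl (lo i) ∨ q = Sum.inl (hi i))
    (σ := c.toCol.sum a) (τ := diagU i) ?_ ?_ h
  · exact this.to_iff
  · rintro (p | p)
    · change (Sum.inl (c.pair p) = _ ∨ Sum.inl (c.pair p) = _) = _
      have h1 : c.pair p = lo i ↔ p = hi i :=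
        ⟨fun e => by rw [← hc, ← e, c.invol], fun e => by rw [e, hc.pair_hi]⟩
      have h2 : c.pair p = hi i ↔ p = lo i :=
        ⟨fun e => by rw [← hc.pair_hi, ← e, c.invol], fun e => by rw [e, hc]⟩
      simp only [Sum.inl.injEq, h1, h2]
      exact propext or_comm
    · simp [ColMatching.sum]
  · have := lo_ne_hi i
    rintro (p | p) <;> by_cases h1 : p = lo i <;> by_cases h2 : p = hi i <;>
      simp_all [diagU, cupCap]

open scoped Classical in
/-- The number of circles of `W(b) U_i a`. -/
theorem numCirc_diagU (b : Crossingless n) (a : ColMatching (par n))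
    {s : Fin (2 * n) ⊕ Fin (2 * n) → Bool} (h1 : ∀ q, s (b.toCol.sum a q) = s q)
    (h2 : ∀ q, s (diagU i q) = s q) (v : Bool) :
    numCirc (b.toCol.sum a) (diagU i) {q | s q = v} =
      numCirc (b.turn i).toCol a {p | s (Sum.inr p) = v} +
        if IsCap i b ∧ s (Sum.inl (lo i)) = v then 1 else 0 := by
  have e := ncard_image_circ Sum.inr (circ (b.turn i).toCol a) (circ (b.toCol.sum a) (diagU i))
    (circ_inr_iff b a) {p | s (Sum.inr p) = v}
  unfold numCirc
  rw [← e]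
  set F := fun p => Quotient.mk (circ (b.toCol.sum a) (diagU i)) p
  have hs : ∀ x y, circ (b.toCol.sum a) (diagU i) x y → s x = s y := fun x y h =>
    sameCircle_const h1 h2 h
  -- A circle either is the closed top circle at `i` or reaches the bottom.
  have hcov : ∀ q, s q = v → (IsCap i b ∧ (q = Sum.inl (lo i) ∨ q = Sum.inl (hi i))) ∨
      F q ∈ F '' (Sum.inr '' {p | s (Sum.inr p) = v}) := by
    have key : ∀ x y, circ (b.toCol.sum a) (diagU i) x (Sum.inr y) → s x = v →
        F x ∈ F '' (Sum.inr '' {p | s (Sum.inr p) = v}) := fun x y h hx =>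
      ⟨Sum.inr y, ⟨y, (hs _ _ h).symm.trans hx, rfl⟩, (Quotient.sound h).symm⟩
    rintro (q | q) hq
    · by_cases q1 : q = lo i ∨ q = hi i
      · by_cases hb : IsCap i b
        · exact Or.inl ⟨hb, by simpa using q1⟩
        · have h3 : b.pair q ≠ lo i ∧ b.pair q ≠ hi i := by
            rcases q1 with rfl | rfl
            · exact ⟨b.pair_ne _, (pair_lo_ne hb).1⟩
            · exact ⟨(pair_lo_ne hb).2, b.pair_ne _⟩
          exact Or.inr (key _ _ ((circ _ _).trans (circ_left b.toCol a (diagU i) q)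
            (circ_diag (diagU_inl h3.1 h3.2))) hq)
      · exact Or.inr (key _ _ (circ_diag (diagU_inl (fun h => q1 (Or.inl h))
          fun h => q1 (Or.inr h))) hq)
    · exact Or.inr ⟨_, ⟨q, hq, rfl⟩, rfl⟩
  have hsub : F '' (Sum.inr '' {p | s (Sum.inr p) = v}) ⊆ F '' {q | s q = v} := by
    refine Set.image_mono ?_
    rintro _ ⟨p, hp, rfl⟩
    exact hp
  have hlh : F (Sum.inl (hi i)) = F (Sum.inl (lo i)) := Quotient.sound (circ_diag diagU_inl_hi)
  split_ifs with hb
  · obtain ⟨hb, hv⟩ := hb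
    have e2 : F '' {q | s q = v} = insert (F (Sum.inl (lo i)))
        (F '' (Sum.inr '' {p | s (Sum.inr p) = v})) := by
      apply Set.Subset.antisymm
      · rintro _ ⟨q, hq, rfl⟩
        rcases hcov q hq with ⟨-, rfl | rfl⟩ | h
        · exact Set.mem_insert _ _
        · rw [hlh]; exact Set.mem_insert _ _
        · exact Or.inr h
      · exact Set.insert_subset ⟨_, hv, rfl⟩ hsub
    rw [e2, Set.ncard_insert_of_notMem _ (Set.toFinite _)]
    rintro ⟨_, ⟨p, _, rfl⟩, hp⟩
    have := (circ_inl_cap hb a (Quotient.exact hp)).2 (Or.inl rfl)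
    simp at this
  · rw [add_zero]
    congr 1
    refine Set.Subset.antisymm ?_ hsub
    rintro _ ⟨q, hq, rfl⟩
    rcases hcov q hq with ⟨h3, h4⟩ | h
    · refine absurd ⟨h3, ?_⟩ hb
      rcases h4 with rfl | rfl
      · exact hq
      · rw [← hq]
        exact hs _ _ (circ_diag (diagU_inl_lo i))
    · exact h

theorem diagU_swap (q : Fin (2 * n) ⊕ Fin (2 * n)) : diagU i q.swap = (diagU i q).swap := by
  rcases q with q | q <;> by_cases h1 : q = lo i <;> by_cases h2 : q = hi i <;>
    simp [diagU, cupCap, h1, h2, (lo_ne_hi i).symm]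

/-- `U_i` is symmetric under reflection. -/
theorem numCirc_swap (b a : ColMatching (par n)) (s : Fin (2 * n) ⊕ Fin (2 * n) → Bool)
    (v : Bool) : numCirc (b.sum a) (diagU i) {q | s q = v} =
      numCirc (a.sum b) (diagU i) {q | s q.swap = v} := by
  have h : ∀ b a : ColMatching (par n), ∀ x y, circ (a.sum b) (diagU i) x y →
      circ (b.sum a) (diagU i) x.swap y.swap := fun b a x y h => by
    refine sameCircle_map (f := Sum.swap) ?_ ?_ h
    · rintro (p | p)
      · exact circ_right b a (diagU i) p
      · exact circ_left b a (diagU i) p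
    · intro p
      exact circ_diag (diagU_swap p)
  have e := ncard_image_circ Sum.swap (circ (a.sum b) (diagU i)) (circ (b.sum a) (diagU i))
    (fun x y => ⟨fun hh => by simpa using h a b _ _ hh, h b a x y⟩) {q | s q.swap = v}
  unfold numCirc
  rw [← e]
  congr 2
  ext q
  exact ⟨fun hq => ⟨q.swap, by simpa using hq, by simp⟩, by rintro ⟨p, hp, rfl⟩; exact hp⟩

theorem const_swap {b a : ColMatching (par n)} {s : Fin (2 * n) ⊕ Fin (2 * n) → Bool}
    (h1 : ∀ q, s (b.sum a q) = s q) (q : Fin (2 * n) ⊕ Fin (2 * n)) :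
    s (Sum.swap (a.sum b q)) = s q.swap := by
  rcases q with q | q
  · exact h1 (Sum.inr q)
  · exact h1 (Sum.inl q)

open scoped Classical in
theorem numCirc_diagU' (b : Crossingless n) (a : ColMatching (par n))
    {s : Fin (2 * n) ⊕ Fin (2 * n) → Bool} (h1 : ∀ q, s (a.sum b.toCol q) = s q)
    (h2 : ∀ q, s (diagU i q) = s q) (v : Bool) :
    numCirc (a.sum b.toCol) (diagU i) {q | s q = v} =
      numCirc (b.turn i).toCol a {p | s (Sum.inl p) = v} +
        if IsCap i b ∧ s (Sum.inr (lo i)) = v then 1 else 0 := by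
  rw [numCirc_swap]
  exact numCirc_diagU (s := s ∘ Sum.swap) b a (const_swap h1)
    (fun q => by rw [Function.comp_apply, ← diagU_swap, h2]; rfl) v

/-- The number of circles of `W(u_i b) b`. -/
theorem numCirc_turn {b : Crossingless n} (hb : ¬ IsCap i b) {s : Fin (2 * n) → Bool}
    (h1 : ∀ p, s (b.toCol p) = s p) (h2 : ∀ p, s ((b.turn i).toCol p) = s p) (v : Bool) :
    numCirc b.toCol b.toCol {p | s p = v} =
      numCirc b.toCol (b.turn i).toCol {p | s p = v} + if s (lo i) = v then 1 else 0 := by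
  refine (saddle_numCirc b.toCol.isMatching b.toCol.isMatching (b.turn i).toCol.isMatching
    (isSaddle_turn hb) (by rw [par_hi]; cases par n (lo i) <;> simp) hb s h1 h1 h2 v).2 ?_
  intro h
  -- Each circle of `W(b)b` contains only one arc of `b`, so `lo i` and `hi i` lie on different
  -- circles and the saddle merges them.
  have key : ∀ x y, SameCircle b.toCol b.toCol x y → y = x ∨ y = b.pair x := by
    intro x y hxy
    induction hxy with
    | rel a b h => rcases h with rfl | rfl <;> simp [toCol_apply]
    | refl => simp
    | symm a c _ ih => rcases ih with rfl | rfl <;> simp [b.invol]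
    | trans a c d _ _ ih ih' =>
      rcases ih with rfl | rfl <;> rcases ih' with rfl | rfl <;> simp [b.invol]
  rcases key _ _ h with h | h
  · exact lo_ne_hi i h.symm
  · exact hb h.symm

/-- The number of circles of `W(b) U_i a`, at a function which takes the same value at the top and
at the bottom. -/
theorem numCirc_diagU_fold (b a : ColMatching (par n)) {s : Fin (2 * n) → Bool}
    (h1 : ∀ p, s (b p) = s p) (h2 : ∀ p, s (a p) = s p) (h : s (hi i) = s (lo i)) (v : Bool) :
    (SameCircle (b.sum a) (diagU i) (Sum.inl (lo i)) (Sum.inr (lo i)) →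
      numCirc b a {p | s p = v} = numCirc (b.sum a) (diagU i) {q | Sum.elim s s q = v} +
        if s (lo i) = v then 1 else 0) ∧
    (¬ SameCircle (b.sum a) (diagU i) (Sum.inl (lo i)) (Sum.inr (lo i)) →
      numCirc (b.sum a) (diagU i) {q | Sum.elim s s q = v} =
        numCirc b a {p | s p = v} + if s (lo i) = v then 1 else 0) := by
  have hsad := saddle_numCirc (b.sum a).isMatching (diagU i).isMatching isMatching_swap
    (isSaddle_diagU i) (by simp [dcol]) (by simp [diagU, cupCap]) (Sum.elim s s)
    ((sum_const_iff b a _).2 ⟨h1, h2⟩) (const_diagU i s h) (by rintro (p | p) <;> rfl) v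
  have hun := numCirc_stage_univ b b a s v
  rw [stage_univ] at hun
  change numCirc (b.sum a) Sum.swap _ = _ at hun
  rwa [hun] at hsad

theorem not_sameCircle_cap {c : Crossingless n} (hc : IsCap i c) (a : ColMatching (par n)) :
    ¬ SameCircle (c.toCol.sum a) (diagU i) (Sum.inl (lo i)) (Sum.inr (lo i)) := fun h => by
  simpa using (circ_inl_cap hc a h).1 (Or.inl rfl)

theorem sameCircle_of_not_isCap {b : Crossingless n} (hb : ¬ IsCap i b) :
    SameCircle (b.toCol.sum b.toCol) (diagU i) (Sum.inl (lo i)) (Sum.inr (lo i)) :=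
  (circ _ _).trans (circ_left b.toCol b.toCol (diagU i) _) ((circ _ _).trans
    (circ_diag (diagU_inl (b.pair_ne _) (pair_lo_ne hb).1))
    ((circ _ _).symm (circ_right b.toCol b.toCol (diagU i) _)))

end CountU

/-! ### Contraction factors for closures of `U_i`. -/

section EpsU

/-- The Euler characteristic count determines the exponents in `ev_eps`, so it suffices to exhibit a
solution. -/
theorem ev_eps_of {P : Type} [Fintype P] {col : P → Bool} {σ τ ρ : ColMatching col}
    {s : P → Bool} (h1 : ∀ p, s (σ p) = s p) (h2 : ∀ p, s (ρ p) = s p) (h3 : ∀ p, s (τ p) = s p)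
    (e : Bool → ℕ)
    (h : ∀ v, 4 * e v + 2 * numCirc σ τ {p | s p = v} + 2 * numCirc τ ρ {p | s p = v} =
        2 * numCirc σ ρ {p | s p = v} + {p | s p = v}.ncard) :
    ev s (eps σ τ ρ) = ∏ v, hval v ^ e v := by
  obtain ⟨e', he, hv⟩ := ev_eps σ.isMatching τ.isMatching ρ.isMatching s h1 h2 h3
  have : e' = e := by
    funext v
    have := h v
    have := hv v
    omega
  rw [he, this]

theorem ev_eps_one {P : Type} [Fintype P] {col : P → Bool} {σ τ ρ : ColMatching col}
    {s : P → Bool} (h1 : ∀ p, s (σ p) = s p) (h2 : ∀ p, s (ρ p) = s p) (h3 : ∀ p, s (τ p) = s p)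
    (h : ∀ v, 2 * numCirc σ τ {p | s p = v} + 2 * numCirc τ ρ {p | s p = v} =
        2 * numCirc σ ρ {p | s p = v} + {p | s p = v}.ncard) : ev s (eps σ τ ρ) = 1 := by
  rw [ev_eps_of h1 h2 h3 0 fun v => by simpa using h v]
  simp

variable {n : ℕ} {i : Fin (2 * n - 1)}

theorem const_lo_hi {s : Fin (2 * n) ⊕ Fin (2 * n) → Bool} (h : ∀ q, s (diagU i q) = s q) :
    s (Sum.inl (hi i)) = s (Sum.inl (lo i)) ∧ s (Sum.inr (hi i)) = s (Sum.inr (lo i)) := by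
  have h1 := h (Sum.inl (lo i))
  have h2 := h (Sum.inr (lo i))
  rw [diagU_inl_lo] at h1
  rw [diagU_inr_lo] at h2
  exact ⟨h1, h2⟩

theorem const_inl_inr {s : Fin (2 * n) ⊕ Fin (2 * n) → Bool} (h : ∀ q, s (diagU i q) = s q)
    {p : Fin (2 * n)} (h1 : p ≠ lo i) (h2 : p ≠ hi i) : s (Sum.inr p) = s (Sum.inl p) := by
  rw [← h, diagU_inr h1 h2]

/-- Away from `i` and `i + 1`, the vertical segments carry the condition from the top to the bottom.
-/
theorem const_cap_inr {c : Crossingless n} (hc : IsCap i c)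
    {s : Fin (2 * n) ⊕ Fin (2 * n) → Bool} (h1 : ∀ p, s (Sum.inl (c.toCol p)) = s (Sum.inl p))
    (h2 : ∀ q, s (diagU i q) = s q) (p : Fin (2 * n)) :
    s (Sum.inr (c.toCol p)) = s (Sum.inr p) := by
  rw [toCol_apply]
  by_cases h3 : p = lo i
  · rw [h3, hc, (const_lo_hi h2).2]
  by_cases h4 : p = hi i
  · rw [h4, hc.pair_hi, (const_lo_hi h2).2]
  have := hc.pair_ne h3 h4
  rw [const_inl_inr h2 h3 h4, const_inl_inr h2 this.1 this.2]
  exact h1 p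

theorem const_cap_inl {c : Crossingless n} (hc : IsCap i c)
    {s : Fin (2 * n) ⊕ Fin (2 * n) → Bool} (h1 : ∀ p, s (Sum.inr (c.toCol p)) = s (Sum.inr p))
    (h2 : ∀ q, s (diagU i q) = s q) (p : Fin (2 * n)) :
    s (Sum.inl (c.toCol p)) = s (Sum.inl p) :=
  const_cap_inr (s := s ∘ Sum.swap) hc h1
    (fun q => by rw [Function.comp_apply, ← diagU_swap, h2]; rfl) p

/-- The circle counts leave exponent zero, which means that the contraction with the generator
involves only mergings. -/
theorem ev_eps_cap_right {c : Crossingless n} (hc : IsCap i c) (a : ColMatching (par n))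
    {s : Fin (2 * n) ⊕ Fin (2 * n) → Bool} (h1 : ∀ q, s (c.toCol.sum a q) = s q)
    (h2 : ∀ q, s (diagU i q) = s q) :
    ev s (eps (c.toCol.sum a) (c.toCol.sum c.toCol) (diagU i)) = 1 := by
  obtain ⟨h3, h4⟩ := (sum_const_iff _ _ s).1 h1
  have h5 := const_cap_inr hc h3 h2
  have h6 := (sum_const_iff c.toCol c.toCol s).2 ⟨h3, h5⟩
  refine ev_eps_one h1 h2 h6 fun v => ?_
  have e1 := numCirc_diagU c a h1 h2 v
  have e2 := numCirc_diagU c c.toCol h6 h2 v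
  have e3 := two_mul_numCirc_self c.toCol (fun p => s (Sum.inl p)) h3 v
  have e4 := two_mul_numCirc_self c.toCol (fun p => s (Sum.inr p)) h5 v
  rw [hc.turn_eq] at e1 e2
  rw [numCirc_closed, ncard_sum, numCirc_comm a c.toCol]
  omega

theorem ev_eps_cap_left {c : Crossingless n} (hc : IsCap i c) (b : ColMatching (par n))
    {s : Fin (2 * n) ⊕ Fin (2 * n) → Bool} (h1 : ∀ q, s (b.sum c.toCol q) = s q)
    (h2 : ∀ q, s (diagU i q) = s q) :
    ev s (eps (b.sum c.toCol) (c.toCol.sum c.toCol) (diagU i)) = 1 := by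
  obtain ⟨h3, h4⟩ := (sum_const_iff _ _ s).1 h1
  have h5 := const_cap_inl hc h4 h2
  have h6 := (sum_const_iff c.toCol c.toCol s).2 ⟨h5, h4⟩
  refine ev_eps_one h1 h2 h6 fun v => ?_
  have e1 := numCirc_diagU' c b h1 h2 v
  have e2 := numCirc_diagU' c c.toCol h6 h2 v
  have e3 := two_mul_numCirc_self c.toCol (fun p => s (Sum.inl p)) h5 v
  have e4 := two_mul_numCirc_self c.toCol (fun p => s (Sum.inr p)) h4 v
  rw [hc.turn_eq] at e1 e2
  rw [numCirc_closed, ncard_sum, numCirc_comm b c.toCol]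
  omega

theorem crossingless_turn_turn (b : Crossingless n) : (b.turn i).turn i = b.turn i :=
  (isCap_turn i b).turn_eq

/-- Here the closed top circle is merged into the rest and nothing splits off. -/
theorem ev_eps_turn {b : Crossingless n} (hb : ¬ IsCap i b) (a : ColMatching (par n))
    {s : Fin (2 * n) ⊕ Fin (2 * n) → Bool} (h1 : ∀ q, s (b.toCol.sum a q) = s q)
    (h2 : ∀ q, s (diagU i q) = s q) :
    ev s (eps (b.toCol.sum a) ((b.turn i).toCol.sum a) (diagU i)) = 1 := by
  obtain ⟨h3, h4⟩ := (sum_const_iff _ _ s).1 h1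
  have hl := (const_lo_hi h2).1
  have h5 : ∀ p, s (Sum.inl ((b.turn i).toCol p)) = s (Sum.inl p) := fun p => by
    rw [toCol_apply, turn_pair]
    rcases turnFun_cases i b p with ⟨h, e⟩ | ⟨h, e⟩ | ⟨h, -, -, e⟩ | ⟨h, -, -, e⟩ |
      ⟨-, -, -, -, e⟩ <;> rw [e]
    · rw [h, hl]
    · rw [h, hl]
    · rw [h]; exact (h3 _).trans (hl.trans (h3 _).symm)
    · rw [h]; exact (h3 _).trans (hl.symm.trans (h3 _).symm)
    · exact h3 p
  have h6 := (sum_const_iff (b.turn i).toCol a s).2 ⟨h5, h4⟩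
  refine ev_eps_one h1 h2 h6 fun v => ?_
  have e1 := numCirc_diagU b a h1 h2 v
  have e2 := numCirc_diagU (b.turn i) a h6 h2 v
  have e3 := two_mul_numCirc_self b.toCol (fun p => s (Sum.inl p)) h3 v
  have e4 := two_mul_numCirc_self a (fun p => s (Sum.inr p)) h4 v
  have e5 := numCirc_turn (s := fun p => s (Sum.inl p)) hb h3 h5 v
  simp only [crossingless_turn_turn, isCap_turn, hb, true_and, false_and, if_false] at e1 e2
  rw [numCirc_closed, ncard_sum]
  omega

/-- In the reverse direction the top circle splits off once, which gives the comultiplication factor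
of that circle and its neighbour. If `s` is not constant along `b`, both sides vanish. -/
theorem ev_eps_turn' {b : Crossingless n} (hb : ¬ IsCap i b) (a : ColMatching (par n))
    {s : Fin (2 * n) ⊕ Fin (2 * n) → Bool} (h1 : ∀ q, s ((b.turn i).toCol.sum a q) = s q)
    (h2 : ∀ q, s (diagU i q) = s q) :
    ev s (eps ((b.turn i).toCol.sum a) (b.toCol.sum a) (diagU i)) =
      ev s (MvPolynomial.X (Sum.inl (lo i)) + MvPolynomial.X (Sum.inl (b.pair (lo i)))) := by
  obtain ⟨h3, h4⟩ := (sum_const_iff _ _ s).1 h1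
  have hl := (const_lo_hi h2).1
  by_cases h5 : ∀ p, s (Sum.inl (b.toCol p)) = s (Sum.inl p)
  · have h6 := (sum_const_iff b.toCol a s).2 ⟨h5, h4⟩
    rw [ev_eps_of h1 h2 h6 (fun v => if s (Sum.inl (lo i)) = v then 1 else 0) fun v => ?_]
    · rw [map_add, ev_X, ev_X, ← toCol_apply, h5]
      cases s (Sum.inl (lo i)) <;> simp [hval] <;> ring
    · have e1 := numCirc_diagU b a h6 h2 v
      have e2 := numCirc_diagU (b.turn i) a h1 h2 v
      have e3 := two_mul_numCirc_self b.toCol (fun p => s (Sum.inl p)) h5 v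
      have e4 := two_mul_numCirc_self a (fun p => s (Sum.inr p)) h4 v
      have e5 := numCirc_turn (s := fun p => s (Sum.inl p)) hb h5 h3 v
      simp only [crossingless_turn_turn, isCap_turn, hb, true_and, false_and, if_false] at e1 e2
      rw [numCirc_closed, ncard_sum, numCirc_comm (b.turn i).toCol b.toCol]
      split_ifs at * <;> omega
  · rw [ev_eps_eq_zero ((b.turn i).toCol.sum a).isMatching (b.toCol.sum a).isMatching
      (diagU i).isMatching s h1 h2 fun h => h5 ((sum_const_iff b.toCol a s).1 h).1]
    -- As `s` is constant along the arcs of `b.turn i`, it can only fail on the two arcs of `b` at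
    -- `lo i` and `hi i`, and it fails on both at once.
    have h6 : s (Sum.inl (b.pair (lo i))) ≠ s (Sum.inl (lo i)) := fun h7 => h5 fun p => by
      have h8 : s (Sum.inl (b.pair (hi i))) = s (Sum.inl (b.pair (lo i))) := by
        have := h3 (b.pair (lo i))
        rwa [show (b.turn i).toCol (b.pair (lo i)) = b.pair (hi i) from
          (isSaddle_turn hb).htx] at this
      rw [toCol_apply]
      have h9 := h3 p
      rw [toCol_apply, turn_pair] at h9
      rcases turnFun_cases i b p with ⟨h, e⟩ | ⟨h, e⟩ | ⟨h, -, -, e⟩ | ⟨h, -, -, e⟩ |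
        ⟨-, -, -, -, e⟩
      · rw [h, h7]
      · rw [h, h8, h7, hl]
      · rw [h, b.invol, h7]
      · rw [h, b.invol, h8, h7, hl]
      · rwa [e] at h9
    rw [map_add, ev_X, ev_X]
    revert h6
    cases s (Sum.inl (lo i)) <;> cases s (Sum.inl (b.pair (lo i))) <;> simp

end EpsU

/-! ### Splitting off the top circle by dual numbers. -/

section RingHoms

variable {n : ℕ} {i : Fin (2 * n - 1)}

open TrivSqZeroExt

/-- The ring homomorphism between the rings of two 1-manifolds which is induced by a map on
points. -/
noncomputable def pointMap {P Q : Type} {σ τ : P → P} {σ' τ' : Q → Q} (f : P → Q)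
    (h1 : ∀ p, SameCircle σ' τ' (f p) (f (σ p))) (h2 : ∀ p, SameCircle σ' τ' (f p) (f (τ p))) :
    Space σ τ →+* Space σ' τ' :=
  Ideal.quotientMap _ (MvPolynomial.rename f).toRingHom (by
    refine circleIdeal_le (fun p => ?_) (fun p => ?_) (fun p => ?_)
    · simpa using X_sq_mem σ' τ' (f p)
    · simpa using X_sub_X_mem (h1 p)
    · simpa using X_sub_X_mem (h2 p))

theorem pointMap_cls {P Q : Type} {σ τ : P → P} {σ' τ' : Q → Q} {f : P → Q}
    (h1 : ∀ p, SameCircle σ' τ' (f p) (f (σ p))) (h2 : ∀ p, SameCircle σ' τ' (f p) (f (τ p)))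
    (g : MvPolynomial P ℤ) :
    pointMap f h1 h2 (cls σ τ g) = cls σ' τ' (MvPolynomial.rename f g) := rfl

theorem cls_X_eq {P : Type} {σ τ : P → P} {p q : P} (h : SameCircle σ τ p q) :
    cls σ τ (MvPolynomial.X p) = cls σ τ (MvPolynomial.X q) :=
  Ideal.Quotient.eq.2 (X_sub_X_mem h)

theorem cls_X_mul_self {P : Type} (σ τ : P → P) (p : P) :
    cls σ τ (MvPolynomial.X p) * cls σ τ (MvPolynomial.X p) = 0 := by
  have := Ideal.Quotient.eq_zero_iff_mem.2 (X_sq_mem σ τ p)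
  rwa [sq, map_mul] at this

theorem cls_induction {P : Type} {σ τ : P → P} {p : Space σ τ → Prop} (h0 : p 0) (h1 : p 1)
    (hneg : ∀ x, p x → p (-x))
    (hadd : ∀ x y, p x → p y → p (x + y))
    (hX : ∀ x q, p x → p (x * cls σ τ (MvPolynomial.X q))) (x : Space σ τ) : p x := by
  obtain ⟨f, rfl⟩ := Ideal.Quotient.mk_surjective x
  induction f using MvPolynomial.induction_on with
  | C k =>
    rw [show (MvPolynomial.C k : MvPolynomial P ℤ) = (k : MvPolynomial P ℤ) from
      (map_intCast MvPolynomial.C k), map_intCast]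
    induction k with
    | zero => simpa using h0
    | succ k ih => push_cast at *; exact hadd _ _ ih h1
    | pred k ih =>
      push_cast at *
      rw [sub_eq_add_neg]
      exact hadd _ _ ih (hneg _ h1)
  | add f g hf hg => rw [map_add]; exact hadd _ _ hf hg
  | mul_X f q hf => rw [map_mul]; exact hX _ q hf

/-- The bottom part of `W(b) U_i a`. -/
noncomputable def low {b c a : ColMatching (par n)}
    (h : ∀ p, SameCircle (b.sum a) (diagU i) (Sum.inr p) (Sum.inr (c p))) :
    Space c a →+* Space (b.sum a) (diagU i) :=
  pointMap Sum.inr h (circ_right b a (diagU i))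

/-- The values of the variables under the projection which splits off the top circle of
`W(c) U_i a`. -/
noncomputable def cutVal (i : Fin (2 * n - 1)) (c a : ColMatching (par n)) :
    Fin (2 * n) ⊕ Fin (2 * n) → DualNumber (Space c a) :=
  Sum.elim (fun p => if p = lo i ∨ p = hi i then DualNumber.eps else
      inl (cls c a (MvPolynomial.X p))) fun p => inl (cls c a (MvPolynomial.X p))

variable (i) in
/-- The projection which splits off the top circle of `W(c) U_i a`, on polynomials. -/
noncomputable def cutPoly (c a : ColMatching (par n)) :
    MvPolynomial (Fin (2 * n) ⊕ Fin (2 * n)) ℤ →+* DualNumber (Space c a) :=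
  MvPolynomial.eval₂Hom (Int.castRingHom _) (cutVal i c a)

theorem cutPoly_X (c a : ColMatching (par n)) (q : Fin (2 * n) ⊕ Fin (2 * n)) :
    cutPoly i c a (MvPolynomial.X q) = cutVal i c a q := MvPolynomial.eval₂Hom_X' _ _ _

theorem cutPoly_rename_inr (c a : ColMatching (par n)) (f : MvPolynomial (Fin (2 * n)) ℤ) :
    cutPoly i c a (MvPolynomial.rename Sum.inr f) = inl (cls c a f) := by
  have : (cutPoly i c a).comp (MvPolynomial.rename Sum.inr).toRingHom =
      (inlHom (Space c a) (Space c a)).comp (Ideal.Quotient.mk (circleIdeal c a)) := by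
    refine MvPolynomial.ringHom_ext (fun k => ?_) fun p => ?_
    · simp
    · change cutPoly i c a (MvPolynomial.rename Sum.inr (MvPolynomial.X p)) = _
      rw [MvPolynomial.rename_X, cutPoly_X]
      rfl
  exact RingHom.congr_fun this f

/-- The projection which splits off the top circle of `W(c) U_i a`. -/
noncomputable def cut {c : Crossingless n} (hc : IsCap i c) (a : ColMatching (par n)) :
    Space (c.toCol.sum a) (diagU i) →+* DualNumber (Space c.toCol a) :=
  Ideal.Quotient.lift _ (cutPoly i c.toCol a) (by
    change circleIdeal _ _ ≤ RingHom.ker (cutPoly i c.toCol a)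
    have hε : (DualNumber.eps : DualNumber (Space c.toCol a)) ^ 2 = 0 := by
      rw [sq, DualNumber.eps_mul_eps]
    have hsq : ∀ p, (inl (cls c.toCol a (MvPolynomial.X p)) : DualNumber (Space c.toCol a)) ^ 2 =
        0 := fun p => by
      rw [sq, inl_mul_inl, cls_X_mul_self, inl_zero]
    have hX : ∀ p, cls c.toCol a (MvPolynomial.X (c.pair p)) = cls c.toCol a (MvPolynomial.X p) :=
      fun p => (cls_X_eq (.rel _ _ (Or.inl rfl))).symm
    have hX' : ∀ p, cls c.toCol a (MvPolynomial.X (a p)) = cls c.toCol a (MvPolynomial.X p) :=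
      fun p => (cls_X_eq (.rel _ _ (Or.inr rfl))).symm
    have h0 : cls c.toCol a (MvPolynomial.X (hi i)) = cls c.toCol a (MvPolynomial.X (lo i)) := by
      rw [← hX (lo i), hc]
    have hlh := (lo_ne_hi i).symm
    have hcp : c.pair (lo i) = hi i := hc
    refine circleIdeal_le (fun p => ?_) (fun p => ?_) (fun p => ?_)
    · rw [RingHom.mem_ker, map_pow, cutPoly_X]
      rcases p with p | p
      · change (if _ then _ else _) ^ 2 = _
        split_ifs
        · exact hε
        · exact hsq p
      · exact hsq p
    · rw [RingHom.mem_ker, map_sub, cutPoly_X, cutPoly_X, sub_eq_zero]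
      rcases p with p | p
      · change (if _ then _ else _) = if c.pair p = lo i ∨ c.pair p = hi i then _ else
          inl (cls c.toCol a (MvPolynomial.X (c.pair p)))
        by_cases h1 : p = lo i
        · simp [h1, hcp]
        by_cases h2 : p = hi i
        · simp [h2, hc.pair_hi]
        have h3 := hc.pair_ne h1 h2
        simp only [h1, h2, h3.1, h3.2, or_self, if_false, hX]
      · exact congrArg inl (hX' p).symm
    · rw [RingHom.mem_ker, map_sub, cutPoly_X, cutPoly_X, sub_eq_zero]
      rcases p with p | p <;> by_cases h1 : p = lo i <;> by_cases h2 : p = hi i <;>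
        simp_all [cutVal, diagU, cupCap])

theorem cut_cls {c : Crossingless n} (hc : IsCap i c) (a : ColMatching (par n))
    (f : MvPolynomial (Fin (2 * n) ⊕ Fin (2 * n)) ℤ) :
    cut hc a (cls (c.toCol.sum a) (diagU i) f) = cutPoly i c.toCol a f := rfl

/-- Since `x` has square zero, sending the dual unit to `x` is multiplicative. So the right-hand
side is multiplicative in `f` as well, and it suffices to compare variables. -/
theorem eq_fst_add_mul_snd {P S Q : Type*} [CommRing S] [CommRing Q]
    (D : MvPolynomial P ℤ →+* DualNumber S) (l : S →+* Q) (x : Q) (hx : x * x = 0)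
    (π : MvPolynomial P ℤ →+* Q) (h : ∀ q, π (MvPolynomial.X q) =
      l (D (MvPolynomial.X q)).fst + x * l (D (MvPolynomial.X q)).snd) (f : MvPolynomial P ℤ) :
    π f = l (D f).fst + x * l (D f).snd := by
  induction f using MvPolynomial.induction_on with
  | C k =>
    rw [show (MvPolynomial.C k : MvPolynomial P ℤ) = (k : MvPolynomial P ℤ) from
      (map_intCast MvPolynomial.C k), map_intCast, map_intCast]
    simp
  | add f g hf hg => rw [map_add, map_add, hf, hg, fst_add, snd_add, map_add, map_add]; ring
  | mul_X f q hf =>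
    rw [map_mul, map_mul, hf, h, fst_mul, snd_mul]
    simp only [map_mul, map_add, smul_eq_mul, MulOpposite.smul_eq_mul_unop, MulOpposite.unop_op]
    linear_combination (l (D f).snd * l (D (MvPolynomial.X q)).snd) * hx

theorem low_cls {b c a : ColMatching (par n)}
    (h : ∀ p, SameCircle (b.sum a) (diagU i) (Sum.inr p) (Sum.inr (c p)))
    (f : MvPolynomial (Fin (2 * n)) ℤ) :
    low h (cls c a f) = cls (b.sum a) (diagU i) (MvPolynomial.rename Sum.inr f) := rfl

/-- Every variable is carried by a bottom point, except at the top points `i` and `i + 1`, where it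
is the variable of `lo i`. This holds whether or not the top circle is closed. -/
theorem cls_eq_low {b c a : ColMatching (par n)}
    (h : ∀ p, SameCircle (b.sum a) (diagU i) (Sum.inr p) (Sum.inr (c p)))
    (f : MvPolynomial (Fin (2 * n) ⊕ Fin (2 * n)) ℤ) :
    cls (b.sum a) (diagU i) f = low h (cutPoly i c a f).fst +
      cls (b.sum a) (diagU i) (MvPolynomial.X (Sum.inl (lo i))) *
        low h (cutPoly i c a f).snd := by
  refine eq_fst_add_mul_snd _ _ _ (cls_X_mul_self _ _ _) (Ideal.Quotient.mk _) (fun q => ?_) f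
  rw [cutPoly_X]
  have h1 : ∀ p, low h (cls c a (MvPolynomial.X p)) =
      cls (b.sum a) (diagU i) (MvPolynomial.X (Sum.inr p)) := fun p => by
    rw [low_cls, MvPolynomial.rename_X]
  rcases q with p | p
  · by_cases h2 : p = lo i
    · simp [cutVal, h2]
    by_cases h3 : p = hi i
    · rw [h3]
      refine (cls_X_eq (circ_diag diagU_inl_hi)).trans ?_
      simp [cutVal]
    · simp only [cutVal, Sum.elim_inl, h2, h3, or_self, if_false, fst_inl, snd_inl, map_zero,
        mul_zero, add_zero, h1]
      exact cls_X_eq (circ_diag (diagU_inl h2 h3))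
  · simp [cutVal, h1]

theorem circ_cap_inr {c : Crossingless n} (hc : IsCap i c) (a : ColMatching (par n))
    (p : Fin (2 * n)) :
    SameCircle (c.toCol.sum a) (diagU i) (Sum.inr p) (Sum.inr (c.toCol p)) := by
  have := circ_inr_turn i c a p
  rwa [hc.turn_eq] at this

theorem circ_cap_inl {c : Crossingless n} (hc : IsCap i c) (b : ColMatching (par n))
    (p : Fin (2 * n)) :
    SameCircle (b.sum c.toCol) (diagU i) (Sum.inl p) (Sum.inl (c.toCol p)) := by
  refine sameCircle_map (f := Sum.swap) ?_ ?_ (circ_cap_inr hc b p)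
  · rintro (p | p)
    · exact circ_right b c.toCol (diagU i) p
    · exact circ_left b c.toCol (diagU i) p
  · intro p
    exact circ_diag (diagU_swap p)

/-- The bottom part of `W(c) U_i a`, where `c` contains a cap. -/
noncomputable abbrev capLow {c : Crossingless n} (hc : IsCap i c) (a : ColMatching (par n)) :
    Space c.toCol a →+* Space (c.toCol.sum a) (diagU i) := low (circ_cap_inr hc a)

/-- The top part of `W(b) U_i c`, where `c` contains a cap. -/
noncomputable def capTop {c : Crossingless n} (hc : IsCap i c) (b : ColMatching (par n)) :
    Space b c.toCol →+* Space (b.sum c.toCol) (diagU i) :=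
  pointMap Sum.inl (circ_left b c.toCol (diagU i)) (circ_cap_inl hc b)

theorem capTop_cls {c : Crossingless n} (hc : IsCap i c) (b : ColMatching (par n))
    (f : MvPolynomial (Fin (2 * n)) ℤ) : capTop hc b (cls b c.toCol f) =
      cls (b.sum c.toCol) (diagU i) (MvPolynomial.rename Sum.inl f) := rfl

theorem cut_low {c : Crossingless n} (hc : IsCap i c) (a : ColMatching (par n))
    (y : Space c.toCol a) : cut hc a (capLow hc a y) = inl y := by
  obtain ⟨f, rfl⟩ := Ideal.Quotient.mk_surjective y
  exact cutPoly_rename_inr _ _ _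

theorem cut_X {c : Crossingless n} (hc : IsCap i c) (a : ColMatching (par n)) :
    cut hc a (cls (c.toCol.sum a) (diagU i) (MvPolynomial.X (Sum.inl (lo i)))) =
      DualNumber.eps := by
  rw [cut_cls, cutPoly_X]
  exact if_pos (Or.inl rfl)

/-- With `cut_low` and `cut_X` this exhibits the group as the dual numbers over the bottom part: the
closed top circle contributes a tensor factor `𝒜`. -/
theorem eq_low_cut {c : Crossingless n} (hc : IsCap i c) (a : ColMatching (par n))
    (v : Space (c.toCol.sum a) (diagU i)) : v = capLow hc a (cut hc a v).fst +
      cls (c.toCol.sum a) (diagU i) (MvPolynomial.X (Sum.inl (lo i))) *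
        capLow hc a (cut hc a v).snd := by
  obtain ⟨f, rfl⟩ := Ideal.Quotient.mk_surjective v
  exact cls_eq_low _ f

end RingHoms

/-! ### Actions of diagonal elements. -/

section ModuleFormulas

variable {n : ℕ} {T : ColMatching (dcol (par n))}

theorem contract_cls_left {P : Type} [Fintype P] {col : P → Bool} (σ ρ : ColMatching col)
    (f : MvPolynomial P ℤ) (w : Space σ ρ) : contract σ σ ρ (cls σ σ f) w = cls σ ρ f * w := by
  have : cls σ σ f = f • cls σ σ 1 := (congrArg (cls σ σ) (mul_one f)).symm
  rw [this, map_smul, LinearMap.smul_apply, contract_one_left]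
  obtain ⟨g, rfl⟩ := Ideal.Quotient.mk_surjective w
  rfl

theorem smul_apply_of_diag {y : ArcRing n} {c : Crossingless n}
    (h : ∀ b, b ≠ c → y c b = 0) {f : MvPolynomial (Fin (2 * n)) ℤ}
    (hf : y c c = cls c.toCol c.toCol f) (v : TangleBimod T) (a : Crossingless n) :
    (y • v) c a = cls (c.toCol.sum a.toCol) T (MvPolynomial.rename Sum.inl f) * v c a := by
  rw [TangleBimod.smul_apply, Finset.sum_eq_single c]
  · rw [hf, inL_cls, contract_cls_left]
  · intro b _ hb
    rw [h b hb, map_zero, map_zero, LinearMap.zero_apply]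
  · simp

theorem op_smul_apply_of_diag {y : ArcRing n} {a : Crossingless n}
    (h : ∀ b, b ≠ a → y b a = 0) {f : MvPolynomial (Fin (2 * n)) ℤ}
    (hf : y a a = cls a.toCol a.toCol f) (v : TangleBimod T) (c : Crossingless n) :
    (MulOpposite.op y • v) c a =
      cls (c.toCol.sum a.toCol) T (MvPolynomial.rename Sum.inr f) * v c a := by
  rw [TangleBimod.op_smul_apply, Finset.sum_eq_single a]
  · rw [MulOpposite.unop_op, hf, inR_cls, contract_cls_left]
  · intro b _ hb
    rw [MulOpposite.unop_op, h b hb, map_zero, map_zero, LinearMap.zero_apply]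
  · simp

theorem diag_smul_apply (f : MvPolynomial (Fin (2 * n)) ℤ) (v : TangleBimod T)
    (c a : Crossingless n) : (ArcRing.diag f • v) c a =
      cls (c.toCol.sum a.toCol) T (MvPolynomial.rename Sum.inl f) * v c a :=
  smul_apply_of_diag (fun _ hb => ArcRing.diag_ne f hb.symm) (ArcRing.diag_self f c) v a

theorem op_diag_smul_apply (f : MvPolynomial (Fin (2 * n)) ℤ) (v : TangleBimod T)
    (c a : Crossingless n) : (MulOpposite.op (ArcRing.diag f) • v) c a =
      cls (c.toCol.sum a.toCol) T (MvPolynomial.rename Sum.inr f) * v c a :=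
  op_smul_apply_of_diag (fun _ hb => ArcRing.diag_ne f hb) (ArcRing.diag_self f a) v c

end ModuleFormulas

/-! ### The generator of the bimodule of `U_i` and the cap of its top circle. -/

section BubbleU

open TrivSqZeroExt MulOpposite
open scoped Classical

theorem cls_zero {P : Type} (σ τ : P → P) : cls σ τ 0 = 0 := map_zero _

theorem cls_one {P : Type} (σ τ : P → P) : cls σ τ 1 = 1 := map_one _

variable {n : ℕ} (i : Fin (2 * n - 1))

local notation "𝐗" i => (ArcRing.diag (MvPolynomial.X (lo i)) : ArcRing _)

/-- The generator of the bimodule of `U_i`. -/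
noncomputable def capElt : TangleBimod (diagU i) := fun c a =>
  if c = a ∧ IsCap i c then cls _ _ 1 else 0

theorem capElt_self {c : Crossingless n} (hc : IsCap i c) : capElt i c c = cls _ _ 1 :=
  if_pos ⟨rfl, hc⟩

theorem capElt_ne {c a : Crossingless n} (h : c ≠ a) : capElt i c a = 0 :=
  if_neg fun h' => h h'.1

theorem capElt_of_not {c : Crossingless n} (h : ¬ IsCap i c) (a : Crossingless n) :
    capElt i c a = 0 := if_neg fun h' => h h'.2

variable {i}

/-- The contraction with the generator has factor one by `ev_eps_cap_left`, so the entry is merely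
placed on the top part of the diagram. -/
theorem smul_capElt (y : ArcRing n) (c : Crossingless n) {b : Crossingless n} (hb : IsCap i b) :
    (y • capElt i) c b = capTop hb c.toCol (y c b) := by
  rw [TangleBimod.smul_apply, Finset.sum_eq_single b]
  · obtain ⟨f, hf⟩ := Ideal.Quotient.mk_surjective (y c b)
    rw [capElt_self i hb, ← hf, inL_cls, contract_cls, capTop_cls]
    refine cls_eq fun s h1 h2 => ?_
    rw [map_mul, ev_eps_cap_left hb c.toCol h1 h2, mul_one, mul_one]
  · intro b' _ h
    rw [capElt_ne i h, map_zero]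
  · simp

theorem smul_capElt_of_not (y : ArcRing n) (c : Crossingless n) {b : Crossingless n}
    (hb : ¬ IsCap i b) : (y • capElt i) c b = 0 := by
  rw [TangleBimod.smul_apply]
  refine Finset.sum_eq_zero fun b' _ => ?_
  by_cases h : b' = b
  · rw [h, capElt_of_not i hb, map_zero]
  · rw [capElt_ne i h, map_zero]

theorem op_smul_capElt (y : ArcRing n) {c : Crossingless n} (hc : IsCap i c)
    (a : Crossingless n) : (op y • capElt i) c a = capLow hc a.toCol (y c a) := by
  rw [TangleBimod.op_smul_apply, Finset.sum_eq_single c]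
  · obtain ⟨f, hf⟩ := Ideal.Quotient.mk_surjective (y c a)
    rw [unop_op, capElt_self i hc, ← hf, inR_cls, contract_cls, low_cls]
    refine cls_eq fun s h1 h2 => ?_
    rw [map_mul, ev_eps_cap_right hc a.toCol h1 h2, mul_one, mul_one]
  · intro b' _ h
    rw [capElt_ne i h.symm, map_zero]
  · simp

theorem op_smul_capElt_of_not (y : ArcRing n) {c : Crossingless n} (hc : ¬ IsCap i c)
    (a : Crossingless n) : (op y • capElt i) c a = 0 := by
  rw [TangleBimod.op_smul_apply]
  refine Finset.sum_eq_zero fun b' _ => ?_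
  rw [capElt_of_not i hc, map_zero]

theorem alpha_capElt_self {c : Crossingless n} (hc : IsCap i c) :
    alpha i (capElt i) c c = cls _ _ 1 := by
  rw [alpha_apply, capElt_self i hc, saddleMap_cls, saddleFactor, if_neg (not_sameCircle_cap hc _),
    map_one, mul_one]

theorem alpha_capElt_of {c a : Crossingless n} (h : ¬ (c = a ∧ IsCap i c)) :
    alpha i (capElt i) c a = 0 := by
  rw [alpha_apply, capElt, if_neg h, map_zero]

theorem alpha_capElt_self_of_not {c : Crossingless n} (hc : ¬ IsCap i c) :
    alpha i (capElt i) c c = cls _ _ 0 := by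
  rw [alpha_capElt_of fun h => hc h.2, cls_zero]

section

variable {T : ColMatching (dcol (par n))}

theorem alpha_smul_of_isCap {c : Crossingless n} (hc : IsCap i c) (v : TangleBimod T)
    (a : Crossingless n) : (alpha i (capElt i) • v) c a = v c a := by
  rw [smul_apply_of_diag (fun b hb => alpha_capElt_of fun h => hb h.1.symm)
    (alpha_capElt_self hc), map_one, cls_one, one_mul]

theorem alpha_smul_of_not {c : Crossingless n} (hc : ¬ IsCap i c) (v : TangleBimod T)
    (a : Crossingless n) : (alpha i (capElt i) • v) c a = 0 := by
  rw [smul_apply_of_diag (fun b hb => alpha_capElt_of fun h => hb h.1.symm)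
    (alpha_capElt_self_of_not hc), map_zero, cls_zero, zero_mul]

theorem op_alpha_smul_of_isCap {a : Crossingless n} (ha : IsCap i a) (v : TangleBimod T)
    (c : Crossingless n) : (op (alpha i (capElt i)) • v) c a = v c a := by
  rw [op_smul_apply_of_diag (fun b hb => alpha_capElt_of fun h => hb h.1)
    (alpha_capElt_self ha), map_one, cls_one, one_mul]

theorem op_alpha_smul_of_not {a : Crossingless n} (ha : ¬ IsCap i a) (v : TangleBimod T)
    (c : Crossingless n) : (op (alpha i (capElt i)) • v) c a = 0 := by
  rw [op_smul_apply_of_diag (fun b hb => alpha_capElt_of fun h => hb h.1)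
    (alpha_capElt_self_of_not ha), map_zero, cls_zero, zero_mul]

end

theorem alpha_mul_of_isCap {c : Crossingless n} (hc : IsCap i c) (y : ArcRing n)
    (a : Crossingless n) : (alpha i (capElt i) * y) c a = y c a := by
  rw [ArcRing.mul_apply, Finset.sum_eq_single c]
  · rw [alpha_capElt_self hc, contract_one_left]
  · intro b _ hb
    rw [alpha_capElt_of fun h => hb h.1.symm, map_zero, LinearMap.zero_apply]
  · simp

theorem alpha_mul_of_not {c : Crossingless n} (hc : ¬ IsCap i c) (y : ArcRing n)
    (a : Crossingless n) : (alpha i (capElt i) * y) c a = 0 := by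
  rw [ArcRing.mul_apply]
  refine Finset.sum_eq_zero fun b _ => ?_
  rw [alpha_capElt_of fun h => hc h.2, map_zero, LinearMap.zero_apply]

variable (i) in
/-- The cap of the top circle. -/
noncomputable def capFun : TangleBimod (diagU i) →+ ArcRing n :=
  AddMonoidHom.mk' (fun v c a => if hc : IsCap i c then (cut hc a.toCol (v c a)).snd else 0)
    fun v w => by
      ext c a
      change (if hc : IsCap i c then (cut hc a.toCol (v c a + w c a)).snd else 0) =
        (if hc : IsCap i c then (cut hc a.toCol (v c a)).snd else 0) +
          if hc : IsCap i c then (cut hc a.toCol (w c a)).snd else 0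
      split_ifs with hc
      · exact (congrArg TrivSqZeroExt.snd (map_add (cut hc a.toCol) _ _)).trans (snd_add _ _)
      · rw [add_zero]

theorem capFun_of_isCap {c : Crossingless n} (hc : IsCap i c) (v : TangleBimod (diagU i))
    (a : Crossingless n) : capFun i v c a = (cut hc a.toCol (v c a)).snd := dif_pos hc

theorem capFun_of_not {c : Crossingless n} (hc : ¬ IsCap i c) (v : TangleBimod (diagU i))
    (a : Crossingless n) : capFun i v c a = 0 := dif_neg hc

/-- Multiplication by the top circle is multiplication by the dual unit, which moves the first
component to the second. -/
theorem capFun_X {c : Crossingless n} (hc : IsCap i c) (v : TangleBimod (diagU i))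
    (a : Crossingless n) : capFun i ((𝐗 i) • v) c a = (cut hc a.toCol (v c a)).fst := by
  rw [capFun_of_isCap hc, diag_smul_apply, MvPolynomial.rename_X, map_mul, cut_X]
  simp

theorem cap_decomp (v : TangleBimod (diagU i)) : alpha i (capElt i) • v =
    op (capFun i ((𝐗 i) • v)) • capElt i + (𝐗 i) • op (capFun i v) • capElt i := by
  ext c a
  rw [TangleBimod.add_apply, diag_smul_apply]
  by_cases hc : IsCap i c
  · rw [alpha_smul_of_isCap hc, op_smul_capElt _ hc, op_smul_capElt _ hc, capFun_X hc,
      capFun_of_isCap hc, MvPolynomial.rename_X]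
    exact eq_low_cut hc _ _
  · rw [alpha_smul_of_not hc, op_smul_capElt_of_not _ hc, op_smul_capElt_of_not _ hc, mul_zero,
      add_zero]

theorem capFun_alpha_smul (v : TangleBimod (diagU i)) :
    capFun i (alpha i (capElt i) • v) = capFun i v := by
  ext c a
  by_cases hc : IsCap i c
  · rw [capFun_of_isCap hc, capFun_of_isCap hc, alpha_smul_of_isCap hc]
  · rw [capFun_of_not hc, capFun_of_not hc]

theorem capFun_op_smul_capElt (y : ArcRing n) : capFun i (op y • capElt i) = 0 := by
  ext c a
  by_cases hc : IsCap i c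
  · rw [capFun_of_isCap hc, op_smul_capElt _ hc, cut_low, snd_inl, ArcRing.zero_apply]
  · rw [capFun_of_not hc, ArcRing.zero_apply]

theorem capFun_X_op_smul_capElt (y : ArcRing n) :
    capFun i ((𝐗 i) • op y • capElt i) = alpha i (capElt i) * y := by
  ext c a
  by_cases hc : IsCap i c
  · rw [capFun_X hc, op_smul_capElt _ hc, cut_low, fst_inl, alpha_mul_of_isCap hc]
  · rw [capFun_of_not hc, alpha_mul_of_not hc]

theorem alpha_mul_capFun (v : TangleBimod (diagU i)) :
    alpha i (capElt i) * capFun i v = capFun i v := by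
  ext c a
  by_cases hc : IsCap i c
  · rw [alpha_mul_of_isCap hc]
  · rw [alpha_mul_of_not hc, capFun_of_not hc]

/-- Right linearity follows from the decomposition of `v` by right multiples of the generator, where
`capFun` is already known. No contraction has to be compared with `cut`. -/
theorem capFun_op_smul (y : ArcRing n) (v : TangleBimod (diagU i)) :
    capFun i (op y • v) = capFun i v * y := by
  have h : alpha i (capElt i) • op y • v = op (capFun i ((𝐗 i) • v) * y) • capElt i +
      (𝐗 i) • op (capFun i v * y) • capElt i := by
    rw [← Bubble.op_smul_smul, cap_decomp, smul_add, smul_smul, ← op_mul, Bubble.op_smul_smul,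
      smul_smul, ← op_mul]
  rw [← capFun_alpha_smul, h, map_add, capFun_op_smul_capElt, zero_add, capFun_X_op_smul_capElt,
    ← mul_assoc, alpha_mul_capFun]

/-- The subring which is generated by the circles through points outside a set. -/
noncomputable def avoid {P : Type} (σ τ : P → P) (D : Set P) : Subring (Space σ τ) :=
  Subring.closure ((fun p => cls σ τ (MvPolynomial.X p)) '' Dᶜ)

theorem avoid_mono {P : Type} {σ τ : P → P} {D E : Set P} (h : D ⊆ E) :
    avoid σ τ E ≤ avoid σ τ D :=
  Subring.closure_mono (Set.image_mono (Set.compl_subset_compl.2 h))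

theorem mem_avoid_empty {P : Type} {σ τ : P → P} (x : Space σ τ) : x ∈ avoid σ τ ∅ := by
  have hX : ∀ q, cls σ τ (MvPolynomial.X q) ∈ avoid σ τ ∅ := fun q =>
    Subring.subset_closure ⟨q, by simp, rfl⟩
  exact cls_induction (zero_mem _) (one_mem _) (fun x => neg_mem) (fun x y => add_mem)
    (fun x q hx => mul_mem hx (hX q)) x

/-- The dual numbers with components in a subring. -/
def dualSubring {S : Type*} [CommRing S] (R : Subring S) : Subring (DualNumber S) where
  carrier := {x | x.fst ∈ R ∧ x.snd ∈ R}
  mul_mem' {x y} hx hy := by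
    refine ⟨?_, ?_⟩
    · rw [fst_mul]; exact mul_mem hx.1 hy.1
    · rw [snd_mul]; exact add_mem (mul_mem hx.1 hy.2) (mul_mem hx.2 hy.1)
  one_mem' := ⟨by simp, by simp⟩
  add_mem' {x y} hx hy := ⟨add_mem hx.1 hy.1, add_mem hx.2 hy.2⟩
  zero_mem' := ⟨zero_mem R, zero_mem R⟩
  neg_mem' {x} hx := ⟨neg_mem hx.1, neg_mem hx.2⟩

/-- A top point other than `i` and `i + 1` continues to the bottom point of the same index. These
two become the dual unit, so their variables disappear from both components. -/
theorem cut_capTop_mem {c b : Crossingless n} (hc : IsCap i c) (hb : IsCap i b)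
    {D : Set (Fin (2 * n))} {x : Space c.toCol b.toCol} (hx : x ∈ avoid c.toCol b.toCol D) :
    (cut hc b.toCol (capTop hb c.toCol x)).fst ∈ avoid c.toCol b.toCol (D ∪ {lo i, hi i}) ∧
    (cut hc b.toCol (capTop hb c.toCol x)).snd ∈ avoid c.toCol b.toCol (D ∪ {lo i, hi i}) := by
  have : avoid c.toCol b.toCol D ≤ (dualSubring (avoid c.toCol b.toCol (D ∪ {lo i, hi i}))).comap
      ((cut hc b.toCol).comp (capTop hb c.toCol)) := by
    refine Subring.closure_le.2 ?_
    rintro _ ⟨p, hp, rfl⟩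
    change cut hc b.toCol (capTop hb c.toCol (cls _ _ _)) ∈ dualSubring _
    rw [capTop_cls, MvPolynomial.rename_X, cut_cls, cutPoly_X]
    change (if p = lo i ∨ p = hi i then DualNumber.eps else
      inl (cls c.toCol b.toCol (MvPolynomial.X p))) ∈ dualSubring _
    split_ifs with h
    · exact ⟨by simp, by simp⟩
    · refine ⟨Subring.subset_closure ⟨p, ?_, rfl⟩, by simp⟩
      simp only [Set.mem_compl_iff, Set.mem_union, Set.mem_insert_iff, Set.mem_singleton_iff]
      exact not_or.2 ⟨hp, h⟩
  exact this hx

/-- The vertical segments identify the top and bottom copies of all remaining variables. -/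
theorem capTop_eq_capLow {c b : Crossingless n} (hc : IsCap i c) (hb : IsCap i b)
    {x : Space c.toCol b.toCol} (hx : x ∈ avoid c.toCol b.toCol {lo i, hi i}) :
    capTop hb c.toCol x = capLow hc b.toCol x := by
  have : avoid c.toCol b.toCol {lo i, hi i} ≤
      (capTop hb c.toCol).eqLocus (capLow hc b.toCol) := by
    refine Subring.closure_le.2 ?_
    rintro _ ⟨p, hp, rfl⟩
    change capTop hb c.toCol (cls _ _ _) = capLow hc b.toCol (cls _ _ _)
    rw [capTop_cls, low_cls, MvPolynomial.rename_X, MvPolynomial.rename_X]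
    simp only [Set.mem_compl_iff, Set.mem_insert_iff, Set.mem_singleton_iff, not_or] at hp
    exact cls_X_eq (circ_diag (diagU_inl hp.1 hp.2))
  exact this hx

/-- An element with entries which avoid the points `i` and `i + 1` commutes with the generator. -/
theorem smul_capElt_comm {y : ArcRing n}
    (h1 : ∀ c b, IsCap i c → IsCap i b → y c b ∈ avoid c.toCol b.toCol {lo i, hi i})
    (h2 : ∀ c b, IsCap i c → ¬ IsCap i b → y c b = 0)
    (h3 : ∀ c b, ¬ IsCap i c → IsCap i b → y c b = 0) :
    y • capElt i = op y • capElt i := by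
  ext c b
  by_cases hc : IsCap i c <;> by_cases hb : IsCap i b
  · rw [smul_capElt y c hb, op_smul_capElt y hc, capTop_eq_capLow hc hb (h1 c b hc hb)]
  · rw [smul_capElt_of_not y c hb, op_smul_capElt y hc, h2 c b hc hb, map_zero]
  · rw [smul_capElt y c hb, op_smul_capElt_of_not y hc, h3 c b hc hb, map_zero]
  · rw [smul_capElt_of_not y c hb, op_smul_capElt_of_not y hc]

theorem capFun_smul_capElt {c b : Crossingless n} (hc : IsCap i c) (hb : IsCap i b)
    (y : ArcRing n) : capFun i (y • capElt i) c b =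
      (cut hc b.toCol (capTop hb c.toCol (y c b))).snd := by
  rw [capFun_of_isCap hc, smul_capElt y c hb]

theorem capFun_smul_capElt_of_not (c : Crossingless n) {b : Crossingless n} (hb : ¬ IsCap i b)
    (y : ArcRing n) : capFun i (y • capElt i) c b = 0 := by
  by_cases hc : IsCap i c
  · rw [capFun_of_isCap hc, smul_capElt_of_not y c hb, map_zero, snd_zero]
  · rw [capFun_of_not hc]

/-- After capping, the entries no longer involve the points `i` and `i + 1`. -/
theorem capFun_smul_capElt_comm (y : ArcRing n) : op (capFun i (y • capElt i)) • capElt i =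
    capFun i (y • capElt i) • capElt i := by
  refine (smul_capElt_comm (fun c b hc hb => ?_)
    (fun c b _ hb => capFun_smul_capElt_of_not c hb y) fun c b hc _ => capFun_of_not hc _ b).symm
  rw [capFun_smul_capElt hc hb]
  have := (cut_capTop_mem hc hb (mem_avoid_empty (y c b))).2
  rwa [Set.empty_union] at this

end BubbleU

/-! ### Generation of the bimodule of `U_i`. -/

section BubbleUSpan

open TrivSqZeroExt MulOpposite
open scoped Classical

variable {n : ℕ} {i : Fin (2 * n - 1)}

local notation "𝐗" i => (ArcRing.diag (MvPolynomial.X (lo i)) : ArcRing _)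

theorem diag_mul_comm (f : MvPolynomial (Fin (2 * n)) ℤ) (y : ArcRing n) :
    ArcRing.diag f * y = y * ArcRing.diag f := by
  ext c a
  rw [ArcRing.diag_mul_apply, ArcRing.mul_diag_apply]

variable (i) in
/-- The entry of the saddle from `u_i b` to `b`. -/
noncomputable def saddleIn (b : Crossingless n) : ArcRing n := fun c a =>
  if c = b ∧ a = b.turn i ∧ ¬ IsCap i b then cls _ _ 1 else 0

variable (i) in
/-- The entry of the saddle from `b` to `u_i b`. -/
noncomputable def saddleOut (b : Crossingless n) : ArcRing n := fun c a =>
  if c = b.turn i ∧ a = b ∧ ¬ IsCap i b then cls _ _ 1 else 0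

theorem saddleIn_smul {b : Crossingless n} (hb : ¬ IsCap i b) (w : TangleBimod (diagU i))
    (a : Crossingless n) : (saddleIn i b • w) b a = contract (b.toCol.sum a.toCol)
      ((b.turn i).toCol.sum a.toCol) (diagU i) (cls _ _ 1) (w (b.turn i) a) := by
  rw [TangleBimod.smul_apply, Finset.sum_eq_single (b.turn i)]
  · rw [saddleIn, if_pos ⟨rfl, rfl, hb⟩, inL_cls, map_one]
  · intro b' _ h
    rw [saddleIn, if_neg fun h' => h h'.2.1, map_zero, map_zero, LinearMap.zero_apply]
  · simp

theorem saddleIn_smul_of_not {b c : Crossingless n} (h : ¬ (c = b ∧ ¬ IsCap i b))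
    (w : TangleBimod (diagU i)) (a : Crossingless n) : (saddleIn i b • w) c a = 0 := by
  rw [TangleBimod.smul_apply]
  refine Finset.sum_eq_zero fun b' _ => ?_
  rw [saddleIn, if_neg fun h' => h ⟨h'.1, h'.2.2⟩, map_zero, map_zero, LinearMap.zero_apply]

theorem saddleOut_smul {b : Crossingless n} (hb : ¬ IsCap i b) (w : TangleBimod (diagU i))
    (a : Crossingless n) : (saddleOut i b • w) (b.turn i) a =
      contract ((b.turn i).toCol.sum a.toCol) (b.toCol.sum a.toCol) (diagU i) (cls _ _ 1)
        (w b a) := by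
  rw [TangleBimod.smul_apply, Finset.sum_eq_single b]
  · rw [saddleOut, if_pos ⟨rfl, rfl, hb⟩, inL_cls, map_one]
  · intro b' _ h
    rw [saddleOut, if_neg fun h' => h h'.2.1, map_zero, map_zero, LinearMap.zero_apply]
  · simp

theorem contract_capLow {b : Crossingless n} (hb : ¬ IsCap i b) (a : ColMatching (par n))
    (z : Space (b.turn i).toCol a) : contract (b.toCol.sum a) ((b.turn i).toCol.sum a) (diagU i)
      (cls _ _ 1) (capLow (isCap_turn i b) a z) = low (circ_inr_turn i b a) z := by
  obtain ⟨f, rfl⟩ := Ideal.Quotient.mk_surjective z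
  refine (contract_cls _ _ _ _ _).trans (cls_eq fun s h1 h2 => ?_)
  rw [map_mul, ev_eps_turn hb a h1 h2, one_mul, mul_one]

/-- Let `u + ε w` be the cut of a representative. The outgoing saddle multiplies it by the sum of
the top variable, which becomes `ε`, and the variable of the partner of `lo i`. Capping leaves `u`
plus the partner variable times `w`. The incoming saddle then puts the partner on the circle of `lo
i`, which recovers `v` by `cls_eq_low`. -/
theorem saddleIn_saddleOut {b : Crossingless n} (hb : ¬ IsCap i b) (v : TangleBimod (diagU i))
    (a : Crossingless n) :
    (saddleIn i b • op (capFun i (saddleOut i b • v)) • capElt i) b a = v b a := by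
  have hc := isCap_turn i b
  rw [saddleIn_smul hb, op_smul_capElt _ hc, contract_capLow hb, capFun_of_isCap hc,
    saddleOut_smul hb]
  obtain ⟨f, hf⟩ := Ideal.Quotient.mk_surjective (v b a)
  have h1 : contract ((b.turn i).toCol.sum a.toCol) (b.toCol.sum a.toCol) (diagU i) (cls _ _ 1)
      (cls _ _ f) = cls _ _ (f * (MvPolynomial.X (Sum.inl (lo i)) +
        MvPolynomial.X (Sum.inl (b.pair (lo i))))) := by
    rw [contract_cls, one_mul]
    refine cls_eq fun s h1 h2 => ?_
    rw [map_mul, map_mul, ev_eps_turn' hb a.toCol h1 h2]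
  have h2 : cutVal i (b.turn i).toCol a.toCol (Sum.inl (lo i)) = DualNumber.eps :=
    if_pos (Or.inl rfl)
  have h3 : cutVal i (b.turn i).toCol a.toCol (Sum.inl (b.pair (lo i))) =
      inl (cls _ _ (MvPolynomial.X (b.pair (lo i)))) :=
    if_neg (not_or.2 ⟨b.pair_ne _, (pair_lo_ne hb).1⟩)
  have h4 : low (circ_inr_turn i b a.toCol) (cls _ _ (MvPolynomial.X (b.pair (lo i)))) =
      cls (b.toCol.sum a.toCol) (diagU i) (MvPolynomial.X (Sum.inl (lo i))) := by
    refine (low_cls _ _).trans ?_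
    rw [MvPolynomial.rename_X]
    refine (cls_X_eq ?_).symm
    exact (circ _ _).trans (circ_left b.toCol a.toCol (diagU i) _)
      (circ_diag (diagU_inl (b.pair_ne _) (pair_lo_ne hb).1))
  have h5 := cls_eq_low (circ_inr_turn i b a.toCol) f
  rw [← hf]
  refine Eq.trans ?_ h5.symm
  refine (congrArg (fun z => low (circ_inr_turn i b a.toCol) (cut hc a.toCol z).snd) h1).trans ?_
  rw [cut_cls, map_mul, map_add, cutPoly_X, cutPoly_X, h2, h3, snd_mul, snd_add, snd_inl, fst_add,
    fst_inl]
  simp only [DualNumber.fst_eps, DualNumber.snd_eps, smul_eq_mul,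
    MulOpposite.smul_eq_mul_unop, MulOpposite.unop_op, map_add, map_mul, zero_add, add_zero,
    mul_one, h4]
  rw [mul_comm (cls _ _ _)]

variable (i) in
/-- The left coefficients of a decomposition of the bimodule of `U_i`. -/
noncomputable def spanLeft : Option (Option (Crossingless n)) → ArcRing n
  | none => 1
  | some none => 𝐗 i
  | some (some b) => saddleIn i b

variable (i) in
/-- The factors of the coordinates of a decomposition of the bimodule of `U_i`. -/
noncomputable def spanRight : Option (Option (Crossingless n)) → ArcRing n
  | none => 𝐗 i
  | some none => 1
  | some (some b) => saddleOut i b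

/-- The rows with an arc at `i` are covered by `cap_decomp`, and every other row `c` by a saddle to
`c.turn i` and back. -/
theorem cap_span (v : TangleBimod (diagU i)) :
    v = ∑ k, spanLeft i k • op (capFun i (spanRight i k • v)) • capElt i := by
  rw [Fintype.sum_option, Fintype.sum_option]
  simp only [spanLeft, spanRight]
  rw [one_smul, one_smul, ← add_assoc, ← cap_decomp]
  have hsum : ∀ c a, (∑ b, saddleIn i b • op (capFun i (saddleOut i b • v)) • capElt i) c a =
      ∑ b, (saddleIn i b • op (capFun i (saddleOut i b • v)) • capElt i) c a := fun c a =>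
    map_sum (⟨⟨fun v => v c a, rfl⟩, fun _ _ => rfl⟩ : TangleBimod (diagU i) →+ _) _ _
  ext c a
  rw [TangleBimod.add_apply, hsum]
  by_cases hc : IsCap i c
  · rw [alpha_smul_of_isCap hc, Finset.sum_eq_zero, add_zero]
    intro b _
    exact saddleIn_smul_of_not (fun h => h.2 (h.1 ▸ hc)) _ _
  · rw [alpha_smul_of_not hc, zero_add, Finset.sum_eq_single c, saddleIn_saddleOut hc]
    · intro b _ hb
      exact saddleIn_smul_of_not (fun h => hb h.1.symm) _ _
    · simp

end BubbleUSpan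

/-! ### The opposite saddle as a central element of the bimodule. -/

section BubbleUUnit

open MulOpposite
open scoped Classical

variable {n : ℕ} {i : Fin (2 * n - 1)}

local notation "𝐗" i => (ArcRing.diag (MvPolynomial.X (lo i)) : ArcRing _)

variable (i) in
/-- The image of `1` under the saddle cobordism from `W(b) b` to `W(b) U_i b`. -/
noncomputable def unitPoly (b : Crossingless n) :
    MvPolynomial (Fin (2 * n) ⊕ Fin (2 * n)) ℤ :=
  if IsCap i b then MvPolynomial.X (Sum.inl (lo i)) + MvPolynomial.X (Sum.inr (lo i)) else 1

variable (i) in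
/-- The image of `1` under the homomorphism from `H^n` to the bimodule of `U_i` which is induced
by the saddle. -/
noncomputable def unitElt : TangleBimod (diagU i) := fun c a =>
  if c = a then cls _ _ (unitPoly i c) else 0

theorem unitElt_self (c : Crossingless n) : unitElt i c c = cls _ _ (unitPoly i c) := if_pos rfl

theorem unitElt_ne {c a : Crossingless n} (h : c ≠ a) : unitElt i c a = 0 := if_neg h

/-- Exactly one of the two opposite saddles splits a circle: the first if there is an arc at `i`,
the second otherwise. The factor is the same in both cases, since the two points then lie on one
circle. -/
theorem alpha_unitElt :
    alpha i (unitElt i) = ArcRing.diag (MvPolynomial.X (lo i) + MvPolynomial.X (hi i)) := by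
  ext c a
  rw [alpha_apply]
  by_cases h : c = a
  · subst h
    rw [unitElt_self, ArcRing.diag_self, saddleMap_cls, unitPoly, saddleFactor]
    by_cases hc : IsCap i c
    · rw [if_pos hc, if_neg (not_sameCircle_cap hc _)]
      refine cls_eq fun s h1 _ => ?_
      have h3 : s (hi i) = s (lo i) := by
        rw [← h1 (lo i), toCol_apply, hc]
      simp only [mul_one, ev_fold, map_add, ev_X, h3]
      rfl
    · rw [if_neg hc, if_pos (sameCircle_of_not_isCap hc), map_one, one_mul]
  · rw [unitElt_ne h, ArcRing.diag_ne _ h, map_zero]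

theorem fold_of_eq {s : Fin (2 * n) ⊕ Fin (2 * n) → Bool} (h : ∀ q, s (diagU i q) = s q)
    (h' : s (Sum.inl (lo i)) = s (Sum.inr (lo i))) :
    Sum.elim (fun p => s (Sum.inl p)) (fun p => s (Sum.inl p)) = s := by
  funext q
  rcases q with p | p
  · rfl
  · by_cases h1 : p = lo i
    · rw [h1]; exact h'
    by_cases h2 : p = hi i
    · rw [h2]; exact (const_lo_hi h).1.trans (h'.trans (const_lo_hi h).2.symm)
    exact (const_inl_inr h h1 h2).symm

/-- The product is supported where the top and bottom caps have equal values, either by the factor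
of the splitting or because the caps lie on the same circle. -/
theorem unitPoly_const {b : Crossingless n} {a : ColMatching (par n)}
    {s : Fin (2 * n) ⊕ Fin (2 * n) → Bool} (h1 : ∀ q, s (a.sum b.toCol q) = s q)
    (h2 : ∀ q, s (diagU i q) = s q) (h3 : s (Sum.inl (lo i)) ≠ s (Sum.inr (lo i))) :
    ev s (unitPoly i b * eps (a.sum b.toCol) (b.toCol.sum b.toCol) (diagU i)) = 0 := by
  rw [map_mul]
  by_cases h4 : ∀ q, s (b.toCol.sum b.toCol q) = s q
  · rw [unitPoly]
    split_ifs with hb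
    · rw [map_add, ev_X, ev_X]
      revert h3
      cases s (Sum.inl (lo i)) <;> cases s (Sum.inr (lo i)) <;> simp
    · exact absurd (sameCircle_const h4 h2 (sameCircle_of_not_isCap hb)) h3
  · rw [ev_eps_eq_zero (a.sum b.toCol).isMatching (b.toCol.sum b.toCol).isMatching
      (diagU i).isMatching s h1 h2 h4, mul_zero]

theorem unitPoly_const' {b : Crossingless n} {a : ColMatching (par n)}
    {s : Fin (2 * n) ⊕ Fin (2 * n) → Bool} (h1 : ∀ q, s (b.toCol.sum a q) = s q)
    (h2 : ∀ q, s (diagU i q) = s q) (h3 : s (Sum.inl (lo i)) ≠ s (Sum.inr (lo i))) :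
    ev s (unitPoly i b * eps (b.toCol.sum a) (b.toCol.sum b.toCol) (diagU i)) = 0 := by
  rw [map_mul]
  by_cases h4 : ∀ q, s (b.toCol.sum b.toCol q) = s q
  · rw [unitPoly]
    split_ifs with hb
    · rw [map_add, ev_X, ev_X]
      revert h3
      cases s (Sum.inl (lo i)) <;> cases s (Sum.inr (lo i)) <;> simp
    · exact absurd (sameCircle_const h4 h2 (sameCircle_of_not_isCap hb)) h3
  · rw [ev_eps_eq_zero (b.toCol.sum a).isMatching (b.toCol.sum b.toCol).isMatching
      (diagU i).isMatching s h1 h2 h4, mul_zero]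

/-- The value of `unitPoly`, at a function which takes the same value at the top and at the
bottom. -/
theorem ev_unitPoly (b : Crossingless n) {s : Fin (2 * n) → Bool}
    (h1 : ∀ p, s (b.toCol p) = s p) (h : s (hi i) = s (lo i)) :
    ∃ e : Bool → ℕ, ev (Sum.elim s s) (unitPoly i b) = ∏ v, hval v ^ e v ∧
      ∀ v, 2 * e v + numCirc b.toCol b.toCol {p | s p = v} =
        numCirc (b.toCol.sum b.toCol) (diagU i) {q | Sum.elim s s q = v} +
          if s (lo i) = v then 1 else 0 := by
  have hn := numCirc_diagU_fold b.toCol b.toCol h1 h1 h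
  rw [unitPoly]
  split_ifs with hb
  · refine ⟨fun v => if s (lo i) = v then 1 else 0, ?_, fun v => ?_⟩
    · rw [map_add, ev_X, ev_X, Sum.elim_inl, Sum.elim_inr]
      cases s (lo i) <;> simp [hval] <;> ring
    · rw [(hn v).2 (not_sameCircle_cap hb _)]
      ring
  · refine ⟨0, by simp, fun v => ?_⟩
    rw [(hn v).1 (sameCircle_of_not_isCap hb)]
    simp

/-- The exponent depends only on the circles of `W(c)b` and `W(c) U_i b`, not on the side where the
unit was inserted; compare `ev_unitPoly_eps'`. -/
theorem ev_unitPoly_eps (c b : Crossingless n) {s : Fin (2 * n) → Bool}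
    (h1 : ∀ p, s (c.toCol p) = s p) (h2 : ∀ p, s (b.toCol p) = s p) (h : s (hi i) = s (lo i)) :
    ∃ e : Bool → ℕ, ev (Sum.elim s s) (unitPoly i b *
        eps (c.toCol.sum b.toCol) (b.toCol.sum b.toCol) (diagU i)) = ∏ v, hval v ^ e v ∧
      ∀ v, 2 * e v + numCirc c.toCol b.toCol {p | s p = v} =
        numCirc (c.toCol.sum b.toCol) (diagU i) {q | Sum.elim s s q = v} +
          if s (lo i) = v then 1 else 0 := by
  obtain ⟨e, he, hv⟩ := ev_unitPoly b h2 h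
  obtain ⟨e', he', hv'⟩ := ev_eps (c.toCol.sum b.toCol).isMatching
    (b.toCol.sum b.toCol).isMatching (diagU i).isMatching (Sum.elim s s)
    ((sum_const_iff _ _ _).2 ⟨h1, h2⟩) (const_diagU i s h) ((sum_const_iff _ _ _).2 ⟨h2, h2⟩)
  refine ⟨e + e', ?_, fun v => ?_⟩
  · rw [map_mul, he, he', ← Finset.prod_mul_distrib]
    exact Finset.prod_congr rfl fun v _ => (pow_add _ _ _).symm
  · have e1 := hv v
    have e2 := hv' v
    have e3 := two_mul_numCirc_self b.toCol s h2 v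
    rw [numCirc_closed, ncard_sum] at e2
    simp only [Sum.elim_inl, Sum.elim_inr, Pi.add_apply] at *
    omega

theorem ev_unitPoly_eps' (c b : Crossingless n) {s : Fin (2 * n) → Bool}
    (h1 : ∀ p, s (c.toCol p) = s p) (h2 : ∀ p, s (b.toCol p) = s p) (h : s (hi i) = s (lo i)) :
    ∃ e : Bool → ℕ, ev (Sum.elim s s) (unitPoly i c *
        eps (c.toCol.sum b.toCol) (c.toCol.sum c.toCol) (diagU i)) = ∏ v, hval v ^ e v ∧
      ∀ v, 2 * e v + numCirc c.toCol b.toCol {p | s p = v} =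
        numCirc (c.toCol.sum b.toCol) (diagU i) {q | Sum.elim s s q = v} +
          if s (lo i) = v then 1 else 0 := by
  obtain ⟨e, he, hv⟩ := ev_unitPoly c h1 h
  obtain ⟨e', he', hv'⟩ := ev_eps (c.toCol.sum b.toCol).isMatching
    (c.toCol.sum c.toCol).isMatching (diagU i).isMatching (Sum.elim s s)
    ((sum_const_iff _ _ _).2 ⟨h1, h2⟩) (const_diagU i s h) ((sum_const_iff _ _ _).2 ⟨h1, h1⟩)
  refine ⟨e + e', ?_, fun v => ?_⟩
  · rw [map_mul, he, he', ← Finset.prod_mul_distrib]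
    exact Finset.prod_congr rfl fun v _ => (pow_add _ _ _).symm
  · have e1 := hv v
    have e2 := hv' v
    have e3 := two_mul_numCirc_self c.toCol s h1 v
    rw [numCirc_closed, ncard_sum, numCirc_comm b.toCol] at e2
    simp only [Sum.elim_inl, Sum.elim_inr, Pi.add_apply] at *
    omega

theorem smul_unitElt {a : ArcRing n} {c b : Crossingless n} {f : MvPolynomial (Fin (2 * n)) ℤ}
    (hf : a c b = cls _ _ f) : (a • unitElt i) c b =
      cls _ _ (MvPolynomial.rename Sum.inl f * (unitPoly i b *
        eps (c.toCol.sum b.toCol) (b.toCol.sum b.toCol) (diagU i))) := by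
  rw [TangleBimod.smul_apply, Finset.sum_eq_single b]
  · rw [unitElt_self, hf, inL_cls, contract_cls, mul_assoc]
  · intro b' _ h
    rw [unitElt_ne h, map_zero]
  · simp

theorem op_smul_unitElt {a : ArcRing n} {c b : Crossingless n}
    {f : MvPolynomial (Fin (2 * n)) ℤ} (hf : a c b = cls _ _ f) : (op a • unitElt i) c b =
      cls _ _ (MvPolynomial.rename Sum.inr f * (unitPoly i c *
        eps (c.toCol.sum b.toCol) (c.toCol.sum c.toCol) (diagU i))) := by
  rw [TangleBimod.op_smul_apply, Finset.sum_eq_single c]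
  · rw [unop_op, unitElt_self, hf, inR_cls, contract_cls, mul_assoc]
  · intro b' _ h
    rw [unitElt_ne h.symm, map_zero]
  · simp

/-- Both products are `f` times a factor that vanishes unless top and bottom have equal values. At
the remaining points the factors have the same exponents, and the two copies of `f` take the same
value. -/
theorem unitElt_comm (a : ArcRing n) : a • unitElt i = op a • unitElt i := by
  ext c b
  obtain ⟨f, hf⟩ := Ideal.Quotient.mk_surjective (a c b)
  rw [smul_unitElt hf.symm, op_smul_unitElt hf.symm]
  refine cls_eq fun s h1 h2 => ?_
  rw [map_mul, map_mul (ev s) (MvPolynomial.rename Sum.inr f)]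
  by_cases h3 : s (Sum.inl (lo i)) = s (Sum.inr (lo i))
  · have h4 := fold_of_eq h2 h3
    set s' : Fin (2 * n) → Bool := fun p => s (Sum.inl p) with hs'
    rw [← h4] at h1 h2 ⊢
    have h5 : ∀ p, s' (c.toCol.pair p) = s' p := fun p => h1 (Sum.inl p)
    have h6 : ∀ p, s' (b.toCol.pair p) = s' p := fun p => h1 (Sum.inr p)
    have h7 : s' (hi i) = s' (lo i) := (const_lo_hi h2).1
    obtain ⟨e, he, hv⟩ := ev_unitPoly_eps c b h5 h6 h7
    obtain ⟨e', he', hv'⟩ := ev_unitPoly_eps' c b h5 h6 h7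
    have : e = e' := by
      funext v
      have := hv v
      have := hv' v
      omega
    rw [he, he', this, ev_rename, ev_rename]
    rfl
  · rw [unitPoly_const h1 h2 h3, unitPoly_const' h1 h2 h3, mul_zero, mul_zero]

theorem alpha_smul_unitElt : alpha i (capElt i) • unitElt i =
    (𝐗 i) • capElt i + op (𝐗 i) • capElt i := by
  ext c a
  rw [TangleBimod.add_apply, diag_smul_apply, op_diag_smul_apply, MvPolynomial.rename_X,
    MvPolynomial.rename_X]
  by_cases hc : IsCap i c
  · rw [alpha_smul_of_isCap hc]
    by_cases h : c = a
    · subst h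
      rw [unitElt_self, capElt_self i hc, unitPoly, if_pos hc, cls_one, mul_one, mul_one]
      exact map_add _ _ _
    · rw [unitElt_ne h, capElt_ne i h, mul_zero, mul_zero, add_zero]
  · rw [alpha_smul_of_not hc, capElt_of_not i hc, mul_zero, mul_zero, add_zero]

variable (i) in
/-- The structure of the bimodule of `U_i`. -/
noncomputable def bubbleU : Bubble (alpha i) where
  g := capElt i
  x := 𝐗 i
  t := unitElt i
  ψ := capFun i
  K := Option (Option (Crossingless n))
  p := spanLeft i
  q := spanRight i
  alpha_op := alpha_op_smul i
  x_comm := diag_mul_comm _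
  x_mul_x := by
    ext c a
    rw [ArcRing.diag_mul_apply]
    by_cases h : c = a
    · subst h
      rw [ArcRing.diag_self]
      exact (map_mul (Ideal.Quotient.mk _) _ _).trans (cls_X_mul_self _ _ _)
    · rw [ArcRing.diag_ne _ h, smul_zero, ArcRing.zero_apply]
  left_unit := by
    ext c a
    by_cases hc : IsCap i c
    · rw [alpha_smul_of_isCap hc]
    · rw [alpha_smul_of_not hc, capElt_of_not i hc]
  right_unit := by
    ext c a
    by_cases ha : IsCap i a
    · rw [op_alpha_smul_of_isCap ha]
    · rw [op_alpha_smul_of_not ha, capElt, if_neg]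
      rintro ⟨rfl, h⟩
      exact ha h
  ψ_op := capFun_op_smul
  ψ_g := by
    have := capFun_op_smul_capElt (i := i) 1
    rwa [op_one, one_smul] at this
  ψ_xg := by
    have := capFun_X_op_smul_capElt (i := i) 1
    rwa [op_one, one_smul, mul_one] at this
  decomp := cap_decomp
  ψ_comm := capFun_smul_capElt_comm
  span := cap_span
  t_comm := unitElt_comm
  t_eq := alpha_smul_unitElt

end BubbleUUnit

/-! ### Elements which commute with the generator. -/

section Avoid

open TrivSqZeroExt MulOpposite
open scoped Classical

variable {n : ℕ} {i j : Fin (2 * n - 1)}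

theorem cls_rename_mem_avoid {P Q : Type} (σ τ : P → P) {D : Set P} {r : Q → P}
    (h : ∀ q, r q ∉ D) (f : MvPolynomial Q ℤ) :
    cls σ τ (MvPolynomial.rename r f) ∈ avoid σ τ D := by
  induction f using MvPolynomial.induction_on with
  | C k =>
    rw [MvPolynomial.rename_C, show (MvPolynomial.C k : MvPolynomial P ℤ) =
      (k : MvPolynomial P ℤ) from (map_intCast MvPolynomial.C k)]
    have : cls σ τ (k : MvPolynomial P ℤ) = k := map_intCast _ k
    rw [this]
    exact intCast_mem _ k
  | add f g hf hg =>
    rw [map_add]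
    exact add_mem hf hg
  | mul_X f q hf =>
    rw [map_mul, MvPolynomial.rename_X]
    exact mul_mem hf (Subring.subset_closure ⟨r q, h q, rfl⟩)

theorem cls_X_mem_avoid {P : Type} (σ τ : P → P) {D : Set P} {p : P} (h : p ∉ D) :
    cls σ τ (MvPolynomial.X p) ∈ avoid σ τ D := Subring.subset_closure ⟨p, h, rfl⟩

theorem cls_one_mem_avoid {P : Type} (σ τ : P → P) (D : Set P) : cls σ τ 1 ∈ avoid σ τ D := by
  rw [cls_one]
  exact one_mem _

theorem mul_alpha_of_isCap {b : Crossingless n} (hb : IsCap i b) (y : ArcRing n)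
    (c : Crossingless n) : (y * alpha i (capElt i)) c b = y c b := by
  rw [ArcRing.mul_apply, Finset.sum_eq_single b]
  · rw [alpha_capElt_self hb, contract_one_right]
  · intro a _ ha
    rw [alpha_capElt_of fun h => ha h.1, map_zero]
  · simp

theorem mul_alpha_of_not {b : Crossingless n} (hb : ¬ IsCap i b) (y : ArcRing n)
    (c : Crossingless n) : (y * alpha i (capElt i)) c b = 0 := by
  rw [ArcRing.mul_apply]
  refine Finset.sum_eq_zero fun a _ => ?_
  have : ¬ (a = b ∧ IsCap i a) := by
    rintro ⟨rfl, h⟩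
    exact hb h
  rw [alpha_capElt_of this, map_zero]

theorem alpha_mul_smul_capElt_comm {y : ArcRing n}
    (h1 : ∀ c b, IsCap i c → IsCap i b → y c b ∈ avoid c.toCol b.toCol {lo i, hi i})
    (h2 : ∀ c b, IsCap i c → ¬ IsCap i b → y c b = 0) :
    (alpha i (capElt i) * y) • capElt i = op (alpha i (capElt i) * y) • capElt i := by
  refine smul_capElt_comm (fun c b hc hb => ?_) (fun c b hc hb => ?_) fun c b hc _ =>
    alpha_mul_of_not hc y b
  · rw [alpha_mul_of_isCap hc]
    exact h1 c b hc hb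
  · rw [alpha_mul_of_isCap hc]
    exact h2 c b hc hb

theorem mul_alpha_smul_capElt_comm {y : ArcRing n}
    (h1 : ∀ c b, IsCap i c → IsCap i b → y c b ∈ avoid c.toCol b.toCol {lo i, hi i})
    (h2 : ∀ c b, ¬ IsCap i c → IsCap i b → y c b = 0) :
    (y * alpha i (capElt i)) • capElt i = op (y * alpha i (capElt i)) • capElt i := by
  refine smul_capElt_comm (fun c b hc hb => ?_) (fun c b _ hb => mul_alpha_of_not hb y c)
    fun c b hc hb => ?_
  · rw [mul_alpha_of_isCap hb]
    exact h1 c b hc hb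
  · rw [mul_alpha_of_isCap hb]
    exact h2 c b hc hb

/-- A converse to `smul_capElt_comm`: commuting with the generator makes the top and bottom copies
of the entry equal. Cutting the bottom copy returns the entry, while cutting the top copy removes
the points `i` and `i + 1`. -/
theorem apply_mem_avoid {y : ArcRing n} (hy : y • capElt i = op y • capElt i)
    {c b : Crossingless n} (hc : IsCap i c) (hb : IsCap i b) :
    y c b ∈ avoid c.toCol b.toCol {lo i, hi i} := by
  have h : capTop hb c.toCol (y c b) = capLow hc b.toCol (y c b) := by
    rw [← smul_capElt y c hb, hy, op_smul_capElt y hc]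
  have h1 := (cut_capTop_mem hc hb (mem_avoid_empty (y c b))).1
  rwa [Set.empty_union, h, cut_low, fst_inl] at h1

theorem apply_eq_zero_of_comm {y : ArcRing n} (hy : y • capElt i = op y • capElt i)
    {c b : Crossingless n} (hc : IsCap i c) (hb : ¬ IsCap i b) : y c b = 0 := by
  have h : capLow hc b.toCol (y c b) = 0 := by
    rw [← op_smul_capElt y hc, ← hy, smul_capElt_of_not y c hb]
  have := cut_low hc b.toCol (y c b)
  rw [h, map_zero] at this
  exact (congrArg TrivSqZeroExt.fst this).symm

theorem capFun_smul_capElt_mem {y : ArcRing n} {c b : Crossingless n} {D : Set (Fin (2 * n))}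
    (hy : y c b ∈ avoid c.toCol b.toCol D) :
    capFun i (y • capElt i) c b ∈ avoid c.toCol b.toCol D := by
  by_cases hc : IsCap i c
  · by_cases hb : IsCap i b
    · rw [capFun_smul_capElt hc hb]
      exact avoid_mono Set.subset_union_left (cut_capTop_mem hc hb hy).2
    · rw [capFun_smul_capElt_of_not c hb]
      exact zero_mem _
  · rw [capFun_of_not hc]
    exact zero_mem _

theorem capFun_smul_capElt_eq_zero {y : ArcRing n} {c b : Crossingless n} (hy : y c b = 0) :
    capFun i (y • capElt i) c b = 0 := by
  by_cases hc : IsCap i c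
  · by_cases hb : IsCap i b
    · rw [capFun_smul_capElt hc hb, hy, map_zero, map_zero, snd_zero]
    · rw [capFun_smul_capElt_of_not c hb]
  · rw [capFun_of_not hc]

end Avoid

/-! ### Distant diagrams `U_i` and `U_j`. -/

section Distant

open MulOpposite
open scoped Classical

variable {n : ℕ} {i j : Fin (2 * n - 1)}

/-- The saddle at `j` only changes the arcs with an endpoint at `j` or `j + 1`, which the arc at `i`
is not. -/
theorem IsCap.turn (h : Disjoint ({lo i, hi i} : Set (Fin (2 * n))) {lo j, hi j})
    {c : Crossingless n} (hc : IsCap i c) : IsCap i (c.turn j) := by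
  simp only [Set.disjoint_insert_left, Set.disjoint_singleton_left, Set.mem_insert_iff,
    Set.mem_singleton_iff, not_or] at h
  obtain ⟨⟨h1, h2⟩, h3, h4⟩ := h
  change turnFun j c.pair (lo i) = hi i
  have hlo : c.pair (lo i) = hi i := hc
  rcases turnFun_cases j c (lo i) with ⟨h, -⟩ | ⟨h, -⟩ | ⟨h, -⟩ | ⟨h, -⟩ | ⟨-, -, -, -, e⟩
  · exact absurd h h1
  · exact absurd h h2
  · rw [h, c.invol] at hlo
    exact absurd hlo.symm h3
  · rw [h, c.invol] at hlo
    exact absurd hlo.symm h4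
  · rw [e, hlo]

theorem diag_X_apply_mem {p : Fin (2 * n)} {D : Set (Fin (2 * n))} (h : p ∉ D)
    (c b : Crossingless n) :
    (ArcRing.diag (MvPolynomial.X p) : ArcRing n) c b ∈ avoid c.toCol b.toCol D := by
  by_cases e : c = b
  · subst e
    rw [ArcRing.diag_self]
    exact cls_X_mem_avoid _ _ h
  · rw [ArcRing.diag_ne _ e]
    exact zero_mem _

theorem one_apply_mem (c b : Crossingless n) (D : Set (Fin (2 * n))) :
    (1 : ArcRing n) c b ∈ avoid c.toCol b.toCol D := by
  change (ArcRing.diag 1 : ArcRing n) c b ∈ _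
  by_cases e : c = b
  · subst e
    rw [ArcRing.diag_self]
    exact cls_one_mem_avoid _ _ _
  · rw [ArcRing.diag_ne _ e]
    exact zero_mem _

theorem spanLeft_mem (h : Disjoint ({lo i, hi i} : Set (Fin (2 * n))) {lo j, hi j})
    (k : Option (Option (Crossingless n))) (c b : Crossingless n) :
    spanLeft j k c b ∈ avoid c.toCol b.toCol {lo i, hi i} := by
  rcases k with _ | _ | d
  · exact one_apply_mem _ _ _
  · exact diag_X_apply_mem (Set.disjoint_right.1 h (Or.inl rfl)) _ _
  · change (if c = d ∧ b = d.turn j ∧ ¬ IsCap j d then cls c.toCol b.toCol 1 else 0) ∈ _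
    split_ifs
    · exact cls_one_mem_avoid _ _ _
    · exact zero_mem _

theorem spanRight_mem (h : Disjoint ({lo i, hi i} : Set (Fin (2 * n))) {lo j, hi j})
    (k : Option (Option (Crossingless n))) (c b : Crossingless n) :
    spanRight j k c b ∈ avoid c.toCol b.toCol {lo i, hi i} := by
  rcases k with _ | _ | d
  · exact diag_X_apply_mem (Set.disjoint_right.1 h (Or.inl rfl)) _ _
  · exact one_apply_mem _ _ _
  · change (if c = d.turn j ∧ b = d ∧ ¬ IsCap j d then cls c.toCol b.toCol 1 else 0) ∈ _
    split_ifs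
    · exact cls_one_mem_avoid _ _ _
    · exact zero_mem _

theorem spanLeft_eq_zero (h : Disjoint ({lo i, hi i} : Set (Fin (2 * n))) {lo j, hi j})
    (k : Option (Option (Crossingless n))) {c b : Crossingless n} (hc : IsCap i c)
    (hb : ¬ IsCap i b) : spanLeft j k c b = 0 := by
  have hcb : c ≠ b := fun e => hb (e ▸ hc)
  rcases k with _ | _ | d
  · exact ArcRing.diag_ne _ hcb
  · exact ArcRing.diag_ne _ hcb
  · refine if_neg fun h' => hb ?_
    rw [h'.2.1]
    exact (h'.1 ▸ hc).turn h

theorem spanRight_eq_zero (h : Disjoint ({lo i, hi i} : Set (Fin (2 * n))) {lo j, hi j})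
    (k : Option (Option (Crossingless n))) {c b : Crossingless n} (hc : ¬ IsCap i c)
    (hb : IsCap i b) : spanRight j k c b = 0 := by
  have hcb : c ≠ b := fun e => hc (e ▸ hb)
  rcases k with _ | _ | d
  · exact ArcRing.diag_ne _ hcb
  · exact ArcRing.diag_ne _ hcb
  · refine if_neg fun h' => hc ?_
    rw [h'.1]
    exact (h'.2.1 ▸ hb).turn h

/-- The conditions are checked entrywise. The coefficients of `U_j` do not involve the points `i`
and `i + 1`, and the saddle at `j` preserves an arc at `i`. -/
theorem isDistant_bubbleU (h : Disjoint ({lo i, hi i} : Set (Fin (2 * n))) {lo j, hi j}) :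
    (bubbleU i).IsDistant (bubbleU j) where
  alpha_smul := by
    change alpha i (capElt i) • capElt j = op (alpha i (capElt i)) • capElt j
    ext c a
    by_cases e : c = a
    · subst e
      by_cases hc : IsCap i c
      · rw [alpha_smul_of_isCap hc, op_alpha_smul_of_isCap hc]
      · rw [alpha_smul_of_not hc, op_alpha_smul_of_not hc]
    · have h0 := capElt_ne j e
      by_cases hc : IsCap i c <;> by_cases ha : IsCap i a <;>
        simp only [alpha_smul_of_isCap, alpha_smul_of_not, op_alpha_smul_of_isCap,
          op_alpha_smul_of_not, hc, ha, h0, not_false_eq_true]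
  p_comm k := alpha_mul_smul_capElt_comm (fun c b _ _ => spanLeft_mem h k c b)
    fun c b hc hb => spanLeft_eq_zero h k hc hb
  q_comm k := mul_alpha_smul_capElt_comm (fun c b _ _ => spanRight_mem h k c b)
    fun c b hc hb => spanRight_eq_zero h k hc hb
  ψ_comm y hy hy' := by
    refine smul_capElt_comm (fun c b hc hb => ?_) (fun c b hc hb => ?_) fun c b hc hb => ?_
    · exact capFun_smul_capElt_mem (apply_mem_avoid hy hc hb)
    · exact capFun_smul_capElt_eq_zero (apply_eq_zero_of_comm hy hc hb)
    · refine capFun_smul_capElt_eq_zero ?_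
      rw [← hy']
      exact alpha_mul_of_not hc y b

end Distant

/-! ### Adjacent diagrams `U_i` and `U_j`. -/

section Adjacent

open MulOpposite
open scoped Classical

variable {n : ℕ} {i j : Fin (2 * n - 1)} {m y z : Fin (2 * n)}

/-- The caps `{m, y}` of `U_i` and `{m, z}` of `U_j` have exactly one point in common. -/
structure Corner (i j : Fin (2 * n - 1)) (m y z : Fin (2 * n)) : Prop where
  left : (lo i = m ∧ hi i = y) ∨ (lo i = y ∧ hi i = m)
  right : (lo j = m ∧ hi j = z) ∨ (lo j = z ∧ hi j = m)
  ne : y ≠ z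

namespace Corner

variable (h : Corner i j m y z)

include h

theorem pair_left : ({lo i, hi i} : Set (Fin (2 * n))) = {m, y} := by
  rcases h.left with ⟨rfl, rfl⟩ | ⟨rfl, rfl⟩
  · rfl
  · exact Set.pair_comm _ _

theorem ne_left : y ≠ m := by
  rcases h.left with ⟨rfl, rfl⟩ | ⟨rfl, rfl⟩
  · exact (lo_ne_hi i).symm
  · exact lo_ne_hi i

theorem ne_right : z ≠ m := by
  rcases h.right with ⟨rfl, rfl⟩ | ⟨rfl, rfl⟩
  · exact (lo_ne_hi j).symm
  · exact lo_ne_hi j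

theorem isCap {c : Crossingless n} (hc : IsCap i c) : c.toCol m = y := by
  rcases h.left with ⟨rfl, rfl⟩ | ⟨rfl, rfl⟩
  · exact hc
  · exact hc.pair_hi

theorem diag_m : diagU j (Sum.inl m) = Sum.inl z := by
  rcases h.right with ⟨rfl, rfl⟩ | ⟨rfl, rfl⟩
  · exact diagU_inl_lo j
  · exact diagU_inl_hi

theorem diag_m' : diagU j (Sum.inr m) = Sum.inr z := by
  rcases h.right with ⟨rfl, rfl⟩ | ⟨rfl, rfl⟩
  · exact diagU_inr_lo
  · exact diagU_inr_hi

theorem diag_y : diagU j (Sum.inl y) = Sum.inr y := by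
  have h1 := h.ne_left
  have h2 := h.ne
  rcases h.right with ⟨rfl, rfl⟩ | ⟨rfl, rfl⟩
  · exact diagU_inl h1 h2
  · exact diagU_inl h2 h1

theorem lo_mem : lo j = m ∨ lo j = z := h.right.imp And.left And.left

/-- The path runs along the top arc from `m` to `y`, down the vertical segment at `y`, and back
along the bottom arc from `y` to `m`. -/
theorem sameCircle_m {c b : Crossingless n} (hc : IsCap i c) (hb : IsCap i b) :
    SameCircle (c.toCol.sum b.toCol) (diagU j) (Sum.inl m) (Sum.inr m) := by
  have h1 : SameCircle (c.toCol.sum b.toCol) (diagU j) (Sum.inl m) (Sum.inl y) := by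
    have := circ_left c.toCol b.toCol (diagU j) m
    rwa [h.isCap hc] at this
  have h2 : SameCircle (c.toCol.sum b.toCol) (diagU j) (Sum.inr m) (Sum.inr y) := by
    have := circ_right c.toCol b.toCol (diagU j) m
    rwa [h.isCap hb] at this
  have h3 : SameCircle (c.toCol.sum b.toCol) (diagU j) (Sum.inl y) (Sum.inr y) :=
    circ_diag h.diag_y
  exact (h1.trans _ _ _ h3).trans _ _ _ (h2.symm _ _)

theorem sameCircle_lo {c b : Crossingless n} (hc : IsCap i c) (hb : IsCap i b) :
    SameCircle (c.toCol.sum b.toCol) (diagU j) (Sum.inl (lo j)) (Sum.inr (lo j)) := by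
  have h1 := h.sameCircle_m hc hb
  rcases h.lo_mem with e | e
  · rwa [e]
  · rw [e]
    have h2 : SameCircle (c.toCol.sum b.toCol) (diagU j) (Sum.inl m) (Sum.inl z) :=
      circ_diag h.diag_m
    have h3 : SameCircle (c.toCol.sum b.toCol) (diagU j) (Sum.inr m) (Sum.inr z) :=
      circ_diag h.diag_m'
    exact (h2.symm _ _).trans _ _ _ (h1.trans _ _ _ h3)

/-- If both closing matchings contain the arc `{m, y}`, the points `m`, `y`, `z` at the top and
bottom lie on one circle. Every class then has a representative without `m` and `y`, so its
coefficient commutes with the generator, and the unit of `U_j` contributes no factor. -/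
theorem exists_smul_unitElt (w : TangleBimod (diagU j)) : ∃ a : ArcRing n,
    a • capElt i = op a • capElt i ∧
      alpha i (capElt i) • op (alpha i (capElt i)) • w = a • unitElt j := by
  -- Top and bottom copies of a point are on the same circle here, so they may be identified. The
  -- points `m` and `y` are replaced by `z`, which avoids the cap of `U_i`.
  let r : Fin (2 * n) ⊕ Fin (2 * n) → Fin (2 * n) :=
    Sum.elim (fun p => if p = m ∨ p = y then z else p) fun p => if p = m ∨ p = y then z else p
  have hrp : ∀ p, (if p = m ∨ p = y then z else p) ∉ ({lo i, hi i} : Set (Fin (2 * n))) := by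
    intro p
    rw [h.pair_left]
    split_ifs with h1
    · simp [h.ne_right, h.ne.symm]
    · simpa using h1
  have hr : ∀ q, r q ∉ ({lo i, hi i} : Set (Fin (2 * n))) := by
    rintro (p | p) <;> exact hrp p
  choose f hf using fun c b => Ideal.Quotient.mk_surjective (w c b)
  let a : ArcRing n := fun c b =>
    if IsCap i c ∧ IsCap i b then cls _ _ (MvPolynomial.rename r (f c b)) else 0
  have ha : ∀ {c b}, IsCap i c → IsCap i b →
      a c b = cls _ _ (MvPolynomial.rename r (f c b)) := fun hc hb => if_pos ⟨hc, hb⟩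
  have ha' : ∀ {c b}, ¬ (IsCap i c ∧ IsCap i b) → a c b = cls _ _ 0 := fun h' =>
    (if_neg h').trans (cls_zero _ _).symm
  refine ⟨a, smul_capElt_comm (fun c b hc hb => ?_) (fun c b _ hb => ?_) (fun c b hc _ => ?_), ?_⟩
  · rw [ha hc hb]
    exact cls_rename_mem_avoid _ _ hr _
  · exact if_neg fun h' => hb h'.2
  · exact if_neg fun h' => hc h'.1
  ext c b
  by_cases hc : IsCap i c
  · rw [alpha_smul_of_isCap hc]
    by_cases hb : IsCap i b
    · rw [op_alpha_smul_of_isCap hb, smul_unitElt (ha hc hb), ← hf c b]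
      refine cls_eq fun s h1 h2 => ?_
      have h3 := fold_of_eq h2 (sameCircle_const h1 h2 (h.sameCircle_lo hc hb))
      set s' : Fin (2 * n) → Bool := fun p => s (Sum.inl p) with hs'
      rw [← h3] at h1 h2 ⊢
      have h5 : ∀ p, s' (c.toCol.pair p) = s' p := fun p => h1 (Sum.inl p)
      have h6 : ∀ p, s' (b.toCol.pair p) = s' p := fun p => h1 (Sum.inr p)
      have h7 : s' (hi j) = s' (lo j) := (const_lo_hi h2).1
      have hmy : s' y = s' m := by
        have := h5 m
        rwa [show c.toCol.pair m = y from h.isCap hc] at this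
      have hmz : s' z = s' m := by
        have := h2 (Sum.inl m)
        rwa [h.diag_m] at this
      obtain ⟨e, he, hv⟩ := ev_unitPoly_eps c b h5 h6 h7
      -- The top and bottom caps of `U_j` lie on one circle, so the saddle to `W(c)b` increases the
      -- number of circles. This is exactly the difference of the two counts.
      have he0 : e = 0 := by
        funext v
        have e1 := hv v
        have e2 := (numCirc_diagU_fold c.toCol b.toCol h5 h6 h7 v).1 (h.sameCircle_lo hc hb)
        simp only [Pi.zero_apply]
        omega
      rw [map_mul, he, he0, ev_rename, ev_rename]
      have hs : ((Sum.elim s' s' ∘ Sum.inl) ∘ r) = Sum.elim s' s' := by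
        have : ∀ p, s' (if p = m ∨ p = y then z else p) = s' p := by
          intro p
          split_ifs with h8
          · rcases h8 with rfl | rfl
            · exact hmz
            · rw [hmz, hmy]
          · rfl
        funext q
        rcases q with p | p <;> exact this p
      rw [hs]
      simp
    · rw [op_alpha_smul_of_not hb, smul_unitElt (ha' fun h' => hb h'.2), map_zero, zero_mul,
        cls_zero]
  · rw [alpha_smul_of_not hc, smul_unitElt (ha' fun h' => hc h'.1), map_zero, zero_mul, cls_zero]

theorem diag_X_smul_capElt : (ArcRing.diag (MvPolynomial.X m) : ArcRing n) • capElt i =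
    (ArcRing.diag (MvPolynomial.X (lo i)) : ArcRing n) • capElt i := by
  ext c a
  rw [diag_smul_apply, diag_smul_apply, MvPolynomial.rename_X, MvPolynomial.rename_X]
  congr 1
  refine cls_X_eq ?_
  rcases h.left with ⟨rfl, rfl⟩ | ⟨rfl, rfl⟩
  · exact .refl _
  · exact circ_diag diagU_inl_hi

/-- The two endpoints of the cap of `U_j` play different roles: `m` also belongs to the cap of
`U_i`, so its variable acts on the circle, while the variable of `z` passes through. -/
theorem isAdjacent_bubbleU : Nonempty ((bubbleU i).IsAdjacent (bubbleU j)) := ⟨{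
  x := ArcRing.diag (MvPolynomial.X m)
  y := ArcRing.diag (MvPolynomial.X z)
  y_comm := diag_mul_comm _
  alpha_t := by
    refine alpha_unitElt.trans ?_
    have h1 : (MvPolynomial.X (lo j) + MvPolynomial.X (hi j) : MvPolynomial (Fin (2 * n)) ℤ) =
        MvPolynomial.X m + MvPolynomial.X z := by
      rcases h.right with ⟨e, e'⟩ | ⟨e, e'⟩
      · rw [e, e']
      · rw [e, e', add_comm]
    rw [h1]
    ext c a
    rw [ArcRing.add_apply]
    by_cases e : c = a
    · subst e
      rw [ArcRing.diag_self, ArcRing.diag_self, ArcRing.diag_self]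
      exact map_add _ _ _
    · rw [ArcRing.diag_ne _ e, ArcRing.diag_ne _ e, ArcRing.diag_ne _ e, add_zero]
  x_smul := h.diag_X_smul_capElt
  y_smul := by
    refine smul_capElt_comm (fun c b _ _ => diag_X_apply_mem ?_ c b)
      (fun c b hc hb => ArcRing.diag_ne _ fun e => hb (e ▸ hc))
      fun c b hc hb => ArcRing.diag_ne _ fun e => hc (e ▸ hb)
    rw [h.pair_left]
    simp [h.ne_right, h.ne.symm]
  exists_smul_t := h.exists_smul_unitElt }⟩

end Corner

theorem corner_of_succ (h : i.1 + 1 = j.1) : Corner i j (hi i) (lo i) (hi j) ∧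
    Corner j i (hi i) (hi j) (lo i) := by
  have e : lo j = hi i := by simp [lo, hi, h]
  have h1 : lo i ≠ hi j := by
    simp [lo, hi, Fin.ext_iff]
    omega
  exact ⟨⟨Or.inr ⟨rfl, rfl⟩, Or.inl ⟨e, rfl⟩, h1⟩, ⟨Or.inl ⟨e, rfl⟩, Or.inr ⟨rfl, rfl⟩, h1.symm⟩⟩

theorem disjoint_of_le (h : i.1 + 2 ≤ j.1) :
    Disjoint ({lo i, hi i} : Set (Fin (2 * n))) {lo j, hi j} := by
  simp only [Set.disjoint_insert_left, Set.disjoint_singleton_left, Set.mem_insert_iff,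
    Set.mem_singleton_iff, not_or, lo, hi, Fin.ext_iff]
  omega

end Adjacent

/-! ### Existence of the braid group action. -/

section BraidAction

open CategoryTheory

theorem exists_isBraidAction (n : ℕ) :
    ∃ F : WeakAction (KArc n) (BraidGroup (2 * n)), IsBraidAction F := by
  refine exists_weakAction_braidGroup (D := KArc n) (m := 2 * n) tensorU
    (fun i => unitConeK (tensorFunctor (ArcRing n) (TangleBimod (diagU i))) (bubbleU i).β)
    (fun i => coneFunctorK_additive _ _) (fun i => nonempty_coneFunctorK_shift _ _)
    (fun i => (bubbleU i).nonempty_unit_comp) (fun i => (bubbleU i).nonempty_comp_unit)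
    (fun i j h => ?_) fun i j h => ?_
  · exact (isDistant_bubbleU (disjoint_of_le h)).nonempty_comm
      (isDistant_bubbleU (disjoint_of_le h).symm)
  · obtain ⟨h1, h2⟩ := corner_of_succ h
    obtain ⟨h3⟩ := h1.isAdjacent_bubbleU
    obtain ⟨h4⟩ := h2.isAdjacent_bubbleU
    exact Bubble.nonempty_braid h3 h4

end BraidAction

/-! ### Bracket words of crossingless matchings. -/

section Paths

variable {n : ℕ}

namespace Crossingless

variable (a b : Crossingless n)

theorem not_cross {x y : Fin (2 * n)} (h1 : x < y) (h2 : y < a.pair x) (h3 : a.pair x < a.pair y) :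
    False := a.noncrossing x y (a.pair x) (a.pair y) h1 h2 h3 ⟨rfl, rfl⟩

/-- The arc with left endpoint `j` is the innermost one which encloses the arc with left
endpoint `k`. -/
structure IsParent (j k : Fin (2 * n)) : Prop where
  lt : j < k
  up : k < a.pair k
  enclose : k < a.pair j
  inner : ∀ x, j < x → x < k → ¬ k < a.pair x

variable {a b}

theorem IsParent.pair_lt {j k : Fin (2 * n)} (h : a.IsParent j k) : a.pair k < a.pair j := by
  have h1 : a.pair k ≠ a.pair j := fun e => h.lt.ne (by rw [← a.invol j, ← e, a.invol])
  rcases lt_or_gt_of_ne h1 with h2 | h2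
  · exact h2
  · exact (a.not_cross h.lt h.enclose h2).elim

theorem IsParent.unique {j j' k : Fin (2 * n)} (h : a.IsParent j k) (h' : a.IsParent j' k) :
    j = j' := by
  rcases lt_trichotomy j j' with h1 | h1 | h1
  · exact absurd h'.enclose (h.inner _ h1 h'.lt)
  · exact h1
  · exact absurd h.enclose (h'.inner _ h1 h.lt)

variable (a) in
/-- The involution with the arc `k` and the arc `j` around it replaced by two adjacent arcs. -/
def graftFun (j k p : Fin (2 * n)) : Fin (2 * n) :=
  if p = j then k else if p = k then j else if p = a.pair k then a.pair j else
    if p = a.pair j then a.pair k else a.pair p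

theorem graftFun_cases (j k p : Fin (2 * n)) :
    (p = j ∧ a.graftFun j k p = k) ∨ (p = k ∧ a.graftFun j k p = j) ∨
    (p = a.pair k ∧ a.graftFun j k p = a.pair j) ∨
    (p = a.pair j ∧ a.graftFun j k p = a.pair k) ∨
    (p ≠ j ∧ p ≠ k ∧ a.pair p ≠ j ∧ a.pair p ≠ k ∧ a.pair p ≠ a.pair j ∧
      a.pair p ≠ a.pair k ∧ a.graftFun j k p = a.pair p) := by
  have h := a.invol
  unfold graftFun
  split_ifs <;> grind

/-- The matching in which the arc `k` and the arc `j` around it are replaced by two adjacent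
arcs. -/
def IsParent.graft {j k : Fin (2 * n)} (h : a.IsParent j k) : Crossingless n where
  pair := a.graftFun j k
  invol p := by
    have := h.lt.ne
    have h1 := a.invol
    have h2 := h.up.ne
    have h3 := h.enclose.ne
    have h4 := a.pair_ne
    unfold graftFun
    grind
  pair_ne p := by
    have := h.lt.ne
    have h1 := a.invol
    have h' := a.pair_ne
    unfold graftFun
    grind
  noncrossing p q r s hpq hqr hrs := by
    rintro ⟨h1, h2⟩
    have cp := graftFun_cases (a := a) j k p
    have cq := graftFun_cases (a := a) j k q
    rw [h1] at cp
    rw [h2] at cq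
    have e1 := h.lt
    have e2 := h.up
    have e4 := h.pair_lt
    have ij := a.invol j
    have ik := a.invol k
    have nc : ∀ x y, ¬ (x < y ∧ y < a.pair x ∧ a.pair x < a.pair y) := fun x y h =>
      a.not_cross h.1 h.2.1 h.2.2
    have ni : ∀ x, ¬ (j < x ∧ x < k ∧ k < a.pair x) := fun x hx => h.inner x hx.1 hx.2.1 hx.2.2
    -- These instances of noncrossing and of innermost enclosure suffice in all cases. The
    -- quantified facts are dropped, so that linear inequalities remain.
    have n1 := nc p j
    have n2 := nc p k
    have n3 := nc j q
    have n4 := nc p q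
    have n5 := nc k p
    have n6 := ni p
    have n7 := ni q
    clear nc ni
    rcases cp with ⟨p1, p2⟩ | ⟨p1, p2⟩ | ⟨p1, p2⟩ | ⟨p1, p2⟩ | ⟨p1, p2, p3, p4, p5, p6, p7⟩ <;>
    rcases cq with ⟨q1, q2⟩ | ⟨q1, q2⟩ | ⟨q1, q2⟩ | ⟨q1, q2⟩ | ⟨q1, q2, q3, q4, q5, q6, q7⟩ <;>
    simp only [Fin.lt_def, Fin.ext_iff, ne_eq] at * <;> omega

/-- A closing bracket is matched with the nearest opening bracket that is still free, so its partner
depends only on the word before it. -/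
theorem pair_eq_of_up_iff {k : Fin (2 * n)} (h : ∀ q < k, q < a.pair q ↔ q < b.pair q)
    (q : Fin (2 * n)) (hq : q < k) (hu : ¬ q < b.pair q) : a.pair q = b.pair q := by
  induction q using WellFoundedLT.induction generalizing a b with
  | ind q ih =>
  -- If the partner in `c` were to the right of the partner in `d`, it would be opened in `d` as
  -- well and, by noncrossing, closed there before `q`. By induction `c` would close it at the same
  -- place, but it is matched with `q`.
  have key : ∀ {c d : Crossingless n}, (∀ q < k, q < c.pair q ↔ q < d.pair q) →
      ¬ q < c.pair q → ¬ q < d.pair q →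
      (∀ r < q, ¬ r < d.pair r → c.pair r = d.pair r) → ¬ d.pair q < c.pair q := by
    intro c d h hc hd ih' hlt
    have h1 : c.pair q < q := lt_of_le_of_ne (not_lt.1 hc) (c.pair_ne q)
    have h2 : c.pair q < d.pair (c.pair q) := by
      rw [← h _ (h1.trans hq), c.invol]
      exact h1
    have h3 : d.pair (c.pair q) < q := by
      by_contra h3
      rcases lt_or_eq_of_le (not_lt.1 h3) with h4 | h4
      · exact d.not_cross hlt (by rwa [d.invol]) (by rwa [d.invol])
      · have := congrArg d.pair h4
        rw [d.invol] at this
        exact absurd this hlt.ne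
    have h4 := ih' _ h3 (by rw [d.invol]; exact not_lt.2 h2.le)
    rw [d.invol] at h4
    have h5 := congrArg c.pair h4
    rw [c.invol, c.invol] at h5
    exact h3.ne h5
  have hu' : ¬ q < a.pair q := fun h' => hu ((h q hq).1 h')
  have h1 := key h hu' hu fun r hr hr' => ih r hr h (hr.trans hq) hr'
  have h2 := key (fun q hq => (h q hq).symm) hu hu' fun r hr hr' =>
    ih r hr (fun q hq => (h q hq).symm) (hr.trans hq) hr'
  exact le_antisymm (not_lt.1 h1) (not_lt.1 h2)

variable (a) in
/-- The sequence of left and right endpoints. -/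
def path : Lex (Fin (2 * n) → Bool) := toLex fun p => decide (p < a.pair p)

/-- At the first difference, the smaller word has a closing bracket, since `false < true`. -/
theorem path_lt_iff : b.path < a.path ↔ ∃ k, (∀ q < k, q < a.pair q ↔ q < b.pair q) ∧
    ¬ k < b.pair k ∧ k < a.pair k := by
  have : b.path < a.path ↔ ∃ k, (∀ q, q < k → decide (q < b.pair q) = decide (q < a.pair q)) ∧
    decide (k < b.pair k) < decide (k < a.pair k) := Iff.rfl
  rw [this]
  refine exists_congr fun k => and_congr (forall₂_congr fun q _ => ?_) ?_
  · rw [decide_eq_decide]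
    exact Iff.comm
  · by_cases h1 : k < b.pair k <;> by_cases h2 : k < a.pair k <;> simp [h1, h2]

theorem path_injective : Function.Injective (path (n := n)) := by
  intro a b h
  have h1 : ∀ q, q < a.pair q ↔ q < b.pair q := fun q =>
    decide_eq_decide.1 (congrFun (toLex.injective h) q)
  have h2 : ∀ q, ¬ q < b.pair q → a.pair q = b.pair q := by
    intro q hq
    by_contra hne
    -- `pair_eq_of_up_iff` needs a point beyond `q`, so only the last point remains to be treated.
    have hk : ∀ k, q < k → False := fun k hqk =>
      hne (pair_eq_of_up_iff (fun q _ => h1 q) q hqk hq)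
    have hb : b.pair q < q := lt_of_le_of_ne (not_lt.1 hq) (b.pair_ne q)
    have ha : a.pair q < q := lt_of_le_of_ne
      (not_lt.1 fun h => hq ((h1 q).1 h)) (a.pair_ne q)
    have hr : ∀ r < q, ¬ r < b.pair r → a.pair r = b.pair r := fun r hr hr' =>
      pair_eq_of_up_iff (k := q) (fun q _ => h1 q) r hr hr'
    have h3 : a.pair (a.pair q) = q := a.invol q
    have h4 : a.pair q < b.pair (a.pair q) := by
      rw [← h1, a.invol]
      exact ha
    rcases lt_trichotomy (b.pair (a.pair q)) q with h5 | h5 | h5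
    · have := hr _ h5 (by rw [b.invol]; exact not_lt.2 h4.le)
      rw [b.invol] at this
      have h6 := congrArg a.pair this
      rw [a.invol, a.invol] at h6
      exact h5.ne h6
    · have := congrArg b.pair h5
      rw [b.invol] at this
      exact hne this
    · exact hk _ h5
  refine pair_injective n (funext fun q => ?_)
  by_cases hq : q < b.pair q
  · have := h2 (b.pair q) (by rw [b.invol]; exact not_lt.2 hq.le)
    rw [b.invol] at this
    have h3 := congrArg a.pair this
    rw [a.invol] at h3
    exact h3.symm
  · exact h2 q hq

/-- Take `k` to be the first difference, where `a` opens and `b` closes, and `j` the partner of `k`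
in `b`. In both matchings `j` is opened before `k`, and everything opened between them is closed
again before `k`. So in `a` the arc at `j` is the innermost one around `k`. -/
theorem exists_isParent_of_path_lt (h : b.path < a.path) :
    ∃ j k, a.IsParent j k ∧ b.pair j = k := by
  obtain ⟨k, h1, h2, h3⟩ := path_lt_iff.1 h
  have h4 : b.pair k < k := lt_of_le_of_ne (not_lt.1 h2) (b.pair_ne k)
  have hret : ∀ x, x < k → x < b.pair x → b.pair x < k → a.pair x = b.pair x := by
    intro x hx hx1 hx2
    have := pair_eq_of_up_iff h1 (b.pair x) hx2 (by rw [b.invol]; exact not_lt.2 hx1.le)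
    rw [b.invol] at this
    rw [← this, a.invol, this]
  have hret' : ∀ x, x < k → x < a.pair x → a.pair x < k → b.pair x = a.pair x := by
    intro x hx hx1 hx2
    have := pair_eq_of_up_iff (fun q hq => (h1 q hq).symm) (a.pair x) hx2
      (by rw [a.invol]; exact not_lt.2 hx1.le)
    rw [a.invol] at this
    rw [← this, b.invol, this]
  refine ⟨b.pair k, k, ⟨h4, h3, ?_, fun x hx1 hx2 hx3 => ?_⟩, b.invol k⟩
  · by_contra h5
    have h6 : b.pair k < a.pair (b.pair k) := by
      rw [h1 _ h4, b.invol]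
      exact h4
    rcases lt_or_eq_of_le (not_lt.1 h5) with h7 | h7
    · have := hret' _ h4 h6 h7
      rw [b.invol] at this
      exact h7.ne this.symm
    · have := congrArg a.pair h7
      rw [a.invol] at this
      rw [← this] at h3
      exact absurd h3 (not_lt.2 h4.le)
  · have h5 : x < b.pair x := by
      rw [← h1 _ hx2]
      exact hx2.trans hx3
    have h6 : b.pair x < k := by
      by_contra h6
      rcases lt_or_eq_of_le (not_lt.1 h6) with h7 | h7
      · exact b.not_cross hx1 (by rwa [b.invol]) (by rwa [b.invol])
      · have := congrArg b.pair h7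
        rw [b.invol] at this
        exact hx1.ne this
    rw [hret x hx2 h5 h6] at hx3
    exact hx3.not_gt h6

/-- Regrafting turns the opening bracket at `k` into a closing one and leaves the word before `k`
unchanged. -/
theorem IsParent.path_graft_lt {j k : Fin (2 * n)} (h : a.IsParent j k) :
    h.graft.path < a.path := by
  refine path_lt_iff.2 ⟨k, fun q hq => ?_, ?_, h.up⟩
  · change _ ↔ q < a.graftFun j k q
    have e1 := h.lt
    have e2 := h.up
    have e3 := h.enclose
    have ij := a.invol j
    have ik := a.invol k
    rcases graftFun_cases (a := a) j k q with ⟨p1, p2⟩ | ⟨p1, p2⟩ | ⟨p1, p2⟩ | ⟨p1, p2⟩ |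
      ⟨-, -, -, -, -, -, p3⟩
    · subst p1
      rw [p2]
      exact iff_of_true (hq.trans e3) e1
    · exact absurd p1 hq.ne
    · exact absurd (p1 ▸ hq) h.up.not_gt
    · exact absurd (p1 ▸ hq) h.enclose.not_gt
    · rw [p3]
  · change ¬ k < a.graftFun j k k
    rw [graftFun, if_neg h.lt.ne', if_pos rfl]
    exact h.lt.not_gt

end Crossingless

end Paths

/-! ### Interpolation along the order of bracket words. -/

section NestedProduct

open scoped Classical

variable {n : ℕ} {a b : Crossingless n}

local notation "𝐱" => (MvPolynomial.X : Fin (2 * n) → MvPolynomial (Fin (2 * n)) ℤ)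

theorem cls_mul {P : Type} (σ τ : P → P) (f g : MvPolynomial P ℤ) :
    cls σ τ (f * g) = cls σ τ f * cls σ τ g := map_mul (Ideal.Quotient.mk _) f g

theorem cls_sub {P : Type} (σ τ : P → P) (f g : MvPolynomial P ℤ) :
    cls σ τ (f - g) = cls σ τ f - cls σ τ g := map_sub (Ideal.Quotient.mk _) f g

theorem cls_add {P : Type} (σ τ : P → P) (f g : MvPolynomial P ℤ) :
    cls σ τ (f + g) = cls σ τ f + cls σ τ g := map_add (Ideal.Quotient.mk _) f g

theorem dvd_sub_rename {P R : Type*} [CommRing R] (π : MvPolynomial P ℤ →+* R) {d : R}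
    {r : P → P} (h : ∀ p, d ∣ π (MvPolynomial.X p) - π (MvPolynomial.X (r p)))
    (f : MvPolynomial P ℤ) : d ∣ π f - π (MvPolynomial.rename r f) := by
  induction f using MvPolynomial.induction_on with
  | C k => rw [MvPolynomial.rename_C, sub_self]; exact dvd_zero d
  | add f g hf hg =>
    rw [map_add, map_add, map_add, add_sub_add_comm]
    exact dvd_add hf hg
  | mul_X f p hf =>
    rw [map_mul, map_mul, map_mul, MvPolynomial.rename_X]
    have : π f * π (MvPolynomial.X p) - π (MvPolynomial.rename r f) * π (MvPolynomial.X (r p)) =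
        (π f - π (MvPolynomial.rename r f)) * π (MvPolynomial.X p) +
        π (MvPolynomial.rename r f) * (π (MvPolynomial.X p) - π (MvPolynomial.X (r p))) := by ring
    rw [this]
    exact dvd_add (Dvd.dvd.mul_right hf _) (Dvd.dvd.mul_left (h p) _)

/-- The factor of the pair of an arc `p.2` and its parent `p.1`. -/
noncomputable def nestFactor (p : Fin (2 * n) × Fin (2 * n)) : MvPolynomial (Fin (2 * n)) ℤ :=
  𝐱 p.2 - 𝐱 p.1

/-- The product of the factors of a set of pairs of nested arcs. -/
noncomputable def nestProd (T : Finset (Fin (2 * n) × Fin (2 * n))) :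
    MvPolynomial (Fin (2 * n)) ℤ := ∏ p ∈ T, nestFactor p

/-- Identifying the arc `k` with the arc `j` kills `f` and fixes `nestProd T`, which only involves
points before `k`. Therefore `g` may be replaced by its difference from its image under the
identification, and this is divisible by the new factor. -/
theorem cls_nestProd_mul {T : Finset (Fin (2 * n) × Fin (2 * n))} {j k : Fin (2 * n)}
    (hT : ∀ p ∈ T, p.1 < k ∧ p.2 < k) (h : a.IsParent j k) {f g : MvPolynomial (Fin (2 * n)) ℤ}
    (h1 : cls a.toCol a.toCol f = cls a.toCol a.toCol (nestProd T * g))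
    (h2 : cls a.toCol a.toCol (nestFactor (j, k)) ∣ cls a.toCol a.toCol f) :
    cls a.toCol a.toCol (nestProd T) * cls a.toCol a.toCol (nestFactor (j, k)) ∣
      cls a.toCol a.toCol f := by
  set r : Fin (2 * n) → Fin (2 * n) := fun p => if p = k ∨ p = a.pair k then j else p with hr
  have hrj : r j = j := if_neg (not_or.2 ⟨h.lt.ne, fun e => (h.lt.trans h.up).ne e⟩)
  have hrk : r k = j := if_pos (Or.inl rfl)
  have hrlt : ∀ p < k, r p = p := fun p hp => if_neg (not_or.2 ⟨hp.ne, (hp.trans h.up).ne⟩)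
  have hra : ∀ p, SameCircle a.toCol a.toCol (r p) (r (a.toCol p)) := by
    intro p
    change SameCircle a.toCol a.toCol (if p = k ∨ p = a.pair k then j else p)
      (if a.pair p = k ∨ a.pair p = a.pair k then j else a.pair p)
    by_cases h1 : p = k
    · subst h1
      simp only [true_or, or_true, if_true]
      exact .refl _
    by_cases h2 : p = a.pair k
    · subst h2
      simp only [true_or, or_true, if_true, a.invol]
      exact .refl _
    · have h3 : a.pair p ≠ k := fun e => h2 (by rw [← e, a.invol])
      have h4 : a.pair p ≠ a.pair k := fun e => h1 (by rw [← a.invol p, e, a.invol])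
      rw [if_neg (not_or.2 ⟨h1, h2⟩), if_neg (not_or.2 ⟨h3, h4⟩)]
      exact .rel _ _ (Or.inl rfl)
  have hd : ∀ p, cls a.toCol a.toCol (nestFactor (j, k)) ∣
      cls a.toCol a.toCol (𝐱 p) - cls a.toCol a.toCol (𝐱 (r p)) := by
    intro p
    change _ ∣ _ - cls _ _ (𝐱 (if p = k ∨ p = a.pair k then j else p))
    split_ifs with h1
    · have : cls a.toCol a.toCol (𝐱 p) = cls a.toCol a.toCol (𝐱 k) := by
        rcases h1 with rfl | rfl
        · rfl
        · exact (cls_X_eq (.rel _ _ (Or.inl rfl))).symm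
      rw [this, ← cls_sub]
      exact dvd_rfl
    · rw [sub_self]
      exact dvd_zero _
  have h3 : MvPolynomial.rename r (nestProd T) = nestProd T := by
    rw [nestProd, map_prod]
    refine Finset.prod_congr rfl fun p hp => ?_
    rw [nestFactor, map_sub, MvPolynomial.rename_X, MvPolynomial.rename_X, hrlt _ (hT p hp).1,
      hrlt _ (hT p hp).2]
  have h4 : pointMap r hra hra (cls a.toCol a.toCol f) = 0 := by
    obtain ⟨y, hy⟩ := h2
    rw [hy, map_mul, pointMap_cls, nestFactor, map_sub, MvPolynomial.rename_X,
      MvPolynomial.rename_X, hrk, hrj, sub_self, cls_zero, zero_mul]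
  rw [h1, pointMap_cls, map_mul, h3, cls_mul] at h4
  have h5 : cls a.toCol a.toCol f = cls a.toCol a.toCol (nestProd T) *
      (cls a.toCol a.toCol g - cls a.toCol a.toCol (MvPolynomial.rename r g)) := by
    rw [mul_sub, h4, h1, cls_mul, sub_zero]
  rw [h5]
  exact mul_dvd_mul_left _ (dvd_sub_rename (Ideal.Quotient.mk _) hd g)

/-- The pairs are added in the order of their inner arcs. Parents are unique, so these arcs are
distinct, and each new factor meets the hypothesis of `cls_nestProd_mul`. -/
theorem cls_nestProd_dvd (T : Finset (Fin (2 * n) × Fin (2 * n)))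
    (hT : ∀ p ∈ T, a.IsParent p.1 p.2) {f : MvPolynomial (Fin (2 * n)) ℤ}
    (hf : ∀ p ∈ T, cls a.toCol a.toCol (nestFactor p) ∣ cls a.toCol a.toCol f) :
    cls a.toCol a.toCol (nestProd T) ∣ cls a.toCol a.toCol f := by
  induction T using Finset.induction_on_max_value
    (f := fun p : Fin (2 * n) × Fin (2 * n) => p.2) with
  | empty =>
    rw [nestProd, Finset.prod_empty, cls_one]
    exact one_dvd _
  | insert p T hp hmax ih =>
    have hT' := fun q hq => hT q (Finset.mem_insert_of_mem hq)
    have hpp := hT p (Finset.mem_insert_self _ _)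
    obtain ⟨y, hy⟩ := ih hT' fun q hq => hf q (Finset.mem_insert_of_mem hq)
    obtain ⟨g, rfl⟩ := Ideal.Quotient.mk_surjective y
    have hlt : ∀ q ∈ T, q.1 < p.2 ∧ q.2 < p.2 := by
      intro q hq
      have h2 : q.2 < p.2 := by
        refine lt_of_le_of_ne (hmax q hq) fun e => hp ?_
        have h3 := hT' q hq
        rw [e] at h3
        have : q = p := Prod.ext (h3.unique hpp) e
        rwa [← this]
      exact ⟨(hT' q hq).lt.trans h2, h2⟩
    have := cls_nestProd_mul hlt hpp (hy.trans (cls_mul _ _ _ _).symm)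
      (hf p (Finset.mem_insert_self _ _))
    rw [nestProd, Finset.prod_insert hp, mul_comm (nestFactor p), cls_mul]
    exact this

variable (a) in
/-- The pairs of nested arcs. -/
noncomputable def nests : Finset (Fin (2 * n) × Fin (2 * n)) :=
  Finset.univ.filter fun p => a.IsParent p.1 p.2

/-- Some factor of the product belongs to a nested pair whose left endpoints are joined by an arc of
`b`. -/
theorem cls_nestProd_of_path_lt (h : b.path < a.path) :
    cls b.toCol b.toCol (nestProd (nests a)) = 0 := by
  obtain ⟨j, k, h1, h2⟩ := Crossingless.exists_isParent_of_path_lt h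
  have hmem : (j, k) ∈ nests a := by simpa [nests] using h1
  rw [nestProd, ← Finset.mul_prod_erase _ _ hmem, cls_mul, nestFactor, cls_sub, sub_eq_zero.2,
    zero_mul]
  refine (cls_X_eq (.rel _ _ (Or.inl ?_))).symm
  exact h2.symm

/-- Modulo the difference of the variables of `j` and `k`, all relations of the closure with the
regrafted matching already hold in `W(a)a`. -/
theorem nestFactor_dvd {j k : Fin (2 * n)} (h : a.IsParent j k)
    {f : MvPolynomial (Fin (2 * n)) ℤ} (hf : cls a.toCol h.graft.toCol f = 0) :
    cls a.toCol a.toCol (nestFactor (j, k)) ∣ cls a.toCol a.toCol f := by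
  have hX : ∀ p, cls a.toCol a.toCol (𝐱 (a.pair p)) = cls a.toCol a.toCol (𝐱 p) := fun p =>
    (cls_X_eq (.rel _ _ (Or.inl rfl))).symm
  have hle : circleIdeal a.toCol h.graft.toCol ≤
      (Ideal.span {cls a.toCol a.toCol (nestFactor (j, k))}).comap
        (Ideal.Quotient.mk (circleIdeal a.toCol a.toCol)) := by
    have hmem : ∀ g, g ∈ (Ideal.span {cls a.toCol a.toCol (nestFactor (j, k))}).comap
        (Ideal.Quotient.mk (circleIdeal a.toCol a.toCol)) ↔
          cls a.toCol a.toCol (nestFactor (j, k)) ∣ cls a.toCol a.toCol g := fun g =>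
      Ideal.mem_span_singleton
    refine circleIdeal_le (fun p => ?_) (fun p => ?_) fun p => ?_
    · rw [hmem, sq, cls_mul, cls_X_mul_self]
      exact dvd_zero _
    · rw [hmem, cls_sub, show a.toCol p = a.pair p from rfl, hX, sub_self]
      exact dvd_zero _
    · rw [hmem, cls_sub]
      change _ ∣ cls _ _ (𝐱 p) - cls _ _ (𝐱 (a.graftFun j k p))
      rw [nestFactor, cls_sub]
      rcases Crossingless.graftFun_cases (a := a) j k p with ⟨p1, p2⟩ | ⟨p1, p2⟩ | ⟨p1, p2⟩ |
        ⟨p1, p2⟩ | ⟨-, -, -, -, -, -, p2⟩ <;> rw [p2]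
      · rw [p1]
        exact (dvd_sub_comm).1 dvd_rfl
      · rw [p1]
      · rw [p1, hX, hX]
      · rw [p1, hX, hX]
        exact (dvd_sub_comm).1 dvd_rfl
      · rw [hX, sub_self]
        exact dvd_zero _
  exact Ideal.mem_span_singleton.1 (hle (Ideal.Quotient.eq_zero_iff_mem.1 hf))

/-- The compatible families of elements are represented by polynomials. -/
theorem exists_cls_eq (f : Crossingless n → MvPolynomial (Fin (2 * n)) ℤ)
    (hf : ∀ a b : Crossingless n, cls a.toCol b.toCol (f a) = cls a.toCol b.toCol (f b)) :
    ∃ F, ∀ a : Crossingless n, cls a.toCol a.toCol (f a) = cls a.toCol a.toCol F := by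
  -- The polynomial is built on sets of matchings that are closed downwards in the order of bracket
  -- words.
  suffices h : ∀ s : Finset (Crossingless n),
      (∀ a ∈ s, ∀ b : Crossingless n, b.path < a.path → b ∈ s) →
        ∃ F, ∀ a ∈ s, cls a.toCol a.toCol (f a) = cls a.toCol a.toCol F by
    obtain ⟨F, hF⟩ := h Finset.univ fun _ _ _ _ => Finset.mem_univ _
    exact ⟨F, fun a => hF a (Finset.mem_univ a)⟩
  intro s
  induction s using Finset.induction_on_max_value
    (f := fun a : Crossingless n => a.path) with
  | empty => exact fun _ => ⟨0, by simp⟩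
  | insert a s ha hmax ih =>
    intro hs
    obtain ⟨F, hF⟩ := ih fun b hb c hc => by
      rcases Finset.mem_insert.1 (hs b (Finset.mem_insert_of_mem hb) c hc) with rfl | h
      · exact absurd hc (hmax b hb).not_gt
      · exact h
    have hlt : ∀ b ∈ s, b.path < a.path := fun b hb =>
      lt_of_le_of_ne (hmax b hb) fun e => ha (Crossingless.path_injective e ▸ hb)
    -- As in Newton interpolation, the error at the new matching is divisible by a product that
    -- vanishes at all earlier ones. Compatibility with the regrafted matchings, which are earlier,
    -- provides each factor.
    have h1 : cls a.toCol a.toCol (nestProd (nests a)) ∣ cls a.toCol a.toCol (f a - F) := by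
      refine cls_nestProd_dvd _ (fun p hp => (Finset.mem_filter.1 hp).2) fun p hp => ?_
      have hp' := (Finset.mem_filter.1 hp).2
      refine nestFactor_dvd hp' ?_
      have hg : hp'.graft ∈ s := by
        rcases Finset.mem_insert.1 (hs a (Finset.mem_insert_self _ _) _ hp'.path_graft_lt)
          with h | h
        · exact absurd hp'.path_graft_lt (by rw [h]; exact lt_irrefl _)
        · exact h
      rw [cls_sub, hf a hp'.graft, sub_eq_zero]
      -- With `c` the regrafted matching, the relations of `W(c)c` hold in `W(a)c` too.
      refine Ideal.Quotient.eq.2 ?_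
      refine circleIdeal_le (fun p => X_sq_mem _ _ p) (fun p => ?_) (fun p => ?_)
        (Ideal.Quotient.eq.1 (hF _ hg)) <;>
      exact X_sub_X_mem (.rel _ _ (Or.inr rfl))
    obtain ⟨y, hy⟩ := h1
    obtain ⟨g, rfl⟩ := Ideal.Quotient.mk_surjective y
    refine ⟨F + nestProd (nests a) * g, fun b hb => ?_⟩
    rw [cls_add, cls_mul]
    rcases Finset.mem_insert.1 hb with rfl | hb
    · rw [cls_sub] at hy
      exact (sub_eq_iff_eq_add'.1 hy)
    · rw [cls_nestProd_of_path_lt (hlt b hb), zero_mul, add_zero]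
      exact hF b hb

end NestedProduct

/-! ### Generators of the centre of `H^n`. -/

section CenterGenerators

open scoped Classical

variable {n : ℕ}

/-- The identity cobordism of `W(b) a`, as a matrix unit. -/
noncomputable def unitEntry (b a : Crossingless n) : ArcRing n := fun c d =>
  if c = b ∧ d = a then cls _ _ 1 else 0

theorem unitEntry_self (b a : Crossingless n) : unitEntry b a b a = cls _ _ 1 := if_pos ⟨rfl, rfl⟩

theorem unitEntry_of_not {b a c d : Crossingless n} (h : ¬ (c = b ∧ d = a)) :
    unitEntry b a c d = 0 := if_neg h

theorem mul_unitEntry (z : ArcRing n) (b a c : Crossingless n) :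
    (z * unitEntry b a) c a = contract c.toCol b.toCol a.toCol (z c b) (cls _ _ 1) := by
  rw [ArcRing.mul_apply, Finset.sum_eq_single b]
  · rw [unitEntry_self]
  · intro d _ h
    rw [unitEntry_of_not fun h' => h h'.1, map_zero]
  · simp

theorem unitEntry_mul (z : ArcRing n) (b a d : Crossingless n) :
    (unitEntry b a * z) b d = contract b.toCol a.toCol d.toCol (cls _ _ 1) (z a d) := by
  rw [ArcRing.mul_apply, Finset.sum_eq_single a]
  · rw [unitEntry_self]
  · intro c _ h
    rw [unitEntry_of_not fun h' => h h'.2, map_zero, LinearMap.zero_apply]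
  · simp

theorem unitEntry_mul_of_ne (z : ArcRing n) {b c : Crossingless n} (h : c ≠ b)
    (a d : Crossingless n) : (unitEntry b a * z) c d = 0 := by
  rw [ArcRing.mul_apply]
  refine Finset.sum_eq_zero fun e _ => ?_
  rw [unitEntry_of_not fun h' => h h'.1, map_zero, LinearMap.zero_apply]

theorem contract_cls_one_right {P : Type} [Fintype P] {col : P → Bool} (σ ρ : ColMatching col)
    (f : MvPolynomial P ℤ) :
    contract σ ρ ρ (cls σ ρ 1) (cls ρ ρ f) = cls σ ρ f := by
  have : cls ρ ρ f = f • cls ρ ρ 1 := (congrArg (cls ρ ρ) (mul_one f)).symm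
  rw [this, map_smul, contract_one_right]
  exact congrArg (cls σ ρ) (mul_one f)

/-- Commuting with the idempotents makes the element diagonal. Commuting with the unit of `W(a)b`,
viewed as a matrix unit, makes the entries at `a` and `b` agree there, so `exists_cls_eq` applies.
-/
theorem exists_eq_diag {z : ArcRing n} (hz : ∀ y, y * z = z * y) :
    ∃ F, z = ArcRing.diag F := by
  choose f hf using fun a : Crossingless n => Ideal.Quotient.mk_surjective (z a a)
  have hf' : ∀ a, z a a = cls a.toCol a.toCol (f a) := fun a => (hf a).symm
  obtain ⟨F, hF⟩ := exists_cls_eq f fun a b => by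
    have h : (unitEntry a b * z) a b = (z * unitEntry a b) a b :=
      congrArg (fun w : ArcRing n => w a b) (hz _)
    rw [unitEntry_mul, mul_unitEntry, hf', hf', contract_cls_one_right, contract_cls_left,
      cls_one, mul_one] at h
    exact h.symm
  refine ⟨F, ?_⟩
  ext c a
  by_cases h : c = a
  · subst h
    rw [ArcRing.diag_self, hf', hF]
  · have h1 : (unitEntry a a * z) c a = (z * unitEntry a a) c a :=
      congrArg (fun w : ArcRing n => w c a) (hz _)
    rw [unitEntry_mul_of_ne z h, mul_unitEntry, contract_one_right] at h1
    rw [ArcRing.diag_ne _ h, ← h1]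

theorem diag_zero : (ArcRing.diag 0 : ArcRing n) = 0 := by
  ext c a
  by_cases e : c = a
  · subst e
    rw [ArcRing.diag_self, cls_zero, ArcRing.zero_apply]
  · rw [ArcRing.diag_ne _ e, ArcRing.zero_apply]

theorem diag_add (f g : MvPolynomial (Fin (2 * n)) ℤ) :
    (ArcRing.diag (f + g) : ArcRing n) = ArcRing.diag f + ArcRing.diag g := by
  ext c a
  rw [ArcRing.add_apply]
  by_cases e : c = a
  · subst e
    rw [ArcRing.diag_self, ArcRing.diag_self, ArcRing.diag_self]
    exact map_add _ _ _
  · rw [ArcRing.diag_ne _ e, ArcRing.diag_ne _ e, ArcRing.diag_ne _ e, add_zero]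

theorem diag_mul (f g : MvPolynomial (Fin (2 * n)) ℤ) :
    (ArcRing.diag (f * g) : ArcRing n) = ArcRing.diag f * ArcRing.diag g := by
  ext c a
  rw [ArcRing.diag_mul_apply]
  by_cases e : c = a
  · subst e
    rw [ArcRing.diag_self, ArcRing.diag_self]
    rfl
  · rw [ArcRing.diag_ne _ e, ArcRing.diag_ne _ e, smul_zero]

variable (n) in
/-- The homomorphism from the ring of polynomials onto the centre. -/
noncomputable def diagZ : MvPolynomial (Fin (2 * n)) ℤ →+* Subring.center (ArcRing n) where
  toFun f := ⟨ArcRing.diag f, Subring.mem_center_iff.2 fun y => (diag_mul_comm f y).symm⟩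
  map_one' := rfl
  map_zero' := Subtype.ext diag_zero
  map_add' f g := Subtype.ext (diag_add f g)
  map_mul' f g := Subtype.ext (diag_mul f g)

theorem diagZ_surjective : Function.Surjective (diagZ n) := fun z => by
  obtain ⟨F, hF⟩ := exists_eq_diag (Subring.mem_center_iff.1 z.2)
  exact ⟨F, Subtype.ext hF.symm⟩

theorem genZ_eq (i : Fin (2 * n)) :
    genZ i = diagZ n ((-1) ^ (i.1 + 1) * MvPolynomial.X i) := rfl

theorem diagZ_X (i : Fin (2 * n)) :
    diagZ n (MvPolynomial.X i) = (-1) ^ (i.1 + 1) * genZ i := by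
  rw [genZ_eq, map_mul, map_pow, map_neg, map_one, ← mul_assoc, ← mul_pow, neg_one_mul, neg_neg,
    one_pow, one_mul]

variable (n) in
/-- The homomorphism from the ring of polynomials to the centre which maps the variables to the
generators. -/
noncomputable def genHom : MvPolynomial (Fin (2 * n)) ℤ →+* Subring.center (ArcRing n) :=
  (MvPolynomial.aeval genZ).toRingHom

theorem genHom_X (i : Fin (2 * n)) : genHom n (MvPolynomial.X i) = genZ i :=
  MvPolynomial.aeval_X _ _

theorem genHom_mem (f : MvPolynomial (Fin (2 * n)) ℤ) :
    genHom n f ∈ Subring.closure (Set.range (genZ (n := n))) := by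
  induction f using MvPolynomial.induction_on with
  | C k =>
    rw [show (MvPolynomial.C k : MvPolynomial (Fin (2 * n)) ℤ) = (k : MvPolynomial _ ℤ) from
      (map_intCast MvPolynomial.C k), map_intCast]
    exact intCast_mem _ k
  | add f g hf hg => rw [map_add]; exact add_mem hf hg
  | mul_X f p hf =>
    rw [map_mul, genHom_X]
    exact mul_mem hf (Subring.subset_closure ⟨p, rfl⟩)

theorem genHom_surjective : Function.Surjective (genHom n) := fun z => by
  obtain ⟨F, rfl⟩ := diagZ_surjective z
  have : diagZ n = (genHom n).comp
      (MvPolynomial.aeval fun i : Fin (2 * n) => ((-1) ^ (i.1 + 1) * MvPolynomial.X i :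
        MvPolynomial (Fin (2 * n)) ℤ)).toRingHom := by
    refine MvPolynomial.ringHom_ext (fun k => ?_) fun i => ?_
    · rw [show (MvPolynomial.C k : MvPolynomial (Fin (2 * n)) ℤ) = (k : MvPolynomial _ ℤ) from
        (map_intCast MvPolynomial.C k), map_intCast, map_intCast]
    · rw [diagZ_X, RingHom.comp_apply]
      change _ = genHom n (MvPolynomial.aeval _ (MvPolynomial.X i))
      rw [MvPolynomial.aeval_X, map_mul, map_pow, map_neg, map_one, genHom_X]
  rw [this]
  exact ⟨_, rfl⟩

theorem closure_range_genZ : Subring.closure (Set.range (genZ (n := n))) = ⊤ := by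
  rw [eq_top_iff]
  intro z _
  obtain ⟨f, rfl⟩ := genHom_surjective z
  exact genHom_mem f

end CenterGenerators

/-! ### Natural transformations of the identity on mapping cones. -/

section ConeCenter

open CategoryTheory Limits CochainComplex CochainComplex.HomComplex

universe v u

variable {C : Type u} [Category.{v} C] [Preadditive C] [HasBinaryBiproducts C]

/-- A map in the opposite direction induces a homotopy between maps of mapping cones. -/
noncomputable def coneMapHomotopyOfComp {K L : CochainComplex C ℤ} (φ : K ⟶ L) {a a' : K ⟶ K}
    {b b' : L ⟶ L} (comm : φ ≫ b = a ≫ φ) (comm' : φ ≫ b' = a' ≫ φ) (h : L ⟶ K)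
    (h1 : b = h ≫ φ + b') (h2 : a = φ ≫ h + a') :
    Homotopy (mappingCone.map φ φ a b comm) (mappingCone.map φ φ a' b' comm') :=
  mappingCone.descHomotopy _ _ _ 0
    ((Cochain.ofHom h).comp (mappingCone.inl φ) (zero_add _))
    (by
      rw [inl_comp_map, inl_comp_map, h2, Cochain.ofHom_add, Cochain.add_comp, δ_zero, zero_add,
        Cochain.ofHom_comp, Cochain.comp_assoc_of_first_is_zero_cochain])
    (by
      rw [inr_comp_map, inr_comp_map, h1, Preadditive.add_comp, Cochain.ofHom_add, δ_ofHom_comp,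
        mappingCone.δ_inl, Category.assoc, Cochain.ofHom_comp])

theorem termwise_mappingCone (z : CatCenter C) {K L : CochainComplex C ℤ} (φ : K ⟶ L) :
    (termwise z).app (mappingCone φ) = mappingCone.map φ φ ((termwise z).app K)
      ((termwise z).app L) ((termwise z).naturality φ) := by
  refine cone_hom_ext (fun p q h => ?_) fun p => ?_
  · rw [inl_map]
    exact z.naturality ((mappingCone.inl φ).v p q h)
  · rw [inr_map]
    exact z.naturality ((mappingCone.inr φ).f p)

/-- On a cone, `z` is the map of cones given by `z` on both parts. It differs from the map induced
by `w` by `h` composed with `η` in the two orders, and this difference is null-homotopic through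
`h`. -/
theorem termwiseK_coneFunctorK (G : C ⥤ C) [G.Additive] (η : G ⟶ 𝟭 C) (z w : CatCenter C)
    (h : 𝟭 C ⟶ G) (h1 : ∀ X, z.app X = (h.app X ≫ η.app X : X ⟶ X) + w.app X)
    (h2 : ∀ X, z.app (G.obj X) = η.app X ≫ h.app X + G.map (w.app X)) (M : KBdd C) :
    (termwiseK z).app ((coneFunctorK G η).obj M) =
      (coneFunctorK G η).map ((termwiseK w).app M) := by
  apply ObjectProperty.hom_ext
  change (HomotopyCategory.quotient C (.up ℤ)).map
      ((termwise z).app (mappingCone (coneMap G η M.obj.as))) =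
    (HomotopyCategory.quotient C (.up ℤ)).map (coneHom G η ((termwise w).app M.obj.as))
  rw [termwise_mappingCone]
  exact HomotopyCategory.eq_of_homotopy _ _ (coneMapHomotopyOfComp _ _
    (coneMap_naturality G η ((termwise w).app M.obj.as))
    { f := fun p => h.app (M.obj.as.X p)
      comm' := fun p q _ => (h.naturality (M.obj.as.d p q)).symm }
    (HomologicalComplex.hom_ext _ _ fun p => h1 _)
    (HomologicalComplex.hom_ext _ _ fun p => h2 _))

end ConeCenter

/-! ### Central elements and the cone of a bubble. -/

section BubbleCenter

open MulOpposite CategoryTheory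

universe u

variable {A V : Type u} [Ring A] [AddCommGroup V] [Module A V] [Module Aᵐᵒᵖ V]
  [SMulCommClass A Aᵐᵒᵖ V] {α : V →ₗ[A] A}

/-- The homotopy is `c • β`. Its composite with `α` on `M` is multiplication by `c • α B.t`, and on
`G(M)` the other composite is given by `t_eq`; the two hypotheses say that these are the required
differences. -/
theorem Bubble.termwiseK_tensorCone (B : Bubble α) (z w : Subring.center A) (c : ℤ)
    (h1 : z.1 = c • α B.t + w.1)
    (h2 : z.1 • B.g = c • (B.x • B.g + op B.x • B.g) + op w.1 • B.g)
    (M : KBdd (ModuleCat.{u} A)) :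
    (termwiseK (centerModule A z)).app (B.tensorCone.obj M) =
      B.tensorCone.map ((termwiseK (centerModule A w)).app M) := by
  refine termwiseK_coneFunctorK _ _ _ _ (c • B.β) (fun X => ?_) (fun X => B.hom_ext' fun m => ?_) M
  · ext m
    change z.1 • m = counitMap α B.alpha_op X (c • tmk (A := A) V B.t m) + w.1 • m
    rw [map_zsmul, h1, add_smul, smul_assoc]
    rfl
  · change z.1 • tmk (A := A) V B.g m = c • tmk (A := A) V B.t (α B.g • m) +
      tmk (A := A) V B.g (w.1 • m)
    rw [← tmk_op_smul, ← tmk_op_smul, ← B.t_comm, B.t_eq, smul_tmk, h2, tmk_add_left]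
    congr 1

end BubbleCenter

/-! ### Injectivity of the map to the centre of the homotopy category. -/

section Injective

open CategoryTheory

theorem centerModule_eq_zero {A : Type} [Ring A] {z : Subring.center A}
    (h : (centerModule A z).app (ModuleCat.of A A) = 0) : z = 0 := by
  have h1 : ((centerModule A z).app (ModuleCat.of A A)).hom (1 : A) = 0 := by
    rw [h]
    rfl
  have h2 : z.1 * 1 = 0 := h1
  rw [mul_one] at h2
  exact Subtype.ext h2

variable {C : Type 1} [Category.{0} C] [Preadditive C] [Limits.HasZeroObject C]

theorem bddProp_single (X : C) : bddProp C ((HomotopyCategory.quotient C (.up ℤ)).obj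
    ((HomologicalComplex.single C (.up ℤ) 0).obj X)) := by
  refine ⟨0, 0, ?_, ?_⟩
  · change CochainComplex.IsStrictlyGE ((HomologicalComplex.single C (.up ℤ) 0).obj X) 0
    rw [CochainComplex.isStrictlyGE_iff]
    exact fun i hi => HomologicalComplex.isZero_single_obj_X _ _ _ _ (by lia)
  · change CochainComplex.IsStrictlyLE ((HomologicalComplex.single C (.up ℤ) 0).obj X) 0
    rw [CochainComplex.isStrictlyLE_iff]
    exact fun i hi => HomologicalComplex.isZero_single_obj_X _ _ _ _ (by lia)

theorem app_eq_zero_of_centerToK (z : CatCenter C) (h : centerToK C z = 0) (X : C) :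
    z.app X = 0 := by
  set S := (HomologicalComplex.single C (.up ℤ) 0).obj X
  have h1 : (HomotopyCategory.quotient C (.up ℤ)).map ((termwise z).app S) =
      (HomotopyCategory.quotient C (.up ℤ)).map 0 := by
    have h2 : (centerToK C z).1.app ⟨_, bddProp_single X⟩ = 0 := by
      rw [h]
      rfl
    refine Eq.trans ?_ (CategoryTheory.Functor.map_zero _ _ _).symm
    exact congrArg (fun f => f.hom) h2
  have h2 := (HomotopyCategory.homotopyOfEq _ _ h1).comm 0
  have h3 : z.app (S.X 0) = 0 := by
    refine Eq.trans h2 ?_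
    -- On a complex concentrated in degree `0` the homotopy terms factor through zero objects, so
    -- homotopic maps are equal.
    rw [dNext_eq _ (show (ComplexShape.up ℤ).Rel 0 1 by simp),
      prevD_eq _ (show (ComplexShape.up ℤ).Rel (-1) 0 by simp)]
    simp [S]
  let e := HomologicalComplex.singleObjXSelf (.up ℤ) (0 : ℤ) X
  have h4 := z.naturality e.hom
  change e.hom ≫ z.app X = z.app (S.X 0) ≫ e.hom at h4
  rw [h3, Limits.zero_comp] at h4
  rw [← cancel_epi e.hom, h4, Limits.comp_zero]

theorem toCenterK_injective (n : ℕ) : Function.Injective (toCenterK n) := by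
  intro z w h
  have h1 : toCenterK n (z - w) = 0 := (RingHom.map_sub _ _ _).trans (sub_eq_zero.2 h)
  exact sub_eq_zero.1 (centerModule_eq_zero (app_eq_zero_of_centerToK _ h1 _))

end Injective

/-! ### Exchange of the generators by `R_i`. -/

section CenterSwap

open MulOpposite CategoryTheory

variable {n : ℕ}

local notation "𝐗" p => (ArcRing.diag (MvPolynomial.X p) : ArcRing _)

theorem genZ_val (p : Fin (2 * n)) : (genZ p).1 = ((-1) ^ (p.1 + 1) : ℤ) • 𝐗 p := by
  have h : genZ p = ((-1) ^ (p.1 + 1) : ℤ) • diagZ n (MvPolynomial.X p) := by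
    rw [diagZ_X, zsmul_eq_mul]
    push_cast
    rw [← mul_assoc, ← mul_pow, neg_one_mul, neg_neg, one_pow, one_mul]
  rw [h]
  rfl

variable {i : Fin (2 * n - 1)}

theorem diag_hi_smul (v : TangleBimod (diagU i)) : (𝐗 (hi i)) • v = (𝐗 (lo i)) • v := by
  ext c a
  rw [diag_smul_apply, diag_smul_apply, MvPolynomial.rename_X, MvPolynomial.rename_X,
    cls_X_eq (circ_diag diagU_inl_hi)]

theorem op_diag_hi_smul (v : TangleBimod (diagU i)) :
    op (𝐗 (hi i)) • v = op (𝐗 (lo i)) • v := by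
  ext c a
  rw [op_diag_smul_apply, op_diag_smul_apply, MvPolynomial.rename_X, MvPolynomial.rename_X,
    cls_X_eq (circ_diag diagU_inr_hi)]

theorem diag_smul_of_ne {p : Fin (2 * n)} (h1 : p ≠ lo i) (h2 : p ≠ hi i)
    (v : TangleBimod (diagU i)) : (𝐗 p) • v = op (𝐗 p) • v := by
  ext c a
  rw [diag_smul_apply, op_diag_smul_apply, MvPolynomial.rename_X, MvPolynomial.rename_X,
    cls_X_eq (circ_diag (diagU_inl h1 h2))]

/-- Neighbouring generators carry opposite signs, so their difference is up to sign the sum of the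
two circle variables, which is the composite of the two saddles. The other generators pass through
`ℱ(U_i)` along vertical segments, and no homotopy is needed for them. -/
theorem toCenterK_tensorU (i : Fin (2 * n - 1)) (j : Fin (2 * n)) (M : KArc n) :
    (toCenterK n (genZ (Equiv.swap (lo i) (hi i) j))).1.app ((tensorU i).obj M) =
      (tensorU i).map ((toCenterK n (genZ j)).1.app M) := by
  have ht : alpha i (bubbleU i).t = (𝐗 (lo i)) + 𝐗 (hi i) :=
    alpha_unitElt.trans (diag_add _ _)
  have key : ∀ z w : Subring.center (ArcRing n), ∀ c : ℤ,
      z.1 = c • ((𝐗 (lo i)) + 𝐗 (hi i)) + w.1 →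
      z.1 • capElt i = c • ((𝐗 (lo i)) • capElt i + op (𝐗 (lo i)) • capElt i) +
        op w.1 • capElt i →
      (toCenterK n z).1.app ((tensorU i).obj M) =
        (tensorU i).map ((toCenterK n w).1.app M) := fun z w c h1 h2 =>
    (bubbleU i).termwiseK_tensorCone z w c (by rw [ht]; exact h1) h2 M
  have hlh : ((-1) ^ ((hi i).1 + 1) : ℤ) = -(-1) ^ ((lo i).1 + 1) := by
    change ((-1) ^ ((lo i).1 + 1 + 1) : ℤ) = _
    rw [pow_succ, mul_neg_one]
  have ho : ∀ (c : ℤ) (y : ArcRing n) (v : TangleBimod (diagU i)),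
      op (c • y) • v = c • op y • v := fun c y v => by
    rw [show op (c • y) = c • op y from rfl, smul_assoc]
  by_cases h1 : j = lo i
  · subst h1
    rw [Equiv.swap_apply_left]
    refine key _ _ ((-1) ^ ((hi i).1 + 1)) ?_ ?_
    · rw [genZ_val, genZ_val, hlh, smul_add]
      module
    · rw [genZ_val, genZ_val, hlh, ho, smul_assoc, diag_hi_smul, neg_smul, neg_smul, smul_add]
      abel
  by_cases h2 : j = hi i
  · subst h2
    rw [Equiv.swap_apply_right]
    refine key _ _ ((-1) ^ ((lo i).1 + 1)) ?_ ?_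
    · rw [genZ_val, genZ_val, hlh, smul_add]
      module
    · rw [genZ_val, genZ_val, hlh, ho, smul_assoc, op_diag_hi_smul, neg_smul, smul_add]
      abel
  rw [Equiv.swap_apply_of_ne_of_ne h1 h2]
  refine key _ _ 0 (by rw [zero_smul, zero_add]) ?_
  rw [genZ_val, ho, smul_assoc, diag_smul_of_ne h1 h2, zero_smul, zero_add]

end CenterSwap

/-! ### The action of the symmetric group on the centre. -/

section SymmetricAction

open CategoryTheory

variable {n : ℕ}

theorem closure_adjacent_swap (m : ℕ) : Submonoid.closure
    {s : Equiv.Perm (Fin m) | ∃ p q : Fin m, p.1 + 1 = q.1 ∧ s = Equiv.swap p q} = ⊤ := by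
  rcases m with _ | m
  · refine eq_top_iff.2 fun s _ => ?_
    rw [Subsingleton.elim s 1]
    exact one_mem _
  · rw [eq_top_iff, ← Equiv.Perm.mclosure_swap_castSucc_succ]
    refine Submonoid.closure_mono ?_
    rintro _ ⟨i, rfl⟩
    exact ⟨_, _, rfl, rfl⟩

theorem perm_σ (i : Fin (2 * n - 1)) :
    BraidGroup.perm n (BraidGroup.σ i) = Equiv.swap (lo i) (hi i) :=
  PresentedGroup.toGroup.of _

theorem perm_surjective (n : ℕ) : Function.Surjective (BraidGroup.perm n) := by
  rw [← MonoidHom.mrange_eq_top, eq_top_iff, ← closure_adjacent_swap, Submonoid.closure_le]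
  rintro _ ⟨p, q, h, rfl⟩
  have hp : p.1 < 2 * n - 1 := by
    have := q.2
    omega
  refine ⟨BraidGroup.σ ⟨p.1, hp⟩, ?_⟩
  rw [perm_σ]
  congr 1
  exact Fin.ext h

/-- The natural isomorphism with `tensorU i` transports the formula of `toCenterK_tensorU`, and the
conjugate is determined by its values on the image of the functor. -/
theorem centerAction_σ {F : WeakAction (KArc n) (BraidGroup (2 * n))} (hF : IsBraidAction F)
    (i : Fin (2 * n - 1)) (j : Fin (2 * n)) :
    F.centerAction (BraidGroup.σ i) (toCenterK n (genZ j)) =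
      toCenterK n (genZ (Equiv.swap (lo i) (hi i) j)) := by
  obtain ⟨e⟩ := hF i
  refine Subtype.ext (conj_unique _ _ _ fun X => ?_).symm
  have h1 := (toCenterK n (genZ (Equiv.swap (lo i) (hi i) j))).1.naturality (e.hom.app X)
  have h2 := e.hom.naturality ((toCenterK n (genZ j)).1.app X)
  change e.hom.app X ≫ (toCenterK n (genZ (Equiv.swap (lo i) (hi i) j))).1.app
      ((tensorU i).obj X) =
    (toCenterK n (genZ (Equiv.swap (lo i) (hi i) j))).1.app ((F.obj (BraidGroup.σ i)).obj X) ≫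
      e.hom.app X at h1
  change (F.obj (BraidGroup.σ i)).map ((toCenterK n (genZ j)).1.app X) ≫ e.hom.app X =
    e.hom.app X ≫ (tensorU i).map ((toCenterK n (genZ j)).1.app X) at h2
  rw [toCenterK_tensorU, ← h2] at h1
  exact ((cancel_mono _).1 h1).symm

theorem centerAction_genHom {F : WeakAction (KArc n) (BraidGroup (2 * n))}
    (hF : IsBraidAction F) (g : BraidGroup (2 * n)) (f : MvPolynomial (Fin (2 * n)) ℤ) :
    F.centerAction g (toCenterK n (genHom n f)) =
      toCenterK n (genHom n (MvPolynomial.rename (BraidGroup.perm n g) f)) := by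
  have hg : g ∈ Subgroup.closure (Set.range (BraidGroup.σ (m := 2 * n))) := by
    have := PresentedGroup.closure_range_of {r | BraidRel (2 * n) r}
    exact this ▸ Subgroup.mem_top g
  induction hg using Subgroup.closure_induction generalizing f with
  | mem g hg =>
    obtain ⟨i, rfl⟩ := hg
    have : ((F.centerAction (BraidGroup.σ i)).toRingHom.comp (toCenterK n)).comp (genHom n) =
        ((toCenterK n).comp (genHom n)).comp
          (MvPolynomial.rename (BraidGroup.perm n (BraidGroup.σ i))).toRingHom := by
      refine MvPolynomial.ringHom_ext (fun k => ?_) fun j => ?_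
      · rw [show (MvPolynomial.C k : MvPolynomial (Fin (2 * n)) ℤ) = (k : MvPolynomial _ ℤ) from
          (map_intCast MvPolynomial.C k)]
        exact (map_intCast _ k).trans (map_intCast _ k).symm
      · change F.centerAction (BraidGroup.σ i) (toCenterK n (genHom n (MvPolynomial.X j))) =
          toCenterK n (genHom n (MvPolynomial.rename _ (MvPolynomial.X j)))
        rw [MvPolynomial.rename_X, genHom_X, genHom_X, perm_σ, centerAction_σ hF]
    exact RingHom.congr_fun this f
  | one =>
    rw [map_one, map_one, Equiv.Perm.coe_one, MvPolynomial.rename_id_apply]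
    rfl
  | mul g h _ _ hg hh =>
    rw [map_mul, map_mul, Equiv.Perm.coe_mul, ← MvPolynomial.rename_rename, ← hg, ← hh]
    rfl
  | inv g _ hg =>
    -- The induction hypothesis for `g` is applied to the polynomial with variables moved back, and
    -- then inverted.
    have h1 := hg (MvPolynomial.rename (BraidGroup.perm n g⁻¹) f)
    rw [MvPolynomial.rename_rename, ← Equiv.Perm.coe_mul, ← map_mul, mul_inv_cancel, map_one,
      Equiv.Perm.coe_one, MvPolynomial.rename_id_apply] at h1
    rw [← h1, ← RingAut.mul_apply, ← map_mul, inv_mul_cancel, map_one, RingAut.one_apply]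

/-- The relations between the generators need not be known explicitly. A lift of `w` to the braid
group acts by ring automorphisms on the centre of the homotopy category and permutes the generators
there, and `toCenterK` is injective. -/
theorem genHom_rename_eq (w : Equiv.Perm (Fin (2 * n))) {f g : MvPolynomial (Fin (2 * n)) ℤ}
    (h : genHom n f = genHom n g) :
    genHom n (MvPolynomial.rename w f) = genHom n (MvPolynomial.rename w g) := by
  obtain ⟨F, hF⟩ := exists_isBraidAction n
  obtain ⟨b, rfl⟩ := perm_surjective n w
  apply toCenterK_injective n
  rw [← centerAction_genHom hF, ← centerAction_genHom hF, h]

/-- The action of a permutation on the centre. -/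
noncomputable def permZ (w : Equiv.Perm (Fin (2 * n))) :
    Subring.center (ArcRing n) →+* Subring.center (ArcRing n) :=
  RingHom.liftOfSurjective (genHom n) genHom_surjective
    ⟨(genHom n).comp (MvPolynomial.rename w).toRingHom, fun f hf => by
      rw [RingHom.mem_ker] at hf ⊢
      have := genHom_rename_eq w (hf.trans (map_zero (genHom n)).symm)
      rw [map_zero, map_zero] at this
      exact this⟩

theorem permZ_genHom (w : Equiv.Perm (Fin (2 * n))) (f : MvPolynomial (Fin (2 * n)) ℤ) :
    permZ w (genHom n f) = genHom n (MvPolynomial.rename w f) :=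
  RingHom.liftOfRightInverse_comp_apply _ _ _ _ _

theorem permZ_mul (w w' : Equiv.Perm (Fin (2 * n))) (z : Subring.center (ArcRing n)) :
    permZ (w * w') z = permZ w (permZ w' z) := by
  obtain ⟨f, rfl⟩ := genHom_surjective z
  rw [permZ_genHom, permZ_genHom, permZ_genHom, MvPolynomial.rename_rename, Equiv.Perm.coe_mul]

theorem permZ_one (z : Subring.center (ArcRing n)) : permZ 1 z = z := by
  obtain ⟨f, rfl⟩ := genHom_surjective z
  rw [permZ_genHom, Equiv.Perm.coe_one, MvPolynomial.rename_id_apply]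

/-- The action of the symmetric group on the centre. -/
noncomputable def permAction (n : ℕ) :
    Equiv.Perm (Fin (2 * n)) →* RingAut (Subring.center (ArcRing n)) where
  toFun w :=
    { permZ w with
      invFun := permZ w⁻¹
      left_inv := fun z => by
        change permZ w⁻¹ (permZ w z) = z
        rw [← permZ_mul, inv_mul_cancel, permZ_one]
      right_inv := fun z => by
        change permZ w (permZ w⁻¹ z) = z
        rw [← permZ_mul, mul_inv_cancel, permZ_one] }
  map_one' := RingEquiv.ext permZ_one
  map_mul' w w' := RingEquiv.ext (permZ_mul w w')

theorem permAction_genHom (w : Equiv.Perm (Fin (2 * n))) (f : MvPolynomial (Fin (2 * n)) ℤ) :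
    permAction n w (genHom n f) = genHom n (MvPolynomial.rename w f) := permZ_genHom w f

end SymmetricAction

end Arc

theorem mainTheorem6 (n : ℕ) :
    (∃ F : Arc.WeakAction (Arc.KArc n) (Arc.BraidGroup (2 * n)), Arc.IsBraidAction F) ∧
    Function.Injective (Arc.toCenterK n) ∧
    Subring.closure (Set.range (Arc.genZ (n := n))) = ⊤ ∧
    ∃ ρ : Equiv.Perm (Fin (2 * n)) →* RingAut (Subring.center (Arc.ArcRing n)),
      (∀ (w : Equiv.Perm (Fin (2 * n))) (i : Fin (2 * n)),
        ρ w (Arc.genZ i) = Arc.genZ (w i)) ∧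
      ∀ F : Arc.WeakAction (Arc.KArc n) (Arc.BraidGroup (2 * n)), Arc.IsBraidAction F →
        ∀ (g : Arc.BraidGroup (2 * n)) (z : Subring.center (Arc.ArcRing n)),
          F.centerAction g (Arc.toCenterK n z) =
            Arc.toCenterK n (ρ (Arc.BraidGroup.perm n g) z) := by
  refine ⟨Arc.exists_isBraidAction n, Arc.toCenterK_injective n, Arc.closure_range_genZ,
    Arc.permAction n, fun w i => ?_, fun F hF g z => ?_⟩
  · rw [← Arc.genHom_X, Arc.permAction_genHom, MvPolynomial.rename_X, Arc.genHom_X]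
  · obtain ⟨f, rfl⟩ := Arc.genHom_surjective z
    rw [Arc.centerAction_genHom hF, Arc.permAction_genHom]
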